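/- Let $\mathbb K$ be a field of characteristic $0$; we use homological conventions. Let $\mathsf{RT}$ be the operad of rooted trees: $\mathsf{RT}(A)$ has as basis the rooted trees with vertex set $A$, and the composition $T\circ_a S$ is the sum of all trees obtained by inserting $S$ into the vertex $a$ of $T$, i.e. the root of $S$ takes the place of $a$ below the parent of $a$, and the children of $a$ are reconnected in all possible ways to vertices of $S$. Let $\mathsf{Lie}\to\mathsf{RT}$ be the operad map sending the bracket $[-,-]$ to (the tree with root $1$ and child $2$) minus (the tree with root $2$ and child $1$). Let $\mathit{Tw}\mathsf{RT}$ be its operadic twisting: the dg operad generated by $\mathsf{RT}$ and an additional zero-ary generator $\alpha$ of degree $-1$ (completed in the number of occurrences of $\alpha$), spanned by trees some of whose vertices are labelled by the inputs, while the other vertices are filled by $\alpha$ and drawn black (so exchanging two black vertices gives a sign). Its differential is $$d f=[\alpha,f]-\sum_{a} f\circ_a[\alpha,a]-\tfrac12\sum_{k} f\circ_k[\alpha,\alpha_k],$$ where $[-,-]$ is the image of the Lie bracket, $a$ runs over the inputs of $f$, $k$ runs over its black vertices $\alpha_k$, and in each term the new $\alpha$ is put first. Let $\mathsf{TRT}\subset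 \mathit{Tw}\mathsf{RT}$ be the dg suboperad spanned by the trees all of whose black vertices have at least two children. Theorem. Regard $\mathsf{Lie}$ as a dg operad concentrated in degree $0$, with zero differential. There is a unique morphism of dg operads $\mathsf{Lie}\to\mathsf{TRT}$ which sends the bracket $[-,-]$ to (the tree with root $1$ and child $2$) minus (the tree with root $2$ and child $1$), and this morphism is a quasi-isomorphism, i.e. it induces an isomorphism in homology on the complex of operations with inputs labelled by $A$ for every finite set $A$. In particular the homology of $\mathsf{TRT}$ is concentrated in degree $0$. -/

import Mathlib

universe u

/-! ### Bijections of finite label sets used to formulate the operad axioms -/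

/-- Move the marked point of the left summand to the outside. -/
def optL (A B : Type) : Option A ⊕ B ≃ Option (A ⊕ B) where
  toFun
    | .inl none => none
    | .inl (some a) => some (.inl a)
    | .inr b => some (.inr b)
  invFun
    | none => .inl none
    | some (.inl a) => .inl (some a)
    | some (.inr b) => .inr b
  left_inv := by rintro ((_ | _) | _) <;> rfl
  right_inv := by rintro (_ | (_ | _)) <;> rfl

/-- Move the marked point of the right summand to the outside. -/
def optR (A B : Type) : A ⊕ Option B ≃ Option (A ⊕ B) where
  toFun
    | .inr none => none
    | .inl a => some (.inl a)
    | .inr (some b) => some (.inr b)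
  invFun
    | none => .inr none
    | some (.inl a) => .inl a
    | some (.inr b) => .inr (some b)
  left_inv := by rintro (_ | (_ | _)) <;> rfl
  right_inv := by rintro (_ | (_ | _)) <;> rfl

/-- Exchange two marked points. -/
def optSwap (A : Type) : Option (Option A) ≃ Option (Option A) where
  toFun
    | none => some none
    | some none => none
    | some (some a) => some (some a)
  invFun
    | none => some none
    | some none => none
    | some (some a) => some (some a)
  left_inv := by rintro (_ | (_ | _)) <;> rfl
  right_inv := by rintro (_ | (_ | _)) <;> rfl

/-- Exchange the two last summands. -/
def sumRight (A B C : Type) : (A ⊕ B) ⊕ C ≃ (A ⊕ C) ⊕ B where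
  toFun
    | .inl (.inl a) => .inl (.inl a)
    | .inl (.inr b) => .inr b
    | .inr c => .inl (.inr c)
  invFun
    | .inl (.inl a) => .inl (.inl a)
    | .inl (.inr b) => .inr b
    | .inr c => .inl (.inr c)
  left_inv := by rintro ((_ | _) | _) <;> rfl
  right_inv := by rintro ((_ | _) | _) <;> rfl

/-- A one-point set is a marked point together with nothing else. -/
def unitOpt : Unit ≃ Option Empty where
  toFun _ := none
  invFun _ := ()
  left_inv _ := rfl
  right_inv := by rintro (_ | x); · rfl
                  · exact x.elim

/-- A `K`-linear symmetric operad, in the formulation with finite label sets and partial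
compositions. `obj A` is the space of operations whose inputs are labelled by `A`; `map` is the
relabelling action of bijections; `comp x y` inserts `y` into the input `none` of `x`
(every pointed finite set is isomorphic to some `Option A`). -/
structure LinOperad (K : Type u) [Field K] where
  obj : (A : Type) → [Finite A] → Type u
  [grp : ∀ (A : Type) [Finite A], AddCommGroup (obj A)]
  [mod : ∀ (A : Type) [Finite A], Module K (obj A)]
  map : ∀ {A B : Type} [Finite A] [Finite B], (A ≃ B) → obj A →ₗ[K] obj B
  one : obj Unit
  comp : ∀ {A B : Type} [Finite A] [Finite B],
    obj (Option A) →ₗ[K] obj B →ₗ[K] obj (A ⊕ B)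
  map_refl : ∀ {A : Type} [Finite A] (x : obj A), map (Equiv.refl A) x = x
  map_map : ∀ {A B C : Type} [Finite A] [Finite B] [Finite C] (e : A ≃ B) (f : B ≃ C) (x : obj A),
    map f (map e x) = map (e.trans f) x
  comp_map : ∀ {A A' B B' : Type} [Finite A] [Finite A'] [Finite B] [Finite B']
    (e : A ≃ A') (f : B ≃ B') (x : obj (Option A)) (y : obj B),
    comp (map e.optionCongr x) (map f y) = map (e.sumCongr f) (comp x y)
  comp_one : ∀ {A : Type} [Finite A] (x : obj (Option A)),
    comp x one = map (Equiv.optionEquivSumPUnit A) x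
  one_comp : ∀ {B : Type} [Finite B] (y : obj B),
    comp (map unitOpt one) y = map (Equiv.emptySum Empty B).symm y
  comp_assoc : ∀ {A B C : Type} [Finite A] [Finite B] [Finite C]
    (x : obj (Option A)) (y : obj (Option B)) (z : obj C),
    comp (map (optR A B) (comp x y)) z = map (Equiv.sumAssoc A B C).symm (comp x (comp y z))
  comp_comm : ∀ {A B C : Type} [Finite A] [Finite B] [Finite C]
    (x : obj (Option (Option A))) (y : obj B) (z : obj C),
    comp (map (optL A B) (comp x y)) z =
      map (sumRight A C B) (comp (map (optL A C) (comp (map (optSwap A) x) z)) y)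

attribute [instance] LinOperad.grp LinOperad.mod

/-- A symmetric operad in dg vector spaces over `K` concentrated in nonpositive homological degrees.
`obj A n` is the space of operations of homological degree `-n` with inputs labelled by `A`;
the differential lowers the homological degree by one. -/
structure DGOperad (K : Type u) [Field K] where
  obj : (A : Type) → [Finite A] → ℕ → Type u
  [grp : ∀ (A : Type) [Finite A] (n : ℕ), AddCommGroup (obj A n)]
  [mod : ∀ (A : Type) [Finite A] (n : ℕ), Module K (obj A n)]
  d : ∀ {A : Type} [Finite A] (n : ℕ), obj A n →ₗ[K] obj A (n + 1)
  map : ∀ {A B : Type} [Finite A] [Finite B] (_ : A ≃ B) (n : ℕ), obj A n →ₗ[K] obj B n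
  one : obj Unit 0
  comp : ∀ {A B : Type} [Finite A] [Finite B] {m n k : ℕ} (_ : m + n = k),
    obj (Option A) m →ₗ[K] obj B n →ₗ[K] obj (A ⊕ B) k
  d_d : ∀ {A : Type} [Finite A] (n : ℕ) (x : obj A n), d (n + 1) (d n x) = 0
  map_refl : ∀ {A : Type} [Finite A] (n : ℕ) (x : obj A n), map (Equiv.refl A) n x = x
  map_map : ∀ {A B C : Type} [Finite A] [Finite B] [Finite C] (e : A ≃ B) (f : B ≃ C) (n : ℕ)
    (x : obj A n), map f n (map e n x) = map (e.trans f) n x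
  d_map : ∀ {A B : Type} [Finite A] [Finite B] (e : A ≃ B) (n : ℕ) (x : obj A n),
    d n (map e n x) = map e (n + 1) (d n x)
  comp_map : ∀ {A A' B B' : Type} [Finite A] [Finite A'] [Finite B] [Finite B'] {m n k : ℕ}
    (h : m + n = k) (e : A ≃ A') (f : B ≃ B') (x : obj (Option A) m) (y : obj B n),
    comp h (map e.optionCongr m x) (map f n y) = map (e.sumCongr f) k (comp h x y)
  comp_one : ∀ {A : Type} [Finite A] (n : ℕ) (x : obj (Option A) n),
    comp (add_zero n) x one = map (Equiv.optionEquivSumPUnit A) n x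
  one_comp : ∀ {B : Type} [Finite B] (n : ℕ) (y : obj B n),
    comp (zero_add n) (map unitOpt 0 one) y = map (Equiv.emptySum Empty B).symm n y
  leibniz : ∀ {A B : Type} [Finite A] [Finite B] {m n k : ℕ} (h : m + n = k)
    (h₁ : m + 1 + n = k + 1) (h₂ : m + (n + 1) = k + 1) (x : obj (Option A) m) (y : obj B n),
    d k (comp h x y) = comp h₁ (d m x) y + (-1 : K) ^ m • comp h₂ x (d n y)
  comp_assoc : ∀ {A B C : Type} [Finite A] [Finite B] [Finite C] {l m n i j k : ℕ}
    (h₁ : l + m = i) (h₂ : i + n = k) (h₃ : m + n = j) (h₄ : l + j = k)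
    (x : obj (Option A) l) (y : obj (Option B) m) (z : obj C n),
    comp h₂ (map (optR A B) i (comp h₁ x y)) z =
      map (Equiv.sumAssoc A B C).symm k (comp h₄ x (comp h₃ y z))
  comp_comm : ∀ {A B C : Type} [Finite A] [Finite B] [Finite C] {l m n i j k : ℕ}
    (h₁ : l + m = i) (h₂ : i + n = k) (h₃ : l + n = j) (h₄ : j + m = k)
    (x : obj (Option (Option A)) l) (y : obj B m) (z : obj C n),
    comp h₂ (map (optL A B) i (comp h₁ x y)) z =
      (-1 : K) ^ (m * n) •
        map (sumRight A C B) k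
          (comp h₄ (map (optL A C) j (comp h₃ (map (optSwap A) l x) z)) y)

attribute [instance] DGOperad.grp DGOperad.mod

namespace DGOperad

open CategoryTheory

variable {K : Type u} [Field K]

/-- The complex of operations with inputs labelled by `A`. Cohomological degree `n` is homological
degree `-n`. -/
noncomputable def complex (P : DGOperad K) (A : Type) [Finite A] :
    CochainComplex (ModuleCat.{u} K) ℕ :=
  CochainComplex.of (fun n => ModuleCat.of K (P.obj A n)) (fun n => ModuleCat.ofHom (P.d n))
    (fun n => by
      rw [← ModuleCat.ofHom_comp]
      exact congrArg ModuleCat.ofHom (LinearMap.ext (P.d_d n)))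

/-- Morphisms of dg operads. -/
structure Hom (P Q : DGOperad K) where
  app : ∀ (A : Type) [Finite A] (n : ℕ), P.obj A n →ₗ[K] Q.obj A n
  app_d : ∀ {A : Type} [Finite A] (n : ℕ) (x : P.obj A n),
    app A (n + 1) (P.d n x) = Q.d n (app A n x)
  app_map : ∀ {A B : Type} [Finite A] [Finite B] (e : A ≃ B) (n : ℕ) (x : P.obj A n),
    app B n (P.map e n x) = Q.map e n (app A n x)
  app_one : app Unit 0 P.one = Q.one
  app_comp : ∀ {A B : Type} [Finite A] [Finite B] {m n k : ℕ} (h : m + n = k)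
    (x : P.obj (Option A) m) (y : P.obj B n),
    app (A ⊕ B) k (P.comp h x y) = Q.comp h (app (Option A) m x) (app B n y)

/-- The chain map underlying a morphism of dg operads. -/
noncomputable def Hom.chainMap {P Q : DGOperad K} (φ : Hom P Q) (A : Type) [Finite A] :
    P.complex A ⟶ Q.complex A :=
  CochainComplex.ofHom (fun n => ModuleCat.ofHom (φ.app A n)) (fun n => by
    have h : ModuleCat.ofHom (φ.app A n) ≫ ModuleCat.ofHom (Q.d n) =
        ModuleCat.ofHom (P.d n) ≫ ModuleCat.ofHom (φ.app A (n + 1)) := by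
      rw [← ModuleCat.ofHom_comp, ← ModuleCat.ofHom_comp]
      exact congrArg ModuleCat.ofHom (LinearMap.ext fun x => (φ.app_d n x).symm)
    simpa [complex] using h)

/-- A morphism of dg operads is a quasi-isomorphism if it is one on every complex of operations. -/
def Hom.IsQuasiIso {P Q : DGOperad K} (φ : Hom P Q) : Prop :=
  ∀ (A : Type) [Finite A], QuasiIso (φ.chainMap A)

end DGOperad

namespace DGOperad

/-- A linear operad regarded as a dg operad concentrated in degree `0`: the component of degree `n`
is the whole space for `n = 0` and zero otherwise. -/
def conc {K : Type u} [Field K] (P : LinOperad K) (A : Type) [Finite A] (n : ℕ) :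
    Submodule K (P.obj A) where
  carrier := {x | n ≠ 0 → x = 0}
  add_mem' hx hy h := by rw [hx h, hy h, add_zero]
  zero_mem' _ := rfl
  smul_mem' c x hx h := by rw [hx h, smul_zero]

/-- A linear operad regarded as a dg operad concentrated in degree `0`. -/
def ofLinOperad {K : Type u} [Field K] (P : LinOperad K) : DGOperad K where
  obj A _ n := conc P A n
  d _ := 0
  map e n := (P.map e).restrict (p := conc P _ n) (q := conc P _ n)
    fun x hx h => by rw [hx h, map_zero]
  one := ⟨P.one, fun h => absurd rfl h⟩
  comp {A B _ _ m n k} h := LinearMap.mk₂ K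
    (fun x y => ⟨P.comp x.1 y.1, fun hk => by
      by_cases hm : m = 0
      · rw [y.2 (by omega), map_zero]
      · rw [x.2 hm, map_zero, LinearMap.zero_apply]⟩)
    (fun x x' y => Subtype.ext (by simp)) (fun c x y => Subtype.ext (by simp))
    (fun x y y' => Subtype.ext (by simp)) (fun c x y => Subtype.ext (by simp))
  d_d _ _ := rfl
  map_refl n x := Subtype.ext (P.map_refl _)
  map_map e f n x := Subtype.ext (P.map_map _ _ _)
  d_map e n x := by simp
  comp_map h e f x y := Subtype.ext (P.comp_map _ _ _ _)
  comp_one n x := Subtype.ext (P.comp_one _)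
  one_comp n x := Subtype.ext (P.one_comp _)
  leibniz h h₁ h₂ x y := Subtype.ext (by simp)
  comp_assoc h₁ h₂ h₃ h₄ x y z := Subtype.ext (P.comp_assoc _ _ _)
  comp_comm {A B C _ _ _ l m n i j k} h₁ h₂ h₃ h₄ x y z := Subtype.ext (by
    change P.comp (P.map (optL A B) (P.comp x.1 y.1)) z.1 = (-1 : K) ^ (m * n) •
      P.map (sumRight A C B) (P.comp (P.map (optL A C) (P.comp (P.map (optSwap A) x.1) z.1)) y.1)
    by_cases hm : m = 0
    · rw [show (-1 : K) ^ (m * n) = 1 by simp [hm], one_smul, P.comp_comm]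
    · simp [show y.1 = 0 from y.2 hm])

end DGOperad

/-! ### The operad of Lie algebras -/

namespace LieOp

variable (K : Type u) [Field K]

/-- Lie monomials in which every generator from `s` occurs exactly once and no other generator
occurs. -/
inductive Mono {A : Type} : Set A → FreeLieAlgebra K A → Prop
  | of (a : A) : Mono {a} (FreeLieAlgebra.of K a)
  | lie {s t : Set A} {x y : FreeLieAlgebra K A} (h : Disjoint s t) :
      Mono s x → Mono t y → Mono (s ∪ t) ⁅x, y⁆

/-- The multilinear part of the free Lie algebra with respect to the set `s` of generators. -/
noncomputable def multilinear {A : Type} (s : Set A) : Submodule K (FreeLieAlgebra K A) :=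
  Submodule.span K {x | Mono K s x}

/-- The homomorphism of free Lie algebras induced by a map of generators. -/
noncomputable def rename {A B : Type} (f : A → B) : FreeLieAlgebra K A →ₗ⁅K⁆ FreeLieAlgebra K B :=
  FreeLieAlgebra.lift K fun a => FreeLieAlgebra.of K (f a)

/-- The homomorphism of free Lie algebras substituting `y` for the generator `none`. -/
noncomputable def subst {A B : Type} (y : FreeLieAlgebra K B) :
    FreeLieAlgebra K (Option A) →ₗ⁅K⁆ FreeLieAlgebra K (A ⊕ B) :=
  FreeLieAlgebra.lift K fun
    | none => rename K Sum.inr y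
    | some a => FreeLieAlgebra.of K (.inl a)

variable {K}

theorem lie_mem {A : Type} {s t : Set A} (h : Disjoint s t) {x y : FreeLieAlgebra K A}
    (hx : x ∈ multilinear K s) (hy : y ∈ multilinear K t) : ⁅x, y⁆ ∈ multilinear K (s ∪ t) := by
  induction hx using Submodule.span_induction with
  | mem x hx =>
    induction hy using Submodule.span_induction with
    | mem y hy => exact Submodule.subset_span (Mono.lie h hx hy)
    | zero => simp
    | add y y' _ _ h h' => rw [lie_add]; exact add_mem h h'
    | smul c y _ h => rw [lie_smul]; exact Submodule.smul_mem _ _ h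
  | zero => simp
  | add y y' _ _ h h' => rw [add_lie]; exact add_mem h h'
  | smul c y _ h => rw [smul_lie]; exact Submodule.smul_mem _ _ h

@[simp] theorem rename_of {A B : Type} (f : A → B) (a : A) :
    rename K f (FreeLieAlgebra.of K a) = FreeLieAlgebra.of K (f a) := by simp [rename]

@[simp] theorem subst_none {A B : Type} (y : FreeLieAlgebra K B) :
    subst K (A := A) y (FreeLieAlgebra.of K none) = rename K Sum.inr y := by simp [subst]

@[simp] theorem subst_some {A B : Type} (y : FreeLieAlgebra K B) (a : A) :
    subst K y (FreeLieAlgebra.of K (some a)) = FreeLieAlgebra.of K (.inl a) := by simp [subst]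

theorem hom_congr {A : Type} {L : Type*} [LieRing L] [LieAlgebra K L]
    (F G : FreeLieAlgebra K A →ₗ⁅K⁆ L) (h : ∀ a, F (.of K a) = G (.of K a)) (x) : F x = G x :=
  LieHom.congr_fun (FreeLieAlgebra.hom_ext h) x

theorem rename_rename {A B C : Type} (f : A → B) (g : B → C) (x : FreeLieAlgebra K A) :
    rename K g (rename K f x) = rename K (g ∘ f) x :=
  hom_congr ((rename K g).comp (rename K f)) _ (by simp) x

theorem rename_id {A : Type} (x : FreeLieAlgebra K A) : rename K id x = x :=
  hom_congr (rename K id) LieHom.id (by simp) x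

theorem rename_mem {A B : Type} {f : A → B} (hf : Function.Injective f) {s : Set A}
    {x : FreeLieAlgebra K A} (hx : x ∈ multilinear K s) :
    rename K f x ∈ multilinear K (f '' s) := by
  induction hx using Submodule.span_induction with
  | mem x hx =>
    induction hx with
    | of a => rw [rename_of, Set.image_singleton]; exact Submodule.subset_span (.of _)
    | lie h _ _ h₁ h₂ =>
      rw [LieHom.map_lie, Set.image_union]
      exact lie_mem ((Set.disjoint_image_iff hf).2 h) h₁ h₂
  | zero => simp
  | add y y' _ _ h h' => rw [map_add]; exact add_mem h h'
  | smul c y _ h => rw [map_smul]; exact Submodule.smul_mem _ _ h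

theorem subst_mono {A B : Type} {s : Set (Option A)} {x : FreeLieAlgebra K (Option A)}
    (hx : Mono K s x) :
    (none ∉ s → ∃ z ∈ multilinear K (Sum.inl '' (some ⁻¹' s) : Set (A ⊕ B)),
      ∀ y, subst K y x = z) ∧
    (none ∈ s → ∃ F : FreeLieAlgebra K B →ₗ[K] FreeLieAlgebra K (A ⊕ B),
      (∀ y, subst K y x = F y) ∧ ∀ y ∈ multilinear K Set.univ,
        F y ∈ multilinear K (Sum.inl '' (some ⁻¹' s) ∪ Set.range Sum.inr)) := by
  induction hx with
  | of a =>
    rcases a with _ | a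
    · refine ⟨fun h => absurd rfl h, fun _ => ⟨(rename K Sum.inr).toLinearMap, by simp, ?_⟩⟩
      intro y hy
      have := rename_mem (f := (Sum.inr : B → A ⊕ B)) Sum.inr_injective hy
      have e : (some ⁻¹' {none} : Set A) = ∅ := by ext; simp
      rw [e]
      simpa using this
    · refine ⟨fun _ => ⟨_, ?_, fun y => subst_some y a⟩, fun h => by simp at h⟩
      have e : (some ⁻¹' {some a} : Set A) = {a} := by ext; simp
      rw [e, Set.image_singleton]
      exact Submodule.subset_span (.of _)
  | @lie s t x x' h _ _ h₁ h₂ =>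
    have hd : Disjoint (Sum.inl '' (some ⁻¹' s) : Set (A ⊕ B)) (Sum.inl '' (some ⁻¹' t)) :=
      (Set.disjoint_image_iff Sum.inl_injective).2 (h.preimage _)
    have hr (s : Set A) : Disjoint (Sum.inl '' s : Set (A ⊕ B)) (Set.range Sum.inr) := by
      rw [Set.disjoint_left]
      rintro _ ⟨a, _, rfl⟩ ⟨b, hb⟩
      cases hb
    by_cases hs : none ∈ s
    · have ht : none ∉ t := Set.disjoint_left.1 h hs
      refine ⟨fun hn => absurd (Or.inl hs) hn, fun _ => ?_⟩
      obtain ⟨F, hF, hF'⟩ := h₁.2 hs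
      obtain ⟨z, hz, hz'⟩ := h₂.1 ht
      refine ⟨-(LieAlgebra.ad K (FreeLieAlgebra K (A ⊕ B)) z : _ →ₗ[K] _) ∘ₗ F, fun y => ?_, fun y hy => ?_⟩
      · simp [hF, hz']
      · have := lie_mem (hd.union_left (hr _).symm) (hF' y hy) hz
        rw [Set.preimage_union, Set.image_union, Set.union_right_comm]
        simpa using this
    · by_cases ht : none ∈ t
      · refine ⟨fun hn => absurd (Or.inr ht) hn, fun _ => ?_⟩
        obtain ⟨F, hF, hF'⟩ := h₂.2 ht
        obtain ⟨z, hz, hz'⟩ := h₁.1 hs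
        refine ⟨(LieAlgebra.ad K (FreeLieAlgebra K (A ⊕ B)) z : _ →ₗ[K] _) ∘ₗ F, fun y => ?_, fun y hy => ?_⟩
        · simp [hF, hz']
        · have := lie_mem (hd.union_right (hr _)) hz (hF' y hy)
          rw [Set.preimage_union, Set.image_union, Set.union_assoc]
          simpa using this
      · refine ⟨fun _ => ?_, fun hn => absurd hn (by simp [hs, ht])⟩
        obtain ⟨z, hz, hz'⟩ := h₁.1 hs
        obtain ⟨w, hw, hw'⟩ := h₂.1 ht
        refine ⟨⁅z, w⁆, ?_, by simp [hz', hw']⟩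
        rw [Set.preimage_union, Set.image_union]
        exact lie_mem hd hz hw

theorem subst_linear {A B : Type} {x : FreeLieAlgebra K (Option A)}
    (hx : x ∈ multilinear K Set.univ) :
    ∃ F : FreeLieAlgebra K B →ₗ[K] FreeLieAlgebra K (A ⊕ B), (∀ y, subst K y x = F y) ∧
      ∀ y ∈ multilinear K Set.univ, F y ∈ multilinear K Set.univ := by
  induction hx using Submodule.span_induction with
  | mem x hx =>
    obtain ⟨F, hF, hF'⟩ := (subst_mono (B := B) hx).2 trivial
    refine ⟨F, hF, fun y hy => ?_⟩
    simpa [Set.range_inl_union_range_inr] using hF' y hy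
  | zero => exact ⟨0, by simp, by simp⟩
  | add x x' _ _ h h' =>
    obtain ⟨F, hF, hF'⟩ := h
    obtain ⟨G, hG, hG'⟩ := h'
    exact ⟨F + G, by simp [hF, hG], fun y hy => add_mem (hF' y hy) (hG' y hy)⟩
  | smul c x _ h =>
    obtain ⟨F, hF, hF'⟩ := h
    exact ⟨c • F, by simp [hF], fun y hy => Submodule.smul_mem _ _ (hF' y hy)⟩

variable (K)

/-- The operad governing Lie algebras: operations with inputs `A` are the elements of the free Lie
algebra on `A` which are multilinear in all generators, composition is substitution. -/
noncomputable def lieLin : LinOperad K where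
  obj A _ := multilinear K (Set.univ : Set A)
  map e := (rename K e).toLinearMap.restrict fun x hx => by
    simpa [e.surjective.range_eq] using rename_mem e.injective hx
  one := ⟨FreeLieAlgebra.of K (), by
    rw [show (Set.univ : Set Unit) = {()} by ext; simp]
    exact Submodule.subset_span (.of _)⟩
  comp {A B _ _} := LinearMap.mk₂ K
    (fun x y => ⟨subst K y.1 x.1, by
      obtain ⟨F, hF, hF'⟩ := subst_linear (B := B) x.2
      rw [hF]; exact hF' _ y.2⟩)
    (fun x x' y => Subtype.ext (by simp)) (fun c x y => Subtype.ext (by simp))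
    (fun x y y' => Subtype.ext (by
      obtain ⟨F, hF, -⟩ := subst_linear (B := B) x.2
      simp [hF]))
    (fun c x y => Subtype.ext (by
      obtain ⟨F, hF, -⟩ := subst_linear (B := B) x.2
      simp [hF]))
  map_refl x := Subtype.ext (rename_id x.1)
  map_map e f x := Subtype.ext (rename_rename e f x.1)
  comp_map {A A' B B' _ _ _ _} e f x y := Subtype.ext <|
    hom_congr ((subst K (rename K f y.1)).comp (rename K e.optionCongr))
      ((rename K (e.sumCongr f)).comp (subst K y.1))
      (by rintro (_ | a) <;> simp [rename_rename]; rfl) x.1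
  comp_one {A _} x := Subtype.ext <| hom_congr (subst K _) (rename K _)
    (by rintro (_ | a) <;> simp) x.1
  one_comp {B _} y := Subtype.ext (by
    simp [unitOpt]; rfl)
  comp_assoc {A B C _ _ _} x y z := Subtype.ext <|
    hom_congr (((subst K z.1).comp (rename K (optR A B))).comp (subst K y.1))
      ((rename K (Equiv.sumAssoc A B C).symm).comp (subst K (subst K z.1 y.1)))
      (by
        rintro (_ | a)
        · simp only [LieHom.comp_apply, subst_none]
          exact hom_congr (((subst K z.1).comp (rename K (optR A B))).comp (rename K Sum.inr))
            (((rename K (Equiv.sumAssoc A B C).symm).comp (rename K Sum.inr)).comp (subst K z.1))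
            (by rintro (_ | a) <;> simp [optR, rename_rename]; rfl) y.1
        · simp [optR]) x.1
  comp_comm {A B C _ _ _} x y z := Subtype.ext <|
    hom_congr (((subst K z.1).comp (rename K (optL A B))).comp (subst K y.1))
      ((rename K (sumRight A C B)).comp <| (subst K y.1).comp <| (rename K (optL A C)).comp <|
        (subst K z.1).comp (rename K (optSwap A)))
      (by
        rintro (_ | _ | a)
        · simp only [LieHom.comp_apply, subst_none, rename_of, optSwap, optL, Equiv.coe_fn_mk,
            subst_some]
          exact hom_congr (((subst K z.1).comp (rename K (optL A B))).comp (rename K Sum.inr))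
            ((rename K (sumRight A C B)).comp (rename K Sum.inr))
            (by simp [optL, sumRight]) y.1
        · simp only [LieHom.comp_apply, subst_none, rename_of, optSwap, optL, Equiv.coe_fn_mk,
            subst_some]
          exact hom_congr (rename K Sum.inr)
            ((((rename K (sumRight A C B)).comp (subst K y.1)).comp (rename K (optL A C))).comp
              (rename K Sum.inr))
            (by simp [optL, sumRight]) z.1
        · simp [optL, optSwap, sumRight]) x.1

end LieOp

/-- The operad `Lie` as a dg operad concentrated in degree `0`. -/
noncomputable def Lie (K : Type u) [Field K] : DGOperad K := DGOperad.ofLinOperad (LieOp.lieLin K)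

/-- The generator of `Lie`: the bracket of the first with the second input. -/
noncomputable def Lie.bracket (K : Type u) [Field K] : (Lie K).obj (Fin 2) 0 :=
  ⟨⟨⁅FreeLieAlgebra.of K (0 : Fin 2), FreeLieAlgebra.of K (1 : Fin 2)⁆, by
    have h := LieOp.Mono.lie (K := K) (s := {(0 : Fin 2)}) (t := {1}) (by simp) (.of _) (.of _)
    rw [show ({0} ∪ {1} : Set (Fin 2)) = Set.univ by ext i; fin_cases i <;> simp] at h
    exact Submodule.subset_span h⟩, fun h => absurd rfl h⟩

/-! ### Rooted trees -/

/-- A rooted tree with vertex set `V`, encoded by the function sending a vertex to its parent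
(`none` for the root). There is exactly one root, and there are no cycles: some height function
decreases strictly towards the root. -/
@[ext] structure RTree (V : Type) where
  parent : V → Option V
  existsUnique_root : ∃! r, parent r = none
  acyclic : ∃ h : V → ℕ, ∀ v w, parent v = some w → h w < h v

namespace RTree

instance {V : Type} [Finite V] : Finite (RTree V) :=
  Finite.of_injective RTree.parent fun _ _ h => RTree.ext h

noncomputable instance {V : Type} [Finite V] : Fintype (RTree V) := Fintype.ofFinite _

/-- Relabelling of the vertices of a tree. -/
def relabel {V W : Type} (e : V ≃ W) (T : RTree V) : RTree W where
  parent w := (T.parent (e.symm w)).map e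
  existsUnique_root := by
    obtain ⟨r, hr, hu⟩ := T.existsUnique_root
    refine ⟨e r, by simpa using hr, fun w hw => ?_⟩
    have := hu (e.symm w) (by simpa using hw)
    rw [← this, e.apply_symm_apply]
  acyclic := by
    obtain ⟨h, hh⟩ := T.acyclic
    refine ⟨fun w => h (e.symm w), fun v w hv => ?_⟩
    rw [Option.map_eq_some_iff] at hv
    obtain ⟨x, hx, rfl⟩ := hv
    simpa using hh _ _ hx

@[simp] theorem relabel_parent {V W : Type} (e : V ≃ W) (T : RTree V) (w : W) :
    (T.relabel e).parent w = (T.parent (e.symm w)).map e := rfl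

theorem relabel_relabel {V W X : Type} (e : V ≃ W) (f : W ≃ X) (T : RTree V) :
    (T.relabel e).relabel f = T.relabel (e.trans f) := by
  ext1; funext x; simp

@[simp] theorem relabel_refl {V : Type} (T : RTree V) : T.relabel (Equiv.refl V) = T := by
  ext1; funext x; simp

theorem parent_ne_self {V : Type} (T : RTree V) (v : V) : T.parent v ≠ some v := by
  obtain ⟨h, hh⟩ := T.acyclic
  exact fun e => lt_irrefl _ (hh v v e)

/-- Collapse the second summand to the point `none`. -/
def collapse {A B : Type} : A ⊕ B → Option A
  | .inl a => some a
  | .inr _ => none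

@[simp] theorem collapse_inl {A B : Type} (a : A) : collapse (.inl a : A ⊕ B) = some a := rfl
@[simp] theorem collapse_inr {A B : Type} (b : B) : collapse (.inr b : A ⊕ B) = none := rfl

/-- The tree with parent function `u` arises by inserting the tree with parent function `s` into the
vertex `none` of the tree with parent function `t`: the edges of `s` are kept, the root of `s` takes
the place of `none` below the parent of `none`, and every child of `none` is reconnected to an
arbitrary vertex of `s`. -/
structure IsInsertion {A B : Type} (t : Option A → Option (Option A)) (s : B → Option B)
    (u : A ⊕ B → Option (A ⊕ B)) : Prop where
  outer : ∀ a, (u (.inl a)).map collapse = t (some a)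
  inner : ∀ b b', s b = some b' → u (.inr b) = some (.inr b')
  root : ∀ b, s b = none → (u (.inr b)).map collapse = t none

theorem IsInsertion.isTree {A B : Type} [Finite B] (T : RTree (Option A)) (S : RTree B)
    {u : A ⊕ B → Option (A ⊕ B)} (h : IsInsertion T.parent S.parent u) :
    ∃ U : RTree (A ⊕ B), U.parent = u := by
  refine ⟨⟨u, ?_, ?_⟩, rfl⟩
  · obtain ⟨t, ht, htu⟩ := T.existsUnique_root
    obtain ⟨s, hs, hsu⟩ := S.existsUnique_root
    rcases t with _ | a
    · refine ⟨.inr s, by simpa [ht] using h.root s hs, ?_⟩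
      rintro (a | b) hx
      · have := h.outer a
        rw [hx] at this
        cases htu _ this.symm
      · rcases hb : S.parent b with _ | b'
        · rw [hsu b hb]
        · rw [h.inner b b' hb] at hx; cases hx
    · refine ⟨.inl a, by simpa [ht] using h.outer a, ?_⟩
      rintro (a' | b) hx
      · have := h.outer a'
        rw [hx] at this
        rw [Option.some_injective _ (htu _ this.symm)]
      · rcases hb : S.parent b with _ | b'
        · have := h.root b hb
          rw [hx] at this
          cases htu _ this.symm
        · rw [h.inner b b' hb] at hx; cases hx
  · obtain ⟨f, hf⟩ := T.acyclic
    obtain ⟨g, hg⟩ := S.acyclic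
    obtain ⟨N, hN⟩ : ∃ N, ∀ b, g b < N := by
      obtain ⟨M, hM⟩ := (Set.finite_range g).bddAbove
      exact ⟨M + 1, fun b => Nat.lt_succ_of_le (hM ⟨b, rfl⟩)⟩
    have key : ∀ (x y : Option A) (i j : ℕ), T.parent x = some y → i < N → j < N →
        N * f y + i < N * f x + j := by
      intro x y i j hxy hi hj
      have := hf x y hxy
      nlinarith
    refine ⟨Sum.elim (fun a => (N + 1) * f (some a)) (fun b => (N + 1) * f none + g b), ?_⟩
    have key : ∀ (x y : Option A) (i j : ℕ), T.parent x = some y → i < N →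
        (N + 1) * f y + i < (N + 1) * f x + j := by
      intro x y i j hxy hi
      have := hf x y hxy
      nlinarith
    have key0 : ∀ (x y : Option A) (j : ℕ), T.parent x = some y →
        (N + 1) * f y < (N + 1) * f x + j := by
      intro x y j hxy
      have := hf x y hxy
      nlinarith
    rintro (a | b) (a' | b') hx
    · have := h.outer a
      rw [hx] at this
      exact key0 _ _ 0 this.symm
    · have := h.outer a
      rw [hx] at this
      exact key _ _ _ 0 this.symm (hN b')
    · rcases hb : S.parent b with _ | b''
      · have := h.root b hb
        rw [hx] at this
        exact key0 _ _ _ this.symm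
      · rw [h.inner b b'' hb] at hx; cases hx
    · rcases hb : S.parent b with _ | b''
      · have := h.root b hb
        rw [hx] at this
        exact absurd this.symm (T.parent_ne_self _)
      · rw [h.inner b b'' hb] at hx
        cases hx
        exact Nat.add_lt_add_left (hg _ _ hb) _

theorem IsInsertion.unique {A B : Type} {T T' : RTree (Option A)} {S S' : RTree B}
    {u : A ⊕ B → Option (A ⊕ B)} (h : IsInsertion T.parent S.parent u)
    (h' : IsInsertion T'.parent S'.parent u) : T = T' ∧ S = S' := by
  have aux : ∀ {T T' : RTree (Option A)} {S S' : RTree B},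
      IsInsertion T.parent S.parent u → IsInsertion T'.parent S'.parent u →
        ∀ b b', S.parent b = some b' → S'.parent b = some b' := by
    intro T T' S S' h h' b b' hb
    have := h.inner b b' hb
    rcases hb' : S'.parent b with _ | b''
    · have h3 := h'.root b hb'
      rw [this] at h3
      exact absurd h3.symm (T'.parent_ne_self _)
    · have h3 := h'.inner b b'' hb'
      rw [this] at h3
      cases h3; rfl
  have hS : S = S' := by
    ext b b'
    exact ⟨aux h h' b b', aux h' h b b'⟩
  subst hS
  refine ⟨?_, rfl⟩
  ext1
  funext x
  rcases x with _ | a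
  · obtain ⟨s, hs, -⟩ := S.existsUnique_root
    rw [← h.root s hs, ← h'.root s hs]
  · rw [← h.outer, ← h'.outer]

theorem IsInsertion.relabel {A A' B B' : Type} (e : A ≃ A') (f : B ≃ B') {T : RTree (Option A)}
    {S : RTree B} {U : RTree (A ⊕ B)} (h : IsInsertion T.parent S.parent U.parent) :
    IsInsertion (T.relabel e.optionCongr).parent (S.relabel f).parent
      (U.relabel (e.sumCongr f)).parent := by
  have hc : ∀ x : Option (A ⊕ B), (x.map (e.sumCongr f)).map collapse =
      (x.map collapse).map e.optionCongr := by
    rintro (_ | (_ | _)) <;> rfl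
  refine ⟨fun a => ?_, fun b b' hb => ?_, fun b hb => ?_⟩
  · have := h.outer (e.symm a)
    simp only [relabel_parent, hc]
    exact congrArg _ this
  · simp only [relabel_parent, Option.map_eq_some_iff] at hb
    obtain ⟨x, hx, rfl⟩ := hb
    have := h.inner _ _ hx
    simp [this]
  · simp only [relabel_parent, Option.map_eq_none_iff] at hb
    have := h.root _ hb
    simp only [relabel_parent, hc]
    exact congrArg _ this

end RTree
namespace RTree
/-- Keep the second summand. -/
def keep {A B : Type} : A ⊕ B → Option B
  | .inl _ => none
  | .inr b => some b

theorem IsInsertion.assoc {A B C : Type} [Finite C] {T : RTree (Option A)} {S : RTree (Option B)}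
    {R : RTree C} {W : RTree (A ⊕ Option B)} {U : RTree ((A ⊕ B) ⊕ C)}
    (h : IsInsertion T.parent S.parent W.parent)
    (h' : IsInsertion (W.relabel (optR A B)).parent R.parent U.parent) :
    ∃ W' : RTree (B ⊕ C), IsInsertion S.parent R.parent W'.parent ∧
      IsInsertion T.parent W'.parent (U.relabel (Equiv.sumAssoc A B C)).parent := by
  have hT := T.parent_ne_self none
  have key : IsInsertion S.parent R.parent
      (fun x => ((U.relabel (Equiv.sumAssoc A B C)).parent (.inr x)).bind keep) := by
    refine ⟨fun b => ?_, fun c c' hc => ?_, fun c hc => ?_⟩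
    · have h1 := h'.outer (.inr b)
      have h2 := h.inner (some b)
      have h3 := h.root (some b)
      rcases hu : U.parent (.inl (.inr b)) with _ | ((_ | _) | _) <;>
      rcases hw : W.parent (.inr (some b)) with _ | (_ | (_ | _)) <;>
      rcases hs : S.parent (some b) with _ | (_ | _) <;>
      simp_all [optR, keep, Equiv.sumAssoc]
    · have := h'.inner c c' hc
      simp_all [keep, Equiv.sumAssoc]
    · have h1 := h'.root c hc
      have h2 := h.inner none
      have h3 := h.root none
      rcases hu : U.parent (.inr c) with _ | ((_ | _) | _) <;>
      rcases hw : W.parent (.inr none) with _ | (_ | (_ | _)) <;>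
      rcases hs : S.parent none with _ | (_ | _) <;>
      simp_all [optR, keep, Equiv.sumAssoc]
  obtain ⟨W', hW'⟩ := key.isTree
  refine ⟨W', hW' ▸ key, ?_⟩
  rw [hW']
  refine ⟨fun a => ?_, fun x x' hx => ?_, fun x hx => ?_⟩
  · have h1 := h'.outer (.inl a)
    have h2 := h.outer a
    rcases hu : U.parent (.inl (.inl a)) with _ | ((_ | _) | _) <;>
      rcases hw : W.parent (.inl a) with _ | (_ | (_ | _)) <;>
      simp_all [optR, keep, Equiv.sumAssoc]
  · simp only [Option.bind_eq_some_iff] at hx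
    obtain ⟨y, hy, hy'⟩ := hx
    rcases y with _ | y
    · cases hy'
    · cases hy'; exact hy
  · rcases x with b | c
    · have h1 := h'.outer (.inr b)
      have h2 := h.inner (some b)
      have h3 := h.root (some b)
      rcases hu : U.parent (.inl (.inr b)) with _ | ((_ | _) | _) <;>
      rcases hw : W.parent (.inr (some b)) with _ | (_ | (_ | _)) <;>
      rcases hs : S.parent (some b) with _ | (_ | _) <;>
      simp_all [optR, keep, Equiv.sumAssoc]
    · have h0 := h'.inner c
      have h1 := h'.root c
      have h2 := h.inner none
      have h3 := h.root none
      rcases hr : R.parent c with _ | _ <;>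
      rcases hu : U.parent (.inr c) with _ | ((_ | _) | _) <;>
      rcases hw : W.parent (.inr none) with _ | (_ | (_ | _)) <;>
      rcases hs : S.parent none with _ | (_ | _) <;>
      simp_all [optR, keep, Equiv.sumAssoc]

theorem IsInsertion.assoc' {A B C : Type} [Finite B] {T : RTree (Option A)} {S : RTree (Option B)}
    {R : RTree C} {W' : RTree (B ⊕ C)} {U : RTree ((A ⊕ B) ⊕ C)}
    (h : IsInsertion S.parent R.parent W'.parent)
    (h' : IsInsertion T.parent W'.parent (U.relabel (Equiv.sumAssoc A B C)).parent) :
    ∃ W : RTree (A ⊕ Option B), IsInsertion T.parent S.parent W.parent ∧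
      IsInsertion (W.relabel (optR A B)).parent R.parent U.parent := by
  have hT := T.parent_ne_self none
  have hS := S.parent_ne_self none
  obtain ⟨c, hc, hcu⟩ := R.existsUnique_root
  have key : IsInsertion T.parent S.parent (fun x : A ⊕ Option B => match x with
      | .inl a => ((U.parent (.inl (.inl a))).map collapse).map (optR A B).symm
      | .inr (some b) => ((U.parent (.inl (.inr b))).map collapse).map (optR A B).symm
      | .inr none => ((U.parent (.inr c)).map collapse).map (optR A B).symm) := by
    refine ⟨fun a => ?_, fun x x' hx => ?_, fun x hx => ?_⟩
    · have h1 := h'.outer a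
      rcases hu : U.parent (.inl (.inl a)) with _ | ((_ | _) | _) <;>
      simp_all [optR, Equiv.sumAssoc]
    · rcases x with _ | b
      · have h1 := h.root c hc
        have h2 := h'.inner (.inr c)
        rcases hw : W'.parent (.inr c) with _ | (_ | _) <;>
        rcases hu : U.parent (.inr c) with _ | ((_ | _) | _) <;>
        simp_all [optR, Equiv.sumAssoc]
      · have h1 := h.outer b
        have h2 := h'.inner (.inl b)
        rcases hw : W'.parent (.inl b) with _ | (_ | _) <;>
        rcases hu : U.parent (.inl (.inr b)) with _ | ((_ | _) | _) <;>
        simp_all [optR, Equiv.sumAssoc]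
    · rcases x with _ | b
      · have h1 := h.root c hc
        have h2 := h'.inner (.inr c)
        have h3 := h'.root (.inr c)
        rcases hw : W'.parent (.inr c) with _ | (_ | _) <;>
        rcases hu : U.parent (.inr c) with _ | ((_ | _) | _) <;>
        simp_all [optR, Equiv.sumAssoc]
      · have h1 := h.outer b
        have h2 := h'.inner (.inl b)
        have h3 := h'.root (.inl b)
        rcases hw : W'.parent (.inl b) with _ | (_ | _) <;>
        rcases hu : U.parent (.inl (.inr b)) with _ | ((_ | _) | _) <;>
        simp_all [optR, Equiv.sumAssoc]
  obtain ⟨W, hW⟩ := key.isTree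
  refine ⟨W, hW ▸ key, ?_⟩
  refine ⟨fun x => ?_, fun d d' hd => ?_, fun d hd => ?_⟩
  · simp only [relabel_parent, hW]
    rcases x with a | b
    · rcases hu : U.parent (.inl (.inl a)) with _ | ((_ | _) | _) <;>
      simp_all [optR]
    · rcases hu : U.parent (.inl (.inr b)) with _ | ((_ | _) | _) <;>
      simp_all [optR]
  · have h1 := h.inner d d' hd
    have h2 := h'.inner (.inr d) _ h1
    rcases hu : U.parent (.inr d) with _ | ((_ | _) | _) <;>
      simp_all [optR, Equiv.sumAssoc]
  · obtain rfl := hcu d hd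
    simp only [relabel_parent, hW]
    rcases hu : U.parent (.inr d) with _ | ((_ | _) | _) <;>
      simp_all [optR]

theorem IsInsertion.comm {A B C : Type} [Finite C] {T : RTree (Option (Option A))} {S : RTree B}
    {R : RTree C} {W : RTree (Option A ⊕ B)} {U : RTree ((A ⊕ B) ⊕ C)}
    (h : IsInsertion T.parent S.parent W.parent)
    (h' : IsInsertion (W.relabel (optL A B)).parent R.parent U.parent) :
    ∃ W' : RTree (Option A ⊕ C),
      IsInsertion (T.relabel (optSwap A)).parent R.parent W'.parent ∧
      IsInsertion (W'.relabel (optL A C)).parent S.parent (U.relabel (sumRight A B C)).parent := by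
  have hT := T.parent_ne_self none
  have hT' := T.parent_ne_self (some none)
  obtain ⟨s, hs, hsu⟩ := S.existsUnique_root
  have key : IsInsertion (T.relabel (optSwap A)).parent R.parent
      (fun x : Option A ⊕ C => match x with
      | .inl (some a) => (((U.relabel (sumRight A B C)).parent (.inl (.inl a))).map collapse).map
          (optL A C).symm
      | .inr c => (((U.relabel (sumRight A B C)).parent (.inl (.inr c))).map collapse).map
          (optL A C).symm
      | .inl none => (((U.relabel (sumRight A B C)).parent (.inr s)).map collapse).map
          (optL A C).symm) := by
    refine ⟨fun a => ?_, fun c c' hc => ?_, fun c hc => ?_⟩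
    · rcases a with _ | a
      · have h1 := h.root s hs
        have h2 := h'.outer (.inr s)
        rcases hu : U.parent (.inl (.inr s)) with _ | ((_ | _) | _) <;>
        rcases hw : W.parent (.inr s) with _ | ((_ | _) | _) <;>
        simp_all [optL, optSwap, sumRight] <;> simp [← h1]
      · have h1 := h.outer (some a)
        have h2 := h'.outer (.inl a)
        rcases hu : U.parent (.inl (.inl a)) with _ | ((_ | _) | _) <;>
        rcases hw : W.parent (.inl (some a)) with _ | ((_ | _) | _) <;>
        simp_all [optL, optSwap, sumRight] <;> simp [← h1]
    · have h1 := h'.inner c c' hc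
      simp_all [optL, sumRight]
    · have h1 := h'.root c hc
      have h2 := h.outer none
      rcases hu : U.parent (.inr c) with _ | ((_ | _) | _) <;>
      rcases hw : W.parent (.inl none) with _ | ((_ | _) | _) <;>
      simp_all [optL, optSwap, sumRight] <;> simp [← h2]
  obtain ⟨W', hW'⟩ := key.isTree
  refine ⟨W', hW' ▸ key, ?_⟩
  refine ⟨fun x => ?_, fun d d' hd => ?_, fun d hd => ?_⟩
  · simp only [relabel_parent, hW']
    rcases x with a | c
    · rcases hu : U.parent (.inl (.inl a)) with _ | ((_ | _) | _) <;>
      simp_all [optL, sumRight]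
    · rcases hu : U.parent (.inr c) with _ | ((_ | _) | _) <;>
      simp_all [optL, sumRight]
  · have h1 := h.inner d d' hd
    have h2 := h'.outer (.inr d)
    rcases hu : U.parent (.inl (.inr d)) with _ | ((_ | _) | _) <;>
      simp_all [optL, sumRight]
  · obtain rfl := hsu d hd
    simp only [relabel_parent, hW']
    rcases hu : U.parent (.inl (.inr d)) with _ | ((_ | _) | _) <;>
      simp_all [optL, sumRight]

end RTree

namespace RTOp

variable (K : Type u) [Field K]

open Classical in
/-- Insertion of linear combinations of rooted trees: `T ∘ S` is the sum of all trees which arise by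
inserting `S` into the vertex `none` of `T`. Linear combinations of trees are encoded by their
coefficient functions. -/
noncomputable def insertion {A B : Type} [Finite A] [Finite B] :
    (RTree (Option A) → K) →ₗ[K] (RTree B → K) →ₗ[K] (RTree (A ⊕ B) → K) :=
  LinearMap.mk₂ K
    (fun f g U => ∑ T : RTree (Option A), ∑ S : RTree B,
      if RTree.IsInsertion T.parent S.parent U.parent then f T * g S else 0)
    (fun f f' g => funext fun U => by
      simp only [Pi.add_apply, ← Finset.sum_add_distrib]
      refine Finset.sum_congr rfl fun T _ => Finset.sum_congr rfl fun S _ => ?_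
      split_ifs <;> ring)
    (fun c f g => funext fun U => by
      simp only [Pi.smul_apply, smul_eq_mul, Finset.mul_sum]
      refine Finset.sum_congr rfl fun T _ => Finset.sum_congr rfl fun S _ => ?_
      split_ifs <;> ring)
    (fun f f' g => funext fun U => by
      simp only [Pi.add_apply, ← Finset.sum_add_distrib]
      refine Finset.sum_congr rfl fun T _ => Finset.sum_congr rfl fun S _ => ?_
      split_ifs <;> ring)
    (fun c f g => funext fun U => by
      simp only [Pi.smul_apply, smul_eq_mul, Finset.mul_sum]
      refine Finset.sum_congr rfl fun T _ => Finset.sum_congr rfl fun S _ => ?_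
      split_ifs <;> ring)

variable {K}

theorem insertion_of {A B : Type} [Finite A] [Finite B] (f : RTree (Option A) → K) (g : RTree B → K)
    {T : RTree (Option A)} {S : RTree B} {U : RTree (A ⊕ B)}
    (h : RTree.IsInsertion T.parent S.parent U.parent) : insertion K f g U = f T * g S := by
  classical
  simp only [insertion, LinearMap.mk₂_apply]
  rw [Finset.sum_eq_single T, Finset.sum_eq_single S, if_pos h]
  · intro S' _ hS
    rw [if_neg fun h' => hS (h'.unique h).2]
  · simp
  · intro T' _ hT
    exact Finset.sum_eq_zero fun S' _ => if_neg fun h' => hT (h'.unique h).1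
  · simp

theorem insertion_not {A B : Type} [Finite A] [Finite B] (f : RTree (Option A) → K)
    (g : RTree B → K) {U : RTree (A ⊕ B)}
    (h : ∀ (T : RTree (Option A)) (S : RTree B), ¬ RTree.IsInsertion T.parent S.parent U.parent) :
    insertion K f g U = 0 :=
  Finset.sum_eq_zero fun T _ => Finset.sum_eq_zero fun S _ => if_neg (h T S)

theorem optSwap_symm (A : Type) : (optSwap A).symm = optSwap A := rfl

theorem relabel_symm_relabel {V W : Type} (e : V ≃ W) (T : RTree W) :
    (T.relabel e.symm).relabel e = T := by
  rw [RTree.relabel_relabel, Equiv.symm_trans_self, RTree.relabel_refl]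

theorem relabel_relabel_symm {V W : Type} (e : V ≃ W) (T : RTree V) :
    (T.relabel e).relabel e.symm = T := by
  rw [RTree.relabel_relabel, Equiv.self_trans_symm, RTree.relabel_refl]

theorem isInsertion_unit {A : Type} (T : RTree (Option A)) (S : RTree Unit) :
    RTree.IsInsertion T.parent S.parent (T.relabel (Equiv.optionEquivSumPUnit A)).parent := by
  refine ⟨fun a => ?_, fun b b' hb => ?_, fun b _ => ?_⟩
  · rcases h : T.parent (some a) with _ | (_ | _) <;> simp [h]
  · exact absurd hb (S.parent_ne_self b)
  · rcases h : T.parent none with _ | (_ | _) <;> simp [h]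

theorem unit_parent (S : RTree Unit) (x : Unit) : S.parent x = none := by
  rcases h : S.parent x with _ | y
  · rfl
  · exact absurd h (S.parent_ne_self x)

theorem optEmpty_parent (S : RTree (Option Empty)) (x : Option Empty) : S.parent x = none := by
  rcases x with _ | x
  · rcases h : S.parent none with _ | (_ | x)
    · rfl
    · exact absurd h (S.parent_ne_self none)
    · exact x.elim
  · exact x.elim

theorem isInsertion_empty {B : Type} (T : RTree (Option Empty)) (S : RTree B) :
    RTree.IsInsertion T.parent S.parent (S.relabel (Equiv.emptySum Empty B).symm).parent := by
  refine ⟨fun a => a.elim, fun b b' hb => ?_, fun b hb => ?_⟩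
  · simp [hb]
  · simp [hb, optEmpty_parent]

/-- The tree with one vertex. -/
def unitTree : RTree Unit where
  parent _ := none
  existsUnique_root := ⟨(), rfl, fun _ _ => rfl⟩
  acyclic := ⟨fun _ => 0, fun _ _ h => by cases h⟩

variable (K)

/-- The operad of rooted trees. -/
noncomputable def rtLin : LinOperad K where
  obj A _ := RTree A → K
  map e := LinearMap.funLeft K K (RTree.relabel e.symm)
  one _ := 1
  comp := insertion K
  map_refl x := by
    funext U
    simp [LinearMap.funLeft_apply]
  map_map e f x := by
    funext U
    simp [LinearMap.funLeft_apply, RTree.relabel_relabel]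
  comp_map e f x y := by
    funext U
    rw [LinearMap.funLeft_apply]
    by_cases h : ∃ (T : RTree (Option _)) (S : RTree _), RTree.IsInsertion T.parent S.parent
        (U.relabel (e.sumCongr f).symm).parent
    · obtain ⟨T, S, h⟩ := h
      have h' := h.relabel e f
      rw [relabel_symm_relabel] at h'
      rw [insertion_of _ _ h, insertion_of _ _ h', LinearMap.funLeft_apply, LinearMap.funLeft_apply,
        relabel_relabel_symm, relabel_relabel_symm]
    · push Not at h
      rw [insertion_not _ _ h, insertion_not]
      intro T S h'
      exact h _ _ (h'.relabel e.symm f.symm)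
  comp_one {A _} x := by
    funext U
    have h := isInsertion_unit (U.relabel (Equiv.optionEquivSumPUnit A).symm) unitTree
    rw [relabel_symm_relabel] at h
    rw [insertion_of _ _ h, mul_one, LinearMap.funLeft_apply]
  one_comp {B _} y := by
    funext U
    have h := isInsertion_empty (unitTree.relabel unitOpt) (U.relabel (Equiv.emptySum Empty B))
    rw [relabel_relabel_symm] at h
    rw [insertion_of _ _ h, LinearMap.funLeft_apply, LinearMap.funLeft_apply, one_mul]
    rfl
  comp_assoc {A B C _ _ _} x y z := by
    funext U
    rw [LinearMap.funLeft_apply, Equiv.symm_symm]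
    by_cases h : ∃ (T : RTree (Option A)) (W' : RTree (B ⊕ C)), RTree.IsInsertion T.parent W'.parent
        (U.relabel (Equiv.sumAssoc A B C)).parent
    · obtain ⟨T, W', h⟩ := h
      rw [insertion_of _ _ h]
      by_cases h' : ∃ (S : RTree (Option B)) (R : RTree C), RTree.IsInsertion S.parent R.parent
          W'.parent
      · obtain ⟨S, R, h'⟩ := h'
        rw [insertion_of _ _ h']
        obtain ⟨W, h1, h2⟩ := h'.assoc' h
        rw [insertion_of _ _ h2, LinearMap.funLeft_apply, relabel_relabel_symm, insertion_of _ _ h1,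
          mul_assoc]
      · push Not at h'
        rw [insertion_not _ _ h', mul_zero]
        by_cases h3 : ∃ (W : RTree (Option (A ⊕ B))) (R : RTree C),
            RTree.IsInsertion W.parent R.parent U.parent
        · obtain ⟨W, R, h3⟩ := h3
          rw [insertion_of _ _ h3, LinearMap.funLeft_apply, insertion_not, zero_mul]
          intro T₂ S h4
          rw [← relabel_symm_relabel (optR A B) W] at h3
          obtain ⟨W₂, h5, h6⟩ := h4.assoc h3
          rw [(h6.unique h).2] at h5
          exact h' _ _ h5
        · push Not at h3
          rw [insertion_not _ _ h3]
    · push Not at h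
      rw [insertion_not _ _ h]
      by_cases h3 : ∃ (W : RTree (Option (A ⊕ B))) (R : RTree C),
          RTree.IsInsertion W.parent R.parent U.parent
      · obtain ⟨W, R, h3⟩ := h3
        rw [insertion_of _ _ h3, LinearMap.funLeft_apply, insertion_not, zero_mul]
        intro T₂ S h4
        rw [← relabel_symm_relabel (optR A B) W] at h3
        obtain ⟨W₂, h5, h6⟩ := h4.assoc h3
        exact h _ _ h6
      · push Not at h3
        rw [insertion_not _ _ h3]
  comp_comm {A B C _ _ _} x y z := by
    have aux : ∀ {A B C : Type} [Finite A] [Finite B] [Finite C] (x : RTree (Option (Option A)) → K)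
        (y : RTree B → K) (z : RTree C → K) (U : RTree ((A ⊕ B) ⊕ C)),
        (∃ (T : RTree (Option (Option A))) (S : RTree B) (R : RTree C) (W : RTree (Option A ⊕ B)),
          RTree.IsInsertion T.parent S.parent W.parent ∧
          RTree.IsInsertion (W.relabel (optL A B)).parent R.parent U.parent ∧
          insertion K (LinearMap.funLeft K K (RTree.relabel (optL A B).symm) (insertion K x y)) z U
            = x T * y S * z R) ∨
        (∀ (T : RTree (Option (Option A))) (S : RTree B) (R : RTree C) (W : RTree (Option A ⊕ B)),
          RTree.IsInsertion T.parent S.parent W.parent →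
          ¬ RTree.IsInsertion (W.relabel (optL A B)).parent R.parent U.parent) ∧
          insertion K (LinearMap.funLeft K K (RTree.relabel (optL A B).symm) (insertion K x y)) z U
            = 0 := by
      intro A B C _ _ _ x y z U
      by_cases h : ∃ (T : RTree (Option (Option A))) (S : RTree B) (R : RTree C)
          (W : RTree (Option A ⊕ B)), RTree.IsInsertion T.parent S.parent W.parent ∧
          RTree.IsInsertion (W.relabel (optL A B)).parent R.parent U.parent
      · left
        obtain ⟨T, S, R, W, h1, h2⟩ := h
        refine ⟨T, S, R, W, h1, h2, ?_⟩
        rw [insertion_of _ _ h2, LinearMap.funLeft_apply, relabel_relabel_symm, insertion_of _ _ h1]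
      · right
        push Not at h
        refine ⟨h, ?_⟩
        by_cases h3 : ∃ (W : RTree (Option (A ⊕ B))) (R : RTree C),
            RTree.IsInsertion W.parent R.parent U.parent
        · obtain ⟨W, R, h3⟩ := h3
          rw [insertion_of _ _ h3, LinearMap.funLeft_apply, insertion_not, zero_mul]
          intro T₂ S h4
          rw [← relabel_symm_relabel (optL A B) W] at h3
          exact h _ _ _ _ h4 h3
        · push Not at h3
          rw [insertion_not _ _ h3]
    funext U
    rw [LinearMap.funLeft_apply]
    rw [show (sumRight A C B).symm = sumRight A B C from
      Equiv.ext (by rintro ((_ | _) | _) <;> rfl)]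
    rcases aux x y z U with ⟨T, S, R, W, h1, h2, e⟩ | ⟨h, e⟩
    · rw [e]
      obtain ⟨W', h3, h4⟩ := h1.comm h2
      rw [insertion_of _ _ h4, LinearMap.funLeft_apply, relabel_relabel_symm, insertion_of _ _ h3,
        LinearMap.funLeft_apply, optSwap_symm, RTree.relabel_relabel]
      rw [show (optSwap A).trans (optSwap A) = Equiv.refl _ from
        (optSwap A).symm_trans_self, RTree.relabel_refl]
      ring
    · rw [e]
      rcases aux (LinearMap.funLeft K K (RTree.relabel (optSwap A).symm) x) z y
        (U.relabel (sumRight A B C)) with ⟨T, S, R, W, h1, h2, e'⟩ | ⟨h', e'⟩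
      · obtain ⟨W', h3, h4⟩ := h1.comm h2
        have h5 : (U.relabel (sumRight A B C)).relabel (sumRight A C B) = U := by
          rw [RTree.relabel_relabel, show (sumRight A B C).trans (sumRight A C B) = Equiv.refl _ from
            Equiv.ext (by rintro ((_ | _) | _) <;> rfl), RTree.relabel_refl]
        rw [h5] at h4
        exact absurd h4 (h _ _ _ _ h3)
      · exact e'.symm

end RTOp

namespace LinOperad

variable {K : Type u} [Field K] (P : LinOperad K)

theorem comp_map_left {A A' B : Type} [Finite A] [Finite A'] [Finite B] (e : A ≃ A')
    (x : P.obj (Option A)) (y : P.obj B) :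
    P.comp (P.map e.optionCongr x) y = P.map (e.sumCongr (Equiv.refl B)) (P.comp x y) := by
  rw [← P.comp_map, P.map_refl]

theorem comp_map_right {A B B' : Type} [Finite A] [Finite B] [Finite B'] (f : B ≃ B')
    (x : P.obj (Option A)) (y : P.obj B) :
    P.comp x (P.map f y) = P.map ((Equiv.refl A).sumCongr f) (P.comp x y) := by
  rw [← P.comp_map, Equiv.optionCongr_refl, P.map_refl]

theorem map_eq_of {A B : Type} [Finite A] [Finite B] {e f : A ≃ B} (h : ∀ x, e x = f x)
    (x : P.obj A) : P.map e x = P.map f x := by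
  rw [Equiv.ext h]

/-- The two-element set, with the second element regarded as marked. -/
def opt2 : Fin 2 ≃ Option Unit where
  toFun i := if i = 0 then some () else none
  invFun
    | some _ => 0
    | none => 1
  left_inv i := by fin_cases i <;> rfl
  right_inv := by rintro (_ | _) <;> rfl

/-- Cyclic permutation of three inputs. -/
def cyc3 : Unit ⊕ Fin 2 ≃ Unit ⊕ Fin 2 where
  toFun
    | .inl _ => .inr 0
    | .inr 0 => .inr 1
    | .inr 1 => .inl ()
  invFun
    | .inl _ => .inr 1
    | .inr 0 => .inl ()
    | .inr 1 => .inr 0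
  left_inv := by rintro (_ | i); · rfl
                 · fin_cases i <;> rfl
  right_inv := by rintro (_ | i); · rfl
                  · fin_cases i <;> rfl

/-- A binary operation `[-,-]` of a linear operad which is antisymmetric and satisfies the Jacobi
identity. This is the same as a morphism from the operad of Lie algebras. -/
structure LieElement where
  /-- the bracket `[0, 1]` -/
  val : P.obj (Fin 2)
  antisymm : P.map (Equiv.swap 0 1) val = -val
  /-- the cyclic sum of `[x, [y, z]]` vanishes -/
  jacobi : P.comp (P.map opt2 val) val + P.map cyc3 (P.comp (P.map opt2 val) val) +
    P.map (cyc3.trans cyc3) (P.comp (P.map opt2 val) val) = 0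

namespace LieElement

variable {P} (β : LieElement P)

/-- A new first element. -/
def unitSum (V : Type) : Unit ⊕ V ≃ Option V where
  toFun
    | .inl _ => none
    | .inr v => some v
  invFun
    | none => .inl ()
    | some v => .inr v
  left_inv := by rintro (_ | _) <;> rfl
  right_inv := by rintro (_ | _) <;> rfl

/-- `none` and `some none` are the two inputs of a bracket inserted into `none`. -/
def splitEquiv (X : Type) : X ⊕ Fin 2 ≃ Option (Option X) where
  toFun
    | .inl x => some (some x)
    | .inr i => if i = 0 then none else some none
  invFun
    | none => .inr 0
    | some none => .inr 1
    | some (some x) => .inl x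
  left_inv := by rintro (_ | i); · rfl
                 · fin_cases i <;> rfl
  right_inv := by rintro (_ | (_ | _)) <;> rfl

/-- The operation `[new, f]`, with the new input called `none`. -/
noncomputable def ad {V : Type} [Finite V] : P.obj V →ₗ[K] P.obj (Option V) :=
  P.map (unitSum V) ∘ₗ P.comp (P.map opt2 β.val)

/-- The operation obtained from `f` by inserting `[new, none]` into the input `none`;
the new input is called `none`, and the old one `some none`. -/
noncomputable def split {X : Type} [Finite X] :
    P.obj (Option X) →ₗ[K] P.obj (Option (Option X)) :=
  P.map (splitEquiv X) ∘ₗ P.comp.flip β.val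

open Classical in
/-- The operation obtained from `f` by inserting `[new, v]` into the input `v`. -/
noncomputable def splitAt {V : Type} [Finite V] (v : V) : P.obj V →ₗ[K] P.obj (Option V) :=
  P.map (Equiv.optionSubtypeNe v).optionCongr ∘ₗ β.split ∘ₗ P.map (Equiv.optionSubtypeNe v).symm

/-- The operation `[new, f] - ∑ c(v) f ∘ᵥ [new, v]`. -/
noncomputable def twistOp {V : Type} [Finite V] (c : V → K) : P.obj V →ₗ[K] P.obj (Option V) :=
  β.ad - ∑ᶠ v, c v • β.splitAt v

theorem twistOp_apply {V : Type} [Fintype V] (c : V → K) (f : P.obj V) :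
    β.twistOp c f = β.ad f - ∑ v, c v • β.splitAt v f := by
  simp [twistOp, finsum_eq_sum_of_fintype]

theorem ad_map {V W : Type} [Finite V] [Finite W] (e : V ≃ W) (f : P.obj V) :
    β.ad (P.map e f) = P.map e.optionCongr (β.ad f) := by
  simp only [ad, LinearMap.comp_apply, P.comp_map_right, P.map_map]
  exact P.map_eq_of (by rintro (_ | _) <;> rfl) _

theorem split_map {X Y : Type} [Finite X] [Finite Y] (e : X ≃ Y) (f : P.obj (Option X)) :
    β.split (P.map e.optionCongr f) = P.map e.optionCongr.optionCongr (β.split f) := by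
  simp only [split, LinearMap.comp_apply, LinearMap.flip_apply, P.comp_map_left, P.map_map]
  refine P.map_eq_of ?_ _
  rintro (_ | i)
  · rfl
  · fin_cases i <;> rfl

theorem splitAt_eq {X V : Type} [Finite X] [Finite V] (e : Option X ≃ V) (f : P.obj V) :
    β.splitAt (e none) f = P.map e.optionCongr (β.split (P.map e.symm f)) := by
  classical
  let g : X ≃ {w // w ≠ e none} :=
    { toFun := fun x => ⟨e (some x), fun h => by simpa using e.injective h⟩
      invFun := fun w => (e.symm w.1).get (by
        rw [← Option.ne_none_iff_isSome]
        intro h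
        exact w.2 ((e.symm_apply_eq).1 h))
      left_inv := fun x => by simp
      right_inv := fun w => by ext; simp }
  have h1 : g.optionCongr.trans (Equiv.optionSubtypeNe (e none)) = e := by
    ext x; rcases x with _ | x <;> simp [g]
  have h2 : P.map e.symm f = P.map g.optionCongr.symm
      (P.map (Equiv.optionSubtypeNe (e none)).symm f) := by
    rw [P.map_map]
    exact congrArg (fun i : Option X ≃ V => P.map i.symm f) h1.symm
  have h3 : P.map (Equiv.optionSubtypeNe (e none)).symm f =
      P.map g.optionCongr (P.map e.symm f) := by
    rw [h2, P.map_map, Equiv.symm_trans_self, P.map_refl]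
  have h4 : splitAt β (e none) f = P.map (Equiv.optionSubtypeNe (e none)).optionCongr
      (β.split (P.map (Equiv.optionSubtypeNe (e none)).symm f)) := by
    unfold splitAt
    simp only [LinearMap.comp_apply]
  rw [h4, h3, split_map, P.map_map]
  refine P.map_eq_of ?_ _
  rintro (_ | x)
  · rfl
  · exact congrArg (fun i : Option X ≃ V => some (i x)) h1

theorem splitAt_none {X : Type} [Finite X] (f : P.obj (Option X)) :
    β.splitAt none f = β.split f := by
  rw [show (none : Option X) = Equiv.refl (Option X) none from rfl, splitAt_eq,
    Equiv.optionCongr_refl, P.map_refl, Equiv.refl_symm, P.map_refl]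

theorem exists_pt {V : Type} [Finite V] (v : V) :
    ∃ (X : Type) (_ : Finite X) (e : Option X ≃ V), e none = v := by
  classical
  exact ⟨{w // w ≠ v}, inferInstance, Equiv.optionSubtypeNe v, rfl⟩

theorem splitAt_map {V W : Type} [Finite V] [Finite W] (e : V ≃ W) (v : V) (f : P.obj V) :
    β.splitAt (e v) (P.map e f) = P.map e.optionCongr (β.splitAt v f) := by
  obtain ⟨X, _, i, rfl⟩ := exists_pt v
  rw [splitAt_eq, show e (i none) = (i.trans e) none from rfl, splitAt_eq, P.map_map, P.map_map]
  rw [show e.trans (i.trans e).symm = i.symm from Equiv.ext fun x => by simp]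
  exact P.map_eq_of (by rintro (_ | _) <;> rfl) _

theorem twistOp_map {V W : Type} [Finite V] [Finite W] (e : V ≃ W) (c : W → K) (f : P.obj V) :
    β.twistOp c (P.map e f) = P.map e.optionCongr (β.twistOp (fun v => c (e v)) f) := by
  cases nonempty_fintype V
  cases nonempty_fintype W
  rw [twistOp_apply, twistOp_apply, map_sub, ad_map, map_sum, ← e.sum_comp]
  simp only [map_smul, splitAt_map]

theorem comp_swap_split {X W : Type} [Finite X] [Finite W] (f : P.obj (Option X)) (g : P.obj W) :
    P.map (optL X W) (P.comp (P.map (optSwap X) (β.split f)) g) =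
      P.map (optR X W) (P.comp f (β.ad g)) := by
  have h := P.comp_assoc f (P.map opt2 β.val) g
  simp only [ad, split, LinearMap.comp_apply, LinearMap.flip_apply, P.comp_map_right, P.map_map]
    at h ⊢
  have h1 : (splitEquiv X).trans (optSwap X) =
      (((Equiv.refl X).sumCongr opt2).trans (optR X Unit)).trans
        (Equiv.optionEquivSumPUnit.{0} X).symm.optionCongr := by
    refine Equiv.ext ?_
    rintro (_ | i)
    · rfl
    · fin_cases i <;> rfl
  rw [h1, ← P.map_map _ (Equiv.optionCongr _), P.comp_map_left, h, P.map_map, P.map_map]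
  refine P.map_eq_of ?_ _
  rintro (_ | (_ | _)) <;> rfl

theorem ad_comp {X W : Type} [Finite X] [Finite W] (f : P.obj (Option X)) (g : P.obj W) :
    β.ad (P.comp f g) = P.map (optL X W) (P.comp (P.map (optSwap X) (β.ad f)) g) := by
  have h := P.comp_assoc (P.map opt2 β.val) f g
  simp only [ad, LinearMap.comp_apply, P.map_map] at h ⊢
  have h1 : (unitSum (Option X)).trans (optSwap X) =
      (optR Unit X).trans (unitSum X).optionCongr := by
    refine Equiv.ext ?_
    rintro (_ | (_ | _)) <;> rfl
  rw [h1, ← P.map_map _ (Equiv.optionCongr _), P.comp_map_left, h, P.map_map, P.map_map]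
  refine P.map_eq_of ?_ _
  rintro (_ | (_ | _)) <;> rfl

theorem splitAt_inr_comp {X W : Type} [Finite X] [Finite W] (f : P.obj (Option X)) (g : P.obj W)
    (w : W) : β.splitAt (.inr w) (P.comp f g) = P.map (optR X W) (P.comp f (β.splitAt w g)) := by
  obtain ⟨Y, _, i, rfl⟩ := exists_pt w
  obtain ⟨g, rfl⟩ : ∃ g', g = P.map i g' := ⟨P.map i.symm g, by
    rw [P.map_map, Equiv.symm_trans_self, P.map_refl]⟩
  have h1 : (.inr (i none) : X ⊕ W) =
      ((optR X Y).symm.trans ((Equiv.refl X).sumCongr i)) none := rfl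
  rw [splitAt_map, splitAt_none, P.comp_map_right, h1, splitAt_eq, P.map_map]
  have h := P.comp_assoc f g β.val
  have h2 : ((Equiv.refl X).sumCongr i).trans
      ((optR X Y).symm.trans ((Equiv.refl X).sumCongr i)).symm = optR X Y := by
    refine Equiv.ext ?_
    rintro (_ | (_ | _)) <;> simp [optR]
  rw [h2]
  simp only [split, LinearMap.comp_apply, LinearMap.flip_apply, h, P.map_map, P.comp_map_right]
  refine P.map_eq_of ?_ _
  rintro (_ | (_ | j))
  · rfl
  · rfl
  · fin_cases j <;> rfl

theorem splitAt_inl_comp {X W : Type} [Finite X] [Finite W] (f : P.obj (Option X)) (g : P.obj W)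
    (x : X) : β.splitAt (.inl x) (P.comp f g) =
      P.map (optL X W) (P.comp (P.map (optSwap X) (β.splitAt (some x) f)) g) := by
  obtain ⟨Y, _, i, rfl⟩ := exists_pt x
  obtain ⟨f, rfl⟩ : ∃ f', f = P.map i.optionCongr f' := ⟨P.map i.optionCongr.symm f, by
    rw [P.map_map, Equiv.symm_trans_self, P.map_refl]⟩
  have h1 : (.inl (i none) : X ⊕ W) =
      ((optL Y W).symm.trans (i.sumCongr (Equiv.refl W))) none := rfl
  have h2 : (some (i none) : Option X) = ((optSwap Y).trans i.optionCongr) none := rfl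
  rw [P.comp_map_left, h1, splitAt_eq, P.map_map, h2, splitAt_eq, P.map_map i.optionCongr, P.map_map]
  have h3 : (i.sumCongr (Equiv.refl W)).trans
      ((optL Y W).symm.trans (i.sumCongr (Equiv.refl W))).symm = optL Y W := by
    refine Equiv.ext ?_
    rintro ((_ | _) | _) <;> simp [optL]
  have h4 : i.optionCongr.trans ((optSwap Y).trans i.optionCongr).symm = optSwap Y := by
    refine Equiv.ext fun x => ?_
    rw [Equiv.trans_apply, Equiv.symm_trans_apply, Equiv.symm_apply_apply]
    rfl
  rw [h3, h4]
  have h := P.comp_comm f g β.val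
  simp only [split, LinearMap.comp_apply, LinearMap.flip_apply, h, P.map_map]
  have h5 : (splitEquiv (Option Y)).trans (((optSwap Y).trans i.optionCongr).optionCongr.trans
      (optSwap X)) = (optL Y (Fin 2)).trans (Equiv.optionCongr
        ((splitEquiv Y).trans i.optionCongr)) := by
    refine Equiv.ext ?_
    rintro ((_ | _) | j)
    · rfl
    · rfl
    · fin_cases j <;> rfl
  rw [h5, ← P.map_map (optL Y (Fin 2)), P.comp_map_left, P.map_map]
  refine P.map_eq_of ?_ _
  rintro ((_ | j) | _)
  · rfl
  · fin_cases j <;> rfl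
  · rfl

theorem twistOp_comp {X W : Type} [Finite X] [Finite W] (f : P.obj (Option X)) (g : P.obj W)
    (c : X ⊕ W → K) :
    β.twistOp c (P.comp f g) =
      P.map (optL X W) (P.comp (P.map (optSwap X)
        (β.twistOp (fun x : Option X => x.elim 1 fun x => c (.inl x)) f)) g) +
      P.map (optR X W) (P.comp f (β.twistOp (fun w => c (.inr w)) g)) := by
  cases nonempty_fintype X
  cases nonempty_fintype W
  simp only [twistOp_apply, Fintype.sum_sum_type, Fintype.sum_option, map_sub, map_add, map_sum,
    map_smul, LinearMap.sub_apply, LinearMap.add_apply, LinearMap.sum_apply, LinearMap.smul_apply,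
    splitAt_inl_comp, splitAt_inr_comp, splitAt_none, comp_swap_split, ad_comp, Option.elim,
    one_smul]
  abel

end LieElement

end LinOperad

namespace LinOperad

namespace LieElement

variable {K : Type u} [Field K] {P : LinOperad K} (β : LieElement P)

theorem map_optSwap_optSwap {X : Type} [Finite X] (x : P.obj (Option (Option X))) :
    P.map (optSwap X) (P.map (optSwap X) x) = x := by
  rw [P.map_map, show (optSwap X).trans (optSwap X) = Equiv.refl _ from
    Equiv.ext (by rintro (_ | (_ | _)) <;> rfl), P.map_refl]

/-- Exchange the first and the third marked point. -/
def swap13 (X : Type) : Option (Option (Option X)) ≃ Option (Option (Option X)) where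
  toFun
    | none => some (some none)
    | some none => some none
    | some (some none) => none
    | some (some (some x)) => some (some (some x))
  invFun
    | none => some (some none)
    | some none => some none
    | some (some none) => none
    | some (some (some x)) => some (some (some x))
  left_inv := by rintro (_ | (_ | (_ | _))) <;> rfl
  right_inv := by rintro (_ | (_ | (_ | _))) <;> rfl

/-- Exchange the first marked point with the only other element. -/
def kap : Option (Option Unit) ≃ Option (Option Unit) where
  toFun
    | none => some (some ())
    | some none => some none
    | some (some _) => none
  invFun
    | none => some (some ())
    | some none => some none
    | some (some _) => none
  left_inv := by rintro (_ | (_ | _)) <;> rfl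
  right_inv := by rintro (_ | (_ | _)) <;> rfl

theorem map_kap_kap (x : P.obj (Option (Option Unit))) : P.map kap (P.map kap x) = x := by
  rw [P.map_map, show kap.trans kap = Equiv.refl _ from
    Equiv.ext (by rintro (_ | (_ | _)) <;> rfl), P.map_refl]

/-- The bracket with the second input marked. -/
noncomputable def br : P.obj (Option Unit) := P.map opt2 β.val

/-- The operation `[u, [new, none]]`. -/
noncomputable def dbl : P.obj (Option (Option Unit)) := β.split β.br

theorem val_eq : β.val = P.map opt2.symm β.br := by
  rw [br, P.map_map, Equiv.self_trans_symm, P.map_refl]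

/-- Exchange the two elements. -/
def sw : Option Unit ≃ Option Unit where
  toFun
    | none => some ()
    | some _ => none
  invFun
    | none => some ()
    | some _ => none
  left_inv := by rintro (_ | _) <;> rfl
  right_inv := by rintro (_ | _) <;> rfl

theorem br_antisymm : P.map sw β.br = -β.br := by
  rw [br, P.map_map, ← map_neg, ← β.antisymm, P.map_map]
  exact P.map_eq_of (by intro i; fin_cases i <;> rfl) _

theorem dbl_antisymm : P.map (optSwap Unit) β.dbl = -β.dbl := by
  have h : -β.dbl = P.map (splitEquiv Unit) (P.comp β.br (-β.val)) := by
    rw [map_neg, map_neg]; rfl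
  rw [h, ← β.antisymm, P.comp_map_right]
  simp only [dbl, split, LinearMap.comp_apply, LinearMap.flip_apply, P.map_map]
  refine P.map_eq_of ?_ _
  rintro (_ | i)
  · rfl
  · fin_cases i <;> rfl

theorem dbl_jacobi : β.dbl + P.map kap (P.map (optSwap Unit) β.dbl) +
    P.map (optSwap Unit) (P.map kap β.dbl) = 0 := by
  have h := congrArg (P.map (splitEquiv Unit)) β.jacobi
  rw [map_add, map_add, map_zero, P.map_map, P.map_map] at h
  rw [← h]
  simp only [dbl, split, LinearMap.comp_apply, LinearMap.flip_apply, P.map_map, br]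
  congr 1
  · congr 1
    refine P.map_eq_of ?_ _
    rintro (_ | i)
    · rfl
    · fin_cases i <;> rfl
  · refine P.map_eq_of ?_ _
    rintro (_ | i)
    · rfl
    · fin_cases i <;> rfl

theorem ad_br : β.ad β.br = P.map kap β.dbl := by
  have h : β.dbl = P.map (splitEquiv Unit) (P.comp β.br β.val) := rfl
  rw [h, val_eq, P.comp_map_right, P.map_map, P.map_map]
  simp only [ad, LinearMap.comp_apply]
  exact P.map_eq_of (by rintro (_ | (_ | _)) <;> rfl) _

theorem splitAt_br : β.splitAt (some ()) β.br = P.map kap β.dbl - β.dbl := by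
  have h1 : β.splitAt (some ()) β.br = -P.map sw.optionCongr β.dbl := by
    rw [show (some () : Option Unit) = sw none from rfl, splitAt_eq,
      show sw.symm = sw from rfl, br_antisymm, map_neg, map_neg]
    rfl
  have h3 : P.map (optSwap Unit) (P.map kap (P.map (optSwap Unit) β.dbl)) =
      P.map sw.optionCongr β.dbl := by
    rw [P.map_map, P.map_map]
    exact P.map_eq_of (by rintro (_ | (_ | _)) <;> rfl) _
  have h4 := β.dbl_jacobi
  rw [dbl_antisymm, map_neg] at h3 h4
  rw [map_neg] at h3
  rw [h1, ← h3, neg_neg]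
  rw [← sub_eq_zero, ← h4]
  abel

theorem splitAt_ad {V : Type} [Finite V] (v : V) (f : P.obj V) :
    β.splitAt (some v) (β.ad f) = P.map (optSwap V) (β.ad (β.splitAt v f)) := by
  simp only [ad, LinearMap.comp_apply]
  rw [show (some v : Option V) = unitSum V (.inr v) from rfl, splitAt_map, splitAt_inr_comp]
  simp only [P.map_map]
  exact P.map_eq_of (by rintro (_ | (_ | _)) <;> rfl) _

theorem split_ad {V : Type} [Finite V] (f : P.obj V) :
    β.splitAt none (β.ad f) = β.ad (β.ad f) - P.map (optSwap V) (β.ad (β.ad f)) := by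
  have h1 : ∀ x : P.obj V, β.ad x = P.map (unitSum V) (P.comp β.br x) := fun _ => rfl
  have h2 : β.ad (β.ad f) = P.map (unitSum V).optionCongr (P.map (optL Unit V)
      (P.comp (P.map (optSwap Unit) (P.map kap β.dbl)) f)) := by
    rw [h1 f, ad_map, ad_comp, ad_br]
  have h3 : β.splitAt none (β.ad f) = P.map (unitSum V).optionCongr (P.map (optL Unit V)
      (P.comp (P.map (optSwap Unit) (P.map kap β.dbl)) f)) - P.map (unitSum V).optionCongr
      (P.map (optL Unit V) (P.comp (P.map (optSwap Unit) β.dbl) f)) := by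
    rw [h1 f, show (none : Option V) = unitSum V (.inl ()) from rfl, splitAt_map, splitAt_inl_comp,
      splitAt_br]
    simp only [map_sub, LinearMap.sub_apply]
  rw [h3, h2]
  congr 1
  have h4 : P.map (optSwap Unit) β.dbl =
      P.map sw.optionCongr (P.map (optSwap Unit) (P.map kap β.dbl)) := by
    conv_lhs => rw [← map_kap_kap β.dbl]
    simp only [P.map_map]
    exact P.map_eq_of (by rintro (_ | (_ | _)) <;> rfl) _
  rw [h4, P.comp_map_left]
  simp only [P.map_map]
  exact P.map_eq_of (by rintro ((_ | _) | _) <;> rfl) _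

theorem split_eq {X : Type} [Finite X] (f : P.obj (Option X)) :
    β.split f = P.map (splitEquiv X) (P.comp f β.val) := rfl

theorem splitAt_comm_aux {X : Type} [Finite X] (x : X) (f : P.obj (Option X)) :
    β.splitAt (some (some x)) (β.split f) =
      P.map (optSwap (Option X)) (β.splitAt (some none) (β.splitAt (some x) f)) := by
  rw [show (some none : Option (Option X)) = optSwap X none from rfl, splitAt_eq,
    show (optSwap X).symm = optSwap X from rfl, split_eq, split_eq,
    show (some (some x) : Option (Option X)) = splitEquiv X (.inl x) from rfl, splitAt_map,
    splitAt_inl_comp, P.map_map, P.map_map, P.map_map]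
  refine P.map_eq_of ?_ _
  rintro ((_ | _) | i)
  · rfl
  · rfl
  · fin_cases i <;> rfl

theorem splitAt_comm {V : Type} [Finite V] {v w : V} (h : v ≠ w) (f : P.obj V) :
    β.splitAt (some w) (β.splitAt v f) =
      P.map (optSwap V) (β.splitAt (some v) (β.splitAt w f)) := by
  obtain ⟨X, _, e, rfl⟩ := exists_pt v
  obtain ⟨f, rfl⟩ : ∃ f', f = P.map e f' := ⟨P.map e.symm f, by
    rw [P.map_map, Equiv.symm_trans_self, P.map_refl]⟩
  obtain ⟨x, rfl⟩ : ∃ x, w = e (some x) := by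
    obtain ⟨y, rfl⟩ := e.surjective w
    rcases y with _ | x
    · exact absurd rfl h
    · exact ⟨x, rfl⟩
  have h1 : ∀ y : Option X, some (e y) = e.optionCongr (some y) := fun _ => rfl
  rw [splitAt_map, splitAt_map, h1, h1, splitAt_map, splitAt_map, splitAt_none, splitAt_comm_aux,
    P.map_map, P.map_map]
  exact P.map_eq_of (by rintro (_ | (_ | _)) <;> rfl) _

/-- Inserting a ternary operation into `f`. -/
noncomputable def place {X : Type} [Finite X] (f : P.obj (Option X)) :
    P.obj (Option (Option Unit)) →ₗ[K] P.obj (Option (Option (Option X))) :=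
  P.map (splitEquiv X).optionCongr ∘ₗ P.map (optR X (Fin 2)) ∘ₗ P.comp f ∘ₗ
    P.map opt2.symm.optionCongr

theorem place_optSwap {X : Type} [Finite X] (f : P.obj (Option X))
    (x : P.obj (Option (Option Unit))) :
    place f (P.map (optSwap Unit) x) = P.map (swap13 X) (place f x) := by
  simp only [place, LinearMap.comp_apply, P.map_map, P.comp_map_right]
  exact P.map_eq_of (by rintro (_ | (_ | (_ | _))) <;> rfl) _

theorem place_kap {X : Type} [Finite X] (f : P.obj (Option X))
    (x : P.obj (Option (Option Unit))) :
    place f (P.map kap x) = P.map (optSwap (Option X)) (place f x) := by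
  simp only [place, LinearMap.comp_apply, P.map_map, P.comp_map_right]
  exact P.map_eq_of (by rintro (_ | (_ | (_ | _))) <;> rfl) _

theorem splitAt_some_split {X : Type} [Finite X] (f : P.obj (Option X)) :
    β.splitAt (some none) (β.split f) = place f β.dbl := by
  rw [split_eq, show (some none : Option (Option X)) = splitEquiv X (.inr 1) from rfl, splitAt_map,
    splitAt_inr_comp, val_eq, show (1 : Fin 2) = opt2.symm none from rfl, splitAt_map,
    splitAt_none]
  rfl

theorem splitAt_none_split {X : Type} [Finite X] (f : P.obj (Option X)) :
    β.splitAt none (β.split f) = P.map (optSwap (Option X)) (β.splitAt (some none) (β.split f)) -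
      β.splitAt (some none) (β.split f) := by
  rw [splitAt_some_split, ← place_kap, ← map_sub, ← splitAt_br,
    split_eq, show (none : Option (Option X)) = splitEquiv X (.inr 0) from rfl, splitAt_map,
    splitAt_inr_comp, val_eq, show (0 : Fin 2) = opt2.symm (some ()) from rfl, splitAt_map]
  rfl

theorem splitAt_none_splitAt {V : Type} [Finite V] (v : V) (f : P.obj V) :
    β.splitAt none (β.splitAt v f) = P.map (optSwap V) (β.splitAt (some v) (β.splitAt v f)) -
      β.splitAt (some v) (β.splitAt v f) := by
  obtain ⟨X, _, e, rfl⟩ := exists_pt v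
  obtain ⟨f, rfl⟩ : ∃ f', f = P.map e f' := ⟨P.map e.symm f, by
    rw [P.map_map, Equiv.symm_trans_self, P.map_refl]⟩
  have h := β.splitAt_map e.optionCongr none (β.split f)
  rw [splitAt_none_split] at h
  rw [splitAt_map, show some (e none) = e.optionCongr (some none) from rfl, splitAt_map,
    β.splitAt_none f]
  refine h.trans ?_
  rw [map_sub, P.map_map, P.map_map]
  congr 1
  exact P.map_eq_of (by rintro (_ | (_ | _)) <;> rfl) _

theorem splitAt_jacobi {V : Type} [Finite V] [DecidableEq V] (v : V) (f : P.obj V) :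
    β.splitAt (some v) (β.splitAt v f) +
      P.map (Equiv.swap none (some none)) (P.map (Equiv.swap none (some (some v)))
        (β.splitAt (some v) (β.splitAt v f))) +
      P.map (Equiv.swap none (some (some v))) (P.map (Equiv.swap none (some none))
        (β.splitAt (some v) (β.splitAt v f))) = 0 := by
  obtain ⟨X, _, e, rfl⟩ := exists_pt v
  obtain ⟨f, rfl⟩ : ∃ f', f = P.map e f' := ⟨P.map e.symm f, by
    rw [P.map_map, Equiv.symm_trans_self, P.map_refl]⟩
  have h := congrArg (fun x => P.map e.optionCongr.optionCongr (place f x)) β.dbl_jacobi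
  simp only [map_add, map_zero, place_kap, place_optSwap] at h
  rw [splitAt_map, show some (e none) = e.optionCongr (some none) from rfl, splitAt_map,
    splitAt_none, splitAt_some_split, ← h]
  have h1 : ∀ x, e.optionCongr.optionCongr (optSwap (Option X) x) =
      Equiv.swap none (some none) (e.optionCongr.optionCongr x) := by
    rintro (_ | (_ | x))
    · rfl
    · rfl
    · exact (Equiv.swap_apply_of_ne_of_ne (by simp [optSwap]) (by simp [optSwap])).symm
  have h2 : ∀ x, e.optionCongr.optionCongr (swap13 X x) =
      Equiv.swap none (some (some (e none))) (e.optionCongr.optionCongr x) := by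
    rintro (_ | (_ | (_ | x)))
    · exact (Equiv.swap_apply_left _ _).symm
    · exact (Equiv.swap_apply_of_ne_of_ne (by simp [swap13]) (by simp [swap13])).symm
    · exact (Equiv.swap_apply_right _ _).symm
    · exact (Equiv.swap_apply_of_ne_of_ne (by simp [swap13]) (by simp [swap13])).symm
  simp only [P.map_map]
  congr 1
  · congr 1
    refine P.map_eq_of (fun x => ?_) _
    simp only [Equiv.trans_apply, h1, h2]
    rfl
  · refine P.map_eq_of (fun x => ?_) _
    simp only [Equiv.trans_apply, h1, h2]
    rfl

end LieElement
end LinOperad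

namespace LinOperad

namespace LieElement

variable {K : Type u} [Field K] {P : LinOperad K} (β : LieElement P)

theorem twistOp_sq [CharZero K] {V : Type} [Finite V] [DecidableEq V] (c : V → K)
    {M : Type*} [AddCommGroup M] [Module K M]
    (m : P.obj (Option (Option V)) →ₗ[K] M)
    (h1 : ∀ x, m (P.map (Equiv.swap none (some none)) x) = -m x)
    (h2 : ∀ v, c v = 1 ∨ (c v = 2⁻¹ ∧ ∀ x, m (P.map (Equiv.swap none (some (some v))) x) = -m x))
    (f : P.obj V) :
    m (β.twistOp (fun x : Option V => x.elim 2⁻¹ c) (β.twistOp c f)) = 0 := by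
  cases nonempty_fintype V
  have h0 : optSwap V = Equiv.swap none (some none) := Equiv.ext (by
    rintro (_ | (_ | x))
    · rfl
    · rfl
    · exact (Equiv.swap_apply_of_ne_of_ne (by simp [optSwap]) (by simp [optSwap])).symm)
  have h3 : ∀ x, m (P.map (optSwap V) x) = -m x := by rw [h0]; exact h1
  have hQ : ∀ v, (c v * c v) • m (β.splitAt (some v) (β.splitAt v f)) =
      c v • m (β.splitAt (some v) (β.splitAt v f)) := by
    intro v
    rcases h2 v with h | ⟨h, h4⟩
    · rw [h, one_mul]
    · have h5 := congrArg m (β.splitAt_jacobi v f)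
      simp only [map_add, map_zero, h1, h4, neg_neg] at h5
      have h6 : (3 : K) • m (β.splitAt (some v) (β.splitAt v f)) = 0 := by
        rw [← h5]; module
      rw [(smul_eq_zero_iff_right (by norm_num)).1 h6, smul_zero, smul_zero]
  have hA : m (β.splitAt none (β.ad f)) = (2 : K) • m (β.ad (β.ad f)) := by
    rw [split_ad, map_sub, h3]; module
  have hB : ∀ v, m (β.splitAt (some v) (β.ad f)) = - m (β.ad (β.splitAt v f)) := by
    intro v; rw [splitAt_ad, h3]
  have hC : ∀ v, m (β.splitAt none (β.splitAt v f)) =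
      -(2 : K) • m (β.splitAt (some v) (β.splitAt v f)) := by
    intro v; rw [splitAt_none_splitAt, map_sub, h3]; module
  have hD : ∑ v, ∑ w, (c v * c w) • m (β.splitAt (some v) (β.splitAt w f)) =
      ∑ v, (c v * c v) • m (β.splitAt (some v) (β.splitAt v f)) := by
    have h4 : ∑ v, ∑ w, (c v * c w) • m (β.splitAt (some v) (β.splitAt w f)) +
        ∑ v, ∑ w, (c v * c w) • m (β.splitAt (some v) (β.splitAt w f)) =
        ∑ v, (c v * c v) • m (β.splitAt (some v) (β.splitAt v f)) +
        ∑ v, (c v * c v) • m (β.splitAt (some v) (β.splitAt v f)) := by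
      conv_lhs => enter [2]; rw [Finset.sum_comm]
      rw [← Finset.sum_add_distrib, ← Finset.sum_add_distrib]
      refine Finset.sum_congr rfl fun v _ => ?_
      rw [← Finset.sum_add_distrib, Finset.sum_eq_single v]
      · intro w _ hw
        rw [splitAt_comm β hw, h3, mul_comm (c w)]
        module
      · simp
    rw [← two_smul K, ← two_smul K] at h4
    exact smul_right_injective _ (two_ne_zero : (2 : K) ≠ 0) h4
  have p1 : m (β.ad (β.twistOp c f)) =
      m (β.ad (β.ad f)) - ∑ v, c v • m (β.ad (β.splitAt v f)) := by
    rw [twistOp_apply]; simp only [map_sub, map_sum, map_smul]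
  have p2 : (2⁻¹ : K) • m (β.splitAt none (β.twistOp c f)) =
      m (β.ad (β.ad f)) + ∑ v, c v • m (β.splitAt (some v) (β.splitAt v f)) := by
    rw [twistOp_apply]
    simp only [map_sub, map_sum, map_smul, hA, hC, smul_sub, Finset.smul_sum, smul_smul]
    rw [sub_eq_add_neg, ← Finset.sum_neg_distrib]
    congr 1
    · rw [inv_mul_cancel₀ two_ne_zero, one_smul]
    · refine Finset.sum_congr rfl fun v _ => ?_
      rw [← neg_smul]
      congr 1
      field_simp
  have p3 : ∀ v, c v • m (β.splitAt (some v) (β.twistOp c f)) =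
      - (c v • m (β.ad (β.splitAt v f))) -
        ∑ w, (c v * c w) • m (β.splitAt (some v) (β.splitAt w f)) := by
    intro v
    rw [twistOp_apply]
    simp only [map_sub, map_sum, map_smul, hB, smul_sub, Finset.smul_sum, smul_smul, smul_neg]
  rw [twistOp_apply]
  simp only [map_sub, Fintype.sum_option, Option.elim]
  rw [map_add, map_sum]
  simp only [map_smul]
  rw [p1, p2]
  simp only [p3, Finset.sum_sub_distrib, Finset.sum_neg_distrib, hD, hQ]
  abel

end LieElement
end LinOperad

namespace LinOperad

namespace LieElement

/-- The place of the black vertices after a composition: first those of the outer operation,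
then those of the inserted one. -/
def block {m n k : ℕ} (h : m + n = k) : Fin m ⊕ Fin n ≃ Fin k :=
  finSumFinEquiv.trans (finCongr h)

@[simp] theorem block_inl {m n k : ℕ} (h : m + n = k) (i : Fin m) :
    ((block h (.inl i) : Fin k) : ℕ) = i := by simp [block]

@[simp] theorem block_inr {m n k : ℕ} (h : m + n = k) (i : Fin n) :
    ((block h (.inr i) : Fin k) : ℕ) = m + i := by simp [block]

/-- Collect the black vertices in a composition. -/
def shuf (A B : Type) {m n k : ℕ} (h : m + n = k) :
    (A ⊕ Fin m) ⊕ (B ⊕ Fin n) ≃ (A ⊕ B) ⊕ Fin k :=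
  (Equiv.sumSumSumComm A (Fin m) B (Fin n)).trans ((Equiv.refl _).sumCongr (block h))

/-- The new vertex becomes the first black vertex. -/
def cons (A : Type) (b : ℕ) : Option (A ⊕ Fin b) ≃ A ⊕ Fin (b + 1) where
  toFun
    | none => .inr 0
    | some (.inl a) => .inl a
    | some (.inr k) => .inr k.succ
  invFun
    | .inl a => some (.inl a)
    | .inr k => Fin.cases none (fun k => some (.inr k)) k
  left_inv := by rintro (_ | (_ | _)) <;> rfl
  right_inv := by
    rintro (_ | k)
    · rfl
    · refine Fin.cases ?_ (fun k => ?_) k <;> rfl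

/-- A permutation of the black vertices. -/
def blackPerm (A : Type) {b : ℕ} (σ : Equiv.Perm (Fin b)) : A ⊕ Fin b ≃ A ⊕ Fin b :=
  (Equiv.refl A).sumCongr σ

theorem finRotate_pow_val (N n : ℕ) (i : Fin (N + 1)) :
    (((finRotate (N + 1) ^ n) i : Fin (N + 1)) : ℕ) = (i + n) % (N + 1) := by
  induction n with
  | zero => simp [Nat.mod_eq_of_lt i.2]
  | succ n ih =>
    rw [pow_succ', Equiv.Perm.mul_apply, finRotate_apply, Fin.val_add, ih, Fin.val_one',
      ← Nat.add_mod, add_assoc]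

/-- The sign of the exchange of two blocks. -/
theorem sign_flip {m n k : ℕ} (h : m + n = k) (h' : n + m = k) (σ : Equiv.Perm (Fin k))
    (h1 : ∀ i : Fin m, σ (block h (.inl i)) = block h' (.inr i))
    (h2 : ∀ j : Fin n, σ (block h (.inr j)) = block h' (.inl j)) :
    (Equiv.Perm.sign σ : ℤ) = (-1) ^ (m * n) := by
  subst h
  rcases Nat.eq_zero_or_pos (m + n) with h0 | h0
  · obtain ⟨rfl, rfl⟩ : m = 0 ∧ n = 0 := by omega
    rw [show σ = 1 from Equiv.ext fun x => x.elim0]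
    simp
  · obtain ⟨N, hN⟩ : ∃ N, m + n = N + 1 := ⟨m + n - 1, by omega⟩
    have key : σ = (finCongr hN).symm.permCongr (finRotate (N + 1) ^ n) := by
      ext i
      obtain ⟨x, rfl⟩ := (block rfl : Fin m ⊕ Fin n ≃ Fin (m + n)).surjective i
      rcases x with i | j
      · rw [h1]
        have := i.2
        simp only [Equiv.permCongr_apply, finCongr_symm, finCongr_apply,
          Fin.val_cast, finRotate_pow_val, block_inl, block_inr]
        rw [Nat.mod_eq_of_lt (by omega)]; omega
      · rw [h2]
        have := j.2
        simp only [Equiv.permCongr_apply, finCongr_symm, finCongr_apply,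
          Fin.val_cast, finRotate_pow_val, block_inl, block_inr]
        rw [show m + (j : ℕ) + n = j + (N + 1) by omega, Nat.add_mod_right,
          Nat.mod_eq_of_lt (by omega)]
    rw [key, Equiv.Perm.sign_permCongr, map_pow, sign_finRotate]
    push_cast
    rw [← pow_mul]
    have e : N * n = m * n + n * (n - 1) := by
      rcases n with _ | n
      · simp
      · obtain rfl : N = m + n := by omega
        simp; ring
    rw [e, pow_add, (Nat.even_mul_pred_self n).neg_one_pow, mul_one]

variable {K : Type u} [Field K] (P : LinOperad K)

/-- The relations saying that the black vertices are odd. -/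
def oddRel (A : Type) [Finite A] (b : ℕ) : Submodule K (P.obj (A ⊕ Fin b)) :=
  Submodule.span K {z | ∃ (σ : Equiv.Perm (Fin b)) (f : P.obj (A ⊕ Fin b)),
    z = P.map (blackPerm A σ) f - ((Equiv.Perm.sign σ : ℤ) : K) • f}

/-- Operations with inputs `A` and `b` additional inputs filled by an odd generator `α` of degree
`-1`: these inputs, drawn as black vertices, are ordered, and permuting them gives the sign of the
permutation. -/
abbrev TwObj (A : Type) [Finite A] (b : ℕ) : Type u := P.obj (A ⊕ Fin b) ⧸ oddRel P A b

/-- The class of an operation with ordered black inputs. -/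
abbrev twMk (A : Type) [Finite A] (b : ℕ) : P.obj (A ⊕ Fin b) →ₗ[K] TwObj P A b :=
  (oddRel P A b).mkQ

variable {P}

theorem twMk_blackPerm {A : Type} [Finite A] {b : ℕ} (σ : Equiv.Perm (Fin b))
    (f : P.obj (A ⊕ Fin b)) :
    twMk P A b (P.map (blackPerm A σ) f) = ((Equiv.Perm.sign σ : ℤ) : K) • twMk P A b f := by
  rw [← sub_eq_zero, ← map_smul, ← map_sub]
  exact (Submodule.Quotient.mk_eq_zero _).2 (Submodule.subset_span ⟨σ, f, rfl⟩)

theorem twMk_map {A W : Type} [Finite A] [Finite W] {b : ℕ} (e f : W ≃ A ⊕ Fin b)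
    (σ : Equiv.Perm (Fin b)) (h : ∀ w, f w = blackPerm A σ (e w)) (x : P.obj W) :
    twMk P A b (P.map f x) = ((Equiv.Perm.sign σ : ℤ) : K) • twMk P A b (P.map e x) := by
  rw [← twMk_blackPerm, P.map_map]
  exact congrArg _ (P.map_eq_of h x)

theorem twMk_map_swap {A W : Type} [Finite A] [Finite W] [DecidableEq W] {b : ℕ}
    (e : W ≃ A ⊕ Fin b) (p q : W) (i j : Fin b) (hij : i ≠ j) (hp : e p = .inr i)
    (hq : e q = .inr j) (x : P.obj W) :
    twMk P A b (P.map e (P.map (Equiv.swap p q) x)) = -twMk P A b (P.map e x) := by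
  classical
  rw [P.map_map, twMk_map e _ (Equiv.swap i j) _ x, Equiv.Perm.sign_swap hij]
  · simp
  · intro w
    rw [Equiv.trans_apply]
    by_cases h1 : w = p
    · rw [h1, Equiv.swap_apply_left, hp, hq]; simp [blackPerm]
    by_cases h2 : w = q
    · rw [h2, Equiv.swap_apply_right, hp, hq]; simp [blackPerm]
    rw [Equiv.swap_apply_of_ne_of_ne h1 h2]
    rcases h3 : e w with a | k
    · rfl
    · have h4 : k ≠ i := by
        rintro rfl; exact h1 (e.injective (h3.trans hp.symm))
      have h5 : k ≠ j := by
        rintro rfl; exact h2 (e.injective (h3.trans hq.symm))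
      exact congrArg Sum.inr (Equiv.swap_apply_of_ne_of_ne h4 h5).symm

theorem lift_oddRel {A : Type} [Finite A] {b : ℕ} {M : Type*} [AddCommGroup M] [Module K M]
    (F : P.obj (A ⊕ Fin b) →ₗ[K] M)
    (h : ∀ (σ : Equiv.Perm (Fin b)) (f : P.obj (A ⊕ Fin b)),
      F (P.map (blackPerm A σ) f) = ((Equiv.Perm.sign σ : ℤ) : K) • F f) :
    oddRel P A b ≤ LinearMap.ker F := by
  refine Submodule.span_le.2 ?_
  rintro _ ⟨σ, f, rfl⟩
  simp [h]

/-- Relabelling. -/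
def rawMap {A B : Type} [Finite A] [Finite B] (e : A ≃ B) (b : ℕ) :
    P.obj (A ⊕ Fin b) →ₗ[K] P.obj (B ⊕ Fin b) :=
  P.map (e.sumCongr (Equiv.refl _))

/-- Composition: the black vertices of the outer operation come before those of the inserted one. -/
def rawComp {A B : Type} [Finite A] [Finite B] {m n k : ℕ} (h : m + n = k) :
    P.obj (Option A ⊕ Fin m) →ₗ[K] P.obj (B ⊕ Fin n) →ₗ[K] P.obj ((A ⊕ B) ⊕ Fin k) :=
  (P.comp ∘ₗ P.map (optL A (Fin m))).compr₂ (P.map (shuf A B h))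

/-- The weights in the twisted differential: `1` for an input and `1/2` for a black vertex. -/
def weight (A : Type) (b : ℕ) : A ⊕ Fin b → K := Sum.elim (fun _ => 1) (fun _ => 2⁻¹)

variable (β : LieElement P)

/-- The twisted differential `f ↦ [α, f] - ∑ f ∘ₐ [α, a] - 1/2 ∑ f ∘ₖ [α, αₖ]`, where `a` runs over
the inputs of `f` and `k` over its black vertices `αₖ`. It reflects the formulas
`d x + [α, x]` for the differential twisted by a Maurer-Cartan element `α`, and
`d α = -1/2 [α, α]`. The new `α` is moved to the first place among the black vertices, which takes
care of all signs. -/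
noncomputable def rawD (A : Type) [Finite A] (b : ℕ) :
    P.obj (A ⊕ Fin b) →ₗ[K] P.obj (A ⊕ Fin (b + 1)) :=
  P.map (cons A b) ∘ₗ β.twistOp (weight A b)

theorem rawMap_blackPerm {A B : Type} [Finite A] [Finite B] (e : A ≃ B) {b : ℕ}
    (σ : Equiv.Perm (Fin b)) (f : P.obj (A ⊕ Fin b)) :
    rawMap e b (P.map (blackPerm A σ) f) = P.map (blackPerm B σ) (rawMap e b f) := by
  simp only [rawMap, P.map_map]
  exact P.map_eq_of (by rintro (_ | _) <;> rfl) _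

theorem rawD_map {A B : Type} [Finite A] [Finite B] (e : A ≃ B) {b : ℕ}
    (σ : Equiv.Perm (Fin b)) (f : P.obj (A ⊕ Fin b)) :
    rawD β B b (P.map (e.sumCongr σ) f) =
      P.map (e.sumCongr (Equiv.Perm.decomposeFin.symm (0, σ))) (rawD β A b f) := by
  have h : (fun v => (weight B b : B ⊕ Fin b → K) (e.sumCongr σ v)) = weight A b := by
    funext v; rcases v with _ | _ <;> rfl
  simp only [rawD, LinearMap.comp_apply, twistOp_map, P.map_map, h]
  refine P.map_eq_of ?_ _
  rintro (_ | (_ | k))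
  · simp [cons]
  · simp [cons]
  · simp [cons]

theorem rawComp_map {A A' B B' : Type} [Finite A] [Finite A'] [Finite B] [Finite B'] {m n k : ℕ}
    (h : m + n = k) (e : A ≃ A') (f : B ≃ B') (σ : Equiv.Perm (Fin m)) (τ : Equiv.Perm (Fin n))
    (x : P.obj (Option A ⊕ Fin m)) (y : P.obj (B ⊕ Fin n)) :
    rawComp h (P.map (e.optionCongr.sumCongr σ) x) (P.map (f.sumCongr τ) y) =
      P.map ((e.sumCongr f).sumCongr ((block h).permCongr (Equiv.Perm.sumCongr σ τ)))
        (rawComp h x y) := by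
  simp only [rawComp, LinearMap.compr₂_apply, LinearMap.comp_apply, P.map_map]
  have h1 : (e.optionCongr.sumCongr σ).trans (optL A' (Fin m)) =
      (optL A (Fin m)).trans (e.sumCongr σ).optionCongr :=
    Equiv.ext (by rintro ((_ | _) | _) <;> rfl)
  rw [h1, ← P.map_map, P.comp_map, P.map_map]
  refine P.map_eq_of ?_ _
  rintro ((_ | _) | (_ | _)) <;> simp [shuf]

theorem rawD_rawD [CharZero K] (A : Type) [Finite A] (b : ℕ) (f : P.obj (A ⊕ Fin b)) :
    twMk P A (b + 2) (rawD β A (b + 1) (rawD β A b f)) = 0 := by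
  classical
  have h : (fun v => (weight A (b + 1) : A ⊕ Fin (b + 1) → K) (cons A b v)) =
      fun x : Option (A ⊕ Fin b) => x.elim 2⁻¹ (weight A b) := by
    funext v; rcases v with _ | (_ | _) <;> rfl
  simp only [rawD, LinearMap.comp_apply, twistOp_map, P.map_map, h]
  refine β.twistOp_sq (weight A b) (twMk P A (b + 2) ∘ₗ
    P.map ((cons A b).optionCongr.trans (cons A (b + 1)))) (fun x => ?_) (fun v => ?_) f
  · exact twMk_map_swap _ _ _ 0 1 (by simp) rfl rfl x
  · rcases v with a | k
    · exact Or.inl rfl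
    · exact Or.inr ⟨rfl, fun x => twMk_map_swap _ _ _ 0 k.succ.succ (Fin.succ_ne_zero _).symm
        rfl rfl x⟩

end LieElement
end LinOperad

namespace LinOperad

namespace LieElement

variable {K : Type u} [Field K] {P : LinOperad K} (β : LieElement P)

/-- The differential of the twisted operad. -/
noncomputable def twD (A : Type) [Finite A] (b : ℕ) : TwObj P A b →ₗ[K] TwObj P A (b + 1) :=
  (oddRel P A b).liftQ (twMk P A (b + 1) ∘ₗ rawD β A b) <| lift_oddRel _ fun σ f => by
    simp only [LinearMap.comp_apply, blackPerm]
    rw [rawD_map β (Equiv.refl A)]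
    have := twMk_blackPerm (A := A) (Equiv.Perm.decomposeFin.symm (0, σ)) (rawD β A b f)
    rw [Equiv.Perm.decomposeFin.symm_sign] at this
    simpa [blackPerm] using this

/-- Relabelling in the twisted operad. -/
def twMap {A B : Type} [Finite A] [Finite B] (e : A ≃ B) (b : ℕ) :
    TwObj P A b →ₗ[K] TwObj P B b :=
  (oddRel P A b).liftQ (twMk P B b ∘ₗ rawMap e b) <| lift_oddRel _ fun σ f => by
    rw [LinearMap.comp_apply, rawMap_blackPerm, twMk_blackPerm]; rfl

theorem sign_block {m n k : ℕ} (h : m + n = k) (σ : Equiv.Perm (Fin m)) (τ : Equiv.Perm (Fin n)) :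
    (Equiv.Perm.sign ((block h).permCongr (Equiv.Perm.sumCongr σ τ)) : ℤ) =
      Equiv.Perm.sign σ * Equiv.Perm.sign τ := by
  rw [Equiv.Perm.sign_permCongr, Equiv.Perm.sign_sumCongr, Units.val_mul]

/-- Composition in the twisted operad. -/
noncomputable def twComp {A B : Type} [Finite A] [Finite B] {m n k : ℕ} (h : m + n = k) :
    TwObj P (Option A) m →ₗ[K] TwObj P B n →ₗ[K] TwObj P (A ⊕ B) k :=
  (oddRel P (Option A) m).liftQ
    ((oddRel P B n).liftQ ((rawComp h).compr₂ (twMk P (A ⊕ B) k)).flip <|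
      lift_oddRel _ fun σ f => LinearMap.ext fun x => by
        have h1 := rawComp_map h (Equiv.refl A) (Equiv.refl B) 1 σ x f
        rw [Equiv.optionCongr_refl, show (Equiv.refl (Option A)).sumCongr (1 : Equiv.Perm (Fin m)) =
          Equiv.refl _ from Equiv.ext (by rintro (_ | _) <;> rfl), P.map_refl] at h1
        have h2 := twMk_blackPerm (A := A ⊕ B) ((block h).permCongr (Equiv.Perm.sumCongr 1 σ))
          (rawComp h x f)
        rw [sign_block, Equiv.Perm.sign_one, Units.val_one, one_mul] at h2
        simp only [LinearMap.flip_apply, LinearMap.compr₂_apply, LinearMap.smul_apply]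
        rw [← h2, blackPerm, h1, blackPerm, Equiv.sumCongr_refl]).flip <|
      lift_oddRel _ fun σ f => LinearMap.ext fun y => by
        obtain ⟨y, rfl⟩ := Submodule.mkQ_surjective _ y
        have h1 := rawComp_map h (Equiv.refl A) (Equiv.refl B) σ 1 f y
        rw [Equiv.optionCongr_refl, show (Equiv.refl B).sumCongr (1 : Equiv.Perm (Fin n)) =
          Equiv.refl _ from Equiv.ext (by rintro (_ | _) <;> rfl), P.map_refl] at h1
        have h2 := twMk_blackPerm (A := A ⊕ B) ((block h).permCongr (Equiv.Perm.sumCongr σ 1))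
          (rawComp h f y)
        rw [sign_block, Equiv.Perm.sign_one, Units.val_one, mul_one] at h2
        simp only [LinearMap.flip_apply, LinearMap.smul_apply, Submodule.mkQ_apply,
          Submodule.liftQ_apply, LinearMap.compr₂_apply]
        rw [blackPerm, h1]
        refine Eq.trans ?_ h2
        rw [blackPerm, Equiv.sumCongr_refl]; rfl

theorem twD_mk (A : Type) [Finite A] (b : ℕ) (f : P.obj (A ⊕ Fin b)) :
    twD β A b (twMk P A b f) = twMk P A (b + 1) (rawD β A b f) := rfl

theorem twMap_mk {A B : Type} [Finite A] [Finite B] (e : A ≃ B) (b : ℕ) (f : P.obj (A ⊕ Fin b)) :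
    twMap e b (twMk P A b f) = twMk P B b (rawMap e b f) := rfl

theorem twComp_mk {A B : Type} [Finite A] [Finite B] {m n k : ℕ} (h : m + n = k)
    (f : P.obj (Option A ⊕ Fin m)) (g : P.obj (B ⊕ Fin n)) :
    twComp h (twMk P (Option A) m f) (twMk P B n g) = twMk P (A ⊕ B) k (rawComp h f g) := rfl

theorem twMk_congr {A W : Type} [Finite A] [Finite W] {b : ℕ} (e f : W ≃ A ⊕ Fin b)
    (h : ∀ w, e w = f w) (x : P.obj W) : twMk P A b (P.map e x) = twMk P A b (P.map f x) := by
  rw [Equiv.ext h]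

theorem tw_leibniz {A B : Type} [Finite A] [Finite B] {m n k : ℕ} (h : m + n = k)
    (h₁ : m + 1 + n = k + 1) (h₂ : m + (n + 1) = k + 1)
    (x : P.obj (Option A ⊕ Fin m)) (y : P.obj (B ⊕ Fin n)) :
    twMk P (A ⊕ B) (k + 1) (rawD β (A ⊕ B) k (rawComp h x y)) =
      twMk P (A ⊕ B) (k + 1) (rawComp h₁ (rawD β (Option A) m x) y) +
      (-1 : K) ^ m • twMk P (A ⊕ B) (k + 1) (rawComp h₂ x (rawD β B n y)) := by
  have w1 : (fun v => (weight (A ⊕ B) k (shuf A B h v) : K)) =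
      Sum.elim (weight A m) (weight B n) := by
    funext v; rcases v with (_ | _) | (_ | _) <;> rfl
  have w2 : (fun v : Option A ⊕ Fin m => Option.elim (optL A (Fin m) v) (1 : K)
      fun x => Sum.elim (weight A m) (weight B n) (.inl x : (A ⊕ Fin m) ⊕ (B ⊕ Fin n))) =
      weight (Option A) m := by
    funext v; rcases v with (_ | _) | _ <;> rfl
  have w3 : (fun w : B ⊕ Fin n => Sum.elim (weight A m) (weight B n : _ → K) (.inr w)) =
    weight B n := rfl
  simp only [rawD, rawComp, LinearMap.compr₂_apply, LinearMap.comp_apply, twistOp_map, w1]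
  rw [twistOp_comp, map_add, map_add, map_add, twistOp_map, w2, w3]
  congr 1
  · have e1 : (cons (Option A) m).trans (optL A (Fin (m + 1))) =
        ((optL A (Fin m)).optionCongr.trans (optSwap (A ⊕ Fin m))).trans
          (cons A m).optionCongr := by
      refine Equiv.ext ?_
      rintro (_ | ((_ | _) | _)) <;> rfl
    simp only [P.map_map]
    rw [e1, ← P.map_map ((optL A (Fin m)).optionCongr.trans (optSwap (A ⊕ Fin m)))
      (cons A m).optionCongr, P.comp_map_left, P.map_map]
    · refine twMk_congr _ _ ?_ _
      rintro ((_ | (_ | _)) | (_ | _))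
      · simp [optL, cons, shuf, Fin.ext_iff]
      · rfl
      · simp [optL, cons, shuf, Fin.ext_iff]
      · rfl
      · simp [optL, cons, shuf, Fin.ext_iff]; omega
  · rw [P.comp_map_right, P.map_map, P.map_map, P.map_map]
    have hm : m < k + 1 := by omega
    rw [twMk_map (((Equiv.refl (A ⊕ Fin m)).sumCongr (cons B n)).trans (shuf A B h₂)) _
      (Fin.cycleRange ⟨m, hm⟩), Fin.sign_cycleRange]
    · simp
    · rintro ((_ | i) | (_ | (_ | j)))
      · rfl
      · have hi : block h₂ (.inl i) < (⟨m, hm⟩ : Fin (k + 1)) := by simp [Fin.lt_def]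
        have h3 : (Fin.cycleRange ⟨m, hm⟩ (block h₂ (.inl i))) = (block h (.inl i)).succ := by
          have := i.2
          rw [Fin.cycleRange_of_lt hi, Fin.ext_iff, Fin.val_add_one_of_lt' (by simp; omega)]
          simp
        exact congrArg Sum.inr h3.symm
      · have h3 : block h₂ (.inr 0) = (⟨m, hm⟩ : Fin (k + 1)) := by simp [Fin.ext_iff]
        have h4 : Fin.cycleRange ⟨m, hm⟩ (block h₂ (.inr 0)) = 0 := by
          rw [h3, Fin.cycleRange_self]
        exact congrArg Sum.inr h4.symm
      · rfl
      · have h3 : (⟨m, hm⟩ : Fin (k + 1)) < block h₂ (.inr j.succ) := by simp [Fin.lt_def]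
        have h4 : Fin.cycleRange ⟨m, hm⟩ (block h₂ (.inr j.succ)) = (block h (.inr j)).succ := by
          rw [Fin.cycleRange_of_gt h3, Fin.ext_iff]
          simp; omega
        exact congrArg Sum.inr h4.symm

end LieElement
end LinOperad

namespace LinOperad

namespace LieElement

variable {K : Type u} [Field K] {P : LinOperad K} (β : LieElement P)

theorem rawComp_assoc {A B C : Type} [Finite A] [Finite B] [Finite C] {l m n i j k : ℕ}
    (h₁ : l + m = i) (h₂ : i + n = k) (h₃ : m + n = j) (h₄ : l + j = k)
    (x : P.obj (Option A ⊕ Fin l)) (y : P.obj (Option B ⊕ Fin m)) (z : P.obj (C ⊕ Fin n)) :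
    rawComp h₂ (rawMap (optR A B) i (rawComp h₁ x y)) z =
      rawMap (Equiv.sumAssoc A B C).symm k (rawComp h₄ x (rawComp h₃ y z)) := by
  have hy : y = P.map (optL B (Fin m)).symm (P.map (optL B (Fin m)) y) := by
    rw [P.map_map, Equiv.self_trans_symm, P.map_refl]
  simp only [rawComp, rawMap, LinearMap.compr₂_apply, LinearMap.comp_apply]
  generalize P.map (optL A (Fin l)) x = x'
  rw [hy]
  generalize P.map (optL B (Fin m)) y = y'
  rw [P.map_map (optL B (Fin m)).symm, Equiv.symm_trans_self, P.map_refl, P.comp_map_right,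
    P.comp_map_right]
  simp only [P.map_map]
  have e1 : ((((Equiv.refl (A ⊕ Fin l)).sumCongr (optL B (Fin m)).symm).trans
      (shuf A (Option B) h₁)).trans ((optR A B).sumCongr (Equiv.refl (Fin i)))).trans
        (optL (A ⊕ B) (Fin i)) =
      (optR (A ⊕ Fin l) (B ⊕ Fin m)).trans (shuf A B h₁).optionCongr := by
    refine Equiv.ext ?_
    rintro ((_ | _) | (_ | (_ | _))) <;> rfl
  rw [e1, ← P.map_map (optR (A ⊕ Fin l) (B ⊕ Fin m)), P.comp_map_left, P.comp_assoc]
  simp only [P.map_map]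
  refine P.map_eq_of ?_ _
  rintro ((_ | _) | ((_ | _) | (_ | _)))
  · rfl
  · simp [shuf, Fin.ext_iff]
  · rfl
  · simp [shuf, Fin.ext_iff]
  · rfl
  · simp [shuf, Fin.ext_iff]; omega

theorem rawComp_comm {A B C : Type} [Finite A] [Finite B] [Finite C] {l m n i j k : ℕ}
    (h₁ : l + m = i) (h₂ : i + n = k) (h₃ : l + n = j) (h₄ : j + m = k)
    (x : P.obj (Option (Option A) ⊕ Fin l)) (y : P.obj (B ⊕ Fin m)) (z : P.obj (C ⊕ Fin n)) :
    twMk P ((A ⊕ B) ⊕ C) k (rawComp h₂ (rawMap (optL A B) i (rawComp h₁ x y)) z) =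
      (-1 : K) ^ (m * n) • twMk P ((A ⊕ B) ⊕ C) k (rawMap (sumRight A C B) k
        (rawComp h₄ (rawMap (optL A C) j (rawComp h₃ (rawMap (optSwap A) l x) z)) y)) := by
  have hx : ∃ x', P.map (optL (Option A) (Fin l)) x = P.map (optL A (Fin l)).optionCongr.symm x' :=
    ⟨P.map (optL A (Fin l)).optionCongr (P.map (optL (Option A) (Fin l)) x), by
      rw [P.map_map (optL A (Fin l)).optionCongr, Equiv.self_trans_symm, P.map_refl]⟩
  obtain ⟨x', hx⟩ := hx
  have hx2 : P.map (optL (Option A) (Fin l)) (P.map ((optSwap A).sumCongr (Equiv.refl (Fin l))) x) =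
      P.map (optL A (Fin l)).symm.optionCongr (P.map (optSwap (A ⊕ Fin l)) x') := by
    have hx3 : x' = P.map (optL A (Fin l)).optionCongr (P.map (optL (Option A) (Fin l)) x) := by
      rw [hx, P.map_map, Equiv.symm_trans_self, P.map_refl]
    rw [hx3]
    simp only [P.map_map]
    exact P.map_eq_of (by rintro ((_ | (_ | _)) | _) <;> rfl) _
  simp only [rawComp, rawMap, LinearMap.compr₂_apply, LinearMap.comp_apply]
  rw [hx2, hx, show (optL A (Fin l)).optionCongr.symm = (optL A (Fin l)).symm.optionCongr from rfl,
    P.comp_map_left, P.comp_map_left]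
  simp only [P.map_map]
  have e1 : ∀ (B : Type) (m i : ℕ) (h₁ : l + m = i),
      ((((optL A (Fin l)).symm.sumCongr (Equiv.refl (B ⊕ Fin m))).trans
      (shuf (Option A) B h₁)).trans ((optL A B).sumCongr (Equiv.refl (Fin i)))).trans
        (optL (A ⊕ B) (Fin i)) =
      (optL (A ⊕ Fin l) (B ⊕ Fin m)).trans (shuf A B h₁).optionCongr := by
    intro B m i h₁
    refine Equiv.ext ?_
    rintro ((_ | (_ | _)) | (_ | _)) <;> rfl
  rw [e1, e1, ← P.map_map (optL (A ⊕ Fin l) (B ⊕ Fin m)), P.comp_map_left, P.comp_comm,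
    ← P.map_map (optL (A ⊕ Fin l) (C ⊕ Fin n)), P.comp_map_left]
  simp only [P.map_map]
  have hlm : l + (m + n) = k := by omega
  have hln : l + (n + m) = k := by omega
  let τ : Fin m ⊕ Fin n ≃ Fin n ⊕ Fin m := Equiv.sumComm _ _
  let ρ : Equiv.Perm (Fin (m + n)) :=
    (block rfl).symm.trans (τ.trans (block (Nat.add_comm n m)))
  have hρ : (Equiv.Perm.sign ρ : ℤ) = (-1) ^ (m * n) :=
    sign_flip rfl (Nat.add_comm n m) ρ (fun i => by simp [ρ, τ]) (fun i => by simp [ρ, τ])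
  let σ : Equiv.Perm (Fin k) := (block hlm).permCongr (Equiv.Perm.sumCongr 1 ρ)
  have hσ : (Equiv.Perm.sign σ : ℤ) = (-1) ^ (m * n) := by
    rw [sign_block, hρ]; simp
  have hσ' : (Equiv.Perm.sign σ.symm : ℤ) = (-1) ^ (m * n) := by
    rw [Equiv.Perm.sign_symm, hσ]
  have hs1 : ∀ i : Fin l, σ (block hlm (.inl i)) = block hlm (.inl i) := by
    intro i; simp [σ]
  have hs2 : ∀ (i : Fin m), σ (block hlm (.inr (block rfl (.inl i)))) =
      block hlm (.inr (block (Nat.add_comm n m) (.inr i))) := by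
    intro i; simp [σ, ρ, τ]
  have hs3 : ∀ (i : Fin n), σ (block hlm (.inr (block rfl (.inr i)))) =
      block hlm (.inr (block (Nat.add_comm n m) (.inl i))) := by
    intro i; simp [σ, ρ, τ]
  have hval : ∀ x : Fin k, (σ x : ℕ) =
      if (x : ℕ) < l then (x : ℕ) else if (x : ℕ) < l + m then x + n else x - m := by
    intro x
    obtain ⟨y, rfl⟩ := (block hlm).surjective x
    rcases y with i | y
    · rw [hs1]; simp
    · obtain ⟨y, rfl⟩ := (block (rfl : m + n = m + n)).surjective y
      rcases y with i | i
      · have := i.2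
        rw [hs2]; simp; omega
      · rw [hs3]; simp; omega
  rw [twMk_map ((shuf A C h₃).sumCongr (Equiv.refl (B ⊕ Fin m)) |>.trans (shuf (A ⊕ C) B h₄) |>.trans
    ((sumRight A C B).sumCongr (Equiv.refl (Fin k)))) _ σ.symm _ _, hσ']
  · simp only [Int.cast_pow, Int.cast_neg, Int.cast_one]
    rfl
  · rintro (((_ | i) | (_ | i)) | (_ | i))
    · rfl
    · refine congrArg Sum.inr ((Equiv.eq_symm_apply _).2 (Fin.ext ?_))
      rw [hval]
      simp
    · rfl
    · refine congrArg Sum.inr ((Equiv.eq_symm_apply _).2 (Fin.ext ?_))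
      have := i.2
      rw [hval]
      simp
      split_ifs <;> omega
    · rfl
    · refine congrArg Sum.inr ((Equiv.eq_symm_apply _).2 (Fin.ext ?_))
      have := i.2
      rw [hval]
      simp
      omega

end LieElement
end LinOperad

namespace LinOperad

namespace LieElement

variable {K : Type u} [Field K] {P : LinOperad K} (β : LieElement P)

/-- The operadic twisting of a morphism from the Lie operad to `P`: the operad generated by `P` and an
additional zero-ary generator `α` of degree `-1`, with the differential prescribed by the
Maurer-Cartan equation for `α`. Its operations of homological degree `-b` contain `α` exactly `b`
times, so that no completion is needed in a fixed degree. -/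
noncomputable def twist [CharZero K] : DGOperad K where
  obj A _ b := TwObj P A b
  d b := twD β _ b
  map e b := twMap e b
  one := twMk P Unit 0 (P.map (Equiv.sumEmpty Unit (Fin 0)).symm P.one)
  comp h := twComp h
  d_d {A _} b x := by
    obtain ⟨x, rfl⟩ := Submodule.mkQ_surjective _ x
    exact rawD_rawD β A b x
  map_refl {A _} b x := by
    obtain ⟨x, rfl⟩ := Submodule.mkQ_surjective _ x
    rw [twMap_mk, rawMap, Equiv.sumCongr_refl, P.map_refl]
  map_map {A B C _ _ _} e f b x := by
    obtain ⟨x, rfl⟩ := Submodule.mkQ_surjective _ x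
    rw [twMap_mk, twMap_mk, twMap_mk, rawMap, rawMap, rawMap, P.map_map]
    exact twMk_congr _ _ (by rintro (_ | _) <;> rfl) _
  d_map {A B _ _} e b x := by
    obtain ⟨x, rfl⟩ := Submodule.mkQ_surjective _ x
    rw [twMap_mk, twD_mk, twD_mk, twMap_mk]
    have := rawD_map β e (1 : Equiv.Perm (Fin b)) x
    rw [Equiv.Perm.decomposeFin_symm_of_one, Equiv.swap_self] at this
    exact congrArg _ this
  comp_map {A A' B B' _ _ _ _ m n k} h e f x y := by
    obtain ⟨x, rfl⟩ := Submodule.mkQ_surjective _ x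
    obtain ⟨y, rfl⟩ := Submodule.mkQ_surjective _ y
    rw [twMap_mk, twMap_mk, twComp_mk, twComp_mk, twMap_mk]
    refine congrArg _ ((rawComp_map h e f 1 1 x y).trans ?_)
    refine P.map_eq_of ?_ _
    rintro (_ | _) <;> simp
  comp_one {A _} n x := by
    obtain ⟨x, rfl⟩ := Submodule.mkQ_surjective _ x
    rw [twMap_mk, twComp_mk]
    refine congrArg _ ?_
    simp only [rawComp, rawMap, LinearMap.compr₂_apply, LinearMap.comp_apply]
    rw [P.comp_map_right, P.comp_one, P.map_map, P.map_map, P.map_map]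
    refine P.map_eq_of ?_ _
    rintro ((_ | a) | k)
    · rfl
    · rfl
    · refine congrArg Sum.inr (Fin.ext ?_)
      exact block_inl (add_zero n) k
  one_comp {B _} n y := by
    obtain ⟨y, rfl⟩ := Submodule.mkQ_surjective _ y
    rw [twMap_mk, twMap_mk, twComp_mk]
    refine congrArg _ ?_
    simp only [rawComp, rawMap, LinearMap.compr₂_apply, LinearMap.comp_apply, P.map_map]
    rw [show ((Equiv.sumEmpty Unit (Fin 0)).symm.trans (unitOpt.sumCongr (Equiv.refl (Fin 0)))).trans
      (optL Empty (Fin 0)) = unitOpt.trans (Equiv.sumEmpty Empty (Fin 0)).symm.optionCongr from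
      Equiv.ext (by rintro ⟨⟩; rfl), ← P.map_map unitOpt, P.comp_map_left, P.one_comp]
    rw [P.map_map, P.map_map]
    refine P.map_eq_of ?_ _
    rintro (b | k)
    · rfl
    · refine congrArg Sum.inr (Fin.ext ?_)
      simp
  leibniz {A B _ _ m n k} h h₁ h₂ x y := by
    obtain ⟨x, rfl⟩ := Submodule.mkQ_surjective _ x
    obtain ⟨y, rfl⟩ := Submodule.mkQ_surjective _ y
    exact tw_leibniz β h h₁ h₂ x y
  comp_assoc h₁ h₂ h₃ h₄ x y z := by
    obtain ⟨x, rfl⟩ := Submodule.mkQ_surjective _ x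
    obtain ⟨y, rfl⟩ := Submodule.mkQ_surjective _ y
    obtain ⟨z, rfl⟩ := Submodule.mkQ_surjective _ z
    exact congrArg _ (rawComp_assoc h₁ h₂ h₃ h₄ x y z)
  comp_comm h₁ h₂ h₃ h₄ x y z := by
    obtain ⟨x, rfl⟩ := Submodule.mkQ_surjective _ x
    obtain ⟨y, rfl⟩ := Submodule.mkQ_surjective _ y
    obtain ⟨z, rfl⟩ := Submodule.mkQ_surjective _ z
    exact rawComp_comm h₁ h₂ h₃ h₄ x y z

end LieElement
end LinOperad

namespace RTOp

/-- The tree on two vertices with root `0`. -/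
def edge01 : RTree (Fin 2) where
  parent := ![none, some 0]
  existsUnique_root := ⟨0, rfl, fun i hi => by fin_cases i; · rfl
                                               · simp at hi⟩
  acyclic := ⟨![0, 1], fun v w h => by fin_cases v <;> simp at h; subst h; simp⟩

/-- The tree on two vertices with root `1`. -/
def edge10 : RTree (Fin 2) where
  parent := ![some 1, none]
  existsUnique_root := ⟨1, rfl, fun i hi => by fin_cases i; · simp at hi
                                               · rfl⟩
  acyclic := ⟨![1, 0], fun v w h => by fin_cases v <;> simp at h; subst h; simp⟩

theorem edge10_ne : edge10 ≠ edge01 := fun h => by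
  have := congrArg (fun T => T.parent 0) h
  simp [edge10, edge01] at this

variable (K : Type u) [Field K]

open Classical in
/-- The tree with root `0` and child `1` minus the tree with root `1` and child `0`. -/
noncomputable def bracketVal : RTree (Fin 2) → K := Pi.single edge01 1 - Pi.single edge10 1

theorem bracketVal_01 : bracketVal K edge01 = 1 := by
  simp [bracketVal, edge10_ne.symm]

theorem bracketVal_10 : bracketVal K edge10 = -1 := by
  simp [bracketVal, edge10_ne]

theorem fin2_cases (U : RTree (Fin 2)) : U = edge01 ∨ U = edge10 := by
  obtain ⟨r, hr, hu⟩ := U.existsUnique_root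
  have h0 := U.parent_ne_self 0
  have h1 := U.parent_ne_self 1
  fin_cases r
  · left
    ext1; funext i
    fin_cases i
    · exact hr
    · rcases h : U.parent 1 with _ | j
      · exact absurd (hu 1 h) (by simp)
      · fin_cases j
        · exact h
        · exact absurd h h1
  · right
    ext1; funext i
    fin_cases i
    · rcases h : U.parent 0 with _ | j
      · exact absurd (hu 0 h) (by simp)
      · fin_cases j
        · exact absurd h h0
        · exact h
    · exact hr

theorem edge01_swap : edge01.relabel (Equiv.swap 0 1) = edge10 := by
  ext1; funext i; fin_cases i <;> simp [edge01, edge10]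

theorem edge10_swap : edge10.relabel (Equiv.swap 0 1) = edge01 := by
  ext1; funext i; fin_cases i <;> simp [edge01, edge10]

/-- The nested bracket. -/
noncomputable abbrev jac : RTree (Unit ⊕ Fin 2) → K :=
  (rtLin K).comp ((rtLin K).map LinOperad.opt2 (bracketVal K)) (bracketVal K)

theorem jac_of {T S : RTree (Fin 2)} {U : RTree (Unit ⊕ Fin 2)}
    (h : RTree.IsInsertion (T.relabel LinOperad.opt2).parent S.parent U.parent) :
    jac K U = bracketVal K T * bracketVal K S := by
  refine (insertion_of _ _ h).trans ?_
  congr 1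
  exact congrArg (bracketVal K) (relabel_relabel_symm _ _)

variable {K} {U : RTree (Unit ⊕ Fin 2)}

theorem jac_1 (hx : U.parent (.inl ()) = none) (h0 : U.parent (.inr 0) = some (.inl ()))
    (h1 : U.parent (.inr 1) = some (.inr 0)) : jac K U = 1 := by
  rw [jac_of K (T := edge01) (S := edge01), bracketVal_01, one_mul]
  refine ⟨fun _ => ?_, fun b b' hb => ?_, fun b hb => ?_⟩
  · simp [hx, LinOperad.opt2, edge01]
  · fin_cases b <;> simp [edge01] at hb
    subst hb; exact h1
  · fin_cases b <;> simp [edge01] at hb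
    simp [h0, LinOperad.opt2, edge01]

theorem jac_2 {i : Fin 2} (hx : U.parent (.inl ()) = some (.inr i)) (h0 : U.parent (.inr 0) = none)
    (h1 : U.parent (.inr 1) = some (.inr 0)) : jac K U = -1 := by
  rw [jac_of K (T := edge10) (S := edge01), bracketVal_01, bracketVal_10, mul_one]
  refine ⟨fun _ => ?_, fun b b' hb => ?_, fun b hb => ?_⟩
  · simp [hx, LinOperad.opt2, edge10]
  · fin_cases b <;> simp [edge01] at hb
    subst hb; exact h1
  · fin_cases b <;> simp [edge01] at hb
    simp [h0, LinOperad.opt2, edge10]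

theorem jac_3 (hx : U.parent (.inl ()) = none) (h1 : U.parent (.inr 1) = some (.inl ()))
    (h0 : U.parent (.inr 0) = some (.inr 1)) : jac K U = -1 := by
  rw [jac_of K (T := edge01) (S := edge10), bracketVal_01, bracketVal_10, one_mul]
  refine ⟨fun _ => ?_, fun b b' hb => ?_, fun b hb => ?_⟩
  · simp [hx, LinOperad.opt2, edge01]
  · fin_cases b <;> simp [edge10] at hb
    subst hb; exact h0
  · fin_cases b <;> simp [edge10] at hb
    simp [h1, LinOperad.opt2, edge01]

theorem jac_4 {i : Fin 2} (hx : U.parent (.inl ()) = some (.inr i)) (h1 : U.parent (.inr 1) = none)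
    (h0 : U.parent (.inr 0) = some (.inr 1)) : jac K U = 1 := by
  rw [jac_of K (T := edge10) (S := edge10), bracketVal_10, neg_mul_neg, one_mul]
  refine ⟨fun _ => ?_, fun b b' hb => ?_, fun b hb => ?_⟩
  · simp [hx, LinOperad.opt2, edge10]
  · fin_cases b <;> simp [edge10] at hb
    subst hb; exact h0
  · fin_cases b <;> simp [edge10] at hb
    simp [h1, LinOperad.opt2, edge10]

theorem jac_0 (h0 : U.parent (.inr 0) ≠ some (.inr 1)) (h1 : U.parent (.inr 1) ≠ some (.inr 0)) :
    jac K U = 0 := by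
  refine insertion_not _ _ fun T S h => ?_
  rcases fin2_cases S with rfl | rfl
  · exact h1 (h.inner 1 0 rfl)
  · exact h0 (h.inner 0 1 rfl)

theorem cases3 (U : RTree (Unit ⊕ Fin 2)) :
    (U.parent (.inl ()) = none ∧
      ((U.parent (.inr 0) = some (.inl ()) ∧ U.parent (.inr 1) = some (.inl ())) ∨
       (U.parent (.inr 0) = some (.inl ()) ∧ U.parent (.inr 1) = some (.inr 0)) ∨
       (U.parent (.inr 0) = some (.inr 1) ∧ U.parent (.inr 1) = some (.inl ())))) ∨
    (U.parent (.inr 0) = none ∧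
      ((U.parent (.inl ()) = some (.inr 0) ∧ U.parent (.inr 1) = some (.inr 0)) ∨
       (U.parent (.inl ()) = some (.inr 0) ∧ U.parent (.inr 1) = some (.inl ())) ∨
       (U.parent (.inl ()) = some (.inr 1) ∧ U.parent (.inr 1) = some (.inr 0)))) ∨
    (U.parent (.inr 1) = none ∧
      ((U.parent (.inl ()) = some (.inr 1) ∧ U.parent (.inr 0) = some (.inr 1)) ∨
       (U.parent (.inl ()) = some (.inr 1) ∧ U.parent (.inr 0) = some (.inl ())) ∨
       (U.parent (.inl ()) = some (.inr 0) ∧ U.parent (.inr 0) = some (.inr 1)))) := by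
  have hs := U.parent_ne_self
  obtain ⟨r, hr, hu⟩ := U.existsUnique_root
  obtain ⟨h, hh⟩ := U.acyclic
  have e : ∀ v, v ≠ r → ∃ w, w ≠ v ∧ U.parent v = some w := by
    intro v hv
    rcases hw : U.parent v with _ | w
    · exact absurd (hu v hw) hv
    · exact ⟨w, fun hwv => hs v (hwv ▸ hw), rfl⟩
  have a : ∀ v w, U.parent v = some w → U.parent w = some v → False :=
    fun v w h1 h2 => lt_asymm (hh _ _ h1) (hh _ _ h2)
  rcases r with ⟨⟩ | r
  · obtain ⟨w0, n0, h0⟩ := e (.inr 0) (by simp)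
    obtain ⟨w1, n1, h1⟩ := e (.inr 1) (by simp)
    rcases w0 with ⟨⟩ | w0
    · rcases w1 with ⟨⟩ | w1
      · simp [*]
      · fin_cases w1 <;> simp_all
    · rcases w1 with ⟨⟩ | w1
      · fin_cases w0 <;> simp_all
      · exfalso
        fin_cases w0 <;> fin_cases w1 <;> first | exact n0 rfl | exact n1 rfl | exact a _ _ h0 h1
  · fin_cases r
    · obtain ⟨w0, n0, h0⟩ := e (.inl ()) (by simp)
      obtain ⟨w1, n1, h1⟩ := e (.inr 1) (by simp)
      rcases w0 with ⟨⟩ | w0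
      · exact absurd rfl n0
      rcases w1 with ⟨⟩ | w1
      · fin_cases w0
        · simp_all
        · exact (a _ _ h0 h1).elim
      · fin_cases w0 <;> fin_cases w1 <;> simp_all
    · obtain ⟨w0, n0, h0⟩ := e (.inl ()) (by simp)
      obtain ⟨w1, n1, h1⟩ := e (.inr 0) (by simp)
      rcases w0 with ⟨⟩ | w0
      · exact absurd rfl n0
      rcases w1 with ⟨⟩ | w1
      · fin_cases w0
        · exact (a _ _ h0 h1).elim
        · simp_all
      · fin_cases w0 <;> fin_cases w1 <;> simp_all

variable (K)

theorem jac_sum (U : RTree (Unit ⊕ Fin 2)) :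
    jac K U + jac K (U.relabel LinOperad.cyc3.symm) +
      jac K (U.relabel (LinOperad.cyc3.trans LinOperad.cyc3).symm) = 0 := by
  have c1 : LinOperad.cyc3 (.inl ()) = .inr 0 := rfl
  have c2 : LinOperad.cyc3 (.inr 0) = .inr 1 := rfl
  have c3 : LinOperad.cyc3 (.inr 1) = .inl () := rfl
  have s1 : LinOperad.cyc3.symm (.inl ()) = .inr 1 := rfl
  have s2 : LinOperad.cyc3.symm (.inr 0) = .inl () := rfl
  have s3 : LinOperad.cyc3.symm (.inr 1) = .inr 0 := rfl
  set V := U.relabel LinOperad.cyc3.symm with hV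
  set W := U.relabel (LinOperad.cyc3.trans LinOperad.cyc3).symm with hW
  have key : ∀ X : RTree (Unit ⊕ Fin 2), ∀ a b c, X.parent (.inl ()) = a → X.parent (.inr 0) = b →
      X.parent (.inr 1) = c → jac K X =
        if c = some (.inr 0) then (if b = none then -1 else 1)
        else if b = some (.inr 1) then (if c = none then 1 else -1) else 0 := by
    rintro X _ _ _ rfl rfl rfl
    rcases cases3 X with ⟨h, h' | h' | h'⟩ | ⟨h, h' | h' | h'⟩ | ⟨h, h' | h' | h'⟩
    · rw [jac_0 (by simp [h, h']) (by simp [h, h'])]; simp [h, h']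
    · rw [jac_1 h h'.1 h'.2]; simp [h, h']
    · rw [jac_3 h h'.2 h'.1]; simp [h, h']
    · rw [jac_2 h'.1 h h'.2]; simp [h, h']
    · rw [jac_0 (by simp [h, h']) (by simp [h, h'])]; simp [h, h']
    · rw [jac_2 h'.1 h h'.2]; simp [h, h']
    · rw [jac_4 h'.1 h h'.2]; simp [h, h']
    · rw [jac_0 (by simp [h, h']) (by simp [h, h'])]; simp [h, h']
    · rw [jac_4 h'.1 h h'.2]; simp [h, h']
  rw [key U _ _ _ rfl rfl rfl, key V _ _ _ rfl rfl rfl, key W _ _ _ rfl rfl rfl]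
  rcases cases3 U with ⟨h, h' | h' | h'⟩ | ⟨h, h' | h' | h'⟩ | ⟨h, h' | h' | h'⟩ <;>
    simp [hV, hW, h, h', c1, c2, c3, s1, s2, s3]

/-- The bracket in the operad of rooted trees. -/
noncomputable def bracket : LinOperad.LieElement (rtLin K) where
  val := bracketVal K
  antisymm := by
    funext U
    change bracketVal K (U.relabel (Equiv.swap 0 1).symm) = -bracketVal K U
    rw [Equiv.symm_swap]
    rcases fin2_cases U with rfl | rfl
    · rw [edge01_swap, bracketVal_01, bracketVal_10]
    · rw [edge10_swap, bracketVal_01, bracketVal_10, neg_neg]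
  jacobi := funext (jac_sum K)

end RTOp

/-- The twisted operad of rooted trees: trees some of whose vertices are labelled by the inputs,
while the other vertices are black and odd of degree `-1`. -/
noncomputable def TwRT (K : Type u) [Field K] [CharZero K] : DGOperad K := (RTOp.bracket K).twist

namespace RTree

/-- The children of a vertex. -/
def children {V : Type} (T : RTree V) (v : V) : Set V := {w | T.parent w = some v}

theorem children_relabel {V W : Type} (e : V ≃ W) (T : RTree V) (v : V) :
    (T.relabel e).children (e v) = e '' T.children v := by
  ext w
  simp only [children, relabel_parent, Set.mem_ofPred_eq, Option.map_eq_some_iff, Set.mem_image]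
  constructor
  · rintro ⟨a, ha, h⟩
    rw [e.injective h] at ha
    exact ⟨_, ha, e.apply_symm_apply w⟩
  · rintro ⟨x, hx, rfl⟩
    exact ⟨v, by simpa using hx, rfl⟩

/-- Identify the new vertex `none` with the vertex `v`. -/
def con {V : Type} (v : V) : Option V → V := fun x => x.getD v

/-- `T` arises from `U` by contracting the edge from the vertex `v` up to the new vertex. -/
structure Above {V : Type} (U : RTree (Option V)) (v : V) (T : RTree V) : Prop where
  edge : U.parent (some v) = some none
  other : ∀ w, w ≠ v → (U.parent (some w)).map (con v) = T.parent w
  top : (U.parent none).map (con v) = T.parent v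

/-- `T` arises from `U` by contracting the edge from the new vertex up to the vertex `v`. -/
structure Below {V : Type} (U : RTree (Option V)) (v : V) (T : RTree V) : Prop where
  edge : U.parent none = some (some v)
  other : ∀ w, w ≠ v → (U.parent (some w)).map (con v) = T.parent w
  top : (U.parent (some v)).map (con v) = T.parent v

/-- `U` arises from `T` by adding a new root. -/
structure NewRoot {V : Type} (U : RTree (Option V)) (T : RTree V) : Prop where
  root : U.parent none = none
  inner : ∀ w w', T.parent w = some w' → U.parent (some w) = some (some w')
  old : ∀ w, T.parent w = none → U.parent (some w) = some none

/-- `U` arises from `T` by adding a new leaf. -/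
structure NewLeaf {V : Type} (U : RTree (Option V)) (T : RTree V) : Prop where
  leaf : ∃ v, U.parent none = some (some v)
  inner : ∀ w, U.parent (some w) = (T.parent w).map some

theorem map_con_relabel {V W : Type} (e : V ≃ W) (v : V) (x : Option (Option V)) :
    (x.map e.optionCongr).map (con (e v)) = (x.map (con v)).map e := by
  rcases x with _ | _ | _ <;> rfl

theorem optionCongr_symm_some {V W : Type} (e : V ≃ W) (v : V) :
    e.optionCongr.symm (some (e v)) = some v := (Equiv.symm_apply_eq _).2 rfl

theorem optionCongr_symm_none {V W : Type} (e : V ≃ W) : e.optionCongr.symm none = none := rfl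

theorem Above.relabel {V W : Type} (e : V ≃ W) {U : RTree (Option V)} {v : V} {T : RTree V}
    (h : Above U v T) : Above (U.relabel e.optionCongr) (e v) (T.relabel e) := by
  refine ⟨?_, fun w hw => ?_, ?_⟩
  · rw [relabel_parent, optionCongr_symm_some, h.edge]; rfl
  · have := h.other (e.symm w) (fun h => hw (by simp [← h]))
    rw [relabel_parent, map_con_relabel, relabel_parent, ← this]
    rfl
  · have := h.top
    rw [relabel_parent, map_con_relabel, relabel_parent, e.symm_apply_apply, ← this]
    rfl

theorem Below.relabel {V W : Type} (e : V ≃ W) {U : RTree (Option V)} {v : V} {T : RTree V}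
    (h : Below U v T) : Below (U.relabel e.optionCongr) (e v) (T.relabel e) := by
  refine ⟨?_, fun w hw => ?_, ?_⟩
  · rw [relabel_parent, optionCongr_symm_none, h.edge]; rfl
  · have := h.other (e.symm w) (fun h => hw (by simp [← h]))
    rw [relabel_parent, map_con_relabel, relabel_parent, ← this]
    rfl
  · have := h.top
    rw [relabel_parent, map_con_relabel, relabel_parent, e.symm_apply_apply, ← this,
      optionCongr_symm_some]

theorem above_relabel_iff {V W : Type} (e : V ≃ W) {U : RTree (Option V)} {v : V} {T : RTree V} :
    Above (U.relabel e.optionCongr) (e v) (T.relabel e) ↔ Above U v T := by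
  refine ⟨fun h => ?_, Above.relabel e⟩
  have := h.relabel e.symm
  rwa [relabel_relabel, relabel_relabel, e.symm_apply_apply, Equiv.self_trans_symm, relabel_refl,
    show e.symm.optionCongr = e.optionCongr.symm from rfl, Equiv.self_trans_symm, relabel_refl] at this

theorem below_relabel_iff {V W : Type} (e : V ≃ W) {U : RTree (Option V)} {v : V} {T : RTree V} :
    Below (U.relabel e.optionCongr) (e v) (T.relabel e) ↔ Below U v T := by
  refine ⟨fun h => ?_, Below.relabel e⟩
  have := h.relabel e.symm
  rwa [relabel_relabel, relabel_relabel, e.symm_apply_apply, Equiv.self_trans_symm, relabel_refl,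
    show e.symm.optionCongr = e.optionCongr.symm from rfl, Equiv.self_trans_symm, relabel_refl] at this

theorem splitEquiv_collapse {X : Type} (x : Option (Option (Option X))) :
    (x.map (LinOperad.LieElement.splitEquiv X).symm).map collapse = x.map (con none) := by
  rcases x with _ | _ | _ | _ <;> rfl

theorem isInsertion_01_iff {X : Type} (U : RTree (Option (Option X))) (T : RTree (Option X)) :
    IsInsertion T.parent RTOp.edge01.parent
      (U.relabel (LinOperad.LieElement.splitEquiv X).symm).parent ↔ Above U none T := by
  constructor
  · intro h
    refine ⟨?_, fun w hw => ?_, ?_⟩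
    · have := h.inner 1 0 rfl
      rw [relabel_parent, Option.map_eq_some_iff] at this
      obtain ⟨x, hx, h2⟩ := this
      rw [Equiv.symm_apply_eq] at h2
      subst h2
      exact hx
    · rcases w with _ | w
      · exact absurd rfl hw
      · rw [← h.outer w, relabel_parent, splitEquiv_collapse]; rfl
    · rw [← h.root 0 rfl, relabel_parent, splitEquiv_collapse]; rfl
  · intro h
    refine ⟨fun a => ?_, fun b b' hb => ?_, fun b hb => ?_⟩
    · rw [relabel_parent, splitEquiv_collapse]
      exact h.other (some a) (by simp)
    · fin_cases b <;> simp [RTOp.edge01] at hb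
      subst hb
      have := h.edge
      simp [relabel_parent, LinOperad.LieElement.splitEquiv, this]
    · fin_cases b <;> simp [RTOp.edge01] at hb
      rw [relabel_parent, splitEquiv_collapse]
      exact h.top

theorem isInsertion_10_iff {X : Type} (U : RTree (Option (Option X))) (T : RTree (Option X)) :
    IsInsertion T.parent RTOp.edge10.parent
      (U.relabel (LinOperad.LieElement.splitEquiv X).symm).parent ↔ Below U none T := by
  constructor
  · intro h
    refine ⟨?_, fun w hw => ?_, ?_⟩
    · have := h.inner 0 1 rfl
      rw [relabel_parent, Option.map_eq_some_iff] at this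
      obtain ⟨x, hx, h2⟩ := this
      rw [Equiv.symm_apply_eq] at h2
      subst h2
      exact hx
    · rcases w with _ | w
      · exact absurd rfl hw
      · rw [← h.outer w, relabel_parent, splitEquiv_collapse]; rfl
    · rw [← h.root 1 rfl, relabel_parent, splitEquiv_collapse]; rfl
  · intro h
    refine ⟨fun a => ?_, fun b b' hb => ?_, fun b hb => ?_⟩
    · rw [relabel_parent, splitEquiv_collapse]
      exact h.other (some a) (by simp)
    · fin_cases b <;> simp [RTOp.edge10] at hb
      subst hb
      have := h.edge
      simp [relabel_parent, LinOperad.LieElement.splitEquiv, this]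
    · fin_cases b <;> simp [RTOp.edge10] at hb
      rw [relabel_parent, splitEquiv_collapse]
      exact h.top

theorem isInsertion_root_iff {V : Type} (U : RTree (Option V)) (T : RTree V) :
    IsInsertion (RTOp.edge01.relabel LinOperad.opt2).parent T.parent
      (U.relabel (LinOperad.LieElement.unitSum V).symm).parent ↔ NewRoot U T := by
  have e1 : (RTOp.edge01.relabel LinOperad.opt2).parent (some ()) = none := rfl
  have e2 : (RTOp.edge01.relabel LinOperad.opt2).parent none = some (some ()) := rfl
  constructor
  · intro h
    refine ⟨?_, fun w w' hw => ?_, fun w hw => ?_⟩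
    · have := h.outer ()
      rw [e1, relabel_parent, Option.map_eq_none_iff, Option.map_eq_none_iff] at this
      exact this
    · have := h.inner w w' hw
      rw [relabel_parent, Option.map_eq_some_iff] at this
      obtain ⟨x, hx, h2⟩ := this
      rw [Equiv.symm_apply_eq] at h2
      subst h2
      exact hx
    · have := h.root w hw
      rw [e2, relabel_parent] at this
      have e3 : (LinOperad.LieElement.unitSum V).symm.symm (.inr w) = some w := rfl
      rw [e3] at this
      rcases h3 : U.parent (some w) with _ | _ | _
      · rw [h3] at this; cases this
      · rfl
      · rw [h3] at this; cases this
  · intro h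
    refine ⟨fun a => ?_, fun b b' hb => ?_, fun b hb => ?_⟩
    · rw [e1, relabel_parent, Option.map_eq_none_iff, Option.map_eq_none_iff]
      exact h.root
    · have := h.inner b b' hb
      simp [LinOperad.LieElement.unitSum, this]
    · have := h.old b hb
      rw [e2]
      simp [LinOperad.LieElement.unitSum, this]

theorem isInsertion_leaf_iff {V : Type} (U : RTree (Option V)) (T : RTree V) :
    IsInsertion (RTOp.edge10.relabel LinOperad.opt2).parent T.parent
      (U.relabel (LinOperad.LieElement.unitSum V).symm).parent ↔ NewLeaf U T := by
  have e1 : (RTOp.edge10.relabel LinOperad.opt2).parent (some ()) = some none := rfl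
  have e2 : (RTOp.edge10.relabel LinOperad.opt2).parent none = none := rfl
  constructor
  · intro h
    refine ⟨?_, fun w => ?_⟩
    · have := h.outer ()
      rw [e1, relabel_parent] at this
      have e3 : (LinOperad.LieElement.unitSum V).symm.symm (.inl ()) = none := rfl
      rw [e3] at this
      rcases h3 : U.parent none with _ | _ | v
      · rw [h3] at this; cases this
      · rw [h3] at this; cases this
      · exact ⟨v, rfl⟩
    · rcases hw : T.parent w with _ | w'
      · have := h.root w hw
        rw [e2, relabel_parent, Option.map_eq_none_iff, Option.map_eq_none_iff] at this
        exact this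
      · have := h.inner w w' hw
        rw [relabel_parent, Option.map_eq_some_iff] at this
        obtain ⟨x, hx, h2⟩ := this
        rw [Equiv.symm_apply_eq] at h2
        subst h2
        exact hx
  · intro h
    refine ⟨fun a => ?_, fun b b' hb => ?_, fun b hb => ?_⟩
    · obtain ⟨v, hv⟩ := h.leaf
      cases a
      rw [e1]
      simp [LinOperad.LieElement.unitSum, hv]
    · have := h.inner b
      simp [LinOperad.LieElement.unitSum, this, hb]
    · have := h.inner b
      rw [e2]
      simp [LinOperad.LieElement.unitSum, this, hb]

end RTree

namespace RTOp

variable (K : Type u) [Field K]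

open Classical in
/-- The basis element belonging to a tree. -/
noncomputable def single {V : Type} (T : RTree V) : RTree V → K := Pi.single T 1

theorem bracketVal_eq : bracketVal K = single K edge01 - single K edge10 := rfl

open Classical in
theorem single_apply {V : Type} (T U : RTree V) : single K T U = if U = T then 1 else 0 :=
  Pi.single_apply _ _ _

theorem single_relabel {V W : Type} [Finite V] [Finite W] (e : V ≃ W) (T : RTree V) :
    (rtLin K).map e (single K T) = single K (T.relabel e) := by
  classical
  funext U
  change single K T (U.relabel e.symm) = _
  rw [single_apply, single_apply]
  refine if_congr ⟨fun h => ?_, fun h => ?_⟩ rfl rfl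
  · rw [← h, relabel_symm_relabel]
  · rw [h, relabel_relabel_symm]

open Classical in
theorem insertion_single {A B : Type} [Finite A] [Finite B] (T : RTree (Option A)) (S : RTree B)
    (U : RTree (A ⊕ B)) : insertion K (single K T) (single K S) U =
      if RTree.IsInsertion T.parent S.parent U.parent then 1 else 0 := by
  simp only [insertion, LinearMap.mk₂_apply]
  rw [Finset.sum_eq_single T, Finset.sum_eq_single S]
  · simp [single_apply]
  · intro S' _ hS; simp [single_apply, hS]
  · simp
  · intro T' _ hT; simp [single_apply, hT]
  · simp

open Classical in
theorem splitAt_single {V : Type} [Finite V] (v : V) (T : RTree V) (U : RTree (Option V)) :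
    (bracket K).splitAt v (single K T) U =
      (if RTree.Above U v T then 1 else 0) - if RTree.Below U v T then 1 else 0 := by
  obtain ⟨X, _, e, rfl⟩ := LinOperad.LieElement.exists_pt v
  obtain ⟨T, rfl⟩ : ∃ T' : RTree (Option X), T = T'.relabel e := ⟨_, (relabel_symm_relabel e T).symm⟩
  obtain ⟨U, rfl⟩ : ∃ U' : RTree (Option (Option X)), U = U'.relabel e.optionCongr := ⟨_, (relabel_symm_relabel _ U).symm⟩
  simp only [RTree.above_relabel_iff, RTree.below_relabel_iff]
  have h : (bracket K).splitAt (e none) (single K (T.relabel e)) =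
      (rtLin K).map e.optionCongr ((bracket K).split (single K T)) := by
    have := LinOperad.LieElement.splitAt_map (bracket K) e none (single K T)
    rw [← single_relabel]
    exact this.trans (congrArg _ (LinOperad.LieElement.splitAt_none (bracket K) (single K T)))
  rw [h]
  change (bracket K).split (single K T) ((U.relabel e.optionCongr).relabel e.optionCongr.symm) = _
  rw [relabel_relabel_symm]
  change insertion K (single K T) (bracketVal K)
    (U.relabel (LinOperad.LieElement.splitEquiv X).symm) = _
  rw [bracketVal_eq, map_sub, Pi.sub_apply, insertion_single, insertion_single]
  simp only [RTree.isInsertion_01_iff, RTree.isInsertion_10_iff]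

open Classical in
theorem ad_single {V : Type} [Finite V] (T : RTree V) (U : RTree (Option V)) :
    (bracket K).ad (single K T) U =
      (if RTree.NewRoot U T then 1 else 0) - if RTree.NewLeaf U T then 1 else 0 := by
  change insertion K ((rtLin K).map LinOperad.opt2 (bracketVal K)) (single K T)
    (U.relabel (LinOperad.LieElement.unitSum V).symm) = _
  have h : (rtLin K).map LinOperad.opt2 (bracketVal K) =
      (single K (edge01.relabel LinOperad.opt2) - single K (edge10.relabel LinOperad.opt2) :
        RTree (Option Unit) → K) := by
    rw [← single_relabel, ← single_relabel]
    exact map_sub ((rtLin K).map LinOperad.opt2) (single K edge01) (single K edge10)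
  rw [h, map_sub, LinearMap.sub_apply, Pi.sub_apply, insertion_single, insertion_single]
  simp only [RTree.isInsertion_root_iff, RTree.isInsertion_leaf_iff]

end RTOp

namespace RTree

variable {V : Type}

theorem map_con_eq {x : Option (Option V)} (h : x ≠ some none) (a b : V) :
    x.map (con a) = x.map (con b) := by
  rcases x with _ | _ | _
  · rfl
  · exact absurd rfl h
  · rfl

theorem map_con_some {x : Option (Option V)} (h : x ≠ some none) (a : V) :
    (x.map (con a)).map some = x := by
  rcases x with _ | _ | _
  · rfl
  · exact absurd rfl h
  · rfl

theorem not_cycle (T : RTree V) {v w : V} (h : T.parent v = some w) : T.parent w ≠ some v := by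
  obtain ⟨f, hf⟩ := T.acyclic
  exact fun h' => lt_asymm (hf _ _ h) (hf _ _ h')

variable {U : RTree (Option V)} {T : RTree V} {v : V}

theorem NewLeaf.ne (h : NewLeaf U T) (w : V) : U.parent (some w) ≠ some none := by
  rw [h.inner]
  rcases T.parent w with _ | _ <;> simp

theorem NewRoot.exists_child (h : NewRoot U T) : ∃ w, U.parent (some w) = some none := by
  obtain ⟨r, hr, -⟩ := T.existsUnique_root
  exact ⟨r, h.old r hr⟩

/-- The new vertex is a leaf below `p`. -/
theorem below_iff_newLeaf {p : V} (hp : U.parent none = some (some p))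
    (h0 : ∀ w, U.parent (some w) ≠ some none) : Below U p T ↔ NewLeaf U T := by
  constructor
  · intro h
    refine ⟨⟨p, hp⟩, fun w => ?_⟩
    by_cases hw : w = p
    · rw [hw, ← h.top, map_con_some (h0 p)]
    · rw [← h.other w hw, map_con_some (h0 w)]
  · intro h
    have key : ∀ w, (U.parent (some w)).map (con p) = T.parent w := fun w => by
      rw [h.inner]; rcases T.parent w with _ | _ <;> rfl
    exact ⟨hp, fun w _ => key w, key p⟩

/-- The new vertex is the root with single child `c`. -/
theorem above_iff_newRoot {c : V} (hr : U.parent none = none)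
    (hc : ∀ w, U.parent (some w) = some none ↔ w = c) : Above U c T ↔ NewRoot U T := by
  constructor
  · intro h
    have hTc : T.parent c = none := by rw [← h.top, hr]; rfl
    refine ⟨hr, fun w w' hw => ?_, fun w hw => ?_⟩
    · have hwc : w ≠ c := by rintro rfl; rw [hTc] at hw; cases hw
      have := h.other w hwc
      rw [← map_con_some (fun h' => hwc ((hc w).1 h')) c, this, hw]; rfl
    · by_cases hwc : w = c
      · exact (hc w).2 hwc
      · have := h.other w hwc
        rw [hw, Option.map_eq_none_iff] at this
        obtain ⟨r, _, hu⟩ := U.existsUnique_root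
        exact absurd ((hu _ this).trans (hu _ hr).symm) (by simp)
  · intro h
    refine ⟨(hc c).2 rfl, fun w hw => ?_, ?_⟩
    · rcases hT : T.parent w with _ | w'
      · exact absurd ((hc w).1 (h.old w hT)) hw
      · rw [h.inner w w' hT]; rfl
    · rcases hT : T.parent c with _ | w'
      · rw [hr]; rfl
      · have := h.inner c w' hT
        rw [(hc c).2 rfl] at this
        cases this

/-- The new vertex has parent `p` and single child `c`. -/
theorem above_iff_below {c p : V} (hp : U.parent none = some (some p))
    (hc : ∀ w, U.parent (some w) = some none ↔ w = c) : Above U c T ↔ Below U p T := by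
  have hcp : c ≠ p := by
    rintro rfl
    exact U.not_cycle hp ((hc c).2 rfl)
  have hn : ∀ w, w ≠ c → U.parent (some w) ≠ some none := fun w hw h => hw ((hc w).1 h)
  constructor
  · intro h
    refine ⟨hp, fun w hw => ?_, ?_⟩
    · by_cases hwc : w = c
      · rw [hwc, (hc c).2 rfl, ← h.top, hp]; rfl
      · rw [← h.other w hwc, map_con_eq (hn w hwc)]
    · rw [← h.other p hcp.symm, map_con_eq (hn p hcp.symm)]
  · intro h
    refine ⟨(hc c).2 rfl, fun w hw => ?_, ?_⟩
    · by_cases hwp : w = p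
      · rw [map_con_eq (hn w hw) c p, hwp, h.top]
      · rw [map_con_eq (hn w hw) c p, h.other w hwp]
    · rw [← h.other c hcp, (hc c).2 rfl, hp]; rfl

/-- `1` if a proposition holds and `0` otherwise. -/
noncomputable def ind (K : Type u) [Field K] (p : Prop) : K := by
  classical exact if p then 1 else 0

section ind

variable {K : Type u} [Field K] {p q : Prop}

theorem ind_pos (h : p) : ind K p = 1 := if_pos h

theorem ind_neg (h : ¬p) : ind K p = 0 := if_neg h

theorem ind_congr (h : p ↔ q) : ind K p = ind K q := by rw [propext h]

end ind

theorem sum_ind_eq (K : Type u) [Field K] [Fintype V] {P : V → Prop} (a : V)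
    (h : ∀ v, P v → v = a) :
    ∑ v, ind K (P v) = ind K (P a) :=
  Finset.sum_eq_single a (fun v _ hv => ind_neg fun hp => hv (h v hp)) (by simp)

theorem sum_ind_zero (K : Type u) [Field K] [Fintype V] {P : V → Prop} (h : ∀ v, ¬P v) :
    ∑ v, ind K (P v) = 0 :=
  Finset.sum_eq_zero fun v _ => ind_neg (h v)

theorem sum_above_below (K : Type u) [Field K] [Fintype V]
    (h : ¬ (U.children none).Nontrivial) :
    ∑ v, ind K (Above U v T) - ∑ v, ind K (Below U v T) =
      ind K (NewRoot U T) - ind K (NewLeaf U T) := by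
  have hb : ∀ {p v}, U.parent none = some (some p) → Below U v T → v = p := fun hp h' => by
    have := h'.edge
    rw [hp] at this
    cases this; rfl
  by_cases h0 : ∃ c, U.parent (some c) = some none
  · obtain ⟨c, hc⟩ := h0
    have hc' : ∀ w, U.parent (some w) = some none ↔ w = c := by
      refine fun w => ⟨fun hw => ?_, fun hw => hw ▸ hc⟩
      by_contra hne
      exact h ⟨some w, hw, some c, hc, fun e => hne (Option.some_injective _ e)⟩
    rw [sum_ind_eq K c (fun v hv => (hc' v).1 hv.edge),
      ind_neg (p := NewLeaf U T) (fun h' => h'.ne c hc)]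
    rcases hp : U.parent none with _ | _ | p
    · rw [sum_ind_zero K (fun v hv => by have := hv.edge; rw [hp] at this; cases this),
        ind_congr (above_iff_newRoot hp hc')]
    · exact absurd hp (U.parent_ne_self none)
    · rw [sum_ind_eq K p (fun v hv => hb hp hv), ind_congr (above_iff_below hp hc'),
        ind_neg (p := NewRoot U T) (fun h' => by have := h'.root; rw [hp] at this; cases this)]
      ring
  · push Not at h0
    rw [sum_ind_zero K (fun v hv => h0 v hv.edge), ind_neg (p := NewRoot U T)
      (fun h' => by obtain ⟨w, hw⟩ := h'.exists_child; exact h0 w hw)]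
    rcases hp : U.parent none with _ | _ | p
    · rw [sum_ind_zero K (fun v hv => by have := hv.edge; rw [hp] at this; cases this),
        ind_neg (p := NewLeaf U T)
          (fun h' => by obtain ⟨p, hp'⟩ := h'.leaf; rw [hp] at hp'; cases hp')]
    · exact absurd hp (U.parent_ne_self none)
    · rw [sum_ind_eq K p (fun v hv => hb hp hv), ind_congr (below_iff_newLeaf hp h0)]

theorem cases_con {x : Option (Option V)} {v u : V} (h : x.map (con v) = some u) :
    x = some (some u) ∨ (x = some none ∧ u = v) := by
  rcases x with _ | _ | _
  · cases h
  · right; exact ⟨rfl, (Option.some_injective _ h).symm⟩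
  · left; cases h; rfl

theorem Above.two (h : Above U v T) (hT : (T.children v).Nontrivial) :
    (U.children none).Nontrivial ∨ (U.children (some v)).Nontrivial := by
  obtain ⟨x, hx, y, hy, hxy⟩ := hT
  have hxv : x ≠ v := by rintro rfl; exact T.parent_ne_self _ hx
  have hyv : y ≠ v := by rintro rfl; exact T.parent_ne_self _ hy
  rcases cases_con ((h.other x hxv).trans hx) with hx' | ⟨hx', -⟩
  · rcases cases_con ((h.other y hyv).trans hy) with hy' | ⟨hy', -⟩
    · exact Or.inr ⟨some x, hx', some y, hy', by simpa⟩
    · exact Or.inl ⟨some y, hy', some v, h.edge, by simpa⟩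
  · exact Or.inl ⟨some x, hx', some v, h.edge, by simpa⟩

theorem Below.two (h : Below U v T) (hT : (T.children v).Nontrivial) :
    (U.children none).Nontrivial ∨ (U.children (some v)).Nontrivial := by
  obtain ⟨x, hx, y, hy, hxy⟩ := hT
  have hxv : x ≠ v := by rintro rfl; exact T.parent_ne_self _ hx
  have hyv : y ≠ v := by rintro rfl; exact T.parent_ne_self _ hy
  rcases cases_con ((h.other x hxv).trans hx) with hx' | ⟨hx', -⟩
  · exact Or.inr ⟨some x, hx', none, h.edge, by simp⟩
  · rcases cases_con ((h.other y hyv).trans hy) with hy' | ⟨hy', -⟩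
    · exact Or.inr ⟨some y, hy', none, h.edge, by simp⟩
    · exact Or.inl ⟨some x, hx', some y, hy', by simpa⟩

theorem Above.other_two {k : V} (h : Above U v T) (hk : k ≠ v) (hT : (T.children k).Nontrivial) :
    (U.children (some k)).Nontrivial := by
  classical
  let f : V → Option V := fun w => if w = v then none else some w
  have hf : ∀ w ∈ T.children k, f w ∈ U.children (some k) := by
    intro w hw
    have e : (U.parent (f w)).map (con v) = some k := by
      by_cases h' : w = v
      · rw [show f w = none from if_pos h', h.top, ← h']; exact hw
      · rw [show f w = some w from if_neg h', h.other w h']; exact hw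
    rcases cases_con e with h' | ⟨-, h'⟩
    · exact h'
    · exact absurd h' hk
  obtain ⟨x, hx, y, hy, hxy⟩ := hT
  refine ⟨f x, hf x hx, f y, hf y hy, ?_⟩
  by_cases h1 : x = v <;> by_cases h2 : y = v <;> simp [f, h1, h2] <;> simp_all

theorem Below.other_two {k : V} (h : Below U v T) (hk : k ≠ v) (hT : (T.children k).Nontrivial) :
    (U.children (some k)).Nontrivial := by
  have hf : ∀ w ∈ T.children k, some w ∈ U.children (some k) := by
    intro w hw
    have e : (U.parent (some w)).map (con v) = some k := by
      by_cases h' : w = v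
      · rw [h', h.top, ← h']; exact hw
      · rw [h.other w h']; exact hw
    rcases cases_con e with h' | ⟨-, h'⟩
    · exact h'
    · exact absurd h' hk
  obtain ⟨x, hx, y, hy, hxy⟩ := hT
  exact ⟨some x, hf x hx, some y, hf y hy, by simpa⟩

/-- The terms in which the new vertex or `v` have less than two children. -/
noncomputable def defect (K : Type u) [Field K] (T : RTree V) (v : V) (U : RTree (Option V)) : K :=
  (ind K (Above U v T ∧ ¬ (U.children none).Nontrivial) -
    ind K (Above U v T ∧ ¬ (U.children (some v)).Nontrivial)) -
  (ind K (Below U v T ∧ ¬ (U.children none).Nontrivial) -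
    ind K (Below U v T ∧ ¬ (U.children (some v)).Nontrivial))

theorem defect_good (K : Type u) [Field K] (h0 : (U.children none).Nontrivial)
    (hv : (U.children (some v)).Nontrivial) : defect K T v U = 0 := by
  rw [defect, ind_neg (fun h => h.2 h0), ind_neg (fun h => h.2 hv), ind_neg (fun h => h.2 h0),
    ind_neg (fun h => h.2 hv)]
  ring

theorem defect_bad (K : Type u) [Field K] [Fintype V] (c : V → K) (B : V → Prop)
    (hB : ∀ v, ¬B v → c v = 1) (hB' : ∀ v, B v → c v = 1 - c v)
    (hT : ∀ v, B v → (T.children v).Nontrivial)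
    (hU : ¬ (U.children none).Nontrivial ∨ ∃ k, B k ∧ ¬ (U.children (some k)).Nontrivial) :
    ind K (NewRoot U T) - ind K (NewLeaf U T) -
      ∑ v, c v * (ind K (Above U v T) - ind K (Below U v T)) =
    ∑ v, (1 - c v) * defect K T v U := by
  by_cases h0 : (U.children none).Nontrivial
  · obtain ⟨k, hk, hkU⟩ : ∃ k, B k ∧ ¬ (U.children (some k)).Nontrivial := by tauto
    rw [ind_neg (p := NewLeaf U T), ind_neg (p := NewRoot U T), sub_zero, zero_sub,
      ← Finset.sum_neg_distrib]
    · refine Finset.sum_congr rfl fun v _ => ?_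
      have e1 : ind K (Above U v T ∧ ¬ (U.children none).Nontrivial) = 0 := ind_neg fun h => h.2 h0
      have e2 : ind K (Below U v T ∧ ¬ (U.children none).Nontrivial) = 0 := ind_neg fun h => h.2 h0
      rw [defect, e1, e2]
      by_cases hv : v = k
      · subst hv
        rw [ind_congr (p := Above U v T ∧ ¬ (U.children (some v)).Nontrivial) (and_iff_left hkU),
          ind_congr (p := Below U v T ∧ ¬ (U.children (some v)).Nontrivial) (and_iff_left hkU),
          ← hB' v hk]
        ring
      · have a1 : ¬ Above U v T := fun h => hkU (h.other_two (Ne.symm hv) (hT k hk))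
        have a2 : ¬ Below U v T := fun h => hkU (h.other_two (Ne.symm hv) (hT k hk))
        rw [ind_neg a1, ind_neg a2, ind_neg (fun h => a1 h.1), ind_neg (fun h => a2 h.1)]
        ring
    · rintro h
      obtain ⟨x, hx, y, hy, hxy⟩ := h0
      have key : ∀ x : Option V, x ∈ U.children none → ∃ x', x = some x' ∧ T.parent x' = none := by
        rintro (_ | x) hx
        · exact absurd hx (U.parent_ne_self none)
        · refine ⟨x, rfl, ?_⟩
          rcases hp : T.parent x with _ | w
          · rfl
          · have := h.inner x w hp
            rw [show U.parent (some x) = some none from hx] at this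
            cases this
      obtain ⟨x, rfl, hx'⟩ := key x hx
      obtain ⟨y, rfl, hy'⟩ := key y hy
      exact hxy (congrArg some (T.existsUnique_root.unique hx' hy'))
    · rintro h
      obtain ⟨x, hx⟩ := h0.nonempty
      rcases x with _ | x
      · exact absurd hx (U.parent_ne_self none)
      · exact h.ne x hx
  · rw [← sum_above_below K h0, ← Finset.sum_sub_distrib, ← Finset.sum_sub_distrib]
    refine Finset.sum_congr rfl fun v _ => ?_
    by_cases hv : B v
    · have a1 : ¬ (Above U v T ∧ ¬ (U.children (some v)).Nontrivial) := fun h =>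
        (h.1.two (hT v hv)).elim h0 h.2
      have a2 : ¬ (Below U v T ∧ ¬ (U.children (some v)).Nontrivial) := fun h =>
        (h.1.two (hT v hv)).elim h0 h.2
      rw [defect, ind_neg a1, ind_neg a2,
        ind_congr (p := Above U v T ∧ ¬ (U.children none).Nontrivial) (and_iff_left h0),
        ind_congr (p := Below U v T ∧ ¬ (U.children none).Nontrivial) (and_iff_left h0)]
      ring
    · rw [hB v hv]; ring

end RTree

namespace DGOperad

/-- The suboperad of a dg operad given by subspaces which are closed under all operations. -/
def sub {K : Type u} [Field K] (Q : DGOperad K)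
    (S : ∀ (A : Type) [Finite A] (n : ℕ), Submodule K (Q.obj A n))
    (hd : ∀ {A : Type} [Finite A] (n : ℕ), ∀ x ∈ S A n, Q.d n x ∈ S A (n + 1))
    (hmap : ∀ {A B : Type} [Finite A] [Finite B] (e : A ≃ B) (n : ℕ), ∀ x ∈ S A n,
      Q.map e n x ∈ S B n)
    (hone : Q.one ∈ S Unit 0)
    (hcomp : ∀ {A B : Type} [Finite A] [Finite B] {m n k : ℕ} (h : m + n = k),
      ∀ x ∈ S (Option A) m, ∀ y ∈ S B n, Q.comp h x y ∈ S (A ⊕ B) k) : DGOperad K where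
  obj A _ n := S A n
  d n := (Q.d n).restrict (hd n)
  map e n := (Q.map e n).restrict (hmap e n)
  one := ⟨Q.one, hone⟩
  comp h := LinearMap.mk₂ K (fun x y => ⟨Q.comp h x.1 y.1, hcomp h x.1 x.2 y.1 y.2⟩)
    (fun x x' y => Subtype.ext (by simp)) (fun c x y => Subtype.ext (by simp))
    (fun x y y' => Subtype.ext (by simp)) (fun c x y => Subtype.ext (by simp))
  d_d n x := Subtype.ext (Q.d_d n _)
  map_refl n x := Subtype.ext (Q.map_refl n _)
  map_map e f n x := Subtype.ext (Q.map_map e f n _)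
  d_map e n x := Subtype.ext (Q.d_map e n _)
  comp_map h e f x y := Subtype.ext (Q.comp_map h e f _ _)
  comp_one n x := Subtype.ext (Q.comp_one n _)
  one_comp n y := Subtype.ext (Q.one_comp n _)
  leibniz h h₁ h₂ x y := Subtype.ext (Q.leibniz h h₁ h₂ _ _)
  comp_assoc h₁ h₂ h₃ h₄ x y z := Subtype.ext (Q.comp_assoc h₁ h₂ h₃ h₄ _ _ _)
  comp_comm h₁ h₂ h₃ h₄ x y z := Subtype.ext (Q.comp_comm h₁ h₂ h₃ h₄ _ _ _)

end DGOperad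

namespace RTOp

open LinOperad LinOperad.LieElement

/-- All black vertices of the tree have at least two children. -/
def IsGood {A : Type} {b : ℕ} (T : RTree (A ⊕ Fin b)) : Prop :=
  ∀ k : Fin b, (T.children (.inr k)).Nontrivial

variable (K : Type u) [Field K]

/-- The span of the trees all of whose black vertices have at least two children. -/
noncomputable def goodSpan (A : Type) [Finite A] (b : ℕ) : Submodule K (TwObj (rtLin K) A b) :=
  Submodule.span K
    {z | ∃ T : RTree (A ⊕ Fin b), IsGood T ∧ z = twMk (rtLin K) A b (single K T)}

variable {K}

theorem goodSpan_of_support {A : Type} [Finite A] {b : ℕ} (f : RTree (A ⊕ Fin b) → K)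
    (h : ∀ U, f U ≠ 0 → IsGood U) : twMk (rtLin K) A b f ∈ goodSpan K A b := by
  classical
  have e : f = ∑ U : RTree (A ⊕ Fin b), f U • single K U := by
    funext V
    rw [Finset.sum_apply, Finset.sum_eq_single V]
    · simp [single_apply]
    · intro U _ hU
      simp [single_apply, Ne.symm hU]
    · simp
  have e2 : twMk (rtLin K) A b f =
      ∑ U : RTree (A ⊕ Fin b), f U • twMk (rtLin K) A b (single K U) := by
    refine (congrArg (twMk (rtLin K) A b) e).trans ?_
    refine (map_sum (twMk (rtLin K) A b) (fun U => f U • single K U) Finset.univ).trans ?_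
    exact Finset.sum_congr rfl fun U _ => map_smul (twMk (rtLin K) A b) (f U) (single K U)
  rw [e2]
  refine Submodule.sum_mem _ fun U _ => ?_
  by_cases hU : f U = 0
  · rw [hU, zero_smul]; exact zero_mem _
  · exact Submodule.smul_mem _ _ (Submodule.subset_span ⟨U, h U hU, rfl⟩)

theorem isGood_cons {A : Type} {b : ℕ} {U : RTree (Option (A ⊕ Fin b))}
    (h0 : (U.children none).Nontrivial)
    (h : ∀ k : Fin b, (U.children (some (.inr k))).Nontrivial) : IsGood (U.relabel (cons A b)) := by
  intro k
  refine Fin.cases ?_ (fun k => ?_) k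
  · have := RTree.children_relabel (cons A b) U none
    rw [show cons A b none = .inr 0 from rfl] at this
    rw [this]
    exact h0.image (cons A b).injective
  · have := RTree.children_relabel (cons A b) U (some (.inr k))
    rw [show cons A b (some (.inr k)) = .inr k.succ from rfl] at this
    rw [this]
    exact (h k).image (cons A b).injective

theorem above_swap {V : Type} [DecidableEq (Option V)] {U : RTree (Option V)} {v : V}
    {T : RTree V} (h : RTree.Above U v T) :
    RTree.Below (U.relabel (Equiv.swap none (some v))) v T := by
  have hc : ∀ x : Option (Option V), (x.map (Equiv.swap none (some v))).map (RTree.con v) =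
      x.map (RTree.con v) := by
    rintro (_ | _ | w)
    · rfl
    · simp [RTree.con]
    · by_cases hw : w = v
      · subst hw; simp [RTree.con]
      · rw [Option.map_some, Equiv.swap_apply_of_ne_of_ne (by simp) (by simpa)]
  refine ⟨?_, fun w hw => ?_, ?_⟩
  · simp [h.edge]
  · rw [RTree.relabel_parent, hc, Equiv.symm_swap,
      Equiv.swap_apply_of_ne_of_ne (by simp) (by simpa)]
    exact h.other w hw
  · rw [RTree.relabel_parent, hc, Equiv.symm_swap, Equiv.swap_apply_right]
    exact h.top

theorem below_swap {V : Type} [DecidableEq (Option V)] {U : RTree (Option V)} {v : V}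
    {T : RTree V} (h : RTree.Below U v T) :
    RTree.Above (U.relabel (Equiv.swap none (some v))) v T := by
  have hc : ∀ x : Option (Option V), (x.map (Equiv.swap none (some v))).map (RTree.con v) =
      x.map (RTree.con v) := by
    rintro (_ | _ | w)
    · rfl
    · simp [RTree.con]
    · by_cases hw : w = v
      · subst hw; simp [RTree.con]
      · rw [Option.map_some, Equiv.swap_apply_of_ne_of_ne (by simp) (by simpa)]
  refine ⟨?_, fun w hw => ?_, ?_⟩
  · simp [h.edge]
  · rw [RTree.relabel_parent, hc, Equiv.symm_swap,
      Equiv.swap_apply_of_ne_of_ne (by simp) (by simpa)]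
    exact h.other w hw
  · rw [RTree.relabel_parent, hc, Equiv.symm_swap, Equiv.swap_apply_left]
    exact h.top

theorem defect_swap {V : Type} [DecidableEq (Option V)] (U : RTree (Option V)) (v : V)
    (T : RTree V) :
    RTree.defect K T v (U.relabel (Equiv.swap none (some v))) = RTree.defect K T v U := by
  have hs : (U.relabel (Equiv.swap none (some v))).relabel (Equiv.swap none (some v)) = U := by
    rw [RTree.relabel_relabel, ← Equiv.Perm.mul_def, Equiv.swap_mul_self]
    exact RTree.relabel_refl U
  have h1 : RTree.Above (U.relabel (Equiv.swap none (some v))) v T ↔ RTree.Below U v T :=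
    ⟨fun h => by have := above_swap h; rwa [hs] at this, below_swap⟩
  have h2 : RTree.Below (U.relabel (Equiv.swap none (some v))) v T ↔ RTree.Above U v T :=
    ⟨fun h => by have := below_swap h; rwa [hs] at this, above_swap⟩
  have h3 : ((U.relabel (Equiv.swap none (some v))).children none).Nontrivial ↔
      (U.children (some v)).Nontrivial := by
    have := RTree.children_relabel (Equiv.swap none (some v)) U (some v)
    rw [Equiv.swap_apply_right] at this
    rw [this, Set.image_nontrivial (Equiv.injective _)]
  have h4 : ((U.relabel (Equiv.swap none (some v))).children (some v)).Nontrivial ↔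
      (U.children none).Nontrivial := by
    have := RTree.children_relabel (Equiv.swap none (some v)) U none
    rw [Equiv.swap_apply_left] at this
    rw [this, Set.image_nontrivial (Equiv.injective _)]
  simp only [RTree.defect, h1, h2, h3, h4]
  ring

theorem twMk_defect [CharZero K] {A : Type} [Finite A] {b : ℕ} (T : RTree (A ⊕ Fin b))
    (k : Fin b) :
    twMk (rtLin K) A (b + 1) ((rtLin K).map (cons A b) (RTree.defect K T (.inr k))) = 0 := by
  classical
  have h := twMk_map_swap (P := rtLin K) (cons A b) none (some (.inr k)) 0 k.succ
    (Fin.succ_ne_zero k).symm rfl rfl (RTree.defect K T (.inr k))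
  have h2 : (rtLin K).map (Equiv.swap none (some (.inr k))) (RTree.defect K T (.inr k)) =
      RTree.defect K T (.inr k) := by
    funext U
    exact defect_swap (K := K) U _ T
  rw [h2] at h
  rw [eq_neg_iff_add_eq_zero, ← two_smul K] at h
  exact (smul_eq_zero.1 h).resolve_left two_ne_zero

theorem twistOp_single {V : Type} [Fintype V] (c : V → K) (T : RTree V) (U : RTree (Option V)) :
    (bracket K).twistOp c (single K T) U =
      RTree.ind K (RTree.NewRoot U T) - RTree.ind K (RTree.NewLeaf U T) -
      ∑ v, c v * (RTree.ind K (RTree.Above U v T) - RTree.ind K (RTree.Below U v T)) := by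
  classical
  have h := congrFun (twistOp_apply (bracket K) c (single K T)) U
  refine h.trans ((congrArg₂ (· - ·) (ad_single K T U) ?_ :))
  refine (Finset.sum_apply U Finset.univ
    (fun v => (c v • (bracket K).splitAt v (single K T) : RTree (Option V) → K))).trans ?_
  refine Finset.sum_congr rfl fun v _ => ?_
  exact congrArg (c v * ·) (splitAt_single K v T U)

theorem goodSpan_d [CharZero K] {A : Type} [Finite A] (b : ℕ) (x : TwObj (rtLin K) A b)
    (hx : x ∈ goodSpan K A b) : twD (bracket K) A b x ∈ goodSpan K A (b + 1) := by
  classical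
  cases nonempty_fintype A
  induction hx using Submodule.span_induction with
  | zero => rw [map_zero]; exact zero_mem _
  | add x y _ _ h h' => rw [map_add]; exact add_mem h h'
  | smul c x _ h => rw [map_smul]; exact Submodule.smul_mem _ _ h
  | mem x hx =>
    obtain ⟨T, hT, rfl⟩ := hx
    let g : RTree (Option (A ⊕ Fin b)) → K := fun U =>
      if (U.children none).Nontrivial ∧ ∀ k : Fin b, (U.children (some (.inr k))).Nontrivial
      then (bracket K).twistOp (weight A b) (single K T) U else 0
    have key : (bracket K).twistOp (weight A b) (single K T) =
        (g + ∑ k : Fin b, (2 : K)⁻¹ • RTree.defect K T (.inr k) : RTree (Option (A ⊕ Fin b)) → K) := by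
      funext U
      rw [Pi.add_apply, Finset.sum_apply]
      by_cases hU : (U.children none).Nontrivial ∧
          ∀ k : Fin b, (U.children (some (.inr k))).Nontrivial
      · rw [Finset.sum_eq_zero, add_zero]
        · exact (if_pos hU).symm
        · intro k _
          rw [Pi.smul_apply, RTree.defect_good K hU.1 (hU.2 k), smul_zero]
      · rw [show g U = 0 from if_neg hU, zero_add, twistOp_single,
          RTree.defect_bad K (weight A b) (fun v => ∃ k, v = .inr k)]
        · rw [Fintype.sum_sum_type, Finset.sum_eq_zero, zero_add]
          · refine Finset.sum_congr rfl fun k _ => ?_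
            rw [Pi.smul_apply, smul_eq_mul]
            congr 1
            change 1 - (2 : K)⁻¹ = 2⁻¹
            norm_num
          · intro a _
            rw [show (weight A b (.inl a) : K) = 1 from rfl]; ring
        · rintro (a | k) h
          · rfl
          · exact absurd ⟨k, rfl⟩ h
        · rintro _ ⟨k, rfl⟩
          change (2 : K)⁻¹ = 1 - 2⁻¹
          norm_num
        · rintro _ ⟨k, rfl⟩
          exact hT k
        · by_contra hcon
          push Not at hcon
          exact hU ⟨hcon.1, fun k => hcon.2 _ ⟨k, rfl⟩⟩
    change twMk (rtLin K) A (b + 1) (rawD (bracket K) A b (single K T)) ∈ _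
    have e : rawD (bracket K) A b (single K T) = (rtLin K).map (cons A b) g +
        ∑ k : Fin b, (2 : K)⁻¹ • (rtLin K).map (cons A b) (RTree.defect K T (.inr k)) := by
      refine (congrArg ((rtLin K).map (cons A b)) key).trans ?_
      refine (map_add ((rtLin K).map (cons A b)) g
        (∑ k : Fin b, (2 : K)⁻¹ • RTree.defect K T (.inr k))).trans ?_
      congr 1
      refine (map_sum ((rtLin K).map (cons A b))
        (fun k : Fin b => (2 : K)⁻¹ • RTree.defect K T (.inr k)) Finset.univ).trans ?_
      exact Finset.sum_congr rfl fun k _ => map_smul ((rtLin K).map (cons A b)) (2 : K)⁻¹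
        (RTree.defect K T (.inr k))
    rw [e, map_add, map_sum]
    simp only [map_smul, twMk_defect, smul_zero, Finset.sum_const_zero, add_zero]
    refine goodSpan_of_support _ fun U hU => ?_
    have h2 : g (U.relabel (cons A b).symm) ≠ 0 := hU
    have h3 : ((U.relabel (cons A b).symm).children none).Nontrivial ∧
        ∀ k : Fin b, ((U.relabel (cons A b).symm).children (some (.inr k))).Nontrivial := by
      by_contra h4
      exact h2 (if_neg h4)
    have := isGood_cons h3.1 h3.2
    rwa [relabel_symm_relabel] at this

theorem goodSpan_map {A B : Type} [Finite A] [Finite B] (e : A ≃ B) (b : ℕ)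
    (x : TwObj (rtLin K) A b) (hx : x ∈ goodSpan K A b) : twMap e b x ∈ goodSpan K B b := by
  induction hx using Submodule.span_induction with
  | zero => rw [map_zero]; exact zero_mem _
  | add x y _ _ h h' => rw [map_add]; exact add_mem h h'
  | smul c x _ h => rw [map_smul]; exact Submodule.smul_mem _ _ h
  | mem x hx =>
    obtain ⟨T, hT, rfl⟩ := hx
    refine Submodule.subset_span ⟨T.relabel (e.sumCongr (Equiv.refl _)), fun k => ?_, ?_⟩
    · have := RTree.children_relabel (e.sumCongr (Equiv.refl (Fin b))) T (.inr k)
      rw [show (e.sumCongr (Equiv.refl (Fin b))) (.inr k) = .inr k from rfl] at this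
      rw [this]
      exact (hT k).image (Equiv.injective _)
    · rw [← single_relabel]
      rfl

theorem isGood_insertion {A B : Type} [Finite A] [Finite B] {m n k : ℕ} (h : m + n = k)
    {T : RTree (Option A ⊕ Fin m)} {S : RTree (B ⊕ Fin n)} (hT : IsGood T) (hS : IsGood S)
    {U : RTree ((A ⊕ Fin m) ⊕ (B ⊕ Fin n))}
    (hU : RTree.IsInsertion (T.relabel (optL A (Fin m))).parent S.parent U.parent) :
    IsGood (U.relabel (shuf A B h)) := by
  have h1 : ∀ i : Fin m, (U.children (.inl (.inr i))).Nontrivial := by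
    intro i
    have hi := (hT i).image (optL A (Fin m)).injective
    rw [← RTree.children_relabel] at hi
    obtain ⟨r, hr, -⟩ := S.existsUnique_root
    have key : ∀ w ∈ (T.relabel (optL A (Fin m))).children (some (.inr i)),
        ∃ x ∈ U.children (.inl (.inr i)), RTree.collapse x = w := by
      have hc : ∀ x : Option ((A ⊕ Fin m) ⊕ (B ⊕ Fin n)),
          x.map RTree.collapse = some (some (.inr i)) → x = some (.inl (.inr i)) := by
        rintro (_ | (_ | _) | _) hx <;> cases hx
        rfl
      rintro (_ | a) hw
      · exact ⟨.inr r, hc _ ((hU.root r hr).trans hw), rfl⟩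
      · exact ⟨.inl a, hc _ ((hU.outer a).trans hw), rfl⟩
    obtain ⟨x, hx, y, hy, hxy⟩ := hi
    obtain ⟨x', hx', rfl⟩ := key x hx
    obtain ⟨y', hy', rfl⟩ := key y hy
    exact ⟨x', hx', y', hy', fun e => hxy (congrArg _ e)⟩
  have h2 : ∀ j : Fin n, (U.children (.inr (.inr j))).Nontrivial := by
    intro j
    obtain ⟨x, hx, y, hy, hxy⟩ := hS j
    exact ⟨.inr x, hU.inner _ _ hx, .inr y, hU.inner _ _ hy, by simpa⟩
  intro i
  obtain ⟨i, rfl⟩ := (block h).surjective i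
  rcases i with i | j
  · have := RTree.children_relabel (shuf A B h) U (.inl (.inr i))
    rw [show shuf A B h (.inl (.inr i)) = .inr (block h (.inl i)) from rfl] at this
    rw [this]
    exact (h1 i).image (Equiv.injective _)
  · have := RTree.children_relabel (shuf A B h) U (.inr (.inr j))
    rw [show shuf A B h (.inr (.inr j)) = .inr (block h (.inr j)) from rfl] at this
    rw [this]
    exact (h2 j).image (Equiv.injective _)

theorem goodSpan_comp {A B : Type} [Finite A] [Finite B] {m n k : ℕ} (h : m + n = k)
    (x : TwObj (rtLin K) (Option A) m) (hx : x ∈ goodSpan K (Option A) m)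
    (y : TwObj (rtLin K) B n) (hy : y ∈ goodSpan K B n) :
    twComp h x y ∈ goodSpan K (A ⊕ B) k := by
  classical
  have key : ∀ (f : (rtLin K).obj (Option A ⊕ Fin m)) (g : (rtLin K).obj (B ⊕ Fin n)),
      twMk (rtLin K) (A ⊕ B) k (rawComp h f g) ∈ goodSpan K (A ⊕ B) k →
      twComp h (twMk (rtLin K) (Option A) m f) (twMk (rtLin K) B n g) ∈ goodSpan K (A ⊕ B) k :=
    fun f g hfg => hfg
  induction hx using Submodule.span_induction with
  | zero => rw [map_zero, LinearMap.zero_apply]; exact zero_mem _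
  | add x x' _ _ h h' => rw [map_add, LinearMap.add_apply]; exact add_mem h h'
  | smul c x _ h => rw [map_smul, LinearMap.smul_apply]; exact Submodule.smul_mem _ _ h
  | mem x hx =>
    induction hy using Submodule.span_induction with
    | zero => rw [map_zero]; exact zero_mem _
    | add y y' _ _ h h' => rw [map_add]; exact add_mem h h'
    | smul c y _ h => rw [map_smul]; exact Submodule.smul_mem _ _ h
    | mem y hy =>
      obtain ⟨T, hT, rfl⟩ := hx
      obtain ⟨S, hS, rfl⟩ := hy
      refine key _ _ ?_
      refine goodSpan_of_support _ fun U hU => ?_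
      have e : rawComp (P := rtLin K) h (single K T) (single K S) U =
          insertion K (single K (T.relabel (optL A (Fin m)))) (single K S)
            (U.relabel (shuf A B h).symm) := by
        rw [← single_relabel]; rfl
      rw [e, insertion_single] at hU
      have h2 : RTree.IsInsertion (T.relabel (optL A (Fin m))).parent S.parent
          (U.relabel (shuf A B h).symm).parent := by
        by_contra hn
        exact hU (if_neg hn)
      have := isGood_insertion h hT hS h2
      rwa [relabel_symm_relabel] at this

end RTOp

/-- The operad of rooted trees whose black vertices have at least two children, as a suboperad of
the twisted operad of rooted trees. -/
noncomputable def TRT (K : Type u) [Field K] [CharZero K] : DGOperad K :=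
  (TwRT K).sub (fun A _ b => RTOp.goodSpan K A b)
    (fun b x hx => RTOp.goodSpan_d b x hx)
    (fun e b x hx => RTOp.goodSpan_map e b x hx)
    (RTOp.goodSpan_of_support _ fun _ _ k => k.elim0)
    (fun h x hx y hy => RTOp.goodSpan_comp h x hx y hy)

/-- The bracket in `TRT`: the tree with root `0` and child `1` minus the tree with root `1` and
child `0`. -/
noncomputable def TRT.bracket (K : Type u) [Field K] [CharZero K] : (TRT K).obj (Fin 2) 0 :=
  ⟨LinOperad.LieElement.twMk (RTOp.rtLin K) (Fin 2) 0
    ((RTOp.rtLin K).map (Equiv.sumEmpty (Fin 2) (Fin 0)).symm (RTOp.bracketVal K)),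
    RTOp.goodSpan_of_support _ fun _ _ k => k.elim0⟩

/-!
The proof is by induction on the number of inputs. Let `A` be a nonempty finite set and `none` a new
input. Inserting the bracket of `none` and `a` into the input `a`, for all `a` in `A`, gives linear
maps from the sum over `A` of copies of the operations with inputs `A` to the operations with inputs
`Option A`, for `Lie` as well as for `TRT`. For `Lie` this map is surjective, since `[none, -]` is a
derivation (`LieOp.exists_sum_ins`). For `TRT` it is the chain map `insAll`, and the main point is
that it is injective (`insAll_injective`), that every cycle of degree `0` comes from cycles
(`exists_insAll_of_d_eq_zero`), and that every other cycle does so up to a boundary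
(`exists_insAll_add_d_of_d_eq_zero`). A morphism which sends the bracket to the bracket is
compatible with these maps, so being injective in degree `0`, with the cycles of degree `0` as image
and all other cycles boundaries, passes from `A` to `Option A` (`IsResolved.option`). With no input
or one input there are no trees with black vertices, and the claim is checked directly.

For the statements about `TRT`, an operation with `n` black vertices is regarded as a function
`coeff` on the trees with `n` ordered black vertices which changes sign under odd permutations; this
uses characteristic zero. The coefficient of `d x` at a tree `U` all of whose black vertices have at
least two children is a signed sum of coefficients of `x` at the trees obtained from `U` by
contracting an edge at a black vertex; the weight `1/2` of the edges between two black vertices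
accounts for their being counted twice (`alt_twD_special`).

Call a tree a target (`IsTarget`) if `none` has exactly one child, or is a leaf whose parent is
black with exactly two children, and let `nonTarget` be the space of operations whose coefficients
at all targets vanish. For a family `f` of operations with inputs `A`, and for `x` in `nonTarget`,
consider the coefficients of `insAll f + d x` at the targets all of whose black vertices have at
least two children. Each of them arises in exactly one of the following ways: by inserting `none`
into the edge above an input `a` of a tree (`insAbove`), or, up to the order of the black vertices,
from a tree which is not a target by creating a black vertex (`expand`). The coefficient at the
target is, up to sign, the coefficient of `f a` or of `x` at that tree, plus coefficients at trees
in which the input `a` or `none` is closer to the root. So `(f, x) ↦ insAll f + d x` is injective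
modulo `nonTarget`, by induction on the depth (`eq_zero_of_insAll_add_d_mem`), and surjective modulo
`nonTarget`, by counting dimensions (`exists_insAll_add_d_sub_mem`). Given a cycle `c`, choose `f`
and `x` such that `y = c - insAll f - d x` is in `nonTarget`. Then `insAll (d f) + d y = 0`, so
`d f = 0` and `y = 0`.

A morphism from `Lie` is determined by the image of the bracket because the Lie monomials span
(`LieOp.hom_unique`). It exists because the bracket of `TRT` is a cycle which is antisymmetric and
satisfies the Jacobi identity: the value of a nonassociative word as an iterated bracket, set to
zero unless every generator occurs exactly once, respects the relations of the free Lie algebra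
(`eval_eq_of_rel`) and defines the morphism `lieHom`.
-/

/-! ### Contraction of edges and splitting of vertices -/

namespace RTree

/-- `T` arises from `U` by contracting the edge from the vertex `c` up to its parent `p`; the map
`π` sends a vertex of `U` to its image in `T`. -/
structure Contr {W V : Type} (π : W → V) (c p : W) (U : RTree W) (T : RTree V) : Prop where
  edge : U.parent c = some p
  glue : π c = π p
  inj : ∀ x y, x ≠ c → y ≠ c → π x = π y → x = y
  surj : ∀ v, ∃ w, w ≠ c ∧ π w = v
  parent : ∀ w, w ≠ c → T.parent (π w) = (U.parent w).map π

section Depth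

variable {V : Type} (T : RTree V)

/-- The depth is found by iterating the parent map until the root is passed. -/
theorem exists_depth : ∃ f : V → ℕ, (∀ v, T.parent v = none → f v = 0) ∧
    ∀ v w, T.parent v = some w → f v = f w + 1 := by
  classical
  obtain ⟨h, hh⟩ := T.acyclic
  have key : ∀ n v, h v < n → ∃ k, (fun x => x.bind T.parent)^[k] (some v) = none := by
    intro n
    induction n with
    | zero => intro v hv; omega
    | succ n ih =>
      intro v hv
      rcases hp : T.parent v with _ | w
      · exact ⟨1, by simpa using hp⟩
      · obtain ⟨k, hk⟩ := ih w (by have := hh _ _ hp; omega)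
        exact ⟨k + 1, by simpa [Function.iterate_succ_apply, hp] using hk⟩
  have key' : ∀ v, ∃ k, (fun x => x.bind T.parent)^[k] (some v) = none := fun v =>
    key _ v (Nat.lt_succ_self _)
  have step : ∀ v, Nat.find (key' v) ≠ 0 := fun v h0 => by
    have := Nat.find_spec (key' v)
    rw [h0] at this
    cases this
  refine ⟨fun v => Nat.find (key' v) - 1, fun v hv => ?_, fun v w hw => ?_⟩
  · have : Nat.find (key' v) ≤ 1 := Nat.find_min' _ (by simpa using hv)
    exact Nat.sub_eq_zero_of_le this
  · have : Nat.find (key' v) = Nat.find (key' w) + 1 := by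
      refine (Nat.find_eq_iff _).2 ⟨?_, fun n hn => ?_⟩
      · simpa [Function.iterate_succ_apply, hw] using Nat.find_spec (key' w)
      · rcases n with _ | n
        · simp
        · simpa [Function.iterate_succ_apply, hw] using Nat.find_min (key' w) (m := n) (by omega)
    have := step w
    dsimp only
    omega

/-- The distance of a vertex from the root. -/
noncomputable def depth : V → ℕ := T.exists_depth.choose

theorem depth_root {v : V} (h : T.parent v = none) : T.depth v = 0 :=
  T.exists_depth.choose_spec.1 v h

theorem depth_succ {v w : V} (h : T.parent v = some w) : T.depth v = T.depth w + 1 :=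
  T.exists_depth.choose_spec.2 v w h

end Depth

theorem mem_children {V : Type} {T : RTree V} {v w : V} :
    w ∈ T.children v ↔ T.parent w = some v := Iff.rfl

namespace Contr

variable {W V : Type} {π : W → V} {c p : W} {U : RTree W} {T : RTree V}

theorem ne (h : Contr π c p U T) : p ≠ c := by
  rintro rfl
  exact U.parent_ne_self _ h.edge

theorem map_eq_some (h : Contr π c p U T) {x : W} (hc : x ≠ c) (hp : x ≠ p) (y : Option W) :
    y.map π = some (π x) ↔ y = some x := by
  refine ⟨fun hy => ?_, fun hy => hy ▸ rfl⟩
  rcases y with _ | y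
  · cases hy
  · have hy' : π y = π x := Option.some_injective _ hy
    by_cases hyc : y = c
    · subst hyc
      exact absurd (h.inj _ _ h.ne hc (h.glue.symm.trans hy')).symm hp
    · rw [h.inj _ _ hyc hc hy']

theorem map_eq_some' (h : Contr π c p U T) (y : Option W) :
    y.map π = some (π p) ↔ y = some p ∨ y = some c := by
  refine ⟨fun hy => ?_, ?_⟩
  · rcases y with _ | y
    · cases hy
    · have hy' : π y = π p := Option.some_injective _ hy
      by_cases hyc : y = c
      · exact Or.inr (congrArg _ hyc)
      · exact Or.inl (congrArg _ (h.inj _ _ hyc h.ne hy'))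
  · rintro (rfl | rfl)
    · rfl
    · exact congrArg some h.glue

theorem children (h : Contr π c p U T) {x : W} (hc : x ≠ c) (hp : x ≠ p) :
    T.children (π x) = π '' U.children x := by
  ext v
  constructor
  · intro hv
    obtain ⟨w, hw, rfl⟩ := h.surj v
    exact ⟨w, (h.map_eq_some hc hp _).1 ((h.parent w hw).symm.trans hv), rfl⟩
  · rintro ⟨w, hw, rfl⟩
    have hwc : w ≠ c := by
      rintro rfl
      exact hp (Option.some_injective _ (hw.symm.trans h.edge))
    exact (h.parent w hwc).trans ((h.map_eq_some hc hp _).2 hw)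

/-- The contracted vertex inherits the children of both ends of the edge. -/
theorem children_glue (h : Contr π c p U T) :
    T.children (π p) = π '' ((U.children p \ {c}) ∪ U.children c) := by
  ext v
  constructor
  · intro hv
    obtain ⟨w, hw, rfl⟩ := h.surj v
    refine ⟨w, ?_, rfl⟩
    rcases (h.map_eq_some' _).1 ((h.parent w hw).symm.trans hv) with h' | h'
    · exact Or.inl ⟨h', hw⟩
    · exact Or.inr h'
  · rintro ⟨w, hw, rfl⟩
    have hwc : w ≠ c := by
      rintro rfl
      rcases hw with hw | hw
      · exact hw.2 rfl
      · exact U.parent_ne_self _ hw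
    exact (h.parent w hwc).trans ((h.map_eq_some' _).2 (hw.imp (fun h => h.1) id))

theorem injOn (h : Contr π c p U T) {s : Set W} (hs : c ∉ s) : Set.InjOn π s :=
  fun x hx y hy e => h.inj x y (fun e => hs (e ▸ hx)) (fun e => hs (e ▸ hy)) e

theorem nontrivial_iff (h : Contr π c p U T) {x : W} (hc : x ≠ c) (hp : x ≠ p) :
    (T.children (π x)).Nontrivial ↔ (U.children x).Nontrivial := by
  rw [h.children hc hp]
  refine ⟨fun hn => Set.nontrivial_of_image _ _ hn,
    fun hn => hn.image_of_injOn (h.injOn fun hcx => ?_)⟩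
  exact hp (Option.some_injective _ (Eq.trans (Eq.symm hcx) h.edge))

/-- Contracting an edge does not change the depth of the vertices which are not deeper than its
upper end. -/
theorem depth_le (h : Contr π c p U T) (x : W) (hx : U.depth x ≤ U.depth p) :
    T.depth (π x) = U.depth x := by
  generalize hn : U.depth x = n
  induction n generalizing x with
  | zero =>
    have hxc : x ≠ c := by
      rintro rfl
      rw [U.depth_succ h.edge] at hx; omega
    rcases hp : U.parent x with _ | w
    · exact T.depth_root (by rw [h.parent x hxc, hp]; rfl)
    · rw [U.depth_succ hp] at hn; omega
  | succ n ih =>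
    have hxc : x ≠ c := by
      rintro rfl
      rw [U.depth_succ h.edge] at hx; omega
    rcases hp : U.parent x with _ | w
    · rw [U.depth_root hp] at hn; omega
    · have hw := U.depth_succ hp
      rw [T.depth_succ (w := π w) (by rw [h.parent x hxc, hp]; rfl),
        ih w (by omega) (by omega)]

theorem depth_glue (h : Contr π c p U T) : T.depth (π p) = U.depth p := h.depth_le p le_rfl

theorem unique (h : Contr π c p U T) {T' : RTree V} (h' : Contr π c p U T') : T = T' := by
  ext1
  funext v
  obtain ⟨w, hw, rfl⟩ := h.surj v
  rw [h.parent w hw, h'.parent w hw]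

theorem exists_tree {U : RTree W} (edge : U.parent c = some p) (glue : π c = π p)
    (inj : ∀ x y, x ≠ c → y ≠ c → π x = π y → x = y) (surj : ∀ v, ∃ w, w ≠ c ∧ π w = v) :
    ∃ T : RTree V, Contr π c p U T := by
  choose s hs hs' using surj
  have hsπ : ∀ w, w ≠ c → s (π w) = w := fun w hw => inj _ _ (hs _) hw (hs' _)
  have hpc : p ≠ c := by
    rintro rfl
    exact U.parent_ne_self _ edge
  obtain ⟨h, hh⟩ := U.acyclic
  refine ⟨⟨fun v => (U.parent (s v)).map π, ?_, fun v => h (s v), fun v w hvw => ?_⟩,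
    edge, glue, inj, fun v => ⟨s v, hs v, hs' v⟩, fun w hw => by
      change (U.parent (s (π w))).map π = _
      rw [hsπ w hw]⟩
  · obtain ⟨r, hr, hu⟩ := U.existsUnique_root
    have hrc : r ≠ c := by
      rintro rfl
      rw [hr] at edge; cases edge
    refine ⟨π r, by simp only [hsπ r hrc, hr, Option.map_none], fun v hv => ?_⟩
    have hv' : U.parent (s v) = none := by
      rcases h0 : U.parent (s v) with _ | y
      · rfl
      · simp [h0] at hv
    rw [← hu _ hv', hs']
  · obtain ⟨y, hy, rfl⟩ := Option.map_eq_some_iff.1 hvw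
    dsimp only
    by_cases hyc : y = c
    · subst hyc
      rw [glue, hsπ p hpc]
      exact (hh _ _ edge).trans (hh _ _ hy)
    · rw [hsπ y hyc]
      exact hh _ _ hy

end Contr

section Con

variable {V : Type} {U : RTree (Option V)} {v : V} {T : RTree V}

theorem con_inj_of_ne_some (v : V) (x y : Option V) (hx : x ≠ some v) (hy : y ≠ some v)
    (h : con v x = con v y) : x = y := by
  rcases x with _ | x <;> rcases y with _ | y <;> simp_all [con]

theorem con_inj_of_ne_none (v : V) (x y : Option V) (hx : x ≠ none) (hy : y ≠ none)
    (h : con v x = con v y) : x = y := by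
  rcases x with _ | x <;> rcases y with _ | y <;> simp_all [con]

theorem con_surj_some (v w : V) : ∃ x, x ≠ some v ∧ con v x = w := by
  by_cases h : w = v
  · exact ⟨none, by simp, h ▸ rfl⟩
  · exact ⟨some w, by simpa, rfl⟩

theorem con_surj_none (v w : V) : ∃ x, x ≠ none ∧ con v x = w := ⟨some w, by simp, rfl⟩

theorem above_iff_contr : Above U v T ↔ Contr (con v) (some v) none U T := by
  constructor
  · intro h
    refine ⟨h.edge, rfl, con_inj_of_ne_some v, con_surj_some v, ?_⟩
    rintro (_ | w) hw
    · exact h.top.symm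
    · exact (h.other w (by simpa using hw)).symm
  · intro h
    exact ⟨h.edge, fun w hw => (h.parent (some w) (by simpa)).symm, (h.parent none (by simp)).symm⟩

theorem below_iff_contr : Below U v T ↔ Contr (con v) none (some v) U T := by
  constructor
  · intro h
    refine ⟨h.edge, rfl, con_inj_of_ne_none v, con_surj_none v, ?_⟩
    rintro (_ | w) hw
    · exact absurd rfl hw
    · by_cases hwv : w = v
      · exact hwv ▸ h.top.symm
      · exact (h.other w hwv).symm
  · intro h
    exact ⟨h.edge, fun w _ => (h.parent (some w) (by simp)).symm,
      (h.parent (some v) (by simp)).symm⟩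

theorem exists_above (h : U.parent (some v) = some none) : ∃ T, Above U v T := by
  simp only [above_iff_contr]
  exact Contr.exists_tree h rfl (con_inj_of_ne_some v) (con_surj_some v)

theorem exists_below (h : U.parent none = some (some v)) : ∃ T, Below U v T := by
  simp only [below_iff_contr]
  exact Contr.exists_tree h rfl (con_inj_of_ne_none v) (con_surj_none v)

end Con

section Split

variable {V : Type} (T : RTree V) (v : V) (S : Set V)

open Classical in
/-- Insert a new vertex `none` into the edge above `v`, and move the children of `v` which belong
to `S` to the new vertex. -/
noncomputable def splitAbove : RTree (Option V) where
  parent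
    | none => (T.parent v).map some
    | some w => if w = v ∨ (T.parent w = some v ∧ w ∈ S) then some none else (T.parent w).map some
  existsUnique_root := by
    obtain ⟨r, hr, hu⟩ := T.existsUnique_root
    by_cases hrv : r = v
    · subst hrv
      refine ⟨none, by simp [hr], ?_⟩
      rintro (_ | w) hw
      · rfl
      · dsimp only at hw
        split_ifs at hw with h
        exact absurd (Or.inl (hu w (by simpa using hw))) h
    · refine ⟨some r, by simp [hr, hrv], ?_⟩
      rintro (_ | w) hw
      · exact absurd (hu v (by simpa using hw)).symm hrv
      · dsimp only at hw
        split_ifs at hw with h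
        exact congrArg some (hu w (by simpa using hw))
  acyclic := by
    obtain ⟨h, hh⟩ := T.acyclic
    refine ⟨fun x => x.elim (2 * h v) fun w => 2 * h w + 1, ?_⟩
    rintro (_ | x) (_ | y) hxy
    · rcases hv : T.parent v with _ | u <;> simp [hv] at hxy
    · rcases hv : T.parent v with _ | u <;> simp [hv] at hxy
      subst hxy
      have := hh _ _ hv
      simp only [Option.elim]; omega
    · dsimp only at hxy
      split_ifs at hxy with h'
      · rcases h' with rfl | h'
        · simp
        · have := hh _ _ h'.1
          simp only [Option.elim]; omega
      · rcases hv : T.parent x with _ | u <;> simp [hv] at hxy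
    · dsimp only at hxy
      split_ifs at hxy with h'
      · simp at hxy
      · rcases hv : T.parent x with _ | u <;> simp [hv] at hxy
        subst hxy
        have := hh _ _ hv
        simp only [Option.elim]; omega

theorem splitAbove_none : (T.splitAbove v S).parent none = (T.parent v).map some := rfl

open Classical in
theorem splitAbove_some (w : V) : (T.splitAbove v S).parent (some w) =
    if w = v ∨ (T.parent w = some v ∧ w ∈ S) then some none else (T.parent w).map some := rfl

theorem above_splitAbove : Above (T.splitAbove v S) v T := by
  refine ⟨by rw [splitAbove_some, if_pos (Or.inl rfl)], fun w hw => ?_, ?_⟩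
  · rw [splitAbove_some]
    split_ifs with h
    · exact (h.resolve_left hw).1.symm
    · rcases T.parent w with _ | _ <;> rfl
  · rw [splitAbove_none]
    rcases T.parent v with _ | _ <;> rfl

theorem children_splitAbove_none :
    (T.splitAbove v S).children none = some '' (insert v (T.children v ∩ S)) := by
  ext x
  rcases x with _ | w
  · simp only [mem_children, splitAbove_none]
    rcases T.parent v with _ | _ <;> simp
  · rw [mem_children, splitAbove_some]
    split_ifs with h
    · simpa [mem_children] using h
    · simp only [Set.mem_image, Option.some.injEq, exists_eq_right]
      refine ⟨fun h' => ?_, fun h' => absurd h' h⟩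
      rcases hv : T.parent w with _ | _ <;> simp [hv] at h'

theorem children_splitAbove_self :
    (T.splitAbove v S).children (some v) = some '' (T.children v \ S) := by
  ext x
  rcases x with _ | w
  · simp only [mem_children, splitAbove_none]
    refine ⟨fun h => ?_, by simp⟩
    rcases hv : T.parent v with _ | u <;> simp [hv] at h
    subst h
    exact absurd hv (T.parent_ne_self _)
  · rw [mem_children, splitAbove_some]
    split_ifs with h
    · simp only [Option.some.injEq, reduceCtorEq, false_iff, Set.mem_image, exists_eq_right]
      rintro ⟨h1, h2⟩
      rcases h with rfl | h
      · exact T.parent_ne_self _ h1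
      · exact h2 h.2
    · simp only [Set.mem_image, Option.some.injEq, exists_eq_right, Set.mem_sdiff, mem_children]
      push Not at h
      constructor
      · intro h'
        have : T.parent w = some v := by
          rcases hv : T.parent w with _ | _ <;> simp [hv] at h'
          rw [h']
        exact ⟨this, h.2 this⟩
      · rintro ⟨h1, -⟩
        rw [h1]; rfl

/-- A tree is recovered from a contraction and the set of vertices below the new vertex. -/
theorem Above.eq_splitAbove {U : RTree (Option V)} {T : RTree V} {v : V} {S : Set V}
    (h : Above U v T)
    (hS : ∀ w, w ≠ v → T.parent w = some v → (U.parent (some w) = some none ↔ w ∈ S)) :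
    U = T.splitAbove v S := by
  ext1
  funext x
  rcases x with _ | w
  · rw [splitAbove_none, ← h.top, map_con_some (U.parent_ne_self none)]
  · rw [splitAbove_some]
    by_cases hw : w = v
    · rw [if_pos (Or.inl hw), hw, h.edge]
    · by_cases h0 : U.parent (some w) = some none
      · have hT : T.parent w = some v := by rw [← h.other w hw, h0]; rfl
        rw [if_pos (Or.inr ⟨hT, (hS w hw hT).1 h0⟩), h0]
      · rw [if_neg, ← h.other w hw, map_con_some h0]
        rintro (h1 | h1)
        · exact hw h1
        · exact h0 ((hS w hw h1.1).2 h1.2)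

theorem splitAbove_relabel {W : Type} (e : V ≃ W) :
    (T.splitAbove v S).relabel e.optionCongr = (T.relabel e).splitAbove (e v) (e '' S) := by
  refine ((T.above_splitAbove v S).relabel e).eq_splitAbove fun w hw hT => ?_
  obtain ⟨w, rfl⟩ := e.surjective w
  have hwv : w ≠ v := fun h => hw (congrArg _ h)
  have hT' : T.parent w = some v := by
    rw [relabel_parent, e.symm_apply_apply, Option.map_eq_some_iff] at hT
    obtain ⟨x, hx, hx'⟩ := hT
    rw [hx, e.injective hx']
  rw [relabel_parent, optionCongr_symm_some, splitAbove_some]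
  by_cases h : w ∈ S
  · rw [if_pos (Or.inr ⟨hT', h⟩)]
    simpa using h
  · rw [if_neg (by tauto), hT']
    simpa using h

end Split

/-! ### Target trees -/

/-- All vertices in `B` have at least two children. -/
def Bushy {V : Type} (B : Set V) (T : RTree V) : Prop := ∀ k ∈ B, (T.children k).Nontrivial

/-- Either `a` has exactly one child, or `a` is a leaf whose parent is in `B` and has exactly one
other child. For the set `B` of black vertices and the last input `a`, these are the trees at which
the leading terms of the differential and of the insertion of a bracket are read off. -/
def IsTarget {V : Type} (B : Set V) (a : V) (T : RTree V) : Prop :=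
  (∃ c, T.children a = {c}) ∨
    T.children a = ∅ ∧ ∃ k ∈ B, ∃ w, w ≠ a ∧ T.children k = {a, w}

theorem bushy_relabel {V W : Type} (e : V ≃ W) {B : Set V} {B' : Set W}
    (hB : ∀ v, e v ∈ B' ↔ v ∈ B) (T : RTree V) : Bushy B' (T.relabel e) ↔ Bushy B T := by
  constructor
  · intro h k hk
    have := h (e k) ((hB k).2 hk)
    rwa [children_relabel, Set.image_nontrivial e.injective] at this
  · intro h k hk
    obtain ⟨k, rfl⟩ := e.surjective k
    rw [children_relabel, Set.image_nontrivial e.injective]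
    exact h k ((hB k).1 hk)

theorem IsTarget.relabel {V W : Type} (e : V ≃ W) {B : Set V} {B' : Set W}
    (hB : ∀ v, e v ∈ B' ↔ v ∈ B) {a : V} {T : RTree V} (h : IsTarget B a T) :
    IsTarget B' (e a) (T.relabel e) := by
  rcases h with ⟨c, hc⟩ | ⟨h0, k, hk, w, hw, h1⟩
  · exact Or.inl ⟨e c, by rw [children_relabel, hc, Set.image_singleton]⟩
  · refine Or.inr ⟨by rw [children_relabel, h0, Set.image_empty], e k, (hB k).2 hk, e w,
      fun h => hw (e.injective h), by rw [children_relabel, h1, Set.image_pair]⟩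

theorem isTarget_relabel {V W : Type} (e : V ≃ W) {B : Set V} {B' : Set W}
    (hB : ∀ v, e v ∈ B' ↔ v ∈ B) {a : V} {T : RTree V} :
    IsTarget B' (e a) (T.relabel e) ↔ IsTarget B a T := by
  refine ⟨fun h => ?_, IsTarget.relabel e hB⟩
  have := h.relabel e.symm (B' := B) fun w => by rw [← hB, e.apply_symm_apply]
  rwa [relabel_relabel, Equiv.self_trans_symm, relabel_refl, e.symm_apply_apply] at this

theorem depth_relabel {V W : Type} (e : V ≃ W) (T : RTree V) (v : V) :
    (T.relabel e).depth (e v) = T.depth v := by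
  generalize hn : T.depth v = n
  induction n generalizing v with
  | zero =>
    rcases hp : T.parent v with _ | w
    · exact depth_root _ (by simp [hp])
    · rw [T.depth_succ hp] at hn; omega
  | succ n ih =>
    rcases hp : T.parent v with _ | w
    · rw [T.depth_root hp] at hn; omega
    · rw [depth_succ _ (w := e w) (by simp [hp]), ih w (by rw [T.depth_succ hp] at hn; omega)]

section Match

variable {V : Type} {B : Set V} {a v : V} {U : RTree (Option V)} {T : RTree V}

/-- The set `B` together with the new vertex `none`. -/
def withNone (B : Set V) : Set (Option V) := insert none (some '' B)

theorem none_mem_withNone : none ∈ withNone B := Set.mem_insert _ _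

theorem some_mem_withNone {k : V} : some k ∈ withNone B ↔ k ∈ B := by simp [withNone]

theorem con_some_ne (h : v ≠ a) {w : Option V} (hw : w ≠ some a) : con v w ≠ a := by
  rcases w with _ | w
  · exact h
  · exact fun h' => hw (congrArg some h')

/-- If `a` has exactly one child in `U`, then a contraction `T` of an edge at the new vertex is a
target, or `a` comes closer to the root, or the contracted edge is the one below `a`. -/
theorem contr_single {i : Option V} (hU : U.children (some a) = {i})
    (h : Above U v T ∨ Below U v T) :
    IsTarget B a T ∨ T.depth a < U.depth (some a) ∨ (v = a ∧ i = none) := by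
  rcases h with h | h
  · by_cases hva : v = a
    · subst hva
      refine Or.inr (Or.inl ?_)
      have := (above_iff_contr.1 h).depth_glue
      rw [U.depth_succ h.edge, ← this]
      exact Nat.lt_succ_self _
    · refine Or.inl (Or.inl ⟨con v i, ?_⟩)
      have := (above_iff_contr.1 h).children (x := some a) (by simpa using Ne.symm hva) (by simp)
      rw [hU, Set.image_singleton] at this
      exact this
  · by_cases hva : v = a
    · subst hva
      refine Or.inr (Or.inr ⟨rfl, ?_⟩)
      have : none ∈ U.children (some v) := h.edge
      rw [hU] at this
      exact this.symm
    · refine Or.inl (Or.inl ⟨con v i, ?_⟩)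
      have := (below_iff_contr.1 h).children (x := some a) (by simp) (by simpa using Ne.symm hva)
      rw [hU, Set.image_singleton] at this
      exact this

/-- If `a` is a leaf of `U` whose parent `k` is new or in `B` and has one other child `w`, then a
contraction `T` of an edge at the new vertex is a target, or `a` comes closer to the root, or the
contracted edge ends at `k`; if `k` is the new vertex, it is the edge from `k` down to `w`. -/
theorem contr_leaf {k w : Option V} (h0 : U.children (some a) = ∅) (hk : k ∈ withNone B)
    (hw : w ≠ some a) (h1 : U.children k = {some a, w}) (h : Above U v T ∨ Below U v T) :
    IsTarget B a T ∨ T.depth a < U.depth (some a) ∨ (k = none ∧ w = some v) ∨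
      k = some v := by
  have hak : U.parent (some a) = some k := by
    have : some a ∈ U.children k := by rw [h1]; exact Set.mem_insert _ _
    exact this
  have hda := U.depth_succ hak
  rcases h with h | h
  · have hc := above_iff_contr.1 h
    by_cases hva : v = a
    · subst hva
      left; left
      obtain rfl : k = none := Option.some_injective _ (hak.symm.trans h.edge)
      refine ⟨con v w, ?_⟩
      have := hc.children_glue
      rw [h0, h1, Set.union_empty, Set.insert_sdiff_of_mem _ (Set.mem_singleton _),
        Set.sdiff_singleton_eq_self (by simpa using Ne.symm hw), Set.image_singleton] at this
      exact this
    rcases k with _ | k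
    · right; right; left
      refine ⟨rfl, ?_⟩
      have : some v ∈ U.children none := h.edge
      rw [h1] at this
      rcases this with this | this
      · exact absurd (Option.some_injective _ this) hva
      · exact this.symm
    by_cases hkv : k = v
    · right; right; right; rw [hkv]
    left; right
    have e1 := hc.children (x := some a) (by simpa using Ne.symm hva) (by simp)
    have e2 := hc.children (x := some k) (by simpa using hkv) (by simp)
    rw [h0, Set.image_empty] at e1
    rw [h1, Set.image_pair] at e2
    exact ⟨e1, k, some_mem_withNone.1 hk, con v w, con_some_ne hva hw, e2⟩
  · have hc := below_iff_contr.1 h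
    have hva : v ≠ a := by
      rintro rfl
      have : none ∈ U.children (some v) := h.edge
      rw [h0] at this; exact this
    rcases k with _ | k
    · right; left
      have e1 : T.parent a = some v := by
        have := hc.parent (some a) (by simp)
        rw [hak] at this
        exact this
      have := hc.depth_glue
      rw [T.depth_succ e1, hda, U.depth_succ h.edge, ← this]
      exact Nat.lt_succ_self _
    by_cases hkv : k = v
    · right; right; right; rw [hkv]
    left; right
    have e1 := hc.children (x := some a) (by simp) (by simpa using Ne.symm hva)
    have e2 := hc.children (x := some k) (by simp) (by simpa using hkv)
    rw [h0, Set.image_empty] at e1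
    rw [h1, Set.image_pair] at e2
    exact ⟨e1, k, some_mem_withNone.1 hk, con v w, con_some_ne hva hw, e2⟩

theorem children_some_nontrivial_of_above (h : Above U v T) {k : V} (hk : k ≠ v) :
    (U.children (some k)).Nontrivial ↔ (T.children k).Nontrivial :=
  ((above_iff_contr.1 h).nontrivial_iff (x := some k) (by simpa using hk) (by simp)).symm

theorem children_some_nontrivial_of_below (h : Below U v T) {k : V} (hk : k ≠ v) :
    (U.children (some k)).Nontrivial ↔ (T.children k).Nontrivial :=
  ((below_iff_contr.1 h).nontrivial_iff (x := some k) (by simp) (by simpa using hk)).symm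

theorem depth_of_above (h : Above U v T) : U.depth none = T.depth v :=
  (above_iff_contr.1 h).depth_glue.symm

theorem depth_of_below (h : Below U v T) : U.depth (some v) = T.depth v :=
  (below_iff_contr.1 h).depth_glue.symm

open Classical in
/-- The tree with a new vertex below `a` which takes over all children of `a`. -/
noncomputable def pushDown (T : RTree V) (a : V) : RTree (Option V) :=
  (T.splitAbove a ∅).relabel (Equiv.swap none (some a))

theorem below_pushDown (T : RTree V) (a : V) : Below (T.pushDown a) a T := by
  classical
  exact RTOp.above_swap (T.above_splitAbove a ∅)

theorem children_pushDown_self (T : RTree V) (a : V) :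
    (T.pushDown a).children (some a) = {none} := by
  classical
  have := children_relabel (Equiv.swap none (some a)) (T.splitAbove a ∅) none
  rw [Equiv.swap_apply_left, children_splitAbove_none, Set.inter_empty, Set.image_image] at this
  simpa [pushDown] using this

theorem children_pushDown_none (T : RTree V) (a : V) (h : (T.children a).Nontrivial) :
    ((T.pushDown a).children none).Nontrivial := by
  classical
  have := children_relabel (Equiv.swap none (some a)) (T.splitAbove a ∅) (some a)
  rw [Equiv.swap_apply_right, children_splitAbove_self, Set.sdiff_empty] at this
  rw [pushDown, this]
  exact (h.image (Option.some_injective _)).image (Equiv.injective _)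

theorem Below.eq_pushDown (h : Below U a T) (hU : U.children (some a) = {none}) :
    U = T.pushDown a := by
  classical
  have h' := RTOp.below_swap h
  have : U.relabel (Equiv.swap none (some a)) = T.splitAbove a ∅ := by
    refine h'.eq_splitAbove fun w hw hT => ?_
    simp only [Set.mem_empty_iff_false, iff_false]
    intro hp
    have hw' : some w ∈ (U.relabel (Equiv.swap none (some a))).children
        (Equiv.swap none (some a) (some a)) := by
      rw [Equiv.swap_apply_right]; exact hp
    rw [children_relabel, hU] at hw'
    simp only [Set.image_singleton, Equiv.swap_apply_left, Set.mem_singleton_iff,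
      Option.some.injEq] at hw'
    exact hw hw'
  rw [pushDown, ← this, relabel_relabel, ← Equiv.Perm.mul_def, Equiv.swap_mul_self]
  exact (relabel_refl U).symm

theorem pushDown_relabel {W : Type} (e : V ≃ W) (T : RTree V) (a : V) :
    (T.pushDown a).relabel e.optionCongr = (T.relabel e).pushDown (e a) := by
  refine ((T.below_pushDown a).relabel e).eq_pushDown ?_
  have := children_relabel e.optionCongr (T.pushDown a) (some a)
  rw [children_pushDown_self, Set.image_singleton] at this
  exact this

end Match

end RTree

/-! ### Antisymmetrization of the black vertices -/

namespace LinOperad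

namespace LieElement

variable {K : Type u} [Field K] {P : LinOperad K} (β : LieElement P)

theorem map_blackPerm_mul {A : Type} [Finite A] {b : ℕ} (σ τ : Equiv.Perm (Fin b))
    (f : P.obj (A ⊕ Fin b)) :
    P.map (blackPerm A σ) (P.map (blackPerm A τ) f) = P.map (blackPerm A (σ * τ)) f := by
  rw [P.map_map]
  exact P.map_eq_of (by rintro (_ | _) <;> rfl) f

/-- Antisymmetrization over the black vertices. -/
noncomputable def altRaw (P : LinOperad K) (A : Type) [Finite A] (b : ℕ) :
    P.obj (A ⊕ Fin b) →ₗ[K] P.obj (A ⊕ Fin b) :=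
  ∑ σ : Equiv.Perm (Fin b), ((Equiv.Perm.sign σ : ℤ) : K) • P.map (blackPerm A σ)

theorem altRaw_apply {A : Type} [Finite A] {b : ℕ} (f : P.obj (A ⊕ Fin b)) :
    altRaw P A b f =
      ∑ σ : Equiv.Perm (Fin b), ((Equiv.Perm.sign σ : ℤ) : K) • P.map (blackPerm A σ) f := by
  simp [altRaw]

theorem sign_mul_sign {b : ℕ} (σ : Equiv.Perm (Fin b)) :
    ((Equiv.Perm.sign σ : ℤ) : K) * ((Equiv.Perm.sign σ : ℤ) : K) = 1 := by
  rcases Int.units_eq_one_or (Equiv.Perm.sign σ) with h | h <;> simp [h]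

theorem altRaw_map {A : Type} [Finite A] {b : ℕ} (τ : Equiv.Perm (Fin b))
    (f : P.obj (A ⊕ Fin b)) :
    altRaw P A b (P.map (blackPerm A τ) f) = ((Equiv.Perm.sign τ : ℤ) : K) • altRaw P A b f := by
  rw [altRaw_apply, altRaw_apply, ← Equiv.sum_comp (Equiv.mulRight τ) (fun σ =>
    ((Equiv.Perm.sign σ : ℤ) : K) • P.map (blackPerm A σ) f), Finset.smul_sum]
  refine Finset.sum_congr rfl fun σ _ => ?_
  rw [map_blackPerm_mul, Equiv.coe_mulRight, smul_smul, Equiv.Perm.sign_mul, Units.val_mul,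
    Int.cast_mul, mul_left_comm, sign_mul_sign, mul_one]

theorem map_altRaw {A : Type} [Finite A] {b : ℕ} (τ : Equiv.Perm (Fin b))
    (f : P.obj (A ⊕ Fin b)) :
    P.map (blackPerm A τ) (altRaw P A b f) = ((Equiv.Perm.sign τ : ℤ) : K) • altRaw P A b f := by
  rw [altRaw_apply, map_sum, ← Equiv.sum_comp (Equiv.mulLeft τ) (fun σ =>
    ((Equiv.Perm.sign σ : ℤ) : K) • P.map (blackPerm A σ) f), Finset.smul_sum]
  refine Finset.sum_congr rfl fun σ _ => ?_
  rw [map_smul, map_blackPerm_mul, Equiv.coe_mulLeft, smul_smul, Equiv.Perm.sign_mul, Units.val_mul,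
    Int.cast_mul, ← mul_assoc, sign_mul_sign, one_mul]

theorem twMk_altRaw {A : Type} [Finite A] {b : ℕ} (f : P.obj (A ⊕ Fin b)) :
    twMk P A b (altRaw P A b f) = (b.factorial : K) • twMk P A b f := by
  rw [altRaw_apply, map_sum]
  simp_rw [map_smul, twMk_blackPerm, smul_smul, sign_mul_sign, one_smul]
  rw [Finset.sum_const, Finset.card_univ, Fintype.card_perm, Fintype.card_fin,
    Nat.cast_smul_eq_nsmul]

/-- The new black vertex of `rawD β A b f` is the first one, so antisymmetrizing over all black
vertices amounts to antisymmetrizing over the old ones and then summing over the positions of the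
new one; moving it to another position by a transposition gives the sign `-1`. -/
theorem altRaw_rawD {A : Type} [Finite A] {b : ℕ} (f : P.obj (A ⊕ Fin b)) :
    altRaw P A (b + 1) (rawD β A b f) = rawD β A b (altRaw P A b f) -
      ∑ k : Fin b, P.map (blackPerm A (Equiv.swap 0 k.succ)) (rawD β A b (altRaw P A b f)) := by
  have key : ∀ (i : Fin (b + 1)) (σ : Equiv.Perm (Fin b)),
      P.map (blackPerm A (Equiv.Perm.decomposeFin.symm (i, σ))) (rawD β A b f) =
        P.map (blackPerm A (Equiv.swap 0 i)) (rawD β A b (P.map (blackPerm A σ) f)) := by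
    intro i σ
    have e : Equiv.Perm.decomposeFin.symm (i, σ) =
        Equiv.swap 0 i * Equiv.Perm.decomposeFin.symm (0, σ) := by
      ext j; refine Fin.cases ?_ (fun j => ?_) j <;> simp
    rw [e, ← map_blackPerm_mul]
    exact congrArg _ (rawD_map β (Equiv.refl A) σ f).symm
  rw [altRaw_apply, ← Equiv.Perm.decomposeFin.symm.sum_comp, Fintype.sum_prod_type,
    Fin.sum_univ_succ, sub_eq_add_neg, ← Finset.sum_neg_distrib]
  congr 1
  · rw [altRaw_apply, map_sum]
    refine Finset.sum_congr rfl fun σ _ => ?_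
    rw [key, Equiv.Perm.decomposeFin.symm_sign, Equiv.swap_self, map_smul]
    simp only [if_true, one_mul]
    congr 1
    exact (P.map_eq_of (by rintro (_ | _) <;> rfl) _).trans (P.map_refl _)
  · refine Finset.sum_congr rfl fun k _ => ?_
    rw [altRaw_apply, map_sum, map_sum, ← Finset.sum_neg_distrib]
    refine Finset.sum_congr rfl fun σ _ => ?_
    rw [key, Equiv.Perm.decomposeFin.symm_sign, map_smul, map_smul, if_neg (Fin.succ_ne_zero k)]
    simp

/-- Antisymmetrization as a map on the twisted operad, whose operations are sign coinvariants. In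
characteristic zero it is injective. -/
noncomputable def alt (P : LinOperad K) (A : Type) [Finite A] (b : ℕ) :
    TwObj P A b →ₗ[K] P.obj (A ⊕ Fin b) :=
  (oddRel P A b).liftQ (altRaw P A b) (lift_oddRel _ fun σ f => altRaw_map σ f)

theorem alt_mk {A : Type} [Finite A] {b : ℕ} (f : P.obj (A ⊕ Fin b)) :
    alt P A b (twMk P A b f) = altRaw P A b f := rfl

theorem twMk_alt {A : Type} [Finite A] {b : ℕ} (x : TwObj P A b) :
    twMk P A b (alt P A b x) = (b.factorial : K) • x := by
  obtain ⟨f, rfl⟩ := Submodule.mkQ_surjective _ x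
  exact twMk_altRaw f

theorem map_alt {A : Type} [Finite A] {b : ℕ} (τ : Equiv.Perm (Fin b)) (x : TwObj P A b) :
    P.map (blackPerm A τ) (alt P A b x) = ((Equiv.Perm.sign τ : ℤ) : K) • alt P A b x := by
  obtain ⟨f, rfl⟩ := Submodule.mkQ_surjective _ x
  exact map_altRaw τ f

theorem alt_injective [CharZero K] (A : Type) [Finite A] (b : ℕ) :
    Function.Injective (alt P A b) := by
  rw [injective_iff_map_eq_zero]
  intro x hx
  have := twMk_alt x
  rw [hx, map_zero] at this
  exact (smul_eq_zero.1 this.symm).resolve_left (by exact_mod_cast b.factorial_ne_zero)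

theorem alt_twD {A : Type} [Finite A] {b : ℕ} (x : TwObj P A b) :
    alt P A (b + 1) (twD β A b x) = rawD β A b (alt P A b x) -
      ∑ k : Fin b, P.map (blackPerm A (Equiv.swap 0 k.succ)) (rawD β A b (alt P A b x)) := by
  obtain ⟨f, rfl⟩ := Submodule.mkQ_surjective _ x
  exact altRaw_rawD β f

/-- An operation of `P` as an operation of the twisted operad without black vertices. -/
noncomputable def emb (P : LinOperad K) (A : Type) [Finite A] : P.obj A →ₗ[K] TwObj P A 0 :=
  twMk P A 0 ∘ₗ P.map (Equiv.sumEmpty A (Fin 0)).symm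

theorem emb_apply {A : Type} [Finite A] (f : P.obj A) :
    emb P A f = twMk P A 0 (P.map (Equiv.sumEmpty A (Fin 0)).symm f) := rfl

theorem emb_map {A B : Type} [Finite A] [Finite B] (e : A ≃ B) (f : P.obj A) :
    emb P B (P.map e f) = twMap e 0 (emb P A f) := by
  rw [emb_apply, emb_apply, twMap_mk, rawMap, P.map_map, P.map_map]
  exact congrArg _ (P.map_eq_of (by intro a; rfl) f)

theorem emb_comp {A B : Type} [Finite A] [Finite B] (f : P.obj (Option A)) (g : P.obj B) :
    emb P (A ⊕ B) (P.comp f g) = twComp (add_zero 0) (emb P (Option A) f) (emb P B g) := by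
  rw [emb_apply, emb_apply, emb_apply, twComp_mk]
  simp only [rawComp, LinearMap.compr₂_apply, LinearMap.comp_apply]
  refine congrArg _ ?_
  rw [P.map_map, show (Equiv.sumEmpty (Option A) (Fin 0)).symm.trans (optL A (Fin 0)) =
    (Equiv.sumEmpty A (Fin 0)).symm.optionCongr from
    Equiv.ext (by rintro (_ | _) <;> rfl), P.comp_map, P.map_map]
  exact P.map_eq_of (by rintro (_ | _) <;> rfl) _

theorem emb_surjective (A : Type) [Finite A] : Function.Surjective (emb P A) := by
  intro x
  obtain ⟨f, rfl⟩ := Submodule.mkQ_surjective _ x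
  refine ⟨P.map (Equiv.sumEmpty A (Fin 0)) f, ?_⟩
  rw [emb_apply, P.map_map, Equiv.self_trans_symm, P.map_refl]

theorem alt_emb {A : Type} [Finite A] (f : P.obj A) :
    alt P A 0 (emb P A f) = P.map (Equiv.sumEmpty A (Fin 0)).symm f := by
  rw [emb_apply, alt_mk, altRaw_apply, Fintype.sum_unique]
  rw [show (default : Equiv.Perm (Fin 0)) = 1 from rfl, Equiv.Perm.sign_one]
  simp only [Units.val_one, Int.cast_one, one_smul]
  exact (P.map_eq_of (by rintro (_ | _) <;> rfl) _).trans (P.map_refl _)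

theorem emb_injective (A : Type) [Finite A] : Function.Injective (emb P A) := by
  intro f g h
  have := congrArg (fun x => P.map (Equiv.sumEmpty A (Fin 0)) (alt P A 0 x)) h
  simpa only [alt_emb, P.map_map, Equiv.symm_trans_self, P.map_refl] using this

end LieElement

end LinOperad

/-! ### Insertion of the bracket with a new input -/

namespace DGOperad

open Classical in
/-- Insert the binary operation `β` into the input `a`; the inputs of `β` are called `none`
and `some a`. -/
noncomputable def ins {K : Type u} [Field K] (Q : DGOperad K) (β : Q.obj (Fin 2) 0) {A : Type}
    [Finite A] (a : A) (n : ℕ) : Q.obj A n →ₗ[K] Q.obj (Option A) n :=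
  Q.map (Equiv.optionSubtypeNe a).optionCongr n ∘ₗ
    Q.map (LinOperad.LieElement.splitEquiv {x // x ≠ a}) n ∘ₗ
    (Q.comp (add_zero n)).flip β ∘ₗ Q.map (Equiv.optionSubtypeNe a).symm n

theorem d_ins {K : Type u} [Field K] (Q : DGOperad K) (β : Q.obj (Fin 2) 0) (hβ : Q.d 0 β = 0)
    {A : Type} [Finite A] (a : A) (n : ℕ) (x : Q.obj A n) :
    Q.d n (Q.ins β a n x) = Q.ins β a (n + 1) (Q.d n x) := by
  simp only [ins, LinearMap.comp_apply, LinearMap.flip_apply, d_map]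
  rw [Q.leibniz (add_zero n) (add_zero (n + 1)) rfl, hβ, map_zero, smul_zero, add_zero, d_map]

theorem Hom.app_ins {K : Type u} [Field K] {Q R : DGOperad K} (φ : Hom Q R) (β : Q.obj (Fin 2) 0)
    {A : Type} [Finite A] (a : A) (n : ℕ) (x : Q.obj A n) :
    φ.app (Option A) n (Q.ins β a n x) = R.ins (φ.app (Fin 2) 0 β) a n (φ.app A n x) := by
  simp only [ins, LinearMap.comp_apply, LinearMap.flip_apply, φ.app_map, φ.app_comp]

end DGOperad

namespace LinOperad

namespace LieElement

variable {K : Type u} [Field K] {P : LinOperad K} (β : LieElement P)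

/-- Insertion of the bracket into an input of an operation with black vertices. -/
theorem twist_ins [CharZero K] {A : Type} [Finite A] (a : A) {b : ℕ} (f : P.obj (A ⊕ Fin b)) :
    β.twist.ins (emb P (Fin 2) β.val) a b (twMk P A b f) =
      twMk P (Option A) b (P.map (optL A (Fin b)).symm (β.splitAt (.inl a) f)) := by
  classical
  have h := β.splitAt_eq (((Equiv.sumCongr (Equiv.optionSubtypeNe a).symm
    (Equiv.refl (Fin b))).trans (optL {x // x ≠ a} (Fin b))).symm) f
  have h0 : ((Equiv.sumCongr (Equiv.optionSubtypeNe a).symm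
    (Equiv.refl (Fin b))).trans (optL {x // x ≠ a} (Fin b))).symm none = .inl a := rfl
  rw [h0] at h
  rw [h]
  change twMap _ b (twMap _ b (twComp _ (twMap _ b (twMk P A b f)) (emb P (Fin 2) β.val))) = _
  rw [emb_apply, twMap_mk, twComp_mk, twMap_mk, twMap_mk]
  refine congrArg _ ?_
  simp only [rawMap, rawComp, LinearMap.compr₂_apply, LinearMap.comp_apply, split,
    LinearMap.flip_apply, P.comp_map_right, P.map_map, Equiv.symm_symm]
  refine P.map_eq_of ?_ _
  rintro ((x | k) | i)
  · rfl
  · refine congrArg Sum.inr (Fin.ext ?_)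
    exact block_inl (add_zero b) k
  · fin_cases i <;> rfl

theorem altRaw_splitAt {A : Type} [Finite A] (a : A) {b : ℕ} (f : P.obj (A ⊕ Fin b)) :
    altRaw P (Option A) b (P.map (optL A (Fin b)).symm (β.splitAt (.inl a) f)) =
      P.map (optL A (Fin b)).symm (β.splitAt (.inl a) (altRaw P A b f)) := by
  rw [altRaw_apply, altRaw_apply, map_sum, map_sum]
  refine Finset.sum_congr rfl fun σ _ => ?_
  rw [map_smul, map_smul]
  congr 1
  rw [show (Sum.inl a : A ⊕ Fin b) = blackPerm A σ (.inl a) from rfl, splitAt_map, P.map_map,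
    P.map_map]
  exact P.map_eq_of (by rintro (_ | (_ | _)) <;> rfl) _

theorem alt_ins [CharZero K] {A : Type} [Finite A] (a : A) {b : ℕ} (x : TwObj P A b) :
    alt P (Option A) b (β.twist.ins (emb P (Fin 2) β.val) a b x) =
      P.map (optL A (Fin b)).symm (β.splitAt (.inl a) (alt P A b x)) := by
  obtain ⟨f, rfl⟩ := Submodule.mkQ_surjective _ x
  have := twist_ins β a f
  exact (congrArg _ this).trans (altRaw_splitAt β a f)

end LieElement

end LinOperad

/-! ### The differential on coefficient functions -/

namespace RTOp

open LinOperad LinOperad.LieElement RTree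

variable {K : Type u} [Field K]

theorem eq_sum_single {V : Type} [Finite V] (F : RTree V → K) :
    F = ∑ T : RTree V, F T • single K T := by
  classical
  funext U
  rw [Finset.sum_apply, Finset.sum_eq_single U]
  · simp [single_apply]
  · intro T _ hT
    simp [single_apply, Ne.symm hT]
  · simp

/-- The operation `splitAt` of the operad of rooted trees on coefficient functions. -/
noncomputable def splitTree (K : Type u) [Field K] {V : Type} [Finite V] (v : V) :
    (RTree V → K) →ₗ[K] (RTree (Option V) → K) := (bracket K).splitAt v

/-- The operation `ad` of the operad of rooted trees on coefficient functions. -/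
noncomputable def adTree (K : Type u) [Field K] {V : Type} [Finite V] :
    (RTree V → K) →ₗ[K] (RTree (Option V) → K) := (bracket K).ad

/-- The operation `twistOp` of the operad of rooted trees on coefficient functions. -/
noncomputable def twistTree {K : Type u} [Field K] {V : Type} [Finite V] (c : V → K) :
    (RTree V → K) →ₗ[K] (RTree (Option V) → K) := (bracket K).twistOp c

/-- Antisymmetrization on coefficient functions. -/
noncomputable def altTree (K : Type u) [Field K] (A : Type) [Finite A] (b : ℕ) :
    TwObj (rtLin K) A b →ₗ[K] (RTree (A ⊕ Fin b) → K) := alt (rtLin K) A b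

/-- The coefficient at `U` collects the coefficients at the contraction of the edge between the
new vertex and `v`, if there is one. -/
theorem splitTree_apply {V : Type} [Finite V] (v : V) (F : RTree V → K) (U : RTree (Option V)) :
    splitTree K v F U = ∑ T : RTree V, F T * (ind K (Above U v T) - ind K (Below U v T)) := by
  classical
  conv_lhs => rw [eq_sum_single F]
  rw [map_sum, Finset.sum_apply]
  refine Finset.sum_congr rfl fun T _ => ?_
  rw [map_smul, Pi.smul_apply, smul_eq_mul]
  exact congrArg (F T * ·) (splitAt_single K v T U)

section

variable {V : Type} [Finite V] {v : V} {F : RTree V → K} {U : RTree (Option V)} {T : RTree V}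

theorem splitTree_above (h : Above U v T) : splitTree K v F U = F T := by
  rw [splitTree_apply, Finset.sum_eq_single T]
  · rw [ind_pos h, ind_neg fun h' => U.not_cycle h.edge h'.edge, sub_zero, mul_one]
  · intro T' _ hT'
    rw [ind_neg fun h' => hT' ((above_iff_contr.1 h').unique (above_iff_contr.1 h)),
      ind_neg fun h' => U.not_cycle h.edge h'.edge, sub_zero, mul_zero]
  · simp

theorem splitTree_below (h : Below U v T) :
    splitTree K v F U = -F T := by
  rw [splitTree_apply, Finset.sum_eq_single T]
  · rw [ind_pos h, ind_neg fun h' => U.not_cycle h.edge h'.edge, zero_sub, mul_neg, mul_one]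
  · intro T' _ hT'
    rw [ind_neg (p := Below U v T') fun h' =>
        hT' ((below_iff_contr.1 h').unique (below_iff_contr.1 h)),
      ind_neg fun h' => U.not_cycle h.edge h'.edge, sub_zero, mul_zero]
  · simp

theorem splitTree_zero (h : ∀ T, Above U v T ∨ Below U v T → F T = 0) :
    splitTree K v F U = 0 := by
  rw [splitTree_apply]
  refine Finset.sum_eq_zero fun T _ => ?_
  by_cases hT : Above U v T ∨ Below U v T
  · rw [h T hT, zero_mul]
  · push Not at hT
    rw [ind_neg hT.1, ind_neg hT.2, sub_zero, mul_zero]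

theorem splitTree_swap [DecidableEq (Option V)] : splitTree K v F
    (U.relabel (Equiv.swap none (some v))) =
      -splitTree K v F U := by
  by_cases h1 : ∃ T, Above U v T
  · obtain ⟨T, h1⟩ := h1
    rw [splitTree_above h1, splitTree_below (above_swap h1)]
  by_cases h2 : ∃ T, Below U v T
  · obtain ⟨T, h2⟩ := h2
    rw [splitTree_below h2, splitTree_above (below_swap h2), neg_neg]
  have hs : (U.relabel (Equiv.swap none (some v))).relabel (Equiv.swap none (some v)) = U := by
    rw [RTree.relabel_relabel, ← Equiv.Perm.mul_def, Equiv.swap_mul_self]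
    exact RTree.relabel_refl U
  rw [splitTree_zero, splitTree_zero, neg_zero]
  · rintro T (h | h)
    · exact absurd ⟨T, h⟩ h1
    · exact absurd ⟨T, h⟩ h2
  · rintro T (h | h)
    · have := above_swap h
      rw [hs] at this
      exact absurd ⟨T, this⟩ h2
    · have := below_swap h
      rw [hs] at this
      exact absurd ⟨T, this⟩ h1

/-- Adding a new root or a new leaf gives a tree whose new vertex has at most one child. -/
theorem adTree_zero (hU : (U.children none).Nontrivial) :
    adTree K F U = 0 := by
  classical
  rw [eq_sum_single F, map_sum, Finset.sum_apply]
  refine Finset.sum_eq_zero fun T _ => ?_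
  rw [map_smul, Pi.smul_apply, smul_eq_mul]
  refine (congrArg (F T * ·) (ad_single K T U)).trans ?_
  rw [if_neg, if_neg, sub_zero, mul_zero]
  · intro h
    obtain ⟨x, hx⟩ := hU.nonempty
    rcases x with _ | x
    · exact U.parent_ne_self none hx
    · exact h.ne x hx
  · intro h
    obtain ⟨x, hx, y, hy, hxy⟩ := hU
    have key : ∀ x : Option V, x ∈ U.children none → ∃ x', x = some x' ∧ T.parent x' = none := by
      rintro (_ | x) hx
      · exact absurd hx (U.parent_ne_self none)
      · refine ⟨x, rfl, ?_⟩
        rcases hp : T.parent x with _ | w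
        · rfl
        · have := h.inner x w hp
          rw [show U.parent (some x) = some none from hx] at this
          cases this
    obtain ⟨x, rfl, hx'⟩ := key x hx
    obtain ⟨y, rfl, hy'⟩ := key y hy
    exact hxy (congrArg some (T.existsUnique_root.unique hx' hy'))

theorem twistTree_apply [Fintype V] (c : V → K) (hU : (U.children none).Nontrivial) :
    twistTree c F U =
      -∑ v, c v * splitTree K v F U := by
  have h : twistTree c F = (adTree K F - ∑ v, c v • splitTree K v F : RTree (Option V) → K) :=
    twistOp_apply (bracket K) c F
  rw [h, Pi.sub_apply, adTree_zero hU, zero_sub, Finset.sum_apply]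
  rfl

end

section

variable {A : Type} [Finite A] {b : ℕ}

/-- The coefficients of the differential: any black vertex can be the new one. The first summand is
the contribution of the first black vertex, the others those of the vertices `k.succ`. -/
theorem alt_twD_apply [DecidableEq (Option (A ⊕ Fin b))] (x : TwObj (rtLin K) A b)
    (U : RTree (Option (A ⊕ Fin b))) :
    altTree K A (b + 1) (twD (bracket K) A b x)
      (U.relabel (cons A b)) =
    twistTree (weight A b) (altTree K A b x) U -
      ∑ k : Fin b, twistTree (weight A b) (altTree K A b x)
        (U.relabel (Equiv.swap none (some (.inr k)))) := by
  let D : RTree (A ⊕ Fin (b + 1)) → K := rawD (bracket K) A b (alt (rtLin K) A b x)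
  have e0 : altTree K A (b + 1) (twD (bracket K) A b x) =
      (D - ∑ k : Fin b, LinearMap.funLeft K K
        (RTree.relabel (blackPerm A (Equiv.swap 0 k.succ)).symm) D : RTree (A ⊕ Fin (b + 1)) → K) :=
    alt_twD (bracket K) x
  have e1 : ∀ V : RTree (A ⊕ Fin (b + 1)),
      D V = twistTree (weight A b) (altTree K A b x) (V.relabel (cons A b).symm) := fun _ => rfl
  rw [e0, Pi.sub_apply, Finset.sum_apply]
  congr 1
  · rw [e1, relabel_relabel_symm]
  · refine Finset.sum_congr rfl fun k _ => ?_
    rw [LinearMap.funLeft_apply]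
    rw [e1, RTree.relabel_relabel, RTree.relabel_relabel]
    refine congrArg (fun e => twistTree (weight A b) (altTree K A b x) (U.relabel e))
      (Equiv.ext fun w => ?_)
    have hs : ∀ y, (blackPerm A (Equiv.swap 0 k.succ)).symm y =
        blackPerm A (Equiv.swap 0 k.succ) y := by
      rintro (_ | _)
      · rfl
      · exact congrArg Sum.inr (by rw [Equiv.symm_swap])
    rw [Equiv.trans_apply, Equiv.trans_apply, hs, Equiv.symm_apply_eq]
    rcases w with _ | a | j
    · rw [Equiv.swap_apply_left]
      exact congrArg Sum.inr (Equiv.swap_apply_left _ _)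
    · rw [Equiv.swap_apply_of_ne_of_ne (by simp) (by simp)]; rfl
    · by_cases hj : j = k
      · subst hj
        rw [Equiv.swap_apply_right]
        exact congrArg Sum.inr (Equiv.swap_apply_right _ _)
      · rw [Equiv.swap_apply_of_ne_of_ne (by simp) (by simpa using hj)]
        exact congrArg Sum.inr (Equiv.swap_apply_of_ne_of_ne (Fin.succ_ne_zero j)
          (by simpa using hj))

/-- The black vertices. -/
def black (A : Type) (b : ℕ) : Set (A ⊕ Fin b) := Set.range Sum.inr

theorem isGood_iff {A : Type} {b : ℕ} {T : RTree (A ⊕ Fin b)} : IsGood T ↔ Bushy (black A b) T := by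
  simp [IsGood, Bushy, black]

theorem cons_mem_black {A : Type} {b : ℕ} {w : Option (A ⊕ Fin b)} :
    cons A b w ∈ black A (b + 1) ↔ w ∈ withNone (black A b) := by
  rcases w with _ | a | k <;> simp [cons, withNone, black]

theorem swap_mem_withNone {A : Type} {b : ℕ} [DecidableEq (Option (A ⊕ Fin b))] (k : Fin b)
    (w : Option (A ⊕ Fin b)) :
    Equiv.swap none (some (.inr k)) w ∈ withNone (black A b) ↔ w ∈ withNone (black A b) := by
  have h1 : (none : Option (A ⊕ Fin b)) ∈ withNone (black A b) := none_mem_withNone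
  have h2 : (some (.inr k) : Option (A ⊕ Fin b)) ∈ withNone (black A b) :=
    some_mem_withNone.2 ⟨k, rfl⟩
  by_cases hw : w = none
  · subst hw; rw [Equiv.swap_apply_left]; exact iff_of_true h2 h1
  by_cases hw' : w = some (.inr k)
  · subst hw'; rw [Equiv.swap_apply_right]; exact iff_of_true h1 h2
  rw [Equiv.swap_apply_of_ne_of_ne hw hw']

variable {x : TwObj (rtLin K) A b} {U : RTree (Option (A ⊕ Fin b))}

/-- If contractions of edges can only contribute at the new vertex, then each of them contributes
with coefficient one: an edge between two black vertices is counted twice, with weight `1/2`. -/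
theorem alt_twD_special [DecidableEq (Option (A ⊕ Fin b))] [CharZero K] [Fintype A]
    (hU : Bushy (withNone (black A b)) U)
    (h : ∀ k v T, v ≠ .inr k → Above (U.relabel (Equiv.swap none (some (.inr k)))) v T ∨
      Below (U.relabel (Equiv.swap none (some (.inr k)))) v T → altTree K A b x T = 0) :
    altTree K A (b + 1) (twD (bracket K) A b x)
      (U.relabel (cons A b)) =
    -∑ v, splitTree K v (altTree K A b x) U := by
  have hU' : ∀ k : Fin b, Bushy (withNone (black A b))
      (U.relabel (Equiv.swap none (some (.inr k)))) := fun k =>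
    (bushy_relabel _ (swap_mem_withNone k) U).2 hU
  rw [alt_twD_apply, twistTree_apply _ (hU none none_mem_withNone)]
  have e : ∀ k : Fin b, twistTree (weight A b) (altTree K A b x)
        (U.relabel (Equiv.swap none (some (.inr k)))) =
      2⁻¹ * splitTree K (.inr k) (altTree K A b x) U := by
    intro k
    rw [twistTree_apply _ (hU' k none none_mem_withNone), Finset.sum_eq_single (.inr k)]
    · rw [splitTree_swap]
      change -((2 : K)⁻¹ * _) = _
      ring
    · intro v _ hv
      rw [splitTree_zero fun T hT => h k v T hv hT, mul_zero]
    · simp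
  rw [Finset.sum_congr rfl fun k _ => e k, Fintype.sum_sum_type, Fintype.sum_sum_type]
  have e1 : ∀ a, (weight A b (.inl a) : K) = 1 := fun _ => rfl
  have e2 : ∀ k, (weight A b (.inr k) : K) = 2⁻¹ := fun _ => rfl
  simp only [e1, e2, one_mul, ← Finset.mul_sum]
  ring

theorem alt_twD_zero [DecidableEq (Option (A ⊕ Fin b))] [CharZero K] [Fintype A]
    (hU : Bushy (withNone (black A b)) U)
    (h0 : ∀ v T, Above U v T ∨ Below U v T → altTree K A b x T = 0)
    (h : ∀ k v T, Above (U.relabel (Equiv.swap none (some (.inr k)))) v T ∨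
      Below (U.relabel (Equiv.swap none (some (.inr k)))) v T → altTree K A b x T = 0) :
    altTree K A (b + 1) (twD (bracket K) A b x)
      (U.relabel (cons A b)) = 0 := by
  rw [alt_twD_special hU fun k v T _ => h k v T, Finset.sum_eq_zero, neg_zero]
  exact fun v _ => splitTree_zero (F := altTree K A b x) (h0 v)

end

end RTOp

/-! ### Triangularity of the differential -/

namespace RTree

theorem exists_parent_of_leaf {V : Type} (T : RTree V) {a : V} (h : T.children a = ∅) {w : V}
    (hw : w ≠ a) : ∃ v, T.parent a = some v := by
  rcases ha : T.parent a with _ | v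
  · exfalso
    have key : ∀ n w, w ≠ a → T.depth w ≠ n := by
      intro n
      induction n with
      | zero =>
        intro w hw h0
        rcases hp : T.parent w with _ | u
        · exact hw (T.existsUnique_root.unique hp ha)
        · rw [T.depth_succ hp] at h0; omega
      | succ n ih =>
        intro w hw h0
        rcases hp : T.parent w with _ | u
        · exact hw (T.existsUnique_root.unique hp ha)
        · refine ih u ?_ (by rw [T.depth_succ hp] at h0; omega)
          rintro rfl
          exact (Set.eq_empty_iff_forall_notMem.1 h) w hp
    exact key _ w hw rfl
  · exact ⟨v, rfl⟩

theorem not_isTarget_of_nontrivial {V : Type} {B : Set V} {a : V} {T : RTree V}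
    (h : (T.children a).Nontrivial) : ¬ IsTarget B a T := by
  rintro (⟨c, hc⟩ | ⟨h0, -⟩)
  · rw [hc] at h; exact Set.not_nontrivial_singleton h
  · rw [h0] at h; exact Set.not_nontrivial_empty h

end RTree

namespace RTOp

open LinOperad LinOperad.LieElement RTree

variable {K : Type u} [Field K] {A : Type}

/-- The tree with the new input `none` inserted into the edge above the input `a`, so that `a` is
its only child. -/
noncomputable def insAbove {n : ℕ} (a : A) (T : RTree (A ⊕ Fin n)) : RTree (Option A ⊕ Fin n) :=
  (T.splitAbove (.inl a) ∅).relabel (optL A (Fin n)).symm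

theorem insAbove_relabel {n : ℕ} (a : A) (T : RTree (A ⊕ Fin n)) :
    (insAbove a T).relabel (optL A (Fin n)) = T.splitAbove (.inl a) ∅ :=
  relabel_symm_relabel _ _

theorem children_insAbove {n : ℕ} (a : A) (T : RTree (A ⊕ Fin n)) :
    (insAbove a T).children (.inl none) = {.inl (some a)} := by
  have := children_relabel (optL A (Fin n)).symm (T.splitAbove (.inl a) ∅) none
  rw [children_splitAbove_none] at this
  refine this.trans ?_
  simp [optL]

theorem isGood_of_above {n : ℕ} {a : A} {T : RTree (A ⊕ Fin n)} {U : RTree (Option A ⊕ Fin n)}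
    (h : Above (U.relabel (optL A (Fin n))) (.inl a) T) : IsGood U ↔ IsGood T := by
  refine forall_congr' fun k => ?_
  rw [← children_some_nontrivial_of_above h (k := .inr k) (by simp)]
  have := children_relabel (optL A (Fin n)) U (.inr k)
  rw [show optL A (Fin n) (.inr k) = some (.inr k) from rfl] at this
  rw [this, Set.image_nontrivial (Equiv.injective _)]

theorem depth_optL {n : ℕ} (U : RTree (Option A ⊕ Fin n)) :
    (U.relabel (optL A (Fin n))).depth none = U.depth (.inl none) :=
  depth_relabel (optL A (Fin n)) U (.inl none)

theorem depth_insAbove {n : ℕ} (a : A) (T : RTree (A ⊕ Fin n)) :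
    (insAbove a T).depth (.inl none) = T.depth (.inl a) := by
  rw [← depth_optL, insAbove_relabel, depth_of_above (T.above_splitAbove (.inl a) ∅)]

theorem swap_children {b : ℕ} [DecidableEq (Option (Option A ⊕ Fin b))]
    (U : RTree (Option (Option A ⊕ Fin b))) (k : Fin b) :
    (U.relabel (Equiv.swap none (some (.inr k)))).children (some (.inl none)) =
      Equiv.swap none (some (.inr k)) '' U.children (some (.inl none)) := by
  have := children_relabel (Equiv.swap none (some (.inr k))) U (some (.inl none))
  rwa [Equiv.swap_apply_of_ne_of_ne (by simp) (by simp)] at this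

theorem swap_depth {b : ℕ} [DecidableEq (Option (Option A ⊕ Fin b))]
    (U : RTree (Option (Option A ⊕ Fin b))) (k : Fin b) :
    (U.relabel (Equiv.swap none (some (.inr k)))).depth (some (.inl none)) =
      U.depth (some (.inl none)) := by
  have := depth_relabel (Equiv.swap none (some (.inr k))) U (some (.inl none))
  rwa [Equiv.swap_apply_of_ne_of_ne (by simp) (by simp)] at this

theorem depth_cons {b : ℕ} (U : RTree (Option (A ⊕ Fin b))) (v : A ⊕ Fin b) :
    U.depth (some v) = (U.relabel (cons A b)).depth (cons A b (some v)) :=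
  (depth_relabel (cons A b) U (some v)).symm

variable {b : ℕ}

open Classical in
/-- The tree whose contraction at the new black vertex gives the tree `T`: the children of `a` are
moved to a new black vertex below `a` or, if `a` is a leaf, a new black vertex is inserted into the
edge above the parent of `a`, and `a` is moved there. The value is of interest only for trees with
at least two vertices in which `a` does not have exactly one child. -/
noncomputable def expand {V : Type} (a : V) (T : RTree V) : RTree (Option V) :=
  if (T.children a).Nontrivial then T.pushDown a else
    match T.parent a with
    | some v => T.splitAbove v {a}
    | none => T.pushDown a

theorem expand_nontrivial {V : Type} {a : V} {T : RTree V} (h : (T.children a).Nontrivial) :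
    expand a T = T.pushDown a := if_pos h

theorem expand_leaf {V : Type} {a v : V} {T : RTree V} (h : T.children a = ∅)
    (hv : T.parent a = some v) : expand a T = T.splitAbove v {a} := by
  rw [expand, if_neg (by rw [h]; exact Set.not_nontrivial_empty), hv]

theorem bushy_expand_nontrivial {V : Type} {B : Set V} {a : V} {T : RTree V} (hT : Bushy B T)
    (ha : a ∉ B) (h : (T.children a).Nontrivial) : Bushy (withNone B) (T.pushDown a) := by
  rintro (_ | k) hk
  · exact children_pushDown_none T a h
  · have hk' : k ∈ B := some_mem_withNone.1 hk
    rw [children_some_nontrivial_of_below (T.below_pushDown a) (by rintro rfl; exact ha hk')]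
    exact hT k hk'

theorem bushy_expand_leaf {V : Type} {B : Set V} {a v : V} {T : RTree V} (hT : Bushy B T)
    (h : T.children a = ∅) (hv : T.parent a = some v) (ht : ¬ IsTarget B a T) :
    Bushy (withNone B) (T.splitAbove v {a}) := by
  have hva : v ≠ a := by rintro rfl; exact T.parent_ne_self _ hv
  have hav : a ∈ T.children v := hv
  rintro (_ | k) hk
  · rw [children_splitAbove_none]
    refine Set.Nontrivial.image ?_ (Option.some_injective _)
    exact ⟨v, Set.mem_insert _ _, a, Set.mem_insert_of_mem _ ⟨hv, rfl⟩, hva⟩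
  · have hk' : k ∈ B := some_mem_withNone.1 hk
    by_cases hkv : k = v
    · subst hkv
      rw [children_splitAbove_self]
      refine Set.Nontrivial.image ?_ (Option.some_injective _)
      by_contra hn
      rw [Set.not_nontrivial_iff] at hn
      obtain ⟨y, hy, hya⟩ := (hT k hk').exists_ne a
      refine ht (Or.inr ⟨h, k, hk', y, hya, ?_⟩)
      ext z
      constructor
      · intro hz
        by_cases hza : z = a
        · exact Or.inl hza
        · exact Or.inr (hn ⟨hz, hza⟩ ⟨hy, hya⟩)
      · rintro (rfl | rfl)
        · exact hav
        · exact hy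
    · rw [children_some_nontrivial_of_above (T.above_splitAbove v {a}) hkv]
      exact hT k hk'

theorem children_splitAbove_leaf {V : Type} {a v : V} {T : RTree V}
    (h : T.children a = ∅) (hv : T.parent a = some v) :
    (T.splitAbove v {a}).children (some a) = ∅ := by
  have hva : v ≠ a := by rintro rfl; exact T.parent_ne_self _ hv
  have := (above_iff_contr.1 (T.above_splitAbove v {a})).children (x := some a)
    (by simpa using hva.symm) (by simp)
  rw [show con v (some a) = a from rfl, h] at this
  exact Set.image_eq_empty.1 this.symm

theorem children_splitAbove_leaf' {V : Type} {a v : V} {T : RTree V} (hv : T.parent a = some v) :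
    (T.splitAbove v {a}).children none = {some a, some v} := by
  have hav : a ∈ T.children v := hv
  rw [children_splitAbove_none, Set.inter_eq_self_of_subset_right (Set.singleton_subset_iff.2 hav),
    Set.image_pair, Set.pair_comm]

theorem depth_splitAbove_leaf {V : Type} {a v : V} {T : RTree V} (hv : T.parent a = some v) :
    (T.splitAbove v {a}).depth (some a) = T.depth a := by
  have h : (T.splitAbove v {a}).parent (some a) = some none := by
    have : some a ∈ (T.splitAbove v {a}).children none := by
      rw [children_splitAbove_leaf' hv]; exact Set.mem_insert _ _
    exact this
  rw [depth_succ _ h, depth_of_above (T.above_splitAbove v {a}), T.depth_succ hv]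

/-- The expansion of a good tree which is not a target is a good target. -/
theorem expand_good [Nonempty A] {T : RTree (Option A ⊕ Fin b)} (hT : IsGood T)
    (ht : ¬ IsTarget (black (Option A) b) (.inl none) T) :
    Bushy (withNone (black (Option A) b)) (expand (.inl none) T) ∧
      IsTarget (withNone (black (Option A) b)) (some (.inl none)) (expand (.inl none) T) := by
  by_cases h : (T.children (.inl none)).Nontrivial
  · rw [expand_nontrivial h]
    exact ⟨bushy_expand_nontrivial (isGood_iff.1 hT) (by simp [black]) h,
      Or.inl ⟨none, children_pushDown_self T _⟩⟩
  · rw [Set.not_nontrivial_iff] at h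
    rcases h.eq_empty_or_singleton with h | ⟨c, h⟩
    · obtain ⟨a⟩ := ‹Nonempty A›
      obtain ⟨v, hv⟩ := T.exists_parent_of_leaf h (w := .inl (some a)) (by simp)
      have hva : v ≠ .inl none := by rintro rfl; exact T.parent_ne_self _ hv
      rw [expand_leaf h hv]
      exact ⟨bushy_expand_leaf (isGood_iff.1 hT) h hv ht,
        Or.inr ⟨children_splitAbove_leaf h hv, none, none_mem_withNone, some v,
          by simpa using hva, children_splitAbove_leaf' hv⟩⟩
    · exact absurd (Or.inl ⟨c, h⟩) ht

variable [Finite A]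

/-- The coefficients of the sum of the operations obtained from `f a` by inserting into the input
`a` the bracket of a new input with `a`. -/
noncomputable def insPart [Fintype A] {n : ℕ} (f : A → RTree (A ⊕ Fin n) → K)
    (U : RTree (Option A ⊕ Fin n)) : K :=
  ∑ a, splitTree K (.inl a) (f a) (U.relabel (optL A (Fin n)))

/-- The summand of the input `a` only sees trees with `a` closer to the root than the marked input
is in `U`, unless `a` is a child of the marked input. -/
theorem splitTree_lower {n : ℕ} {f : A → RTree (A ⊕ Fin n) → K} {U : RTree (Option A ⊕ Fin n)}
    (hf : ∀ a T, T.depth (.inl a) < U.depth (.inl none) → f a T = 0) {a : A}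
    (ha : U.parent (.inl (some a)) ≠ some (.inl none)) :
    splitTree K (.inl a) (f a) (U.relabel (optL A (Fin n))) = 0 := by
  refine splitTree_zero fun T hT => ?_
  rcases hT with h | h
  · exfalso
    apply ha
    have := h.edge
    rw [relabel_parent, Option.map_eq_some_iff] at this
    obtain ⟨w, hw, hw'⟩ := this
    rw [show (optL A (Fin n)).symm (some (.inl a)) = .inl (some a) from rfl] at hw
    rw [← Equiv.eq_symm_apply] at hw'
    rw [hw, hw']; rfl
  · apply hf
    rw [← depth_of_below h, ← depth_optL, depth_succ _ h.edge]
    exact Nat.lt_succ_self _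

theorem insPart_zero [Fintype A] {n : ℕ} {f : A → RTree (A ⊕ Fin n) → K}
    {U : RTree (Option A ⊕ Fin n)}
    (hf : ∀ a T, T.depth (.inl a) < U.depth (.inl none) → f a T = 0)
    (ha : ∀ a, U.parent (.inl (some a)) ≠ some (.inl none)) : insPart f U = 0 :=
  Finset.sum_eq_zero fun a _ => splitTree_lower hf (ha a)

/-- The value at the target `insAbove a T` is the coefficient at `T`, up to coefficients at trees in
which the relevant input is closer to the root. -/
theorem insPart_insAbove [Fintype A] {n : ℕ} {f : A → RTree (A ⊕ Fin n) → K} {a : A}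
    {T : RTree (A ⊕ Fin n)}
    (hf : ∀ a' T', T'.depth (.inl a') < T.depth (.inl a) → f a' T' = 0) :
    insPart f (insAbove a T) = f a T := by
  rw [insPart, Finset.sum_eq_single a]
  · rw [insAbove_relabel, splitTree_above (T.above_splitAbove _ _)]
  · intro a' _ ha'
    refine splitTree_lower (fun a'' T'' h => hf a'' T'' ?_) fun h => ha' ?_
    · rwa [depth_insAbove] at h
    · have h' : Sum.inl (some a') ∈ (insAbove a T).children (.inl none) := h
      rw [children_insAbove] at h'
      simpa using h'
  · simp

section

variable [CharZero K] {x : TwObj (rtLin K) (Option A) b}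

/-- A tree in which the marked input has exactly one child, not the new black vertex: only
contractions with its parent can contribute. -/
theorem alt_twD_zero_of_single
    (hF : ∀ T, IsTarget (black (Option A) b) (.inl none) T → altTree K (Option A) b x T = 0)
    {U : RTree (Option A ⊕ Fin (b + 1))} (hU : IsGood U) {a : A}
    (hc : U.children (.inl none) = {.inl (some a)})
    (hlow : ∀ T, T.depth (.inl none) < U.depth (.inl none) → altTree K (Option A) b x T = 0) :
    altTree K (Option A) (b + 1) (twD (bracket K) (Option A) b x) U = 0 := by
  classical
  cases nonempty_fintype A
  obtain ⟨U, rfl⟩ : ∃ U', U = RTree.relabel (cons (Option A) b) U' :=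
    ⟨U.relabel (cons (Option A) b).symm, (relabel_symm_relabel _ _).symm⟩
  have hd := depth_cons U (.inl none)
  rw [show cons (Option A) b (some (.inl none)) = .inl none from rfl] at hd
  rw [← hd] at hlow
  have hc' : U.children (some (.inl none)) = {some (.inl (some a))} := by
    have := children_relabel (cons (Option A) b) U (some (.inl none))
    rw [show cons (Option A) b (some (.inl none)) = .inl none from rfl, hc,
      show (.inl (some a) : Option A ⊕ Fin (b + 1)) = cons (Option A) b (some (.inl (some a)))
      from rfl, ← Set.image_singleton] at this
    exact ((Equiv.injective _).image_injective this).symm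
  refine alt_twD_zero ((bushy_relabel (cons (Option A) b) (fun _ => cons_mem_black) U).1
    (isGood_iff.1 hU)) (fun v T hT => ?_) fun k v T hT => ?_
  · rcases contr_single (B := black (Option A) b) hc' hT with h | h | ⟨-, h⟩
    · exact hF T h
    · exact hlow T h
    · simp at h
  · have hc'' : (U.relabel (Equiv.swap none (some (.inr k)))).children (some (.inl none)) =
        {some (.inl (some a))} := by
      rw [swap_children, hc', Set.image_singleton, Equiv.swap_apply_of_ne_of_ne (by simp) (by simp)]
    rcases contr_single (B := black (Option A) b) hc'' hT with h | h | ⟨-, h⟩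
    · exact hF T h
    · rw [swap_depth] at h
      exact hlow T h
    · simp at h

/-- The tree `T` contributes with a sign to the differential at its expansion; all other
contributions vanish or come from trees in which the marked input is closer to the root. -/
theorem alt_twD_expand [Nonempty A]
    (hF : ∀ T, IsTarget (black (Option A) b) (.inl none) T → altTree K (Option A) b x T = 0)
    {T : RTree (Option A ⊕ Fin b)} (hT : IsGood T)
    (ht : ¬ IsTarget (black (Option A) b) (.inl none) T)
    (hlow : ∀ T', T'.depth (.inl none) < T.depth (.inl none) → altTree K (Option A) b x T' = 0)
    (h0 : altTree K (Option A) (b + 1) (twD (bracket K) (Option A) b x)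
      ((expand (.inl none) T).relabel (cons (Option A) b)) = 0) :
    altTree K (Option A) b x T = 0 := by
  classical
  cases nonempty_fintype A
  have hb := (expand_good hT ht).1
  by_cases h : (T.children (.inl none)).Nontrivial
  · rw [expand_nontrivial h] at h0 hb
    have hd : (T.pushDown (.inl none)).depth (some (.inl none)) = T.depth (.inl none) :=
      depth_of_below (T.below_pushDown _)
    have hc := children_pushDown_self T (.inl none)
    rw [alt_twD_special hb, Finset.sum_eq_single (.inl none),
      splitTree_below (T.below_pushDown _), neg_neg] at h0
    · exact h0
    · intro v _ hv
      refine splitTree_zero fun T' hT' => ?_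
      rcases contr_single (B := black (Option A) b) hc hT' with h | h | ⟨h, -⟩
      · exact hF T' h
      · exact hlow T' (hd ▸ h)
      · exact absurd h hv
    · simp
    · intro k v T' hv hT'
      have hc'' : ((T.pushDown (.inl none)).relabel (Equiv.swap none (some (.inr k)))).children
          (some (.inl none)) = {some (.inr k)} := by
        rw [swap_children, hc, Set.image_singleton, Equiv.swap_apply_left]
      rcases contr_single (B := black (Option A) b) hc'' hT' with h | h | ⟨-, h⟩
      · exact hF T' h
      · rw [swap_depth] at h
        exact hlow T' (hd ▸ h)
      · simp at h
  · rw [Set.not_nontrivial_iff] at h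
    rcases h.eq_empty_or_singleton with h | ⟨c, h⟩
    · obtain ⟨a⟩ := ‹Nonempty A›
      obtain ⟨v, hv⟩ := T.exists_parent_of_leaf h (w := .inl (some a)) (by simp)
      have hva : v ≠ .inl none := by rintro rfl; exact T.parent_ne_self _ hv
      rw [expand_leaf h hv] at h0 hb
      have hd := depth_splitAbove_leaf hv
      have hc := children_splitAbove_leaf h hv
      have hc' := children_splitAbove_leaf' hv
      rw [alt_twD_special hb, Finset.sum_eq_single v,
        splitTree_above (T.above_splitAbove _ _), neg_eq_zero] at h0
      · exact h0
      · intro v' _ hv'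
        refine splitTree_zero fun T' hT' => ?_
        rcases contr_leaf (B := black (Option A) b) hc none_mem_withNone (by simpa using hva)
          hc' hT' with h | h | ⟨-, h⟩ | h
        · exact hF T' h
        · exact hlow T' (hd ▸ h)
        · exact absurd (Option.some_injective _ h).symm hv'
        · simp at h
      · simp
      · intro k v' T' hv' hT'
        have e1 : ((T.splitAbove v {.inl none}).relabel (Equiv.swap none (some (.inr k)))).children
            (some (.inl none)) = ∅ := by
          rw [swap_children, hc, Set.image_empty]
        have e2 : ((T.splitAbove v {.inl none}).relabel (Equiv.swap none (some (.inr k)))).children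
            (some (.inr k)) = {some (.inl none), Equiv.swap none (some (.inr k)) (some v)} := by
          have := children_relabel (Equiv.swap none (some (.inr k)))
            (T.splitAbove v {.inl none}) none
          rwa [Equiv.swap_apply_left, hc', Set.image_pair,
            Equiv.swap_apply_of_ne_of_ne (a := none) (x := some (Sum.inl none)) (by simp) (by simp)]
            at this
        have e3 : Equiv.swap none (some (.inr k)) (some v) ≠
            some (.inl none : Option A ⊕ Fin b) := by
          intro h
          rw [← Equiv.swap_apply_of_ne_of_ne (a := none) (b := some (.inr k))
            (x := some (.inl none : Option A ⊕ Fin b)) (by simp) (by simp)] at h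
          exact hva (Option.some_injective _ ((Equiv.injective _) h))
        rcases contr_leaf (B := black (Option A) b) e1 (some_mem_withNone.2 ⟨k, rfl⟩) e3 e2 hT'
          with h | h | ⟨h, -⟩ | h
        · exact hF T' h
        · rw [swap_depth] at h
          exact hlow T' (hd ▸ h)
        · simp at h
        · exact absurd (Option.some_injective _ h).symm hv'
    · exact absurd (Or.inl ⟨c, h⟩) ht

end

end RTOp

/-! ### Target trees as expansions -/

namespace RTOp

open LinOperad LinOperad.LieElement RTree

section

variable {V W : Type} {B : Set V} {a : V}

theorem expand_relabel (e : V ≃ W) (T : RTree V) :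
    expand (e a) (T.relabel e) = (expand a T).relabel e.optionCongr := by
  have hn : ((T.relabel e).children (e a)).Nontrivial ↔ (T.children a).Nontrivial := by
    rw [children_relabel, Set.image_nontrivial e.injective]
  by_cases h : (T.children a).Nontrivial
  · rw [expand_nontrivial h, expand_nontrivial (hn.2 h), pushDown_relabel]
  · rw [expand, expand, if_neg h, if_neg (fun h' => h (hn.1 h'))]
    have hp : (T.relabel e).parent (e a) = (T.parent a).map e := by simp
    rw [hp]
    rcases T.parent a with _ | v
    · exact (pushDown_relabel e T a).symm
    · have := splitAbove_relabel T v {a} e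
      rw [Set.image_singleton] at this
      exact this.symm

theorem exists_pushDown {U : RTree (Option V)} (hU : Bushy (withNone B) U) (ha : a ∉ B)
    (hc : U.children (some a) = {none}) :
    ∃ T, Bushy B T ∧ ¬ IsTarget B a T ∧ U = expand a T := by
  have hp : U.parent none = some (some a) := by
    have : none ∈ U.children (some a) := by rw [hc]; rfl
    exact this
  obtain ⟨T, hT⟩ := exists_below hp
  have hn : (T.children a).Nontrivial := by
    have h1 := (below_iff_contr.1 hT).children_glue
    rw [show con a (some a) = a from rfl] at h1
    rw [h1]
    exact ((hU none none_mem_withNone).image_of_injOn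
      ((below_iff_contr.1 hT).injOn (U.parent_ne_self none))).mono
      (Set.image_mono Set.subset_union_right)
  refine ⟨T, fun k hk => ?_, not_isTarget_of_nontrivial hn, ?_⟩
  · rw [← children_some_nontrivial_of_below hT (by rintro rfl; exact ha hk)]
    exact hU _ (some_mem_withNone.2 hk)
  · rw [expand_nontrivial hn, hT.eq_pushDown hc]

theorem exists_splitAbove {U : RTree (Option V)} (hU : Bushy (withNone B) U)
    (h0 : U.children (some a) = ∅) {w : Option V} (hw : w ≠ some a)
    (hc : U.children none = {some a, w}) :
    ∃ T, Bushy B T ∧ ¬ IsTarget B a T ∧ U = expand a T := by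
  have hpw : w ∈ U.children none := by rw [hc]; exact Or.inr rfl
  have hpa : some a ∈ U.children none := by rw [hc]; exact Or.inl rfl
  rcases w with _ | v
  · exact absurd hpw (U.parent_ne_self none)
  have hva : v ≠ a := fun h => hw (congrArg some h)
  obtain ⟨T, hT⟩ := exists_above hpw
  have hC := above_iff_contr.1 hT
  have hTa : T.parent a = some v := by
    have := hC.parent (some a) (by simpa using hva.symm)
    rwa [show U.parent (some a) = some none from hpa] at this
  have hT0 : T.children a = ∅ := by
    have := hC.children (x := some a) (by simpa using hva.symm) (by simp)
    rwa [h0, Set.image_empty] at this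
  have hU' : U = T.splitAbove v {a} := by
    refine hT.eq_splitAbove fun u hu _ => ?_
    have : some u ∈ U.children none ↔ some u ∈ ({some a, some v} : Set (Option V)) := by rw [hc]
    rw [show U.parent (some u) = some none ↔ some u ∈ U.children none from Iff.rfl, this]
    simp [hu]
  have hv : ∀ y ∈ U.children (some v), con v y ∈ T.children v ∧ con v y ≠ a := by
    intro y hy
    refine ⟨?_, con_some_ne hva ?_⟩
    · have h1 := hC.children_glue
      rw [show con v none = v from rfl] at h1
      rw [h1]
      exact Set.mem_image_of_mem _ (Or.inr hy)
    · rintro rfl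
      have h2 : U.parent (some a) = some none := hpa
      rw [show U.parent (some a) = some (some v) from hy] at h2
      simp at h2
  have hinj : Set.InjOn (con v) (U.children (some v)) := hC.injOn (U.parent_ne_self (some v))
  refine ⟨T, fun k hk => ?_, ?_, by rw [expand_leaf hT0 hTa, hU']⟩
  · by_cases hkv : k = v
    · subst hkv
      obtain ⟨y, hy, z, hz, hyz⟩ := hU _ (some_mem_withNone.2 hk)
      exact ⟨_, (hv y hy).1, _, (hv z hz).1, fun h => hyz (hinj hy hz h)⟩
    · rw [← children_some_nontrivial_of_above hT hkv]
      exact hU _ (some_mem_withNone.2 hk)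
  · rintro (⟨c, hc⟩ | ⟨-, k, hk, u, -, hk'⟩)
    · rw [hT0] at hc; exact Set.singleton_ne_empty _ hc.symm
    · have : a ∈ T.children k := by rw [hk']; exact Or.inl rfl
      obtain rfl : v = k := Option.some_injective _ (hTa.symm.trans this)
      obtain ⟨y, hy, z, hz, hyz⟩ := hU _ (some_mem_withNone.2 hk)
      have h1 := (hv y hy).1
      have h2 := (hv z hz).1
      rw [hk'] at h1 h2
      have h1 := h1.resolve_left (hv y hy).2
      have h2 := h2.resolve_left (hv z hz).2
      exact hyz (hinj hy hz (h1.trans h2.symm))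

end

variable {K : Type u} [Field K] {A : Type} {b n : ℕ}

theorem depth_expand [Nonempty A] {T : RTree (Option A ⊕ Fin b)}
    (ht : ¬ IsTarget (black (Option A) b) (.inl none) T) :
    (expand (.inl none) T).depth (some (.inl none)) = T.depth (.inl none) ∧
      ∀ a, (expand (.inl none) T).parent (some (.inl (some a))) ≠ some (some (.inl none)) := by
  by_cases h : (T.children (.inl none)).Nontrivial
  · rw [expand_nontrivial h]
    refine ⟨depth_of_below (T.below_pushDown _), fun a ha => ?_⟩
    have : some (.inl (some a)) ∈ (T.pushDown (.inl none)).children (some (.inl none)) := ha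
    rw [children_pushDown_self] at this
    simp at this
  · rw [Set.not_nontrivial_iff] at h
    rcases h.eq_empty_or_singleton with h | ⟨c, h⟩
    · obtain ⟨a⟩ := ‹Nonempty A›
      obtain ⟨v, hv⟩ := T.exists_parent_of_leaf h (w := .inl (some a)) (by simp)
      rw [expand_leaf h hv]
      refine ⟨depth_splitAbove_leaf hv, fun a ha => ?_⟩
      have : some (.inl (some a)) ∈ (T.splitAbove v {.inl none}).children (some (.inl none)) := ha
      rw [children_splitAbove_leaf h hv] at this
      exact this
    · exact absurd (Or.inl ⟨c, h⟩) ht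

theorem isGood_relabel_cons {U : RTree (Option (A ⊕ Fin b))} :
    IsGood (U.relabel (cons A b)) ↔ Bushy (withNone (black A b)) U := by
  rw [isGood_iff, bushy_relabel (cons A b) (fun _ => cons_mem_black)]

theorem isTarget_relabel_cons {U : RTree (Option (A ⊕ Fin b))} {v : A ⊕ Fin b} :
    IsTarget (black A (b + 1)) (cons A b (some v)) (U.relabel (cons A b)) ↔
      IsTarget (withNone (black A b)) (some v) U :=
  isTarget_relabel (cons A b) (fun _ => cons_mem_black)

theorem blackPerm_mem_black (σ : Equiv.Perm (Fin n)) (w : A ⊕ Fin n) :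
    blackPerm A σ w ∈ black A n ↔ w ∈ black A n := by
  rcases w with _ | _ <;> simp [blackPerm, black]

theorem isGood_blackPerm (σ : Equiv.Perm (Fin n)) (U : RTree (A ⊕ Fin n)) :
    IsGood (U.relabel (blackPerm A σ)) ↔ IsGood U := by
  rw [isGood_iff, isGood_iff, bushy_relabel _ (blackPerm_mem_black σ)]

theorem isTarget_blackPerm (σ : Equiv.Perm (Fin n)) (U : RTree (A ⊕ Fin n)) (a : A) :
    IsTarget (black A n) (.inl a) (U.relabel (blackPerm A σ)) ↔ IsTarget (black A n) (.inl a) U :=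
  isTarget_relabel (blackPerm A σ) (blackPerm_mem_black σ) (a := .inl a)

theorem exists_insAbove {U : RTree (Option A ⊕ Fin n)} {a : A}
    (h : U.children (.inl none) = {.inl (some a)}) : ∃ T, U = insAbove a T := by
  have hc : (U.relabel (optL A (Fin n))).children none = {some (.inl a)} := by
    have := children_relabel (optL A (Fin n)) U (.inl none)
    rw [h, Set.image_singleton] at this
    exact this
  obtain ⟨T, hT⟩ := exists_above (U := U.relabel (optL A (Fin n))) (v := .inl a) (by
    have : some (.inl a) ∈ (U.relabel (optL A (Fin n))).children none := by rw [hc]; rfl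
    exact this)
  refine ⟨T, ?_⟩
  rw [insAbove, ← hT.eq_splitAbove (S := ∅) fun w hw _ => ?_, relabel_relabel_symm]
  simp only [Set.mem_empty_iff_false, iff_false]
  intro hp
  have : some w ∈ (U.relabel (optL A (Fin n))).children none := hp
  rw [hc] at this
  exact hw (Option.some_injective _ this)

/-- A good target in which the only child of the marked input, or its parent when it is a leaf, is a
black vertex is, up to the order of the black vertices, the expansion of a good tree which is not a
target. -/
theorem exists_expand {U : RTree (Option A ⊕ Fin (b + 1))} (hU : IsGood U) (k : Fin (b + 1))
    (h : U.children (.inl none) = {.inr k} ∨ U.children (.inl none) = ∅ ∧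
      ∃ w, w ≠ .inl none ∧ U.children (.inr k) = {.inl none, w}) :
    ∃ (σ : Equiv.Perm (Fin (b + 1))) (T : RTree (Option A ⊕ Fin b)), IsGood T ∧
      ¬ IsTarget (black (Option A) b) (.inl none) T ∧
      U.relabel (blackPerm (Option A) σ) =
        (expand (.inl none) T).relabel (cons (Option A) b) := by
  obtain ⟨U', hU'⟩ : ∃ U' : RTree (Option (Option A ⊕ Fin b)),
      U.relabel (blackPerm (Option A) (Equiv.swap 0 k)) = U'.relabel (cons (Option A) b) :=
    ⟨_, (relabel_symm_relabel (cons (Option A) b) _).symm⟩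
  let e := (blackPerm (Option A) (Equiv.swap 0 k)).trans (cons (Option A) b).symm
  have hUe : U' = U.relabel e := by
    rw [← RTree.relabel_relabel, hU', relabel_relabel_symm]
  have ea : e (.inl none) = some (.inl none) := rfl
  have ek : e (.inr k) = none := by
    change (cons (Option A) b).symm (.inr (Equiv.swap 0 k k)) = none
    rw [Equiv.swap_apply_right]; rfl
  have hB : Bushy (withNone (black (Option A) b)) U' := by
    rwa [← isGood_relabel_cons, ← hU', isGood_blackPerm]
  have ca := children_relabel e U (.inl none)
  have ck := children_relabel e U (.inr k)
  rw [ea, ← hUe] at ca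
  rw [ek, ← hUe] at ck
  have hT : ∃ T, Bushy (black (Option A) b) T ∧ ¬ IsTarget (black (Option A) b) (.inl none) T ∧
      U' = expand (.inl none) T := by
    rcases h with h | ⟨h0, w, hw, h1⟩
    · refine exists_pushDown hB (by simp [black]) ?_
      rw [ca, h, Set.image_singleton, ek]
    · refine exists_splitAbove hB (by rw [ca, h0, Set.image_empty]) (w := e w) ?_
        (by rw [ck, h1, Set.image_pair, ea])
      rw [← ea]
      exact fun h => hw (e.injective h)
  obtain ⟨T, h1, h2, h3⟩ := hT
  exact ⟨Equiv.swap 0 k, T, isGood_iff.2 h1, h2, by rw [hU', h3]⟩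

section Injective

variable [Finite A] [Fintype A]

/-- Coefficients which contribute nothing to the target trees vanish, by induction on the depth of
the input into which the bracket is inserted. -/
theorem eq_zero_of_insPart {f : A → RTree (A ⊕ Fin n) → K} (hf : ∀ a T, ¬ IsGood T → f a T = 0)
    (h : ∀ U, IsGood U → IsTarget (black (Option A) n) (.inl none) U → insPart f U = 0)
    (a : A) (T : RTree (A ⊕ Fin n)) : f a T = 0 := by
  have key : ∀ d a (T : RTree (A ⊕ Fin n)), T.depth (.inl a) < d → f a T = 0 := by
    intro d
    induction d with
    | zero => intro a T hd; omega
    | succ d ih =>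
      intro a T hd
      by_cases hT : IsGood T
      · rw [← insPart_insAbove fun a' T' h' => ih a' T' (by omega)]
        refine h _ ?_ (Or.inl ⟨_, children_insAbove a T⟩)
        rwa [isGood_of_above (a := a) (T := T)]
        rw [insAbove_relabel]
        exact T.above_splitAbove _ _
      · exact hf a T hT
  exact key _ a T (Nat.lt_succ_self _)

/-- The same with the differential of an operation `x` without coefficients at target trees: the
induction is on the depth of the input into which the bracket is inserted and, for `x`, on the depth
of the marked input. -/
theorem eq_zero_of_insPart_add [CharZero K] [Nonempty A] {x : TwObj (rtLin K) (Option A) b}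
    {f : A → RTree (A ⊕ Fin (b + 1)) → K} (hf : ∀ a T, ¬ IsGood T → f a T = 0)
    (hx : ∀ T, ¬ IsGood T → altTree K (Option A) b x T = 0)
    (hF : ∀ T, IsTarget (black (Option A) b) (.inl none) T → altTree K (Option A) b x T = 0)
    (h : ∀ U, IsGood U → IsTarget (black (Option A) (b + 1)) (.inl none) U →
      insPart f U + altTree K (Option A) (b + 1) (twD (bracket K) (Option A) b x) U = 0) :
    (∀ a T, f a T = 0) ∧ ∀ T, altTree K (Option A) b x T = 0 := by
  have key : ∀ d, (∀ a (T : RTree (A ⊕ Fin (b + 1))), T.depth (.inl a) < d → f a T = 0) ∧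
      ∀ T : RTree (Option A ⊕ Fin b), T.depth (.inl none) < d → altTree K (Option A) b x T = 0 := by
    intro d
    induction d with
    | zero =>
      exact ⟨fun _ _ h => absurd h (Nat.not_lt_zero _), fun _ h => absurd h (Nat.not_lt_zero _)⟩
    | succ d ih =>
      refine ⟨fun a T hd => ?_, fun T hd => ?_⟩
      · by_cases hT : IsGood T
        · have hg : IsGood (insAbove a T) := by
            rwa [isGood_of_above (a := a) (T := T)]
            rw [insAbove_relabel]
            exact T.above_splitAbove _ _
          have := h _ hg (Or.inl ⟨_, children_insAbove a T⟩)
          rwa [insPart_insAbove fun a' T' h' => ih.1 a' T' (by omega),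
            alt_twD_zero_of_single hF hg (children_insAbove a T) fun T' h' => ih.2 T' (by
              rw [depth_insAbove] at h'; omega), add_zero] at this
        · exact hf a T hT
      · by_cases hT : IsGood T
        · by_cases ht : IsTarget (black (Option A) b) (.inl none) T
          · exact hF T ht
          obtain ⟨hd', hc⟩ := depth_expand ht
          obtain ⟨h1, h2⟩ := expand_good hT ht
          refine alt_twD_expand hF hT ht (fun T' h' => ih.2 T' (by omega)) ?_
          have := h _ (isGood_relabel_cons.2 h1) (isTarget_relabel_cons.2 h2)
          rwa [insPart_zero, zero_add] at this
          · intro a T' h'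
            refine ih.1 a T' ?_
            have := depth_cons (expand (.inl none) T) (.inl none)
            rw [show cons (Option A) b (some (.inl none)) = .inl none from rfl] at this
            omega
          · intro a ha
            refine hc a ?_
            rw [RTree.relabel_parent, Option.map_eq_some_iff] at ha
            obtain ⟨w, hw, hw'⟩ := ha
            rw [← Equiv.eq_symm_apply] at hw'
            rw [hw'] at hw
            exact hw
        · exact hx T hT
  exact ⟨fun a T => (key _).1 a T (Nat.lt_succ_self _), fun T => (key _).2 T (Nat.lt_succ_self _)⟩

end Injective

end RTOp

/-! ### Preparations from linear algebra -/

/-- A map `M` which is injective modulo `S` is surjective modulo `S` if `Z ⧸ S` is not larger than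
`X`, as is witnessed by a map `J` with kernel contained in `S`. -/
theorem LinearMap.exists_sub_mem_of_injective {K X Z : Type*} [Field K] [AddCommGroup X]
    [Module K X] [AddCommGroup Z] [Module K Z] [Module.Finite K X] [Module.Finite K Z]
    (M : X →ₗ[K] Z) (J : Z →ₗ[K] X) (S : Submodule K Z) (hJ : LinearMap.ker J ≤ S)
    (hM : ∀ x, M x ∈ S → x = 0) (z : Z) : ∃ x, z - M x ∈ S := by
  have h1 : Function.Injective (S.mkQ ∘ₗ M) := by
    rw [injective_iff_map_eq_zero]
    intro x hx
    exact hM x ((Submodule.Quotient.mk_eq_zero S).1 hx)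
  have h2 : Module.finrank K (Z ⧸ S) ≤ Module.finrank K X := by
    have e1 := S.finrank_quotient_add_finrank
    have e2 := J.finrank_range_add_finrank_ker
    have e3 := Submodule.finrank_mono hJ
    have e4 := Submodule.finrank_le (LinearMap.range J)
    omega
  have h3 : Function.Surjective (S.mkQ ∘ₗ M) :=
    (LinearMap.injective_iff_surjective_of_finrank_eq_finrank
      (le_antisymm (LinearMap.finrank_le_finrank_of_injective h1) h2)).1 h1
  obtain ⟨x, hx⟩ := h3 (S.mkQ z)
  exact ⟨x, (Submodule.Quotient.eq S).1 hx.symm⟩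

/-! ### The bracket is a cycle -/

namespace LinOperad.LieElement

variable {K : Type u} [Field K] {P : LinOperad K} (β : LieElement P)

/-- The bracket is a cycle in the twisted operad: this is the Jacobi identity. -/
theorem twD_emb_val : twD β (Fin 2) 0 (emb P (Fin 2) β.val) = 0 := by
  have h : β.twistOp (fun _ => 1) β.br = 0 := by
    rw [twistOp_apply, Fintype.sum_option, Fintype.sum_unique, splitAt_none, one_smul, one_smul,
      ad_br]
    change _ - (β.dbl + β.splitAt (some ()) β.br) = 0
    rw [splitAt_br]
    abel
  rw [emb_apply, twD_mk, rawD, LinearMap.comp_apply, val_eq, P.map_map]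
  have h2 := twistOp_map β (opt2.symm.trans (Equiv.sumEmpty (Fin 2) (Fin 0)).symm)
    (weight (K := K) (Fin 2) 0) β.br
  have h3 : (fun v => weight (K := K) (Fin 2) 0 ((opt2.symm.trans
      (Equiv.sumEmpty (Fin 2) (Fin 0)).symm) v)) = fun _ => 1 := rfl
  rw [h2]
  rw [h3, h, map_zero, map_zero, map_zero]

end LinOperad.LieElement

namespace RTOp

open LinOperad LinOperad.LieElement RTree

variable {K : Type u} [Field K]

/-! ### Operations as functions on trees -/

theorem altTree_injective [CharZero K] (A : Type) [Finite A] (n : ℕ) :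
    Function.Injective (altTree K A n) := alt_injective (P := rtLin K) A n

theorem altTree_equivariant {A : Type} [Finite A] {n : ℕ} (x : TwObj (rtLin K) A n)
    (σ : Equiv.Perm (Fin n)) (U : RTree (A ⊕ Fin n)) :
    altTree K A n x (U.relabel (blackPerm A σ)) =
      ((Equiv.Perm.sign σ : ℤ) : K) * altTree K A n x U := by
  have h := congrFun (map_alt (P := rtLin K) σ x) (U.relabel (blackPerm A σ))
  have h2 : altTree K A n x ((U.relabel (blackPerm A σ)).relabel (blackPerm A σ).symm) =
      ((Equiv.Perm.sign σ : ℤ) : K) * altTree K A n x (U.relabel (blackPerm A σ)) := h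
  rw [relabel_relabel_symm] at h2
  rw [h2, ← mul_assoc, sign_mul_sign, one_mul]

theorem altTree_mk_apply {A : Type} [Finite A] {n : ℕ} (f : RTree (A ⊕ Fin n) → K)
    (U : RTree (A ⊕ Fin n)) :
    altTree K A n (twMk (rtLin K) A n f) U = ∑ σ : Equiv.Perm (Fin n),
      ((Equiv.Perm.sign σ : ℤ) : K) * f (U.relabel (blackPerm A σ).symm) := by
  have h : altTree K A n (twMk (rtLin K) A n f) = (∑ σ : Equiv.Perm (Fin n),
      ((Equiv.Perm.sign σ : ℤ) : K) • fun U => f (U.relabel (blackPerm A σ).symm) :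
      RTree (A ⊕ Fin n) → K) := altRaw_apply (P := rtLin K) f
  rw [h, Finset.sum_apply]
  rfl

theorem blackPerm_symm {A : Type} {n : ℕ} (σ : Equiv.Perm (Fin n)) :
    (blackPerm A σ).symm = blackPerm A σ⁻¹ := by
  ext (_ | _) <;> rfl

theorem altTree_good {A : Type} [Finite A] {n : ℕ} {x : TwObj (rtLin K) A n}
    (hx : x ∈ goodSpan K A n) {U : RTree (A ⊕ Fin n)} (hU : ¬ IsGood U) :
    altTree K A n x U = 0 := by
  classical
  induction hx using Submodule.span_induction with
  | zero => rw [map_zero]; rfl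
  | add x y _ _ h h' => rw [map_add, Pi.add_apply, h, h', add_zero]
  | smul c x _ h => rw [map_smul, Pi.smul_apply, h, smul_zero]
  | mem x hx =>
    obtain ⟨T, hT, rfl⟩ := hx
    rw [altTree_mk_apply]
    refine Finset.sum_eq_zero fun σ _ => ?_
    rw [single_apply, if_neg, mul_zero]
    rintro rfl
    rw [blackPerm_symm, isGood_blackPerm] at hT
    exact hU hT

section

variable {A : Type} {n : ℕ}

theorem insAbove_blackPerm (a : A) (T : RTree (A ⊕ Fin n)) (σ : Equiv.Perm (Fin n)) :
    insAbove a (T.relabel (blackPerm A σ)) = (insAbove a T).relabel (blackPerm (Option A) σ) := by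
  have h := splitAbove_relabel T (.inl a) ∅ (blackPerm A σ)
  rw [Set.image_empty, show blackPerm A σ (.inl a) = .inl a from rfl] at h
  rw [insAbove, insAbove, ← h, relabel_relabel, relabel_relabel]
  congr 1
  ext (_ | _ | _) <;> rfl

theorem expand_blackPerm (T : RTree (Option A ⊕ Fin n)) (σ : Equiv.Perm (Fin n)) :
    (expand (.inl none) (T.relabel (blackPerm (Option A) σ))).relabel (cons (Option A) n) =
      ((expand (.inl none) T).relabel (cons (Option A) n)).relabel
        (blackPerm (Option A) (Equiv.Perm.decomposeFin.symm (0, σ))) := by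
  have h := expand_relabel (a := .inl none) (blackPerm (Option A) σ) T
  rw [show blackPerm (Option A) σ (.inl none) = .inl none from rfl] at h
  rw [h, relabel_relabel, relabel_relabel]
  congr 1
  refine Equiv.ext ?_
  rintro (_ | _ | k)
  · exact congrArg Sum.inr (by simp)
  · rfl
  · exact congrArg Sum.inr (by simp)

theorem isGood_insAbove (a : A) (T : RTree (A ⊕ Fin n)) : IsGood (insAbove a T) ↔ IsGood T :=
  isGood_of_above (a := a) (by rw [insAbove_relabel]; exact T.above_splitAbove _ _)

open Classical in
/-- The function whose value at a good tree `T` which is not a target is the given coefficient at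
the expansion of `T`. -/
noncomputable def readExpandFun (A : Type) (n : ℕ) :
    (RTree (Option A ⊕ Fin (n + 1)) → K) →ₗ[K] (RTree (Option A ⊕ Fin n) → K) :=
  LinearMap.pi fun T => if IsGood T ∧ ¬ IsTarget (black (Option A) n) (.inl none) T then
    LinearMap.proj ((expand (.inl none) T).relabel (cons (Option A) n)) else 0

theorem readExpandFun_pos (f : RTree (Option A ⊕ Fin (n + 1)) → K) {T : RTree (Option A ⊕ Fin n)}
    (h : IsGood T) (h' : ¬ IsTarget (black (Option A) n) (.inl none) T) :
    readExpandFun A n f T = f ((expand (.inl none) T).relabel (cons (Option A) n)) := by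
  rw [readExpandFun, LinearMap.pi_apply, if_pos ⟨h, h'⟩]; rfl

theorem readExpandFun_neg (f : RTree (Option A ⊕ Fin (n + 1)) → K) {T : RTree (Option A ⊕ Fin n)}
    (h : ¬ (IsGood T ∧ ¬ IsTarget (black (Option A) n) (.inl none) T)) :
    readExpandFun A n f T = 0 := by
  rw [readExpandFun, LinearMap.pi_apply, if_neg h]; rfl

end

section

variable [CharZero K]

/-- The coefficients of an operation of `TRT`, as a sign-equivariant function on trees with ordered
black vertices. -/
noncomputable def coeff (A : Type) [Finite A] (n : ℕ) :
    (TRT K).obj A n →ₗ[K] (RTree (A ⊕ Fin n) → K) :=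
  (altTree K A n ∘ₗ (goodSpan K A n).subtype : goodSpan K A n →ₗ[K] (RTree (A ⊕ Fin n) → K))

variable {A : Type} [Finite A] {n : ℕ}

theorem coeff_injective : Function.Injective (coeff (K := K) A n) :=
  (altTree_injective A n).comp Subtype.val_injective

theorem coeff_equivariant (x : (TRT K).obj A n) (σ : Equiv.Perm (Fin n)) (U : RTree (A ⊕ Fin n)) :
    coeff A n x (U.relabel (blackPerm A σ)) = ((Equiv.Perm.sign σ : ℤ) : K) * coeff A n x U :=
  altTree_equivariant _ σ U

theorem coeff_good (x : (TRT K).obj A n) {U : RTree (A ⊕ Fin n)} (hU : ¬ IsGood U) :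
    coeff A n x U = 0 := altTree_good x.2 hU

theorem coeff_d (x : (TRT K).obj A n) :
    coeff A (n + 1) ((TRT K).d n x) = altTree K A (n + 1) (twD (bracket K) A n x.1) := rfl

theorem coeff_ins (a : A) (x : (TRT K).obj A n) (U : RTree (Option A ⊕ Fin n)) :
    coeff (Option A) n ((TRT K).ins (TRT.bracket K) a n x) U =
      splitTree K (.inl a) (coeff A n x) (U.relabel (optL A (Fin n))) :=
  congrFun (alt_ins (bracket K) a x.1) U

theorem coeff_sum_ins [Fintype A] (f : A → (TRT K).obj A n) (U : RTree (Option A ⊕ Fin n)) :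
    coeff (Option A) n (∑ a, (TRT K).ins (TRT.bracket K) a n (f a)) U =
      insPart (fun a => coeff A n (f a)) U := by
  rw [map_sum, Finset.sum_apply]
  exact Finset.sum_congr rfl fun a _ => coeff_ins a (f a) U

theorem d_bracket : (TRT K).d 0 (TRT.bracket K) = 0 :=
  Subtype.ext (twD_emb_val (bracket K))

instance : Module.Finite K ((TRT K).obj A n) :=
  Module.Finite.of_injective (coeff A n) coeff_injective

open Classical in
/-- The operation of `TRT` represented by a function on trees; its values at trees with a black
vertex with fewer than two children are discarded. -/
noncomputable def ofCoeff (A : Type) [Finite A] (n : ℕ) :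
    (RTree (A ⊕ Fin n) → K) →ₗ[K] (TRT K).obj A n :=
  let E : (RTree (A ⊕ Fin n) → K) →ₗ[K] (RTree (A ⊕ Fin n) → K) :=
    LinearMap.pi fun U => if IsGood U then LinearMap.proj U else 0
  (LinearMap.codRestrict (goodSpan K A n) (twMk (rtLin K) A n ∘ₗ E) fun f =>
    goodSpan_of_support (E f) fun U hU => by
      by_contra h
      exact hU (by simp [E, h]) : (RTree (A ⊕ Fin n) → K) →ₗ[K] goodSpan K A n)

theorem coeff_ofCoeff {f : RTree (A ⊕ Fin n) → K} (hf : ∀ U, ¬ IsGood U → f U = 0)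
    (he : ∀ σ U, f (U.relabel (blackPerm A σ)) = ((Equiv.Perm.sign σ : ℤ) : K) * f U)
    (U : RTree (A ⊕ Fin n)) : coeff A n (ofCoeff A n f) U = (n.factorial : K) * f U := by
  classical
  have h : coeff A n (ofCoeff A n f) = altTree K A n (twMk (rtLin K) A n f) := by
    refine congrArg (fun g => altTree K A n (twMk (rtLin K) A n g)) (funext fun U => ?_)
    change (if IsGood U then LinearMap.proj U else 0 : (RTree (A ⊕ Fin n) → K) →ₗ[K] K) f = f U
    split_ifs with hU
    · rfl
    · exact (hf U hU).symm
  rw [h, altTree_mk_apply]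
  have h2 : ∀ σ : Equiv.Perm (Fin n), ((Equiv.Perm.sign σ : ℤ) : K) *
      f (U.relabel (blackPerm A σ).symm) = f U := fun σ => by
    rw [blackPerm_symm, he, ← mul_assoc, Equiv.Perm.sign_inv, sign_mul_sign, one_mul]
  simp_rw [h2]
  rw [Finset.sum_const, Finset.card_univ, Fintype.card_perm, Fintype.card_fin, nsmul_eq_mul]

/-! ### Solving for the coefficients of the target trees -/

/-- The operation whose coefficient at `T` is `n!` times the given coefficient at
`insAbove a T`. -/
noncomputable def readAbove (a : A) (n : ℕ) : (TRT K).obj (Option A) n →ₗ[K] (TRT K).obj A n :=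
  ofCoeff A n ∘ₗ LinearMap.funLeft K K (insAbove a) ∘ₗ coeff (Option A) n

theorem coeff_readAbove (a : A) (z : (TRT K).obj (Option A) n) (T : RTree (A ⊕ Fin n)) :
    coeff A n (readAbove a n z) T = (n.factorial : K) * coeff (Option A) n z (insAbove a T) := by
  refine coeff_ofCoeff (f := fun T => coeff (Option A) n z (insAbove a T)) (fun U hU => ?_)
    (fun σ U => ?_) T
  · exact coeff_good z (mt (isGood_insAbove a U).1 hU)
  · rw [insAbove_blackPerm, coeff_equivariant]

variable (K A n) in
/-- The operations whose coefficients at all target trees vanish. -/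
noncomputable def nonTarget : Submodule K ((TRT K).obj (Option A) n) where
  carrier := {x | ∀ T, IsTarget (black (Option A) n) (.inl none) T → coeff (Option A) n x T = 0}
  add_mem' hx hy T hT := by rw [map_add, Pi.add_apply, hx T hT, hy T hT, add_zero]
  zero_mem' T _ := by rw [map_zero]; rfl
  smul_mem' c x hx T hT := by rw [map_smul, Pi.smul_apply, hx T hT, smul_zero]

theorem coeff_ofCoeff_readExpandFun (z : (TRT K).obj (Option A) (n + 1))
    (T : RTree (Option A ⊕ Fin n)) :
    coeff (Option A) n (ofCoeff (Option A) n (readExpandFun A n (coeff _ _ z))) T =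
      (n.factorial : K) * readExpandFun A n (coeff _ _ z) T := by
  refine coeff_ofCoeff (fun U hU => readExpandFun_neg _ fun h => hU h.1) (fun σ U => ?_) T
  by_cases h : IsGood U ∧ ¬ IsTarget (black (Option A) n) (.inl none) U
  · rw [readExpandFun_pos _ h.1 h.2, readExpandFun_pos _ ((isGood_blackPerm σ U).2 h.1)
      (mt (isTarget_blackPerm σ U none).1 h.2), expand_blackPerm, coeff_equivariant,
      Equiv.Perm.decomposeFin.symm_sign, if_pos rfl, one_mul]
  · rw [readExpandFun_neg _ h, readExpandFun_neg, mul_zero]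
    rwa [isGood_blackPerm, isTarget_blackPerm]

/-- The operation whose coefficient at a tree `T` which is not a target is `n!` times the given
coefficient at the expansion of `T`. -/
noncomputable def readExpand (A : Type) [Finite A] (n : ℕ) :
    (TRT K).obj (Option A) (n + 1) →ₗ[K] nonTarget K A n :=
  LinearMap.codRestrict _ (ofCoeff (Option A) n ∘ₗ readExpandFun A n ∘ₗ coeff _ _) fun z T hT =>
    (coeff_ofCoeff_readExpandFun z T).trans (by
      rw [readExpandFun_neg _ fun h => h.2 hT, mul_zero])

theorem mem_nonTarget_of_readAbove {z : (TRT K).obj (Option A) 0}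
    (h : ∀ a, readAbove a 0 z = 0) : z ∈ nonTarget K A 0 := by
  intro U hU
  rcases hU with ⟨v, hv⟩ | ⟨-, k, ⟨j, -⟩, -⟩
  · rcases v with (_ | a) | k
    · exact absurd (show U.parent (.inl none) = some (.inl none) by
        have : Sum.inl none ∈ U.children (.inl none) := by rw [hv]; rfl
        exact this) (U.parent_ne_self _)
    · obtain ⟨T, rfl⟩ := exists_insAbove hv
      have := coeff_readAbove a z T
      rw [h a, map_zero] at this
      simpa using this.symm
    · exact k.elim0
  · exact j.elim0

theorem mem_nonTarget_of_read {z : (TRT K).obj (Option A) (n + 1)}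
    (h : ∀ a, readAbove a (n + 1) z = 0) (h' : readExpand A n z = 0) :
    z ∈ nonTarget K A (n + 1) := by
  intro U hU
  by_cases hg : IsGood U
  swap
  · exact coeff_good z hg
  have key : ∀ k : Fin (n + 1), (U.children (.inl none) = {.inr k} ∨
      U.children (.inl none) = ∅ ∧
        ∃ w, w ≠ .inl none ∧ U.children (.inr k) = {.inl none, w}) →
      coeff (Option A) (n + 1) z U = 0 := by
    intro k hk
    obtain ⟨σ, T, hT, ht, hUT⟩ := exists_expand hg k hk
    have h1 := coeff_ofCoeff_readExpandFun z T
    rw [readExpandFun_pos _ hT ht, ← hUT, coeff_equivariant] at h1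
    have h2 : ofCoeff (Option A) n (readExpandFun A n (coeff _ _ z)) = 0 :=
      congrArg Subtype.val h'
    rw [h2, map_zero] at h1
    have h3 := mul_eq_zero.1 h1.symm
    have h4 : (n.factorial : K) ≠ 0 := by exact_mod_cast n.factorial_ne_zero
    have h5 := (mul_eq_zero.1 (h3.resolve_left h4))
    refine h5.resolve_left fun h6 => ?_
    have := sign_mul_sign (K := K) σ
    rw [h6, zero_mul] at this
    exact zero_ne_one this
  rcases hU with ⟨v, hv⟩ | ⟨h0, k, ⟨j, rfl⟩, u, hu, hk⟩
  · rcases v with (_ | a) | k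
    · exact absurd (show U.parent (.inl none) = some (.inl none) by
        have : Sum.inl none ∈ U.children (.inl none) := by rw [hv]; rfl
        exact this) (U.parent_ne_self _)
    · obtain ⟨T, rfl⟩ := exists_insAbove hv
      have := coeff_readAbove a z T
      rw [h a, map_zero] at this
      exact (mul_eq_zero.1 this.symm).resolve_left (by exact_mod_cast (n + 1).factorial_ne_zero)
    · exact key k (Or.inl hv)
  · exact key j (Or.inr ⟨h0, u, hu, hk⟩)

variable [Fintype A]

variable (K A n) in
/-- The operation obtained by inserting the bracket with the new input into all inputs. -/
noncomputable def insAll : (A → (TRT K).obj A n) →ₗ[K] (TRT K).obj (Option A) n :=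
  ∑ a, (TRT K).ins (TRT.bracket K) a n ∘ₗ LinearMap.proj a

theorem insAll_apply (f : A → (TRT K).obj A n) :
    insAll K A n f = ∑ a, (TRT K).ins (TRT.bracket K) a n (f a) := by
  simp [insAll]

theorem d_insAll (f : A → (TRT K).obj A n) :
    (TRT K).d n (insAll K A n f) = insAll K A (n + 1) fun a => (TRT K).d n (f a) := by
  rw [insAll_apply, insAll_apply, map_sum]
  exact Finset.sum_congr rfl fun a _ => (TRT K).d_ins _ d_bracket a n (f a)

/-! ### Cycles with one more input -/

theorem eq_zero_of_insAll_mem {f : A → (TRT K).obj A n} (h : insAll K A n f ∈ nonTarget K A n) :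
    f = 0 := by
  funext a
  refine coeff_injective ?_
  rw [Pi.zero_apply, map_zero]
  funext T
  refine eq_zero_of_insPart (f := fun a => coeff A n (f a)) (fun a T hT => coeff_good _ hT) ?_ a T
  intro U _ hU
  rw [← coeff_sum_ins, ← insAll_apply]
  exact h U hU

/-- The triangular map is injective. -/
theorem eq_zero_of_insAll_add_d_mem [Nonempty A] {f : A → (TRT K).obj A (n + 1)}
    {x : (TRT K).obj (Option A) n} (hx : x ∈ nonTarget K A n)
    (h : insAll K A (n + 1) f + (TRT K).d n x ∈ nonTarget K A (n + 1)) : f = 0 ∧ x = 0 := by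
  have := eq_zero_of_insPart_add (x := x.1) (f := fun a => coeff A (n + 1) (f a))
    (fun a T hT => coeff_good _ hT) (fun T hT => coeff_good x hT) hx (fun U _ hU => by
      rw [← coeff_sum_ins, ← insAll_apply, ← coeff_d, ← Pi.add_apply, ← map_add]
      exact h U hU)
  refine ⟨funext fun a => coeff_injective ?_, coeff_injective ?_⟩
  · rw [Pi.zero_apply, map_zero]; exact funext (this.1 a)
  · rw [map_zero]; exact funext this.2

theorem exists_insAll_sub_mem (z : (TRT K).obj (Option A) 0) :
    ∃ f, z - insAll K A 0 f ∈ nonTarget K A 0 :=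
  LinearMap.exists_sub_mem_of_injective (insAll K A 0) (LinearMap.pi fun a => readAbove a 0) _
    (fun _ hz => mem_nonTarget_of_readAbove (congrFun hz)) (fun _ => eq_zero_of_insAll_mem) z

/-- The triangular map is surjective onto the operations modulo `nonTarget`: reading off the leading
coefficients bounds the dimension of this quotient by that of the source. -/
theorem exists_insAll_add_d_sub_mem [Nonempty A] (z : (TRT K).obj (Option A) (n + 1)) :
    ∃ f, ∃ x, z - (insAll K A (n + 1) f + (TRT K).d n x) ∈ nonTarget K A (n + 1) := by
  obtain ⟨⟨f, x⟩, h⟩ := LinearMap.exists_sub_mem_of_injective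
    ((insAll K A (n + 1)).coprod ((TRT K).d n ∘ₗ (nonTarget K A n).subtype))
    ((LinearMap.pi fun a => readAbove a (n + 1)).prod (readExpand A n)) (nonTarget K A (n + 1))
    (fun z hz => mem_nonTarget_of_read (congrFun (congrArg Prod.fst hz)) (congrArg Prod.snd hz))
    (fun x hx => by
      obtain ⟨h1, h2⟩ := eq_zero_of_insAll_add_d_mem x.2.2 hx
      exact Prod.ext h1 (Subtype.ext h2)) z
  exact ⟨f, x, h⟩

/-- A cycle of degree zero comes from cycles with one input less. -/
theorem exists_insAll_of_d_eq_zero [Nonempty A] {c : (TRT K).obj (Option A) 0}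
    (hc : (TRT K).d 0 c = 0) : ∃ f, (∀ a, (TRT K).d 0 (f a) = 0) ∧ c = insAll K A 0 f := by
  obtain ⟨f, hf⟩ := exists_insAll_sub_mem c
  -- Apply the injectivity in the next degree to the differential of `f` and the remainder.
  obtain ⟨h1, h2⟩ := eq_zero_of_insAll_add_d_mem (f := fun a => (TRT K).d 0 (f a)) hf (by
    rw [map_sub, hc, d_insAll, zero_sub, add_neg_cancel]; exact zero_mem _)
  exact ⟨f, congrFun h1, sub_eq_zero.1 h2⟩

/-- A cycle of nonzero degree comes from cycles with one input less, up to a boundary. -/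
theorem exists_insAll_add_d_of_d_eq_zero [Nonempty A] {c : (TRT K).obj (Option A) (n + 1)}
    (hc : (TRT K).d (n + 1) c = 0) : ∃ f, (∀ a, (TRT K).d (n + 1) (f a) = 0) ∧
      ∃ x, c = insAll K A (n + 1) f + (TRT K).d n x := by
  obtain ⟨f, x, hf⟩ := exists_insAll_add_d_sub_mem c
  obtain ⟨h1, h2⟩ := eq_zero_of_insAll_add_d_mem (f := fun a => (TRT K).d (n + 1) (f a)) hf (by
    rw [map_sub, map_add, hc, d_insAll, (TRT K).d_d, add_zero, zero_sub, add_neg_cancel]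
    exact zero_mem _)
  exact ⟨f, congrFun h1, x, sub_eq_zero.1 h2⟩

theorem insAll_injective : Function.Injective (insAll K A n) := by
  rw [injective_iff_map_eq_zero]
  intro f hf
  exact eq_zero_of_insAll_mem (hf ▸ zero_mem _)

end

end RTOp

/-! ### The bracket of two operations -/

namespace LinOperad.LieElement

variable {K : Type u} [Field K] {P : LinOperad K} (β : LieElement P)

/-- The operation `[f, g]`. -/
noncomputable def lieMul {X Y : Type} [Finite X] [Finite Y] :
    P.obj X →ₗ[K] P.obj Y →ₗ[K] P.obj (X ⊕ Y) :=
  ((P.comp ∘ₗ β.ad).flip).compr₂ (P.map (Equiv.sumComm Y X))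

variable {X Y Z : Type} [Finite X] [Finite Y] [Finite Z]

theorem lieMul_apply (f : P.obj X) (g : P.obj Y) :
    β.lieMul f g = P.map (Equiv.sumComm Y X) (P.comp (β.ad g) f) := rfl

theorem lieMul_map {X' Y' : Type} [Finite X'] [Finite Y'] (e : X ≃ X') (e' : Y ≃ Y') (f : P.obj X)
    (g : P.obj Y) :
    β.lieMul (P.map e f) (P.map e' g) = P.map (e.sumCongr e') (β.lieMul f g) := by
  rw [lieMul_apply, lieMul_apply, ad_map, P.comp_map, P.map_map, P.map_map]
  exact P.map_eq_of (by rintro (_ | _) <;> rfl) _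

theorem lieMul_swap (f : P.obj X) (g : P.obj Y) :
    β.lieMul g f = -P.map (Equiv.sumComm X Y) (β.lieMul f g) := by
  let e0 : Unit ≃ Option Empty := unitOpt
  have key : ∀ {V W : Type} [Finite V] [Finite W] (f : P.obj V) (g : P.obj W),
      P.comp (β.ad g) f = P.map ((Equiv.emptySum Empty W).sumCongr (Equiv.refl V))
        (P.comp (P.map (optL Empty W) (P.comp (P.map e0.optionCongr β.br) g)) f) := by
    intro V W _ _ f g
    have h : P.comp (β.ad g) f = P.comp (P.map (unitSum W) (P.comp β.br g)) f := rfl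
    rw [h, P.comp_map_left, P.map_map, show unitSum W = ((e0.sumCongr (Equiv.refl W)).trans
      (optL Empty W)).trans (Equiv.emptySum Empty W).optionCongr from Equiv.ext (by
        rintro (_ | _) <;> rfl), ← P.map_map _ (Equiv.optionCongr _), P.comp_map_left]
  have h1 : P.map (optSwap Empty) (P.map e0.optionCongr β.br) = -P.map e0.optionCongr β.br := by
    rw [← map_neg, ← β.br_antisymm, P.map_map, P.map_map]
    exact P.map_eq_of (by rintro (_ | _) <;> rfl) _
  rw [lieMul_apply, lieMul_apply, key g f, key f g, P.comp_comm, h1]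
  simp only [map_neg, LinearMap.neg_apply, P.map_map]
  congr 1
  exact P.map_eq_of (by rintro ((x | _) | _); · exact x.elim
                        all_goals rfl) _

/-- The Jacobi identity, in the form of the Leibniz rule for `[f, -]`. -/
theorem lieMul_jacobi (f : P.obj X) (g : P.obj Y) (h : P.obj Z) :
    β.lieMul f (β.lieMul g h) = P.map (Equiv.sumAssoc X Y Z) (β.lieMul (β.lieMul f g) h) +
      P.map (((Equiv.sumAssoc Y X Z).symm.trans
        ((Equiv.sumComm Y X).sumCongr (Equiv.refl Z))).trans (Equiv.sumAssoc X Y Z))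
        (β.lieMul g (β.lieMul f h)) := by
  have hs := β.split_ad h
  rw [splitAt_none] at hs
  set w := β.ad (β.ad h) with hw
  have e1 : β.lieMul f (β.lieMul g h) =
      P.map ((Equiv.sumComm (Z ⊕ Y) X).trans ((Equiv.refl X).sumCongr (Equiv.sumComm Z Y)))
        (P.comp (P.map (optL Z Y) (P.comp (P.map (optSwap Z) w) g)) f) := by
    rw [lieMul_apply, lieMul_apply, ad_map, P.comp_map_left, ad_comp, P.map_map]
    exact P.map_eq_of (by rintro ((_ | _) | _) <;> rfl) _
  have e2 : β.lieMul (β.lieMul f g) h =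
      P.map ((((Equiv.sumAssoc Z Y X).trans (Equiv.sumComm Z (Y ⊕ X))).trans
        ((Equiv.sumComm Y X).sumCongr (Equiv.refl Z))))
        (P.comp (P.map (optL Z Y) (P.comp (P.map (optSwap Z) (w - P.map (optSwap Z) w)) g)) f) := by
    rw [← hs, comp_swap_split, P.comp_assoc, lieMul_apply, lieMul_apply, P.comp_map_right,
      P.map_map, P.map_map]
    exact P.map_eq_of (by rintro (_ | (_ | _)) <;> rfl) _
  have e3 : β.lieMul g (β.lieMul f h) =
      P.map ((Equiv.sumAssoc Z Y X).trans ((Equiv.sumComm Z (Y ⊕ X)).trans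
        (Equiv.sumAssoc Y X Z)))
        (P.comp (P.map (optL Z Y) (P.comp w g)) f) := by
    rw [lieMul_apply, lieMul_apply, ad_map, P.comp_map_left, ad_comp, P.comp_comm,
      map_optSwap_optSwap, P.map_map, P.map_map]
    exact P.map_eq_of (by rintro ((_ | _) | _) <;> rfl) _
  have e4 : P.map (optSwap Z) w = P.map (optSwap Z) (w - P.map (optSwap Z) w) + w := by
    rw [map_sub, map_optSwap_optSwap, sub_add_cancel]
  rw [e1, e4, e2, e3]
  simp only [map_add, LinearMap.add_apply, P.map_map]
  congr 1
  · exact P.map_eq_of (by rintro ((_ | _) | _) <;> rfl) _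
  · exact P.map_eq_of (by rintro ((_ | _) | _) <;> rfl) _

theorem comp_lieMul_left {B : Type} [Finite B] (f : P.obj (Option X)) (g : P.obj Y) (h : P.obj B) :
    P.comp (P.map (optL X Y) (β.lieMul f g)) h =
      P.map (sumRight X B Y) (β.lieMul (P.comp f h) g) := by
  have h1 := P.comp_assoc (β.ad g) f h
  have h2 : (Equiv.sumComm Y (Option X)).trans (optL X Y) =
      (optR Y X).trans (Equiv.sumComm Y X).optionCongr :=
    Equiv.ext (by rintro (_ | (_ | _)) <;> rfl)
  rw [lieMul_apply, lieMul_apply, P.map_map, h2, ← P.map_map _ (Equiv.optionCongr _),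
    P.comp_map_left, h1, P.map_map, P.map_map]
  exact P.map_eq_of (by rintro (_ | (_ | _)) <;> rfl) _

theorem comp_lieMul_right {B : Type} [Finite B] (f : P.obj X) (g : P.obj (Option Y)) (h : P.obj B) :
    P.comp (P.map (optR X Y) (β.lieMul f g)) h =
      P.map (Equiv.sumAssoc X Y B).symm (β.lieMul f (P.comp g h)) := by
  have h2 : (Equiv.sumComm (Option Y) X).trans (optR X Y) =
      (optL Y X).trans (Equiv.sumComm Y X).optionCongr :=
    Equiv.ext (by rintro ((_ | _) | _) <;> rfl)
  rw [β.lieMul_swap g f, β.lieMul_swap (P.comp g h) f]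
  simp only [map_neg, LinearMap.neg_apply, P.map_map]
  rw [h2, ← P.map_map _ (Equiv.optionCongr _), P.comp_map_left, comp_lieMul_left, P.map_map]
  congr 1
  exact P.map_eq_of (by rintro ((_ | _) | _) <;> rfl) _

/-! ### The value of a nonassociative word -/

/-- The set of letters of a word. -/
def Leaves {X : Type} : FreeMagma X → Type
  | .of _ => Unit
  | .mul u v => Leaves u ⊕ Leaves v

instance finite_leaves {X : Type} : ∀ w : FreeMagma X, Finite (Leaves w)
  | .of _ => inferInstanceAs (Finite Unit)
  | .mul u v =>
    have := finite_leaves u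
    have := finite_leaves v
    inferInstanceAs (Finite (Leaves u ⊕ Leaves v))

/-- The generator at a letter of a word. -/
def label {X : Type} : (w : FreeMagma X) → Leaves w → X
  | .of x => fun _ => x
  | .mul u v => Sum.elim (label u) (label v)

/-- The iterated bracket with the shape of a word. -/
noncomputable def wordOp {X : Type} : (w : FreeMagma X) → P.obj (Leaves w)
  | .of _ => P.one
  | .mul u v => β.lieMul (wordOp u) (wordOp v)

open Classical in
/-- Relabelling along a map of label sets; it is zero unless the map is bijective. -/
noncomputable def push (P : LinOperad K) {V X : Type} [Finite V] [Finite X] (g : V → X) :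
    P.obj V →ₗ[K] P.obj X :=
  if h : Function.Bijective g then P.map (Equiv.ofBijective g h) else 0

theorem push_equiv (e : X ≃ Y) (f : P.obj X) : push P e f = P.map e f := by
  rw [push, dif_pos e.bijective]
  exact P.map_eq_of (by simp) f

theorem push_of_not {g : X → Y} (h : ¬ Function.Bijective g) (f : P.obj X) : push P g f = 0 := by
  rw [push, dif_neg h, LinearMap.zero_apply]

theorem push_map (e : X ≃ Y) (g : Y → Z) (f : P.obj X) :
    push P g (P.map e f) = push P (g ∘ e) f := by
  by_cases h : Function.Bijective g
  · rw [show g = Equiv.ofBijective g h from rfl, push_equiv, P.map_map,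
      show (Equiv.ofBijective g h) ∘ e = e.trans (Equiv.ofBijective g h) from rfl, push_equiv]
  · rw [push_of_not h, push_of_not]
    exact fun h' => h ((e.bijective.of_comp_iff g).1 h')

theorem map_push (e : Y ≃ Z) (g : X → Y) (f : P.obj X) :
    P.map e (push P g f) = push P (e ∘ g) f := by
  by_cases h : Function.Bijective g
  · rw [show g = Equiv.ofBijective g h from rfl, push_equiv, P.map_map,
      show e ∘ (Equiv.ofBijective g h) = (Equiv.ofBijective g h).trans e from rfl, push_equiv]
  · rw [push_of_not h, push_of_not, map_zero]
    exact fun h' => h ((e.bijective.of_comp_iff' g).1 h')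

theorem lieMul_push {X' Y' : Type} [Finite X'] [Finite Y'] (g : X → X') (g' : Y → Y') (f : P.obj X)
    (f' : P.obj Y) :
    β.lieMul (push P g f) (push P g' f') = push P (Sum.map g g') (β.lieMul f f') := by
  by_cases h : Function.Bijective g ∧ Function.Bijective g'
  · obtain ⟨h, h'⟩ := h
    obtain ⟨e, rfl⟩ : ∃ e : X ≃ X', g = e := ⟨Equiv.ofBijective g h, rfl⟩
    obtain ⟨e', rfl⟩ : ∃ e' : Y ≃ Y', g' = e' := ⟨Equiv.ofBijective g' h', rfl⟩
    rw [push_equiv, push_equiv, lieMul_map]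
    exact (push_equiv (e.sumCongr e') _).symm
  · rw [push_of_not (mt Sum.map_bijective.1 h)]
    rw [not_and_or] at h
    rcases h with h | h
    · rw [push_of_not h, map_zero, LinearMap.zero_apply]
    · rw [push_of_not h, map_zero]

/-- A natural way to put an operation with arbitrary inputs into a larger operation with
additional inputs `Y`. -/
structure Context (P : LinOperad K) (Y : Type) [Finite Y] where
  app : ∀ {V : Type} [Finite V], P.obj V →ₗ[K] P.obj (V ⊕ Y)
  app_map : ∀ {V W : Type} [Finite V] [Finite W] (e : V ≃ W) (f : P.obj V),
    app (P.map e f) = P.map (e.sumCongr (Equiv.refl Y)) (app f)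

/-- The linear extension of the map sending a word to its value in a context; here `l` labels the
additional inputs. The result is zero on words that do not, together with `l`, contain
each generator exactly once. -/
noncomputable def eval {Y : Type} [Finite Y] (N : Context P Y) (l : Y → X) :
    FreeNonUnitalNonAssocAlgebra K X →ₗ[K] P.obj X :=
  (Finsupp.lsum K fun w => LinearMap.toSpanSingleton K _
    (push P (Sum.elim (label w) l) (N.app (β.wordOp w)))) ∘ₗ
    (MonoidAlgebra.coeffLinearEquiv K).toLinearMap

theorem eval_single {Y : Type} [Finite Y] (N : Context P Y) (l : Y → X) (w : FreeMagma X) (c : K) :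
    β.eval N l (MonoidAlgebra.single w c) =
      c • push P (Sum.elim (label w) l) (N.app (β.wordOp w)) := by
  simp [eval, MonoidAlgebra.coeffLinearEquiv]

/-- The context `[-, g]`. -/
noncomputable def Context.mulRight {Y : Type} [Finite Y] (N : Context P Y) (g : P.obj Z) :
    Context P (Z ⊕ Y) where
  app {V _} := P.map (Equiv.sumAssoc V Z Y) ∘ₗ N.app ∘ₗ β.lieMul.flip g
  app_map {V W _ _} e f := by
    have := β.lieMul_map e (Equiv.refl Z) f g
    rw [P.map_refl] at this
    simp only [LinearMap.comp_apply, LinearMap.flip_apply]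
    rw [this, N.app_map, P.map_map, P.map_map]
    exact P.map_eq_of (by rintro ((_ | _) | _) <;> rfl) _

theorem eval_mul_single {Y : Type} [Finite Y] (N : Context P Y) (l : Y → X) (v : FreeMagma X)
    (c : K) (a : FreeNonUnitalNonAssocAlgebra K X) :
    β.eval N l (a * MonoidAlgebra.single v c) =
      c • β.eval (Context.mulRight β N (β.wordOp v)) (Sum.elim (label v) l) a := by
  induction a using MonoidAlgebra.induction_linear with
  | zero => simp
  | add a b ha hb => rw [add_mul, map_add, map_add, ha, hb, smul_add]
  | single u d =>
    rw [MonoidAlgebra.single_mul_single, eval_single, eval_single, smul_smul, mul_comm d c]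
    congr 1
    simp only [Context.mulRight, LinearMap.comp_apply, LinearMap.flip_apply]
    rw [push_map]
    have : (Sum.elim (label u) (Sum.elim (label v) l)) ∘ (Equiv.sumAssoc (Leaves u) (Leaves v) Y) =
        Sum.elim (label (u * v)) l := by
      funext x
      rcases x with (_ | _) | _ <;> rfl
    rw [this]
    rfl

theorem eval_mul_swap {Y : Type} [Finite Y] (N : Context P Y) (l : Y → X)
    (a b : FreeNonUnitalNonAssocAlgebra K X) : β.eval N l (b * a) = -β.eval N l (a * b) := by
  induction a using MonoidAlgebra.induction_linear with
  | zero => simp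
  | add a a' ha hb => rw [add_mul, mul_add, map_add, map_add, ha, hb, neg_add]
  | single u d =>
    induction b using MonoidAlgebra.induction_linear with
    | zero => simp
    | add b b' ha hb => rw [add_mul, mul_add, map_add, map_add, ha, hb, neg_add]
    | single v c =>
      rw [MonoidAlgebra.single_mul_single, MonoidAlgebra.single_mul_single, eval_single,
        eval_single, mul_comm d c, ← smul_neg]
      congr 1
      change push P (Sum.elim (Sum.elim (label v) (label u)) l)
          (N.app (β.lieMul (β.wordOp v) (β.wordOp u))) =
        -push P (Sum.elim (Sum.elim (label u) (label v)) l)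
          (N.app (β.lieMul (β.wordOp u) (β.wordOp v)))
      rw [lieMul_swap, map_neg, map_neg, N.app_map, push_map]
      congr 1
      refine congrArg (fun g => push P g _) (funext ?_)
      rintro ((_ | _) | _) <;> rfl

theorem eval_jacobi {Y : Type} [Finite Y] (N : Context P Y) (l : Y → X)
    (a b c : FreeNonUnitalNonAssocAlgebra K X) :
    β.eval N l (a * (b * c)) = β.eval N l (a * b * c + b * (a * c)) := by
  induction a using MonoidAlgebra.induction_linear with
  | zero => simp
  | add a a' h h' =>
    simp only [add_mul, mul_add, map_add] at h h' ⊢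
    rw [h, h']; abel
  | single u p =>
    induction b using MonoidAlgebra.induction_linear with
    | zero => simp
    | add b b' h h' =>
      simp only [add_mul, mul_add, map_add] at h h' ⊢
      rw [h, h']; abel
    | single v q =>
      induction c using MonoidAlgebra.induction_linear with
      | zero => simp
      | add c c' h h' =>
        simp only [mul_add, map_add] at h h' ⊢
        rw [h, h']; abel
      | single w r =>
        simp only [map_add, MonoidAlgebra.single_mul_single, eval_single]
        rw [mul_left_comm q p r, mul_assoc p q r, ← smul_add]
        congr 1
        change push P (Sum.elim (Sum.elim (label u) (Sum.elim (label v) (label w))) l)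
            (N.app (β.lieMul (β.wordOp u) (β.lieMul (β.wordOp v) (β.wordOp w)))) =
          push P (Sum.elim (Sum.elim (Sum.elim (label u) (label v)) (label w)) l)
            (N.app (β.lieMul (β.lieMul (β.wordOp u) (β.wordOp v)) (β.wordOp w))) +
          push P (Sum.elim (Sum.elim (label v) (Sum.elim (label u) (label w))) l)
            (N.app (β.lieMul (β.wordOp v) (β.lieMul (β.wordOp u) (β.wordOp w))))
        rw [lieMul_jacobi, map_add, map_add, N.app_map, N.app_map, push_map, push_map]
        congr 1
        · refine congrArg (fun g => push P g _) (funext ?_)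
          rintro (((_ | _) | _) | _) <;> rfl
        · refine congrArg (fun g => push P g _) (funext ?_)
          rintro ((_ | (_ | _)) | _) <;> rfl

/-- Words related by the axioms of a Lie algebra have the same value. A relation multiplied by a
word is handled by enlarging the context, so the statement is proved for all contexts at once. -/
theorem eval_eq_of_rel [CharZero K] {a b : FreeNonUnitalNonAssocAlgebra K X}
    (h : FreeLieAlgebra.Rel K X a b) :
    ∀ {Y : Type} [Finite Y] (N : Context P Y) (l : Y → X), β.eval N l a = β.eval N l b := by
  have key : ∀ {a b : FreeNonUnitalNonAssocAlgebra K X} (c : FreeNonUnitalNonAssocAlgebra K X),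
      (∀ {Y : Type} [Finite Y] (N : Context P Y) (l : Y → X), β.eval N l a = β.eval N l b) →
      ∀ {Y : Type} [Finite Y] (N : Context P Y) (l : Y → X),
        β.eval N l (a * c) = β.eval N l (b * c) := by
    intro a b c h Y _ N l
    induction c using MonoidAlgebra.induction_linear with
    | zero => simp
    | add c c' h h' => rw [mul_add, mul_add, map_add, map_add, h, h']
    | single w r => rw [eval_mul_single, eval_mul_single, h]
  induction h with
  | lie_self a =>
    intro Y _ N l
    have := eval_mul_swap β N l a a
    rw [eq_neg_iff_add_eq_zero, ← two_smul K] at this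
    rw [map_zero]
    exact (smul_eq_zero.1 this).resolve_left two_ne_zero
  | leibniz_lie a b c => exact fun N l => eval_jacobi β N l a b c
  | smul t _ h => intro Y _ N l; rw [map_smul, map_smul, h]
  | add_right c _ h => intro Y _ N l; rw [map_add, map_add, h]
  | mul_right c _ h => exact key c h
  | mul_left c _ h =>
    intro Y _ N l
    rw [eval_mul_swap, eval_mul_swap β N l _ c, key c h]

/-- The context without additional inputs. -/
noncomputable def emptyContext (P : LinOperad K) : Context P Empty where
  app {V _} := P.map (Equiv.sumEmpty V Empty).symm
  app_map e f := by
    rw [P.map_map, P.map_map]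
    exact P.map_eq_of (by intro; rfl) _

/-- The linear map from the free Lie algebra to the operations of `P` which vanishes on
words that are not multilinear, and sends a multilinear word to the corresponding iterated
bracket. -/
noncomputable def lieEval [CharZero K] (X : Type) [Finite X] :
    FreeLieAlgebra K X →ₗ[K] P.obj X where
  toFun := Quot.lift (β.eval (emptyContext P) Empty.elim) fun _ _ h => β.eval_eq_of_rel h _ _
  map_add' := by rintro ⟨a⟩ ⟨b⟩; exact map_add (β.eval (emptyContext P) Empty.elim) a b
  map_smul' := by rintro c ⟨a⟩; exact map_smul (β.eval (emptyContext P) Empty.elim) c a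

end LinOperad.LieElement

/-! ### Words and monomials in the free Lie algebra -/

namespace LinOperad.LieElement

open LieOp

variable {K : Type u} [Field K] {P : LinOperad K} (β : LieElement P)

variable {X Y Z : Type} [Finite X] [Finite Y] [Finite Z]

variable (K) in
/-- The element of the free Lie algebra given by a word. -/
noncomputable def wordLie {X : Type} : FreeMagma X → FreeLieAlgebra K X
  | .of x => FreeLieAlgebra.of K x
  | .mul u v => ⁅wordLie u, wordLie v⁆

variable (K) in
/-- The projection onto the free Lie algebra as a linear map. -/
def mkLie (X : Type) : FreeNonUnitalNonAssocAlgebra K X →ₗ[K] FreeLieAlgebra K X where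
  toFun := Quot.mk _
  map_add' _ _ := rfl
  map_smul' _ _ := rfl

theorem mkLie_single {X : Type} (w : FreeMagma X) :
    mkLie K X (MonoidAlgebra.single w 1) = wordLie K w := by
  induction w using FreeMagma.rec with
  | of x => rfl
  | mul u v hu hv =>
    have : (MonoidAlgebra.single (u * v) 1 : FreeNonUnitalNonAssocAlgebra K X) =
        MonoidAlgebra.single u 1 * MonoidAlgebra.single v 1 := by
      rw [MonoidAlgebra.single_mul_single, mul_one]
    change mkLie K X (MonoidAlgebra.single (u * v) 1) = _
    rw [this, wordLie, ← hu, ← hv]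
    rfl

theorem span_wordLie {X : Type} : Submodule.span K (Set.range (wordLie K (X := X))) = ⊤ := by
  rw [eq_top_iff]
  rintro ⟨a⟩ -
  change mkLie K X a ∈ _
  induction a using MonoidAlgebra.induction_linear with
  | zero => rw [map_zero]; exact zero_mem _
  | add a b h h' => rw [map_add]; exact add_mem h h'
  | single w c =>
    rw [← mul_one c, ← smul_eq_mul, ← MonoidAlgebra.smul_single, map_smul, mkLie_single]
    exact Submodule.smul_mem _ _ (Submodule.subset_span ⟨w, rfl⟩)

theorem ext_wordLie {X : Type} {M : Type*} [AddCommGroup M] [Module K M]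
    {F G : FreeLieAlgebra K X →ₗ[K] M} (h : ∀ w, F (wordLie K w) = G (wordLie K w)) : F = G :=
  LinearMap.ext_on span_wordLie (by rintro _ ⟨w, rfl⟩; exact h w)

theorem lieEval_wordLie [CharZero K] (w : FreeMagma X) :
    β.lieEval X (wordLie K w) = push P (label w) (β.wordOp w) := by
  rw [← mkLie_single]
  change β.eval (emptyContext P) Empty.elim (MonoidAlgebra.single w 1) = _
  rw [eval_single, one_smul, emptyContext, push_map]
  rfl

/-- Renaming the generators of a word. -/
theorem exists_rename_wordLie {X Y : Type} (f : X → Y) (w : FreeMagma X) :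
    ∃ (w' : FreeMagma Y) (ε : Leaves w ≃ Leaves w'), rename K f (wordLie K w) = wordLie K w' ∧
      label w' ∘ ε = f ∘ label w ∧ P.map ε (β.wordOp w) = β.wordOp w' := by
  induction w using FreeMagma.rec with
  | of x => exact ⟨.of (f x), Equiv.refl _, rename_of f x, rfl, P.map_refl _⟩
  | mul u v hu hv =>
    obtain ⟨u', ε, h1, h2, h3⟩ := hu
    obtain ⟨v', ε', h1', h2', h3'⟩ := hv
    refine ⟨.mul u' v', ε.sumCongr ε', ?_, ?_, ?_⟩
    · rw [wordLie, LieHom.map_lie, h1, h1']; rfl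
    · funext x
      rcases x with x | x
      · exact congrFun h2 x
      · exact congrFun h2' x
    · exact (β.lieMul_map ε ε' _ _).symm.trans (by rw [h3, h3']; rfl)

theorem lieEval_map [CharZero K] (e : X ≃ Y) (x : FreeLieAlgebra K X) :
    β.lieEval Y (rename K e x) = P.map e (β.lieEval X x) := by
  have : β.lieEval Y ∘ₗ (rename K e).toLinearMap = P.map e ∘ₗ β.lieEval X := by
    refine ext_wordLie fun w => ?_
    obtain ⟨w', ε, h1, h2, h3⟩ := β.exists_rename_wordLie e w
    change β.lieEval Y (rename K e (wordLie K w)) = P.map e (β.lieEval X (wordLie K w))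
    rw [h1, lieEval_wordLie, lieEval_wordLie, map_push, ← h3, push_map, h2]
  exact LinearMap.congr_fun this x

/-- The bracket of elements of the free Lie algebras on two sets of generators. -/
noncomputable def disjLie (X Y : Type) :
    FreeLieAlgebra K X →ₗ[K] FreeLieAlgebra K Y →ₗ[K] FreeLieAlgebra K (X ⊕ Y) :=
  LinearMap.mk₂ K (fun x y =>
    ⁅rename K (Sum.inl : X → X ⊕ Y) x, rename K (Sum.inr : Y → X ⊕ Y) y⁆)
    (by simp) (by simp) (by simp) (by simp)

theorem disjLie_apply {X Y : Type} (x : FreeLieAlgebra K X) (y : FreeLieAlgebra K Y) :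
    disjLie X Y x y = ⁅rename K (Sum.inl : X → X ⊕ Y) x, rename K (Sum.inr : Y → X ⊕ Y) y⁆ := rfl

theorem lieEval_disjLie [CharZero K] (x : FreeLieAlgebra K X) (y : FreeLieAlgebra K Y) :
    β.lieEval (X ⊕ Y) (disjLie X Y x y) = β.lieMul (β.lieEval X x) (β.lieEval Y y) := by
  have h : (disjLie X Y).compr₂ (β.lieEval (X ⊕ Y)) =
      (β.lieMul ∘ₗ β.lieEval X).compl₂ (β.lieEval Y) := by
    refine ext_wordLie fun u => ext_wordLie fun v => ?_
    obtain ⟨u', ε, h1, h2, h3⟩ := β.exists_rename_wordLie (Sum.inl : X → X ⊕ Y) u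
    obtain ⟨v', ε', h1', h2', h3'⟩ := β.exists_rename_wordLie (Sum.inr : Y → X ⊕ Y) v
    change β.lieEval (X ⊕ Y) (disjLie X Y (wordLie K u) (wordLie K v)) =
      β.lieMul (β.lieEval X (wordLie K u)) (β.lieEval Y (wordLie K v))
    rw [disjLie_apply, h1, h1', lieEval_wordLie, lieEval_wordLie, lieMul_push]
    refine (lieEval_wordLie β (u' * v')).trans ?_
    change push P (Sum.elim (label u') (label v')) (β.lieMul (β.wordOp u') (β.wordOp v')) = _
    rw [← h3, ← h3', lieMul_map, push_map]
    refine congrArg (fun g => push P g _) (funext ?_)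
    rintro (x | x)
    · exact congrFun h2 x
    · exact congrFun h2' x
  exact LinearMap.congr_fun (LinearMap.congr_fun h x) y

theorem lieEval_of [CharZero K] : β.lieEval Unit (FreeLieAlgebra.of K ()) = P.one := by
  have := β.lieEval_wordLie (.of ())
  refine this.trans ?_
  exact (push_equiv (Equiv.refl Unit) _).trans (P.map_refl _)

/-- Lie monomials in which every generator occurs exactly once, built from monomials in disjoint
sets of generators. -/
inductive IsMonomial (K : Type u) [Field K] : ∀ {X : Type}, FreeLieAlgebra K X → Prop
  | of : IsMonomial K (FreeLieAlgebra.of K ())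
  | lie {X Y : Type} {x : FreeLieAlgebra K X} {y : FreeLieAlgebra K Y} : IsMonomial K x →
      IsMonomial K y → IsMonomial K (disjLie X Y x y)
  | map {X Y : Type} (e : X ≃ Y) {x : FreeLieAlgebra K X} : IsMonomial K x →
      IsMonomial K (rename K e x)

theorem IsMonomial.finite {X : Type} {x : FreeLieAlgebra K X} (h : IsMonomial K x) : Finite X := by
  induction h with
  | of => infer_instance
  | lie _ _ h h' => infer_instance
  | map e _ h => exact Finite.of_equiv _ e

theorem IsMonomial.mem {X : Type} {x : FreeLieAlgebra K X} (h : IsMonomial K x) :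
    x ∈ multilinear K (Set.univ : Set X) := by
  induction h with
  | of => exact (lieLin K).one.2
  | @lie X Y x y _ _ h h' =>
    have := lie_mem (by
      rw [Set.image_univ, Set.image_univ]; exact Set.isCompl_range_inl_range_inr.disjoint)
      (rename_mem (Sum.inl_injective (β := Y)) h) (rename_mem (Sum.inr_injective (α := X)) h')
    rwa [Set.image_univ, Set.image_univ, Set.range_inl_union_range_inr] at this
  | map e _ h =>
    have := rename_mem e.injective h
    rwa [Set.image_univ, e.surjective.range_eq] at this

theorem exists_isMonomial {X : Type} {s : Set X} {x : FreeLieAlgebra K X} (h : Mono K s x) :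
    ∃ (Y : Type) (j : Y → X) (y : FreeLieAlgebra K Y), Function.Injective j ∧ Set.range j = s ∧
      IsMonomial K y ∧ rename K j y = x := by
  induction h with
  | of a =>
    exact ⟨Unit, fun _ => a, _, fun _ _ _ => rfl, Set.range_const, .of, rename_of _ _⟩
  | lie h _ _ h1 h2 =>
    obtain ⟨Y, j, y, hj, rfl, hy, rfl⟩ := h1
    obtain ⟨Y', j', y', hj', rfl, hy', rfl⟩ := h2
    refine ⟨Y ⊕ Y', Sum.elim j j', _, hj.sumElim hj' fun a b hab => ?_, Set.Sum.elim_range j j',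
      .lie hy hy', ?_⟩
    · exact Set.disjoint_left.1 h ⟨a, rfl⟩ ⟨b, hab.symm⟩
    · rw [disjLie_apply, LieHom.map_lie, rename_rename, rename_rename]; rfl

theorem multilinear_univ_eq {X : Type} :
    multilinear K (Set.univ : Set X) = Submodule.span K {x | IsMonomial K x} := by
  refine le_antisymm (Submodule.span_le.2 fun x hx => ?_) (Submodule.span_le.2 fun x hx => hx.mem)
  obtain ⟨Y, j, y, hj, hs, hy, rfl⟩ := exists_isMonomial hx
  exact Submodule.subset_span (.map (Equiv.ofBijective j ⟨hj, Set.range_eq_univ.1 hs⟩) hy)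

theorem exists_optionCongr {V W : Type} (E : Option V ≃ Option W) (h : E none = none) :
    ∃ e : V ≃ W, E = e.optionCongr := by
  refine ⟨E.removeNone, Equiv.ext ?_⟩
  rintro (_ | v)
  · exact h
  · rcases hv : E (some v) with _ | w
    · exact absurd (E.injective (hv.trans h.symm)) (by simp)
    · rw [Equiv.optionCongr_apply, Option.map_some, Equiv.removeNone_some _ ⟨w, hv⟩, hv]

/-- Substitution into a Lie monomial corresponds to composition in the operad. -/
theorem lieEval_subst [CharZero K] {B : Type} [Finite B] {X : Type} {x : FreeLieAlgebra K X}
    (hx : IsMonomial K x) (y : FreeLieAlgebra K B) :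
    ∀ {A : Type} [Finite A] (e : X ≃ Option A), β.lieEval (A ⊕ B) (subst K y (rename K e x)) =
      P.comp (β.lieEval (Option A) (rename K e x)) (β.lieEval B y) := by
  induction hx with
  | of =>
    intro A _ e
    obtain ⟨ε, hε⟩ := exists_optionCongr (unitOpt.symm.trans e) (by
      have : Subsingleton (Option A) := e.symm.subsingleton
      exact Subsingleton.elim _ _)
    have he : e = unitOpt.trans ε.optionCongr := by
      rw [← hε]; ext; simp
    have h0 : e () = none := by rw [he]; rfl
    have h1 : rename K (Sum.inr : B → A ⊕ B) y =
        rename K ((Equiv.emptySum Empty B).symm.trans (ε.sumCongr (Equiv.refl B))) y := rfl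
    rw [lieEval_map, lieEval_of, rename_of, h0, subst_none, h1, lieEval_map, he,
      ← P.map_map unitOpt, P.comp_map_left, P.one_comp, P.map_map]
  | map e' _ h =>
    intro A _ e
    have := h (e'.trans e)
    rwa [Equiv.coe_trans, ← rename_rename] at this
  | @lie X Y x y' hx hy' h h' =>
    intro A _ e
    have := hx.finite
    have := hy'.finite
    rcases h0 : e.symm none with x0 | y0
    · obtain ⟨X1, _, i, hi⟩ := exists_pt x0
      obtain ⟨e', he'⟩ := exists_optionCongr
        ((optL X1 Y).symm.trans ((i.sumCongr (Equiv.refl Y)).trans e)) (by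
          change e (.inl (i none)) = none
          rw [hi, ← h0, e.apply_symm_apply])
      have he : e = (i.symm.sumCongr (Equiv.refl Y)).trans
          ((optL X1 Y).trans e'.optionCongr) := by
        rw [← he']; ext (_ | _) <;> simp
      have hL : subst K y (rename K e (disjLie X Y x y')) =
          rename K ((sumRight X1 B Y).trans (e'.sumCongr (Equiv.refl B)))
            (disjLie (X1 ⊕ B) Y (subst K y (rename K i.symm x)) y') := by
        simp only [disjLie_apply, LieHom.map_lie]
        congr 1
        · refine hom_congr (((subst K y).comp (rename K e)).comp (rename K Sum.inl))
            (((rename K ((sumRight X1 B Y).trans (e'.sumCongr (Equiv.refl B)))).comp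
              (rename K Sum.inl)).comp ((subst K y).comp (rename K i.symm))) (fun v => ?_) x
          obtain ⟨w, rfl⟩ := i.surjective v
          rcases w with _ | w
          · simp only [LieHom.comp_apply, rename_of, he, Equiv.trans_apply,
              Equiv.sumCongr_apply, Sum.map_inl, Equiv.symm_apply_apply, subst_none]
            change subst K y (FreeLieAlgebra.of K none) = _
            rw [subst_none, rename_rename, rename_rename]
            rfl
          · simp only [LieHom.comp_apply, rename_of, he, Equiv.trans_apply,
              Equiv.sumCongr_apply, Sum.map_inl, Equiv.symm_apply_apply, subst_some]
            exact subst_some y _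
        · refine hom_congr (((subst K y).comp (rename K e)).comp (rename K Sum.inr))
            ((rename K ((sumRight X1 B Y).trans (e'.sumCongr (Equiv.refl B)))).comp
              (rename K Sum.inr)) (fun v => ?_) y'
          simp only [LieHom.comp_apply, rename_of, he]
          exact subst_some y _
      have hR : P.map e (β.lieMul (β.lieEval X x) (β.lieEval Y y')) =
          P.map e'.optionCongr (P.map (optL X1 Y)
            (β.lieMul (P.map i.symm (β.lieEval X x)) (β.lieEval Y y'))) := by
        have := β.lieMul_map i.symm (Equiv.refl Y) (β.lieEval X x) (β.lieEval Y y')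
        rw [P.map_refl] at this
        rw [this, P.map_map, P.map_map, he]
      rw [hL, lieEval_map, lieEval_disjLie, h i.symm, lieEval_map, lieEval_map, lieEval_disjLie, hR,
        P.comp_map_left, comp_lieMul_left, P.map_map]
    · obtain ⟨Y1, _, i, hi⟩ := exists_pt y0
      obtain ⟨e', he'⟩ := exists_optionCongr
        ((optR X Y1).symm.trans (((Equiv.refl X).sumCongr i).trans e)) (by
          change e (.inr (i none)) = none
          rw [hi, ← h0, e.apply_symm_apply])
      have he : e = ((Equiv.refl X).sumCongr i.symm).trans
          ((optR X Y1).trans e'.optionCongr) := by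
        rw [← he']; ext (_ | _) <;> simp
      have hL : subst K y (rename K e (disjLie X Y x y')) =
          rename K ((Equiv.sumAssoc X Y1 B).symm.trans (e'.sumCongr (Equiv.refl B)))
            (disjLie X (Y1 ⊕ B) x (subst K y (rename K i.symm y'))) := by
        simp only [disjLie_apply, LieHom.map_lie]
        congr 1
        · refine hom_congr (((subst K y).comp (rename K e)).comp (rename K Sum.inl))
            ((rename K ((Equiv.sumAssoc X Y1 B).symm.trans (e'.sumCongr (Equiv.refl B)))).comp
              (rename K Sum.inl)) (fun v => ?_) x
          simp only [LieHom.comp_apply, rename_of, he]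
          exact subst_some y _
        · refine hom_congr (((subst K y).comp (rename K e)).comp (rename K Sum.inr))
            (((rename K ((Equiv.sumAssoc X Y1 B).symm.trans (e'.sumCongr (Equiv.refl B)))).comp
              (rename K Sum.inr)).comp ((subst K y).comp (rename K i.symm))) (fun v => ?_) y'
          obtain ⟨w, rfl⟩ := i.surjective v
          rcases w with _ | w
          · simp only [LieHom.comp_apply, rename_of, he, Equiv.trans_apply,
              Equiv.sumCongr_apply, Sum.map_inr, Equiv.symm_apply_apply, subst_none]
            change subst K y (FreeLieAlgebra.of K none) = _
            rw [subst_none, rename_rename, rename_rename]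
            rfl
          · simp only [LieHom.comp_apply, rename_of, he, Equiv.trans_apply,
              Equiv.sumCongr_apply, Sum.map_inr, Equiv.symm_apply_apply, subst_some]
            exact subst_some y _
      have hR : P.map e (β.lieMul (β.lieEval X x) (β.lieEval Y y')) =
          P.map e'.optionCongr (P.map (optR X Y1)
            (β.lieMul (β.lieEval X x) (P.map i.symm (β.lieEval Y y')))) := by
        have := β.lieMul_map (Equiv.refl X) i.symm (β.lieEval X x) (β.lieEval Y y')
        rw [P.map_refl] at this
        rw [this, P.map_map, P.map_map, he]
      rw [hL, lieEval_map, lieEval_disjLie, h' i.symm, lieEval_map, lieEval_map, lieEval_disjLie,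
        hR, P.comp_map_left, comp_lieMul_right, P.map_map]

end LinOperad.LieElement

/-! ### Products of operations of degree zero -/

namespace DGOperad

variable {K : Type u} [Field K]

open LinOperad.LieElement

/-- The operation obtained by inserting `x` and `y` into the two inputs of `β`. -/
noncomputable def mul (Q : DGOperad K) (β : Q.obj (Fin 2) 0) {X Y : Type} [Finite X] [Finite Y]
    (x : Q.obj X 0) (y : Q.obj Y 0) : Q.obj (X ⊕ Y) 0 :=
  Q.map (Equiv.sumComm Y X) 0
    (Q.comp (add_zero 0) (Q.map (unitSum Y) 0 (Q.comp (add_zero 0) (Q.map LinOperad.opt2 0 β) y)) x)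

theorem d_mul (Q : DGOperad K) {β : Q.obj (Fin 2) 0} (hβ : Q.d 0 β = 0) {X Y : Type} [Finite X]
    [Finite Y] {x : Q.obj X 0} {y : Q.obj Y 0} (hx : Q.d 0 x = 0) (hy : Q.d 0 y = 0) :
    Q.d 0 (Q.mul β x y) = 0 := by
  simp only [mul, d_map, hx, hy, hβ, map_zero, LinearMap.zero_apply, smul_zero, add_zero,
    Q.leibniz (add_zero 0) (add_zero 1) rfl]

/-- The unit is idempotent under composition, so by the Leibniz rule its differential equals twice
itself. -/
theorem d_one (Q : DGOperad K) : Q.d 0 Q.one = 0 := by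
  have h := Q.leibniz (add_zero 0) (add_zero 1) rfl (Q.map unitOpt 0 Q.one) Q.one
  have h1 := Q.one_comp 1 (Q.d 0 Q.one)
  rw [Q.comp_one, Q.d_map, Q.d_map, Q.comp_one, pow_zero, one_smul, left_eq_add] at h
  rw [h] at h1
  have h2 := congrArg (Q.map (Equiv.emptySum Empty Unit) 1) h1
  rw [Q.map_map, Equiv.symm_trans_self, Q.map_refl, map_zero] at h2
  exact h2.symm

theorem Hom.app_mul {Q R : DGOperad K} (φ : Hom Q R) (β : Q.obj (Fin 2) 0) {X Y : Type} [Finite X]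
    [Finite Y] (x : Q.obj X 0) (y : Q.obj Y 0) :
    φ.app (X ⊕ Y) 0 (Q.mul β x y) = R.mul (φ.app (Fin 2) 0 β) (φ.app X 0 x) (φ.app Y 0 y) := by
  simp only [mul, φ.app_map, φ.app_comp]

theorem Hom.ext_app {Q R : DGOperad K} {φ ψ : Hom Q R}
    (h : ∀ (A : Type) [Finite A] (n : ℕ) (x : Q.obj A n), φ.app A n x = ψ.app A n x) : φ = ψ := by
  rcases φ with ⟨φ, _, _, _, _⟩
  rcases ψ with ⟨ψ, _, _, _, _⟩
  have : @φ = @ψ := by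
    funext A _ n
    exact LinearMap.ext (h A n)
  subst this
  rfl

end DGOperad

/-! ### Morphisms from the operad of Lie algebras -/

namespace LieOp

open LinOperad.LieElement

variable {K : Type u} [Field K]

variable (K) in
/-- An element of the free Lie algebra as an operation of `Lie`. -/
noncomputable def toLie {A : Type} [Finite A] (x : FreeLieAlgebra K A)
    (hx : x ∈ multilinear K (Set.univ : Set A)) : (Lie K).obj A 0 :=
  ⟨⟨x, hx⟩, fun h => absurd rfl h⟩

/-- The element of the free Lie algebra underlying an operation of `Lie`. -/
noncomputable def val {A : Type} [Finite A] : (Lie K).obj A 0 →ₗ[K] FreeLieAlgebra K A :=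
  ((multilinear K (Set.univ : Set A)).subtype ∘ₗ (DGOperad.conc (lieLin K) A 0).subtype :
    DGOperad.conc (lieLin K) A 0 →ₗ[K] FreeLieAlgebra K A)

theorem val_injective {A : Type} [Finite A] : Function.Injective (val (K := K) (A := A)) :=
  Subtype.val_injective.comp Subtype.val_injective

theorem val_toLie {A : Type} [Finite A] (x : FreeLieAlgebra K A)
    (hx : x ∈ multilinear K (Set.univ : Set A)) : val (toLie K x hx) = x := rfl

theorem val_mem {A : Type} [Finite A] (x : (Lie K).obj A 0) :
    val x ∈ multilinear K (Set.univ : Set A) := x.1.2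

theorem val_map {A B : Type} [Finite A] [Finite B] (e : A ≃ B) (x : (Lie K).obj A 0) :
    val ((Lie K).map e 0 x) = rename K e (val x) := rfl

theorem val_comp {A B : Type} [Finite A] [Finite B] (x : (Lie K).obj (Option A) 0)
    (y : (Lie K).obj B 0) : val ((Lie K).comp (add_zero 0) x y) = subst K (val y) (val x) := rfl

theorem val_one : val (Lie K).one = FreeLieAlgebra.of K () := rfl

theorem val_bracket :
    val (Lie.bracket K) = ⁅FreeLieAlgebra.of K (0 : Fin 2), FreeLieAlgebra.of K (1 : Fin 2)⁆ := rfl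

theorem val_mul {X Y : Type} [Finite X] [Finite Y] (x : (Lie K).obj X 0) (y : (Lie K).obj Y 0) :
    val ((Lie K).mul (Lie.bracket K) x y) = disjLie X Y (val x) (val y) := by
  rw [DGOperad.mul, val_map, val_comp, val_map, val_comp, val_map, val_bracket, disjLie_apply]
  have h0 : LinOperad.opt2 0 = some () := rfl
  have h1 : LinOperad.opt2 1 = none := rfl
  simp only [LieHom.map_lie, rename_of, h0, h1, subst_none, subst_some, rename_rename]
  change ⁅rename K (Equiv.sumComm Y X) (subst K (val x) (FreeLieAlgebra.of K none)),
    rename K (Equiv.sumComm Y X) (subst K (val x) (rename K some (val y)))⁆ = _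
  rw [subst_none, rename_rename]
  congr 1
  exact hom_congr (((rename K (Equiv.sumComm Y X)).comp (subst K (val x))).comp (rename K some))
    (rename K Sum.inr) (fun v => by simp) (val y)

theorem eq_zero_of_ne {A : Type} [Finite A] {n : ℕ} (hn : n ≠ 0) (x : (Lie K).obj A n) : x = 0 :=
  Subtype.ext (x.2 hn)

/-- Two linear maps on operations of `Lie` agree if they do on monomials. -/
theorem ext_isMonomial {A : Type} [Finite A] {M : Type*} [AddCommGroup M] [Module K M]
    {F G : (Lie K).obj A 0 →ₗ[K] M}
    (h : ∀ x (hx : IsMonomial K x), F (toLie K x hx.mem) = G (toLie K x hx.mem)) : F = G := by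
  have key : ∀ x (hx : x ∈ Submodule.span K {x : FreeLieAlgebra K A | IsMonomial K x})
      (hx' : x ∈ multilinear K (Set.univ : Set A)), F (toLie K x hx') = G (toLie K x hx') := by
    intro x hx
    induction hx using Submodule.span_induction with
    | zero =>
      intro hx'
      rw [show toLie K (0 : FreeLieAlgebra K A) hx' = 0 from rfl, map_zero, map_zero]
    | mem x hx => exact fun _ => h x hx
    | add x y hx hy h1 h2 =>
      rw [← multilinear_univ_eq] at hx hy
      intro hx'
      rw [show toLie K (x + y) hx' = toLie K x hx + toLie K y hy from rfl, map_add, map_add,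
        h1 hx, h2 hy]
    | smul c x hx h1 =>
      rw [← multilinear_univ_eq] at hx
      intro hx'
      rw [show toLie K (c • x) hx' = c • toLie K x hx from rfl, map_smul, map_smul, h1 hx]
  refine LinearMap.ext fun x => key (val x) ?_ (val_mem x)
  rw [← multilinear_univ_eq]
  exact val_mem x

/-- A morphism from the operad of Lie algebras is determined by the image of the bracket. -/
theorem hom_unique {Q : DGOperad K} {φ ψ : DGOperad.Hom (Lie K) Q}
    (h : φ.app (Fin 2) 0 (Lie.bracket K) = ψ.app (Fin 2) 0 (Lie.bracket K)) : φ = ψ := by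
  have key : ∀ {X : Type} {x : FreeLieAlgebra K X} (hx : IsMonomial K x) [Finite X],
      φ.app X 0 (toLie K x hx.mem) = ψ.app X 0 (toLie K x hx.mem) := by
    intro X x hx
    induction hx with
    | of =>
      intro _
      rw [show toLie K (FreeLieAlgebra.of K ()) _ = (Lie K).one from val_injective rfl,
        φ.app_one, ψ.app_one]
    | @lie X Y x y hx hy h1 h2 =>
      intro _
      have := hx.finite
      have := hy.finite
      rw [show toLie K (disjLie X Y x y) (IsMonomial.lie hx hy).mem = (Lie K).mul (Lie.bracket K)
        (toLie K x hx.mem) (toLie K y hy.mem) from val_injective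
          (val_mul (toLie K x hx.mem) (toLie K y hy.mem)).symm, φ.app_mul,
        ψ.app_mul, h, h1, h2]
    | @map X Y e x hx h1 =>
      intro _
      have := hx.finite
      rw [show toLie K (rename K e x) (IsMonomial.map e hx).mem =
        (Lie K).map e 0 (toLie K x hx.mem) from rfl, φ.app_map, ψ.app_map, h1]
  refine DGOperad.Hom.ext_app fun A _ n x => ?_
  rcases n with _ | n
  · exact LinearMap.congr_fun (ext_isMonomial fun x hx => key hx) x
  · rw [eq_zero_of_ne n.succ_ne_zero x, map_zero, map_zero]

/-! ### Lie operations with one more input -/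

open Classical in
/-- The substitution `a ↦ [none, a]`. -/
noncomputable def adSubst (K : Type u) [Field K] {A : Type} (a : A) :
    FreeLieAlgebra K A →ₗ⁅K⁆ FreeLieAlgebra K (Option A) :=
  FreeLieAlgebra.lift K fun b => if b = a then
      ⁅FreeLieAlgebra.of K (none : Option A), FreeLieAlgebra.of K (some a)⁆
    else FreeLieAlgebra.of K (some b)

theorem adSubst_self {A : Type} (a : A) :
    adSubst K a (FreeLieAlgebra.of K a) =
      ⁅FreeLieAlgebra.of K (none : Option A), FreeLieAlgebra.of K (some a)⁆ := by
  simp [adSubst]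

theorem adSubst_ne {A : Type} {a b : A} (h : b ≠ a) :
    adSubst K a (FreeLieAlgebra.of K b) = FreeLieAlgebra.of K (some b) := by
  simp [adSubst, h]

theorem val_ins {A : Type} [Finite A] (a : A) (x : (Lie K).obj A 0) :
    val ((Lie K).ins (Lie.bracket K) a 0 x) = adSubst K a (val x) := by
  classical
  simp only [DGOperad.ins, LinearMap.comp_apply, LinearMap.flip_apply, val_map, val_comp,
    val_bracket]
  refine hom_congr ((((rename K (Equiv.optionSubtypeNe a).optionCongr).comp
    (rename K (splitEquiv {x // x ≠ a}))).comp
    (subst K ⁅FreeLieAlgebra.of K (0 : Fin 2), FreeLieAlgebra.of K (1 : Fin 2)⁆)).comp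
    (rename K (Equiv.optionSubtypeNe a).symm)) (adSubst K a) (fun b => ?_) (val x)
  simp only [LieHom.comp_apply, rename_of]
  by_cases h : b = a
  · subst h
    rw [Equiv.optionSubtypeNe_symm_self, subst_none, adSubst_self]
    simp only [LieHom.map_lie, rename_of]
    rfl
  · rw [Equiv.optionSubtypeNe_symm_of_ne h, subst_some, adSubst_ne h]
    simp only [rename_of]
    rfl

/-- The span of the elements obtained by the substitutions `a ↦ [none, a]` with `a` in `s` from
multilinear elements in the generators `s`. -/
noncomputable def adSpan (K : Type u) [Field K] {A : Type} (s : Set A) :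
    Submodule K (FreeLieAlgebra K (Option A)) :=
  Submodule.span K {x | ∃ a ∈ s, ∃ z ∈ multilinear K s, x = adSubst K a z}

section

variable {A : Type}

theorem adSubst_of_notMem {a : A} {s : Set A} (ha : a ∉ s) {z : FreeLieAlgebra K A}
    (hz : z ∈ multilinear K s) : adSubst K a z = rename K some z := by
  induction hz using Submodule.span_induction with
  | zero => simp
  | add x y _ _ h h' => rw [map_add, map_add, h, h']
  | smul c x _ h => rw [map_smul, map_smul, h]
  | mem z hz =>
    induction hz with
    | of b => rw [adSubst_ne (by rintro rfl; exact ha rfl), rename_of]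
    | lie _ _ _ h h' =>
      rw [LieHom.map_lie, LieHom.map_lie, h fun h => ha (Or.inl h), h' fun h => ha (Or.inr h)]

theorem lie_mem_adSpan {s t : Set A} (hst : Disjoint s t) {x : FreeLieAlgebra K (Option A)}
    (hx : x ∈ adSpan K s) {z : FreeLieAlgebra K A} (hz : z ∈ multilinear K t) :
    ⁅x, rename K some z⁆ ∈ adSpan K (s ∪ t) := by
  induction hx using Submodule.span_induction with
  | zero => simp
  | add x y _ _ h h' => rw [add_lie]; exact add_mem h h'
  | smul c x _ h => rw [smul_lie]; exact Submodule.smul_mem _ _ h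
  | mem x hx =>
    obtain ⟨a, ha, w, hw, rfl⟩ := hx
    rw [← adSubst_of_notMem (Set.disjoint_left.1 hst ha) hz, ← LieHom.map_lie]
    exact Submodule.subset_span ⟨a, Or.inl ha, _, lie_mem hst hw hz, rfl⟩

/-- The bracket `[none, -]` is a derivation, hence the sum of the substitutions `a ↦ [none, a]`. -/
theorem lie_none_mem_adSpan {t : Set A} {z : FreeLieAlgebra K A} (hz : z ∈ multilinear K t) :
    ⁅FreeLieAlgebra.of K (none : Option A), rename K some z⁆ ∈ adSpan K t := by
  induction hz using Submodule.span_induction with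
  | zero => simp
  | add x y _ _ h h' => rw [map_add, lie_add]; exact add_mem h h'
  | smul c x _ h => rw [map_smul, lie_smul]; exact Submodule.smul_mem _ _ h
  | mem z hz =>
    induction hz with
    | of b =>
      rw [rename_of, ← adSubst_self]
      exact Submodule.subset_span ⟨b, rfl, _, Submodule.subset_span (.of b), rfl⟩
    | @lie s t x y hst hx hy h h' =>
      rw [LieHom.map_lie, leibniz_lie,
        ← lie_skew (rename K some x) ⁅_, _⁆]
      refine add_mem (lie_mem_adSpan hst h (Submodule.subset_span hy)) (neg_mem ?_)
      rw [Set.union_comm]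
      exact lie_mem_adSpan hst.symm h' (Submodule.subset_span hx)

/-- A Lie monomial is either free of the generator `none`, or it is `none`, or it comes from the
substitutions `a ↦ [none, a]`: the innermost bracket containing `none` is, up to sign, of the form
`[none, -]`. -/
theorem mem_adSpan_of_mono {s : Set (Option A)} {x : FreeLieAlgebra K (Option A)}
    (hx : Mono K s x) :
    (none ∉ s → ∃ z ∈ multilinear K (some ⁻¹' s), x = rename K some z) ∧
    (none ∈ s → (s = {none} ∧ x = FreeLieAlgebra.of K none) ∨ x ∈ adSpan K (some ⁻¹' s)) := by
  have hd : ∀ {s t : Set (Option A)}, Disjoint s t →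
      Disjoint (some ⁻¹' s : Set A) (some ⁻¹' t) := fun h => h.preimage some
  induction hx with
  | of a =>
    rcases a with _ | a
    · exact ⟨fun h => absurd rfl h, fun _ => Or.inl ⟨rfl, rfl⟩⟩
    · refine ⟨fun _ => ⟨FreeLieAlgebra.of K a, ?_, (rename_of some a).symm⟩, fun h => by simp at h⟩
      rw [show (some ⁻¹' {some a} : Set A) = {a} by ext; simp]
      exact Submodule.subset_span (.of a)
  | @lie s t x y hst hx hy h h' =>
    have key : ∀ {s t : Set (Option A)} {x y : FreeLieAlgebra K (Option A)}, Disjoint s t →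
        none ∈ s →
        ((s = {none} ∧ x = FreeLieAlgebra.of K none) ∨ x ∈ adSpan K (some ⁻¹' s)) →
        (∃ z ∈ multilinear K (some ⁻¹' t), y = rename K some z) →
        ⁅x, y⁆ ∈ adSpan K (some ⁻¹' (s ∪ t)) := by
      rintro s t x y hst hs (⟨rfl, rfl⟩ | hx) ⟨z, hz, rfl⟩
      · rw [show (some ⁻¹' ({none} ∪ t) : Set A) = some ⁻¹' t by ext; simp]
        exact lie_none_mem_adSpan hz
      · exact lie_mem_adSpan (hd hst) hx hz
    refine ⟨fun hn => ?_, fun hn => Or.inr ?_⟩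
    · obtain ⟨z, hz, rfl⟩ := h.1 fun h => hn (Or.inl h)
      obtain ⟨w, hw, rfl⟩ := h'.1 fun h => hn (Or.inr h)
      exact ⟨⁅z, w⁆, lie_mem (hd hst) hz hw, (LieHom.map_lie _ _ _).symm⟩
    · rcases hn with hn | hn
      · exact key hst hn (h.2 hn) (h'.1 (Set.disjoint_left.1 hst hn))
      · rw [← lie_skew, Set.union_comm]
        exact neg_mem (key hst.symm hn (h'.2 hn) (h.1 (Set.disjoint_right.1 hst hn)))

end

/-- Every Lie operation comes from Lie operations with one input less. -/
theorem exists_sum_ins {A : Type} [Fintype A] [Nonempty A] (x : (Lie K).obj (Option A) 0) :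
    ∃ f : A → (Lie K).obj A 0, x = ∑ a, (Lie K).ins (Lie.bracket K) a 0 (f a) := by
  classical
  let F : (A → (Lie K).obj A 0) →ₗ[K] (Lie K).obj (Option A) 0 :=
    ∑ a, (Lie K).ins (Lie.bracket K) a 0 ∘ₗ LinearMap.proj a
  have hF : ∀ f, F f = ∑ a, (Lie K).ins (Lie.bracket K) a 0 (f a) := fun f => by simp [F]
  have hs : adSpan K (Set.univ : Set A) ≤ (LinearMap.range F).map val := by
    refine Submodule.span_le.2 ?_
    rintro _ ⟨a, -, z, hz, rfl⟩
    refine ⟨F (Pi.single a (toLie K z hz)), ⟨_, rfl⟩, ?_⟩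
    rw [hF, Finset.sum_eq_single a]
    · rw [Pi.single_eq_same, val_ins, val_toLie]
    · intro b _ hb
      rw [Pi.single_eq_of_ne hb, map_zero]
    · simp
  have hm : multilinear K (Set.univ : Set (Option A)) ≤ adSpan K (Set.univ : Set A) := by
    refine Submodule.span_le.2 fun x hx => ?_
    rcases (mem_adSpan_of_mono hx).2 trivial with ⟨h, -⟩ | h
    · obtain ⟨a⟩ := ‹Nonempty A›
      have : (some a : Option A) ∈ ({none} : Set (Option A)) := h ▸ trivial
      simp at this
    · exact h
  obtain ⟨_, ⟨f, rfl⟩, hf⟩ := hs (hm (val_mem x))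
  exact ⟨f, by rw [← hF]; exact (val_injective hf).symm⟩

end LieOp

/-! ### Complexes of operations -/

namespace DGOperad

open CategoryTheory

theorem complex_d {K : Type u} [Field K] (Q : DGOperad K) (A : Type) [Finite A] (n : ℕ) :
    (Q.complex A).d n (n + 1) = ModuleCat.ofHom (Q.d n) := by
  simp [DGOperad.complex]

/-- Exactness in a positive cohomological degree, in terms of elements. -/
theorem exactAt_of {K : Type u} [Field K] (Q : DGOperad K) (A : Type) [Finite A] (n : ℕ)
    (h : ∀ c : Q.obj A (n + 1), Q.d (n + 1) c = 0 → ∃ x : Q.obj A n, Q.d n x = c) :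
    (Q.complex A).ExactAt (n + 1) := by
  rw [HomologicalComplex.exactAt_iff' _ n (n + 1) (n + 2) (by simp) (by simp),
    ShortComplex.moduleCat_exact_iff]
  intro c hc
  change (Q.complex A).d (n + 1) (n + 2) c = 0 at hc
  rw [Q.complex_d] at hc
  obtain ⟨x, hx⟩ := h c hc
  refine ⟨x, ?_⟩
  change (Q.complex A).d n (n + 1) x = c
  rw [Q.complex_d]
  exact hx

end DGOperad

namespace RTOp

open LinOperad LinOperad.LieElement LieOp

variable {K : Type u} [Field K]

/-! ### Lie operations with few inputs -/

theorem subsingleton_lie {A : Type} [Finite A] [IsEmpty A] : Subsingleton ((Lie K).obj A 0) := by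
  have h : ∀ x ∈ multilinear K (Set.univ : Set A), x = 0 := by
    intro x hx
    induction hx using Submodule.span_induction with
    | zero => rfl
    | add x y _ _ h h' => rw [h, h', add_zero]
    | smul c x _ h => rw [h, smul_zero]
    | mem x hx =>
      exfalso
      clear * - hx
      generalize (Set.univ : Set A) = s at hx
      induction hx with
      | of a => exact isEmptyElim a
      | lie _ _ _ h _ => exact h
  exact ⟨fun x y => val_injective ((h _ (val_mem x)).trans (h _ (val_mem y)).symm)⟩

theorem exists_smul_one (x : (Lie K).obj Unit 0) : ∃ c : K, x = c • (Lie K).one := by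
  have h : multilinear K (Set.univ : Set Unit) ≤ Submodule.span K {FreeLieAlgebra.of K ()} := by
    refine Submodule.span_mono ?_
    have : ∀ {s : Set Unit} {x : FreeLieAlgebra K Unit}, Mono K s x →
        () ∈ s ∧ x = FreeLieAlgebra.of K () := by
      intro s x hx
      induction hx with
      | of a => exact ⟨rfl, rfl⟩
      | lie hst _ _ h h' => exact absurd h'.1 (Set.disjoint_left.1 hst h.1)
    exact fun x hx => (this hx).2
  obtain ⟨c, hc⟩ := Submodule.mem_span_singleton.1 (h (val_mem x))
  exact ⟨c, val_injective (by rw [← hc, map_smul, val_one])⟩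

/-! ### The morphism -/

variable [CharZero K]

/-- An operation of the operad of rooted trees as an operation of `TRT`. -/
noncomputable def embT (K : Type u) [Field K] [CharZero K] (A : Type) [Finite A] :
    (rtLin K).obj A →ₗ[K] (TRT K).obj A 0 :=
  (LinearMap.codRestrict (goodSpan K A 0) (emb (rtLin K) A) fun _ =>
    goodSpan_of_support _ fun _ _ k => k.elim0 : (rtLin K).obj A →ₗ[K] goodSpan K A 0)

theorem embT_map {A B : Type} [Finite A] [Finite B] (e : A ≃ B) (f : (rtLin K).obj A) :
    embT K B ((rtLin K).map e f) = (TRT K).map e 0 (embT K A f) :=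
  Subtype.ext (emb_map e f)

theorem embT_comp {A B : Type} [Finite A] [Finite B] (f : (rtLin K).obj (Option A))
    (g : (rtLin K).obj B) :
    embT K (A ⊕ B) ((rtLin K).comp f g) =
      (TRT K).comp (add_zero 0) (embT K (Option A) f) (embT K B g) :=
  Subtype.ext (emb_comp f g)

theorem embT_one : embT K Unit (rtLin K).one = (TRT K).one := rfl

theorem embT_bracket : embT K (Fin 2) (bracket K).val = TRT.bracket K := rfl

theorem embT_lieMul {X Y : Type} [Finite X] [Finite Y] (f : (rtLin K).obj X)
    (g : (rtLin K).obj Y) : embT K (X ⊕ Y) ((bracket K).lieMul f g) =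
      (TRT K).mul (TRT.bracket K) (embT K X f) (embT K Y g) := by
  rw [lieMul_apply, embT_map, embT_comp, ad, LinearMap.comp_apply, embT_map, embT_comp, embT_map,
    embT_bracket]
  rfl

theorem embT_surjective (A : Type) [Finite A] : Function.Surjective (embT K A) := by
  intro x
  obtain ⟨f, hf⟩ := emb_surjective A x.1
  exact ⟨f, Subtype.ext hf⟩

theorem d_embT_lieEval {X : Type} {x : FreeLieAlgebra K X} (hx : IsMonomial K x) :
    ∀ [Finite X], (TRT K).d 0 (embT K X ((bracket K).lieEval X x)) = 0 := by
  induction hx with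
  | of =>
    intro _
    rw [lieEval_of, embT_one, DGOperad.d_one]
  | @lie X Y x y hx hy h h' =>
    intro _
    have := hx.finite
    have := hy.finite
    rw [lieEval_disjLie, embT_lieMul, DGOperad.d_mul _ d_bracket h h']
  | @map X Y e x hx h =>
    intro _
    have := hx.finite
    rw [lieEval_map, embT_map, DGOperad.d_map, h, map_zero]

/-- The morphism of operads on operations with inputs `A`. -/
noncomputable def lieHomApp (K : Type u) [Field K] [CharZero K] (A : Type) [Finite A] :
    (n : ℕ) → (Lie K).obj A n →ₗ[K] (TRT K).obj A n
  | 0 => embT K A ∘ₗ (bracket K).lieEval A ∘ₗ val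
  | _ + 1 => 0

theorem lieHomApp_zero {A : Type} [Finite A] (x : (Lie K).obj A 0) :
    lieHomApp K A 0 x = embT K A ((bracket K).lieEval A (val x)) := rfl

/-- The morphism from the operad of Lie algebras to the operad of trees. -/
noncomputable def lieHom (K : Type u) [Field K] [CharZero K] : DGOperad.Hom (Lie K) (TRT K) where
  app A _ n := lieHomApp K A n
  app_d {A _} n x := by
    rw [show (Lie K).d n x = 0 from rfl, map_zero]
    rcases n with _ | n
    · have : (TRT K).d 0 ∘ₗ lieHomApp K A 0 = 0 := ext_isMonomial fun x hx => d_embT_lieEval hx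
      exact (LinearMap.congr_fun this x).symm
    · rw [eq_zero_of_ne n.succ_ne_zero x, map_zero, map_zero]
  app_map {A B _ _} e n x := by
    rcases n with _ | n
    · rw [lieHomApp_zero, lieHomApp_zero, val_map, lieEval_map, embT_map]
    · rw [eq_zero_of_ne n.succ_ne_zero x, map_zero, map_zero, map_zero, map_zero]
  app_one := by
    rw [lieHomApp_zero, val_one, lieEval_of, embT_one]
  app_comp {A B _ _ m n k} h x y := by
    subst h
    by_cases hm : m = 0
    swap
    · rw [eq_zero_of_ne hm x]; simp
    by_cases hn : n = 0
    swap
    · rw [eq_zero_of_ne hn y]; simp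
    subst hm
    subst hn
    have : (bracket K).lieEval (A ⊕ B) ∘ₗ (subst K (val y)).toLinearMap ∘ₗ val =
        (rtLin K).comp.flip ((bracket K).lieEval B (val y)) ∘ₗ
          (bracket K).lieEval (Option A) ∘ₗ val := by
      refine ext_isMonomial fun x hx => ?_
      have := lieEval_subst (bracket K) hx (val y) (Equiv.refl (Option A))
      rwa [Equiv.coe_refl, rename_id] at this
    refine (congrArg (embT K (A ⊕ B)) (LinearMap.congr_fun this x)).trans ?_
    exact embT_comp _ _

theorem lieHom_bracket : (lieHom K).app (Fin 2) 0 (Lie.bracket K) = TRT.bracket K := by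
  let e : Unit ⊕ Unit ≃ Fin 2 :=
    { toFun := Sum.elim (fun _ => 0) (fun _ => 1)
      invFun := fun i => if i = 0 then .inl () else .inr ()
      left_inv := by rintro (_ | _) <;> rfl
      right_inv := by intro i; fin_cases i <;> rfl }
  have h : val (Lie.bracket K) = rename K e
      (disjLie Unit Unit (FreeLieAlgebra.of K ()) (FreeLieAlgebra.of K ())) := by
    rw [val_bracket, disjLie_apply, LieHom.map_lie]
    simp only [rename_of]
    rfl
  change embT K (Fin 2) ((bracket K).lieEval (Fin 2) (val (Lie.bracket K))) = _
  rw [h, lieEval_map, lieEval_disjLie, lieEval_of, lieMul_apply, ad, LinearMap.comp_apply,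
    (rtLin K).comp_one, (rtLin K).comp_one, (rtLin K).map_map, (rtLin K).map_map,
    (rtLin K).map_map, (rtLin K).map_map, (rtLin K).map_map, ← embT_bracket]
  refine congrArg _ (((rtLin K).map_eq_of (f := Equiv.refl _) ?_ _).trans ((rtLin K).map_refl _))
  intro i
  fin_cases i <;> rfl

/-! ### Trees with few inputs -/

/-- The root and two children of every black vertex are different vertices. -/
theorem card_of_isGood {A : Type} [Finite A] {n : ℕ} {T : RTree (A ⊕ Fin n)} (hT : IsGood T) :
    n + 1 ≤ Nat.card A := by
  choose x hx y hy hxy using hT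
  -- Together with the root, there are `2 * n + 1` vertices, at most `Nat.card A + n` in total.
  obtain ⟨r, hr, -⟩ := T.existsUnique_root
  let g : Option (Fin n ⊕ Fin n) → A ⊕ Fin n
    | none => r
    | some (.inl k) => x k
    | some (.inr k) => y k
  have hx' : ∀ k, T.parent (x k) = some (.inr k) := hx
  have hy' : ∀ k, T.parent (y k) = some (.inr k) := hy
  have hg : Function.Injective g := by
    have h1 : ∀ v, T.parent (g v) = v.map fun k => .inr (k.elim id id) := by
      rintro (_ | k | k)
      · exact hr
      · exact hx k
      · exact hy k
    intro v w hvw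
    have h2 := congrArg T.parent hvw
    rw [h1, h1] at h2
    rcases v with _ | k | k <;> rcases w with _ | l | l <;> simp at h2
    · rfl
    · rw [h2]
    · subst h2; exact absurd hvw (hxy k)
    · subst h2; exact absurd hvw.symm (hxy k)
    · rw [h2]
  have := Nat.card_le_card_of_injective g hg
  simp [Nat.card_sum] at this
  omega

theorem subsingleton_obj {A : Type} [Finite A] {n : ℕ} (h : Nat.card A ≤ n) :
    Subsingleton ((TRT K).obj A n) := by
  refine ⟨fun x y => coeff_injective (funext fun U => ?_)⟩
  have hU : ¬ IsGood U := fun hU => by have := card_of_isGood hU; omega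
  rw [coeff_good x hU, coeff_good y hU]

theorem exists_smul_one_tree (c : (TRT K).obj Unit 0) : ∃ k : K, c = k • (TRT K).one := by
  obtain ⟨f, rfl⟩ := embT_surjective Unit c
  refine ⟨f unitTree, ?_⟩
  rw [← embT_one, ← map_smul]
  refine congrArg _ (funext fun T => ?_)
  have : T = unitTree := RTree.ext (funext fun x => by rw [unit_parent, unit_parent])
  subst this
  exact (mul_one _).symm

theorem one_ne_zero_tree : (TRT K).one ≠ 0 := by
  intro h
  have h1 : emb (rtLin K) Unit (rtLin K).one = emb (rtLin K) Unit 0 := by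
    rw [map_zero]; exact congrArg Subtype.val h
  exact one_ne_zero (congrFun (emb_injective Unit h1) unitTree)

/-! ### The homology -/

/-- The morphism is injective, every cycle of degree zero is in its image, and every cycle of
another degree is a boundary. -/
def IsResolved (φ : DGOperad.Hom (Lie K) (TRT K)) (A : Type) [Finite A] : Prop :=
  Function.Injective (φ.app A 0) ∧
    (∀ c : (TRT K).obj A 0, (TRT K).d 0 c = 0 → ∃ x, φ.app A 0 x = c) ∧
    ∀ (n : ℕ) (c : (TRT K).obj A (n + 1)), (TRT K).d (n + 1) c = 0 →
      ∃ x : (TRT K).obj A n, (TRT K).d n x = c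

theorem IsResolved.of_equiv {φ : DGOperad.Hom (Lie K) (TRT K)} {A B : Type} [Finite A] [Finite B]
    (e : A ≃ B) (h : IsResolved φ A) : IsResolved φ B := by
  obtain ⟨h1, h2, h3⟩ := h
  have hs : ∀ (Q : DGOperad K) n (x : Q.obj B n), Q.map e n (Q.map e.symm n x) = x := by
    intro Q n x
    rw [Q.map_map, Equiv.symm_trans_self, Q.map_refl]
  refine ⟨fun x y hxy => ?_, fun c hc => ?_, fun n c hc => ?_⟩
  · have : (Lie K).map e.symm 0 x = (Lie K).map e.symm 0 y := h1 (by
      rw [φ.app_map, φ.app_map, hxy])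
    rw [← hs _ _ x, this, hs]
  · obtain ⟨x, hx⟩ := h2 ((TRT K).map e.symm 0 c) (by rw [DGOperad.d_map, hc, map_zero])
    exact ⟨(Lie K).map e 0 x, by rw [φ.app_map, hx, hs]⟩
  · obtain ⟨x, hx⟩ := h3 n ((TRT K).map e.symm (n + 1) c) (by
      rw [DGOperad.d_map, hc, map_zero])
    exact ⟨(TRT K).map e n x, by rw [DGOperad.d_map, hx, hs]⟩

theorem isResolved_of_isEmpty (φ : DGOperad.Hom (Lie K) (TRT K)) (A : Type) [Finite A] [IsEmpty A] :
    IsResolved φ A := by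
  have h : ∀ n, Subsingleton ((TRT K).obj A n) := fun n => subsingleton_obj (by simp)
  have := subsingleton_lie (K := K) (A := A)
  exact ⟨fun _ _ _ => Subsingleton.elim _ _, fun _ _ => ⟨0, (h 0).elim _ _⟩,
    fun n _ _ => ⟨0, (h (n + 1)).elim _ _⟩⟩

theorem isResolved_unit (φ : DGOperad.Hom (Lie K) (TRT K)) : IsResolved φ Unit := by
  have h : ∀ n, Subsingleton ((TRT K).obj Unit (n + 1)) := fun n => subsingleton_obj (by simp)
  refine ⟨(injective_iff_map_eq_zero _).2 fun x hx => ?_, fun c _ => ?_,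
    fun n _ _ => ⟨0, (h n).elim _ _⟩⟩
  · obtain ⟨c, rfl⟩ := exists_smul_one x
    rw [map_smul, φ.app_one] at hx
    rw [(smul_eq_zero.1 hx).resolve_right one_ne_zero_tree, zero_smul]
  · obtain ⟨k, rfl⟩ := exists_smul_one_tree c
    exact ⟨k • (Lie K).one, by rw [map_smul, φ.app_one]⟩

/-- A new input: both `Lie` and, up to boundaries, the cycles of `TRT` are obtained by inserting the
bracket with the new input. -/
theorem IsResolved.option {φ : DGOperad.Hom (Lie K) (TRT K)}
    (hφ : φ.app (Fin 2) 0 (Lie.bracket K) = TRT.bracket K) {A : Type} [Fintype A] [Nonempty A]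
    (h : IsResolved φ A) : IsResolved φ (Option A) := by
  obtain ⟨h1, h2, h3⟩ := h
  have key : ∀ f : A → (Lie K).obj A 0,
      φ.app (Option A) 0 (∑ a, (Lie K).ins (Lie.bracket K) a 0 (f a)) =
        insAll K A 0 fun a => φ.app A 0 (f a) := by
    intro f
    rw [map_sum, insAll_apply]
    exact Finset.sum_congr rfl fun a _ => by rw [φ.app_ins, hφ]
  refine ⟨(injective_iff_map_eq_zero _).2 fun x hx => ?_, fun c hc => ?_, fun n c hc => ?_⟩
  · obtain ⟨f, rfl⟩ := exists_sum_ins x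
    rw [key, ← map_zero (insAll K A 0)] at hx
    have h4 := insAll_injective hx
    refine Finset.sum_eq_zero fun a _ => ?_
    rw [h1 ((congrFun h4 a).trans (map_zero (φ.app A 0)).symm), map_zero]
  · obtain ⟨f, hf, rfl⟩ := exists_insAll_of_d_eq_zero hc
    choose g hg using fun a => h2 (f a) (hf a)
    exact ⟨_, (key g).trans (congrArg _ (funext hg))⟩
  · obtain ⟨f, hf, x, rfl⟩ := exists_insAll_add_d_of_d_eq_zero hc
    choose g hg using fun a => h3 n (f a) (hf a)
    refine ⟨insAll K A n g + x, ?_⟩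
    rw [map_add, d_insAll]
    exact congrArg (fun z => insAll K A (n + 1) z + _) (funext hg)

theorem isResolved {φ : DGOperad.Hom (Lie K) (TRT K)}
    (hφ : φ.app (Fin 2) 0 (Lie.bracket K) = TRT.bracket K) (A : Type) [Finite A] :
    IsResolved φ A := by
  have key : ∀ [Finite A], IsResolved φ A := by
    refine Finite.induction_empty_option (P := fun A => ∀ [Finite A], IsResolved φ A) ?_ ?_ ?_ A
    · intro A B e h _
      have := Finite.of_equiv B e.symm
      exact h.of_equiv e
    · intro _
      exact isResolved_of_isEmpty φ _
    · intro A _ h _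
      rcases isEmpty_or_nonempty A with hA | hA
      · exact (isResolved_unit φ).of_equiv (Equiv.ofUnique Unit (Option A))
      · exact IsResolved.option hφ h
  exact key

open CategoryTheory in
theorem IsResolved.quasiIso {φ : DGOperad.Hom (Lie K) (TRT K)}
    (h : ∀ (A : Type) [Finite A], IsResolved φ A) : φ.IsQuasiIso := by
  intro A _
  obtain ⟨h1, h2, h3⟩ := h A
  refine ⟨fun i => ?_⟩
  rcases i with _ | n
  · rw [quasiIsoAt_iff' _ 0 0 1 (by simp) (by simp)]
    refine (ShortComplex.quasiIso_iff_of_zeros _ ?_ ?_ ?_).2 ⟨?_, ?_⟩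
    · exact ((Lie K).complex A).shape 0 0 (by simp)
    · exact (DGOperad.complex_d _ _ _).trans (by ext; rfl)
    · exact ((TRT K).complex A).shape 0 0 (by simp)
    · rw [ShortComplex.moduleCat_exact_iff]
      intro c hc
      change ((TRT K).complex A).d 0 1 c = 0 at hc
      rw [DGOperad.complex_d] at hc
      exact h2 c hc
    · exact (ModuleCat.mono_iff_injective _).2 h1
  · have e1 : ((Lie K).complex A).ExactAt (n + 1) :=
      DGOperad.exactAt_of _ A n fun c _ => ⟨0, by rw [map_zero, eq_zero_of_ne n.succ_ne_zero c]⟩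
    rw [quasiIsoAt_iff_exactAt _ _ e1]
    exact DGOperad.exactAt_of _ A n (h3 n)

end RTOp

theorem mainTheorem6 (K : Type u) [Field K] [CharZero K] :
    (∃! φ : DGOperad.Hom (Lie K) (TRT K), φ.app (Fin 2) 0 (Lie.bracket K) = TRT.bracket K) ∧
    (∀ φ : DGOperad.Hom (Lie K) (TRT K),
      φ.app (Fin 2) 0 (Lie.bracket K) = TRT.bracket K → φ.IsQuasiIso) ∧
    (∀ (A : Type) [Finite A] (n : ℕ), n ≠ 0 →
      CategoryTheory.Limits.IsZero (((TRT K).complex A).homology n)) := by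
  refine ⟨⟨RTOp.lieHom K, RTOp.lieHom_bracket, fun ψ hψ =>
    LieOp.hom_unique (hψ.trans RTOp.lieHom_bracket.symm)⟩,
    fun φ hφ => RTOp.IsResolved.quasiIso fun A _ => RTOp.isResolved hφ A, fun A _ n hn => ?_⟩
  obtain ⟨n, rfl⟩ := Nat.exists_eq_succ_of_ne_zero hn
  rw [← HomologicalComplex.exactAt_iff_isZero_homology]
  exact DGOperad.exactAt_of _ A n ((RTOp.isResolved RTOp.lieHom_bracket A).2.2 n)
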